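/- Let $\Omega\subset\mathbb R^3$ be a nonempty bounded convex open set with smooth boundary, unit outer normal $n$ and surface measure $\mu$ on $\partial\Omega$; put $\Gamma_\pm=\{(x,v)\in\partial\Omega\times\mathbb R^3:\pm n(x)\cdot v>0\}$ and $d\sigma=|n(x)\cdot v|\,d\mu(x)\,dv$. Let $E:\overline\Omega\to\mathbb R^3$ be continuous, of class $C^1$ in $\Omega$ with finite $C^1$ norm, with $E\cdot n=0$ on $\partial\Omega$, and with one identically vanishing component, $E_j\equiv0$ in $\Omega$ for some $j\in\{1,2,3\}$ (for $j=1$: $E=(0,E_2,E_3)$). Let $T>0$, let $\mathcal U\subset\mathbb R^3$ be measurable, and let $\mathcal V\subset\mathbb R^3$ contain every $v$ with $v_j=w_j$ for some $w\in\mathcal U$. Assume that there are $\beta,r,\gamma_0>0$, $R\in\mathbb R$ and $\varphi_0\in C^1(\Omega\times\mathbb R^3)$ such that $T>(R-r)/\beta$ and, for all $(x,v)\in\Omega\times\mathcal V$, $$r\le\varphi_0(x,v)\le R,\qquad -\beta+v\cdot\nabla_x\varphi_0(x,v)+E(x)\cdot\nabla_v\varphi_0(x,v)\ge\gamma_0 .$$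 Let $S\in L^2((0,T)\times\Omega\times\mathbb R^3)$ and $C_1,C_2>0$. For $q$, $g\in L^2(\Omega\times\mathbb R^3)$ and $h\in L^2((0,T)\times\Gamma_-;d\sigma\,dt)$, a solution of $$\partial_tu+v\cdot\nabla_xu+E\cdot\nabla_vu+qu=S\ \text{ in }(0,T)\times\Omega\times\mathbb R^3,\qquad u|_{t=0}=g,\qquad u|_{(0,T)\times\Gamma_-}=h$$ is a function $u\in L^2((0,T)\times\Omega\times\mathbb R^3)$ with a trace $u|_{\Gamma_+}\in L^2((0,T)\times\Gamma_+;d\sigma\,dt)$ such that for all $\phi\in C^1_c(\mathbb R\times\mathbb R^3\times\mathbb R^3)$ supported in $\{t<T\}$ $$\int_0^T\!\!\int_{\Omega\times\mathbb R^3}\big[u(\partial_t\phi+v\cdot\nabla_x\phi+E\cdot\nabla_v\phi)+(S-qu)\phi\big]dx\,dv\,dt+\int_{\Omega\times\mathbb R^3}g\,\phi(0)\,dx\,dv+\int_0^T\!\!\int_{\Gamma_-}h\phi\,d\sigma\,dt=\int_0^T\!\!\int_{\Gamma_+}u|_{\Gamma_+}\phi\,d\sigma\,dt .$$ Then there is $c>0$,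 depending only on $\Omega,E,S,T,\mathcal U,C_1,C_2$ (and $\mathcal V$), and for every $C_0$ there is $C>0$, depending only on these and on $C_0$, such that the following holds. Let $q_1,q_2\in L^\infty(\Omega\times\mathbb R^3)$ be nonnegative and compactly supported in $v$ (for each $i$ there is a compact $K\subset\mathbb R^3$ with $q_i(x,v)=0$ for $x\in\Omega$, $v\notin K$), with $\|q_1\|_{L^\infty}\le C_0$ and $\operatorname{supp}(q_1-q_2)(x,\cdot)\subset\mathcal U$ for every $x\in\Omega$. Let $u_1,u_2$ be solutions, in the above sense, with absorption coefficients $q_1,q_2$ and the same $S,g,h$, and let $u_2\in\mathcal P_{\mathcal U}$, that is, on $\Omega\times\mathcal U$ the function $u_2$ is (a.e. in $(x,v)$) absolutely continuous in $t$ with initial value $g$, $$\|g\|_{L^\infty(\Omega\times\mathcal U)}\le C_1,\qquad\|\partial_tu_2\|_{L^\infty((0,T)\times\Omega\times\mathcal U)}\le C_1,\qquad|g|\ge C_2\ \text{ a.e. in }\Omega\times\mathcal U .$$ Then $u_1|_{\Gamma_+}-u_2|_{\Gamma_+}$ has a time derivative $\partial_tu_1-\partial_tu_2\in L^2((0,T)\times\Gamma_+;d\sigma\,dt)$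 and $$c\,\|\partial_tu_1-\partial_tu_2\|_{L^2((0,T)\times\Gamma_+)}\le\|q_1-q_2\|_{L^2(\Omega\times\mathbb R^3)}\le C\,\|\partial_tu_1-\partial_tu_2\|_{L^2((0,T)\times\Gamma_+)} .$$ -/

import Mathlib

open MeasureTheory Set
open scoped ContDiff ENNReal

noncomputable section

namespace Transport

/-- Position space and velocity space, with the Euclidean norm. -/
abbrev R3 : Type := EuclideanSpace ℝ (Fin 3)

/-- `Ω` is a nonempty bounded convex open set with smooth boundary, described by a global smooth
defining function `ρ` whose gradient does not vanish on the boundary. -/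
structure IsSmoothConvexDomain (Ω : Set R3) (ρ : R3 → ℝ) : Prop where
  nonempty : Ω.Nonempty
  bounded : Bornology.IsBounded Ω
  convex : Convex ℝ Ω
  smooth : ContDiff ℝ ∞ ρ
  eq_sublevel : Ω = {x | ρ x < 0}
  regular : ∀ x, ρ x = 0 → gradient ρ x ≠ 0

/-- The unit outer normal `n(x)` at a boundary point of `{ρ < 0}`. -/
def outerNormal (ρ : R3 → ℝ) (x : R3) : R3 := ‖gradient ρ x‖⁻¹ • gradient ρ x

/-- `Γ₊`: boundary points with outgoing velocity. -/
def GammaPlus (Ω : Set R3) (ρ : R3 → ℝ) : Set (R3 × R3) :=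
  {z | z.1 ∈ frontier Ω ∧ 0 < inner ℝ (outerNormal ρ z.1) z.2}

/-- `Γ₋`: boundary points with incoming velocity. -/
def GammaMinus (Ω : Set R3) (ρ : R3 → ℝ) : Set (R3 × R3) :=
  {z | z.1 ∈ frontier Ω ∧ inner ℝ (outerNormal ρ z.1) z.2 < 0}

/-- Surface measure on `∂Ω`: two-dimensional Hausdorff measure, normalized so that it is
Lebesgue measure on planes. -/
def surfaceMeasure (Ω : Set R3) : Measure R3 :=
  (Measure.euclideanHausdorffMeasure 2 : Measure R3).restrict (frontier Ω)

/-- `dσ = |n(x)·v| dμ(x) dv` on `∂Ω × ℝ³`. -/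
def sigma (Ω : Set R3) (ρ : R3 → ℝ) : Measure (R3 × R3) :=
  ((surfaceMeasure Ω).prod volume).withDensity
    fun z => ENNReal.ofReal |inner ℝ (outerNormal ρ z.1) z.2|

/-- `dσ` on `Γ₊`. -/
def sigmaPlus (Ω : Set R3) (ρ : R3 → ℝ) : Measure (R3 × R3) :=
  (sigma Ω ρ).restrict (GammaPlus Ω ρ)

/-- `dσ` on `Γ₋`. -/
def sigmaMinus (Ω : Set R3) (ρ : R3 → ℝ) : Measure (R3 × R3) :=
  (sigma Ω ρ).restrict (GammaMinus Ω ρ)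

/-- Lebesgue measure `dx dv` on `Ω × 𝒰`. -/
def phase (Ω U : Set R3) : Measure (R3 × R3) := volume.restrict (Ω ×ˢ U)

/-- The measure `dt ⊗ μ` on `(0,T) × (ℝ³ × ℝ³)`. -/
def timed (T : ℝ) (μ : Measure (R3 × R3)) : Measure (ℝ × R3 × R3) :=
  (volume.restrict (Ioo 0 T)).prod μ

/-- The external field: `C¹` in `Ω` with finite `C¹` norm, continuous up to the boundary, and
tangential there. -/
structure IsForceField (Ω : Set R3) (ρ : R3 → ℝ) (E : R3 → R3) : Prop where
  contDiffOn : ContDiffOn ℝ 1 E Ω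
  bounded : ∃ M : ℝ, ∀ x ∈ Ω, ‖E x‖ ≤ M ∧ ‖fderiv ℝ E x‖ ≤ M
  continuousOn : ContinuousOn E (closure Ω)
  tangential : ∀ x ∈ frontier Ω, inner ℝ (outerNormal ρ x) (E x) = 0

/-- `u`, with outgoing trace `γ` on `(0,T) × Γ₊`, is a weak solution in `L²` of
`∂ₜu + v·∇ₓu + E·∇ᵥu + q u = S` in `(0,T) × Ω × ℝ³`, `u = g` at `t = 0`, `u = h` on `(0,T) × Γ₋`.
The derivative of the test function in the direction `(1, v, E(x))` is
`∂ₜφ + v·∇ₓφ + E·∇ᵥφ`; the test functions vanish near `t = T`, but not on the rest of the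
boundary of `(0,T) × Ω × ℝ³`. -/
structure IsWeakSolution (T : ℝ) (Ω : Set R3) (ρ : R3 → ℝ) (E : R3 → R3)
    (q : R3 × R3 → ℝ) (S : ℝ × R3 × R3 → ℝ) (g : R3 × R3 → ℝ) (h : ℝ × R3 × R3 → ℝ)
    (u γ : ℝ × R3 × R3 → ℝ) : Prop where
  memLp : MemLp u 2 (timed T (phase Ω univ))
  memLp_trace : MemLp γ 2 (timed T (sigmaPlus Ω ρ))
  weak : ∀ φ : ℝ × R3 × R3 → ℝ, ContDiff ℝ 1 φ → HasCompactSupport φ →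
    tsupport φ ⊆ {p | p.1 < T} →
    (∫ p, (u p * fderiv ℝ φ p (1, p.2.2, E p.2.1) + (S p - q p.2 * u p) * φ p)
          ∂(timed T (phase Ω univ)))
        + (∫ z, g z * φ (0, z) ∂(phase Ω univ))
        + (∫ p, h p * φ p ∂(timed T (sigmaMinus Ω ρ)))
      = ∫ p, γ p * φ p ∂(timed T (sigmaPlus Ω ρ))

/-- On `(0,T)` and for almost every point with respect to `μ`, the function `f` is absolutely
continuous in time (after a change on a null set) with initial value `f₀` and time derivative
`d`. -/
def HasTimeDeriv (T : ℝ) (μ : Measure (R3 × R3)) (f : ℝ × R3 × R3 → ℝ) (f₀ : R3 × R3 → ℝ)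
    (d : ℝ × R3 × R3 → ℝ) : Prop :=
  ∀ᵐ p ∂(timed T μ), f p = f₀ p.2 + ∫ s in (0 : ℝ)..p.1, d (s, p.2)

/-- The class `𝒫_𝒰`, for a function `f` with initial value `f(0,·,·) = f₀`:
`‖f(0)‖_{L^∞(Ω × 𝒰)} ≤ C₁`, `‖∂ₜf‖_{L^∞((0,T) × Ω × 𝒰)} ≤ C₁`, `inf_{Ω × 𝒰} |f(0)| ≥ C₂`. -/
def MemP (T : ℝ) (Ω U : Set R3) (C₁ C₂ : ℝ) (f₀ : R3 × R3 → ℝ) (f : ℝ × R3 × R3 → ℝ) : Prop :=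
  (∀ᵐ z ∂(phase Ω U), |f₀ z| ≤ C₁) ∧ (∀ᵐ z ∂(phase Ω U), C₂ ≤ |f₀ z|) ∧
    ∃ d : ℝ × R3 × R3 → ℝ, AEStronglyMeasurable d (timed T (phase Ω U)) ∧
      (∀ᵐ p ∂(timed T (phase Ω U)), |d p| ≤ C₁) ∧ HasTimeDeriv T (phase Ω U) f f₀ d

/-- On `Ω × 𝒱` there is a weight `φ(t,x,v) = -β t + φ₀(x,v)` with `0 < r ≤ φ₀ ≤ R`, with
`∂ₜφ + v·∇ₓφ + E·∇ᵥφ ≥ γ₀ > 0`, and the observation time satisfies `T > (R - r)/β`. -/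
def HasWeight (T : ℝ) (Ω : Set R3) (E : R3 → R3) (V : Set R3) : Prop :=
  ∃ (φ₀ : R3 × R3 → ℝ) (β r R γ₀ : ℝ),
    0 < β ∧ 0 < r ∧ 0 < γ₀ ∧ ContDiffOn ℝ 1 φ₀ (Ω ×ˢ univ) ∧
    (∀ x ∈ Ω, ∀ v ∈ V, r ≤ φ₀ (x, v) ∧ φ₀ (x, v) ≤ R) ∧
    (R - r) / β < T ∧
    ∀ x ∈ Ω, ∀ v ∈ V, γ₀ ≤ -β + fderiv ℝ φ₀ (x, v) (v, E x)

/-- `q` is an absorption coefficient: nonnegative, in `L^∞(Ω × ℝ³)`, compactly supported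
in `v`. -/
structure IsAbsorption (Ω : Set R3) (q : R3 × R3 → ℝ) : Prop where
  memLp : MemLp q ∞ (phase Ω univ)
  nonneg : ∀ᵐ z ∂(phase Ω univ), 0 ≤ q z
  compact : ∃ K : Set R3, IsCompact K ∧ ∀ x ∈ Ω, ∀ v, v ∉ K → q (x, v) = 0

end Transport

end

open MeasureTheory Set
open scoped ContDiff ENNReal

noncomputable section

namespace Transport

open Filter Topology NNReal

/-! ### Global flow of a Lipschitz vector field. -/

section Flow

variable {G : Type*} [NormedAddCommGroup G] [NormedSpace ℝ G]

/-! The difference of the two solutions satisfies a transport equation with absorption q₁, source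
(q₂ - q₁)u₂ and zero initial and incoming data, since S, g and h cancel. Let Z be the flow of (v,
E(x)) and Q = q₂ - q₁, extended by zero outside Ω. Integration along characteristics gives, for
almost every t and y ∈ Γ₊, γ₁ - γ₂ = ∫₀ᵗ A(s) u₂(t-s, Z₋ₛy) ds, with A(s) = Q(Z₋ₛy) exp(-∫₀ˢ
q₁(Z₋ᵣy) dr) (`trace_representation`). As Q does not depend on time, the t-derivative falls on u₂
alone: D(t,y) = A(t) g(Z₋ₜy) + ∫₀ᵗ A(s) ∂ₜu₂(t-s, Z₋ₛy) ds. Where Q ≠ 0 one has |g| ≥ C₂ and |g|,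
|∂ₜu₂| ≤ C₁, while the exponential lies between e^(-C₀T) and 1 (taking C₀ ≥ 0). So D controls
|Q(Z₋ₜy)| through a Volterra inequality, and Grönwall bounds ∫Q² by ∫D² on every orbit
(`integral_back_sq_le`). The converse bound is direct and does not involve C₀
(`integral_traceDeriv_sq_le`).

To sum over the orbits one uses that (a, y) ↦ Zₐy carries da dσ on ℝ × Γ₊ to Lebesgue measure on the
union of the orbits through Γ₊ (`measurePreserving_swept`). The estimate of Q also requires that the
orbits through its support reach Γ₊ before time T. This is what the weight provides: as long as an
orbit stays in Ω, φ₀ grows along it at rate at least β + γ₀, but φ₀ only has the range [r, R]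
(`exists_exit_lt`). The vanishing component of E keeps vⱼ constant, so the orbit stays over 𝒱.

The geometric input is that an orbit crosses Γ₊ at most once, and that an orbit leaving Ω does so
through Γ₊. The force is extended to ℝ³ through the nearest-point projection, which gives a
Lipschitz field and a global flow. Along an orbit the distance to the closure of Ω is then convex,
because the force is constant along normals and tangential at their feet; so there is no return
after Γ₊ (`fst_notMem_closure_of_gammaPlus`). Inside Ω the distance to the complement is concave up
to an error proportional to itself, and an argument in the manner of Hopf's boundary lemma excludes
tangential exit (`exists_exit`).

The analytic input is a Green formula for (v, B(x)) on Ω × ℝ³, which rests on a divergence theorem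
for Ω obtained by slicing along coordinate lines and computing the area of coordinate projections of
the boundary (`volume_coordProj_image`). Green's formula gives both the invariance of phase volume
and the change of variables. The trace formula follows by duality: the weak equations are tested
with backward Duhamel solutions whose source lies outside the closure of Ω. These are merely
Lipschitz, and q₁ is merely measurable, so they enter through mollification with a commutator
estimate and through approximation of q₁ almost everywhere along orbits (`weak_transport`). -/

/-- Through every point passes an integral curve of `b` on the time interval `(-a, a)`. -/
def HasLocalCurves (b : G → G) (a : ℝ) : Prop :=
  ∀ x, ∃ α : ℝ → G, α 0 = x ∧ ∀ t ∈ Ioo (-a) a, HasDerivAt α (b (α t)) t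

/-- Picard–Lindelöf with a lifetime depending on `K` only, not on the starting point; this
uniformity is what permits continuation to all times. -/
lemma hasLocalCurves_of_lipschitzWith [CompleteSpace G] {b : G → G} {K : ℝ≥0}
    (hb : LipschitzWith K b) : HasLocalCurves b (1 / (2 * (K + 1))) := by
  intro x
  set ε : ℝ := 1 / (2 * (K + 1)) with hε
  have hε0 : 0 < ε := by positivity
  -- On the ball of radius `a` the speed is at most `‖b x‖ + K a`. Since `K ε ≤ 1/2` and `ε ‖b x‖ =
  -- a/2`, a curve cannot leave the ball within time `ε`.
  set a : ℝ≥0 := ⟨2 * ε * ‖b x‖, by positivity⟩ with ha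
  set L : ℝ≥0 := ⟨‖b x‖ + K * a, by positivity⟩ with hL
  have h0 : (0 : ℝ) ∈ Icc (-ε) ε := ⟨by linarith, hε0.le⟩
  have hP : IsPicardLindelof (fun _ => b) (⟨0, h0⟩ : Icc (-ε) ε) x a 0 L K := by
    refine IsPicardLindelof.of_time_independent ?_ hb.lipschitzOnWith ?_
    · intro y hy
      have h1 : ‖b y - b x‖ ≤ K * ‖y - x‖ := by
        simpa [dist_eq_norm] using hb.dist_le_mul y x
      have h2 : ‖y - x‖ ≤ a := by simpa [dist_eq_norm] using hy
      have h3 : ‖b y‖ ≤ ‖b x‖ + ‖b y - b x‖ := by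
        simpa using norm_add_le (b x) (b y - b x)
      have h4 : (K : ℝ) * ‖y - x‖ ≤ K * a := by gcongr
      change ‖b y‖ ≤ ‖b x‖ + K * a
      linarith
    · have hKε : (K : ℝ) * ε ≤ 1 / 2 := by
        rw [hε, mul_one_div, div_le_div_iff₀ (by positivity) (by norm_num)]
        nlinarith [K.2]
      have ha' : (a : ℝ) = 2 * ε * ‖b x‖ := rfl
      have hL' : (L : ℝ) = ‖b x‖ + K * a := rfl
      simp only [sub_zero, zero_sub, neg_neg, max_self, NNReal.coe_zero]
      rw [hL']
      nlinarith [a.2, norm_nonneg (b x)]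
  obtain ⟨α, hα0, hα⟩ := hP.exists_eq_forall_mem_Icc_hasDerivWithinAt₀
  exact ⟨α, hα0, fun t ht => (hα t (Ioo_subset_Icc_self ht)).hasDerivAt (Icc_mem_nhds ht.1 ht.2)⟩

lemma integralCurve_unique {b : G → G} {K : ℝ≥0} (hb : LipschitzWith K b) {α β : ℝ → G}
    {l r t₀ : ℝ} (h₀ : t₀ ∈ Ioo l r) (hα : ∀ t ∈ Ioo l r, HasDerivAt α (b (α t)) t)
    (hβ : ∀ t ∈ Ioo l r, HasDerivAt β (b (β t)) t) (h : α t₀ = β t₀) : EqOn α β (Ioo l r) :=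
  ODE_solution_unique_of_mem_Ioo (v := fun _ => b) (s := fun _ => univ)
    (fun _ _ => hb.lipschitzOnWith) h₀ (fun t ht => ⟨hα t ht, trivial⟩)
    (fun t ht => ⟨hβ t ht, trivial⟩) h

lemma HasDerivAt.comp_sub_shift {α : ℝ → G} {d : G} {t c : ℝ} (h : HasDerivAt α d (t - c)) :
    HasDerivAt (fun s => α (s - c)) d t := by
  simpa using HasDerivAt.comp_sub_const t c h

/-- The curve is restarted at its points at times `±a/2`. By uniqueness the three curves agree on
the overlaps and glue. -/
lemma HasLocalCurves.extend {b : G → G} {K : ℝ≥0} (hb : LipschitzWith K b) {a : ℝ} (ha : 0 < a)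
    (h : HasLocalCurves b a) : HasLocalCurves b (a + a / 2) := by
  intro x
  obtain ⟨α, hα0, hα⟩ := h x
  obtain ⟨β, hβ0, hβ⟩ := h (α (a / 2))
  obtain ⟨γ, hγ0, hγ⟩ := h (α (-(a / 2)))
  have hβ' : ∀ t ∈ Ioo (-(a / 2)) (a + a / 2),
      HasDerivAt (fun s => β (s - a / 2)) (b (β (t - a / 2))) t := fun t ht =>
    HasDerivAt.comp_sub_shift (hβ _ ⟨by linarith [ht.1], by linarith [ht.2]⟩)
  have hγ' : ∀ t ∈ Ioo (-(a + a / 2)) (a / 2),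
      HasDerivAt (fun s => γ (s - -(a / 2))) (b (γ (t - -(a / 2)))) t := fun t ht =>
    HasDerivAt.comp_sub_shift (hγ _ ⟨by linarith [ht.1], by linarith [ht.2]⟩)
  have e1 : EqOn α (fun s => β (s - a / 2)) (Ioo (-(a / 2)) a) :=
    integralCurve_unique hb (t₀ := a / 2) ⟨by linarith, by linarith⟩
      (fun t ht => hα t ⟨by linarith [ht.1], ht.2⟩)
      (fun t ht => hβ' t ⟨ht.1, by linarith [ht.2]⟩) (by simp [hβ0])
  have e2 : EqOn α (fun s => γ (s - -(a / 2))) (Ioo (-a) (a / 2)) :=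
    integralCurve_unique hb (t₀ := -(a / 2)) ⟨by linarith, by linarith⟩
      (fun t ht => hα t ⟨ht.1, by linarith [ht.2]⟩)
      (fun t ht => hγ' t ⟨by linarith [ht.1], ht.2⟩) (by simp [hγ0])
  set δ : ℝ → G := fun t => if t < -(a / 2) then γ (t - -(a / 2)) else
    if t ≤ a / 2 then α t else β (t - a / 2) with hδ
  have d1 : EqOn δ α (Ioo (-a) a) := by
    intro t ht
    simp only [hδ]
    split_ifs with h1 h2
    · exact (e2 ⟨ht.1, by linarith⟩).symm
    · rfl
    · exact (e1 ⟨by linarith, ht.2⟩).symm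
  have d2 : EqOn δ (fun s => β (s - a / 2)) (Ioo (-(a / 2)) (a + a / 2)) := by
    intro t ht
    simp only [hδ]
    split_ifs with h1 h2
    · linarith [ht.1]
    · exact e1 ⟨ht.1, by linarith⟩
    · rfl
  have d3 : EqOn δ (fun s => γ (s - -(a / 2))) (Ioo (-(a + a / 2)) (a / 2)) := by
    intro t ht
    simp only [hδ]
    split_ifs with h1 h2
    · rfl
    · exact e2 ⟨by linarith, ht.2⟩
    · linarith [ht.2]
  refine ⟨δ, by rw [d1 ⟨by linarith, ha⟩, hα0], fun t ht => ?_⟩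
  rcases lt_or_ge t (a / 2) with h1 | h1
  · have hm : t ∈ Ioo (-(a + a / 2)) (a / 2) := ⟨by linarith [ht.1], h1⟩
    rw [d3 hm]
    exact (hγ' t hm).congr_of_eventuallyEq (d3.eventuallyEq_of_mem (Ioo_mem_nhds hm.1 hm.2))
  · have hm : t ∈ Ioo (-(a / 2)) (a + a / 2) := ⟨by linarith, ht.2⟩
    rw [d2 hm]
    exact (hβ' t hm).congr_of_eventuallyEq (d2.eventuallyEq_of_mem (Ioo_mem_nhds hm.1 hm.2))

/-- `Z` is the global flow of the vector field `b`. -/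
structure IsFlow (b : G → G) (Z : ℝ → G → G) : Prop where
  zero : ∀ x, Z 0 x = x
  deriv : ∀ t x, HasDerivAt (fun s => Z s x) (b (Z t x)) t

/-- Each extension multiplies the lifetime by 3/2, so the lifetimes tend to infinity, and by
uniqueness curves with different lifetimes agree where both are defined. -/
theorem exists_isFlow [CompleteSpace G] {b : G → G} {K : ℝ≥0} (hb : LipschitzWith K b) :
    ∃ Z, IsFlow b Z := by
  set ε : ℝ := 1 / (2 * (K + 1)) with hε
  have hε0 : 0 < ε := by positivity
  have key : ∀ n : ℕ, HasLocalCurves b (ε * (3 / 2) ^ n) := by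
    intro n
    induction n with
    | zero =>
      rw [pow_zero, mul_one]
      exact hasLocalCurves_of_lipschitzWith hb
    | succ n ih =>
      have := ih.extend hb (by positivity)
      convert this using 1
      ring
  have hlim : Tendsto (fun n : ℕ => ε * (3 / 2 : ℝ) ^ n) atTop atTop :=
    (tendsto_pow_atTop_atTop_of_one_lt (by norm_num)).const_mul_atTop hε0
  have hN : ∀ t : ℝ, ∃ n : ℕ, |t| < ε * (3 / 2 : ℝ) ^ n := fun t =>
    (hlim.eventually_gt_atTop |t|).exists
  choose N hN using hN
  choose A hA0 hA using key
  have agree : ∀ (m n : ℕ) (x : G) (t : ℝ), |t| < ε * (3 / 2 : ℝ) ^ m → |t| < ε * (3 / 2 : ℝ) ^ n →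
      A m x t = A n x t := by
    intro m n x t hm hn
    set c := min (ε * (3 / 2 : ℝ) ^ m) (ε * (3 / 2 : ℝ) ^ n)
    have hc : 0 < c := by positivity
    refine integralCurve_unique hb (l := -c) (r := c) (t₀ := 0) ⟨by linarith, hc⟩ ?_ ?_ ?_ ?_
    · intro s hs
      exact hA m x s ⟨by linarith [hs.1, min_le_left (ε * (3 / 2 : ℝ) ^ m) (ε * (3 / 2 : ℝ) ^ n)],
        hs.2.trans_le (min_le_left _ _)⟩
    · intro s hs
      exact hA n x s ⟨by linarith [hs.1, min_le_right (ε * (3 / 2 : ℝ) ^ m) (ε * (3 / 2 : ℝ) ^ n)],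
        hs.2.trans_le (min_le_right _ _)⟩
    · rw [hA0, hA0]
    · exact abs_lt.mp (lt_min hm hn)
  refine ⟨fun t x => A (N t) x t, fun x => hA0 _ x, fun t x => ?_⟩
  refine (hA (N t) x t (abs_lt.mp (hN t))).congr_of_eventuallyEq ?_
  have : ∀ᶠ s in 𝓝 t, |s| < ε * (3 / 2 : ℝ) ^ N t :=
    continuous_abs.continuousAt.eventually_lt continuousAt_const (hN t)
  filter_upwards [this] with s hs
  exact agree _ _ _ _ (hN s) hs

namespace IsFlow

variable {b : G → G} {Z : ℝ → G → G} {K : ℝ≥0}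

lemma curve_eq (hZ : IsFlow b Z) (hb : LipschitzWith K b) {α : ℝ → G}
    (hα : ∀ t, HasDerivAt α (b (α t)) t) (t : ℝ) : α t = Z t (α 0) := by
  have := ODE_solution_unique_univ (v := fun _ => b) (s := fun _ => univ) (t₀ := 0)
    (fun _ => hb.lipschitzOnWith) (f := α) (g := fun t => Z t (α 0))
    (fun t => ⟨hα t, trivial⟩) (fun t => ⟨hZ.deriv t _, trivial⟩) (by simp [hZ.zero])
  exact congrFun this t

lemma add (hZ : IsFlow b Z) (hb : LipschitzWith K b) (s t : ℝ) (x : G) :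
    Z (s + t) x = Z s (Z t x) := by
  have h : ∀ s, HasDerivAt (fun s => Z (s + t) x) (b (Z (s + t) x)) s := fun s =>
    HasDerivAt.comp_add_const s t (hZ.deriv (s + t) x)
  have := hZ.curve_eq hb h s
  simpa using this

lemma neg_apply (hZ : IsFlow b Z) (hb : LipschitzWith K b) (t : ℝ) (x : G) :
    Z (-t) (Z t x) = x := by
  rw [← hZ.add hb, neg_add_cancel, hZ.zero]

lemma apply_neg (hZ : IsFlow b Z) (hb : LipschitzWith K b) (t : ℝ) (x : G) :
    Z t (Z (-t) x) = x := by
  rw [← hZ.add hb, add_neg_cancel, hZ.zero]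

lemma continuous_time (hZ : IsFlow b Z) (x : G) : Continuous fun t => Z t x :=
  continuous_iff_continuousAt.2 fun t => (hZ.deriv t x).continuousAt

lemma dist_le (hZ : IsFlow b Z) (hb : LipschitzWith K b) (t : ℝ) (x y : G) :
    dist (Z t x) (Z t y) ≤ Real.exp (K * |t|) * dist x y := by
  rcases le_total 0 t with ht | ht
  · have := dist_le_of_trajectories_ODE (v := fun _ => b) (fun _ => hb) (f := fun s => Z s x)
      (g := fun s => Z s y) (a := 0) (b := t) (δ := dist x y) (hZ.continuous_time x).continuousOn
      (fun s _ => (hZ.deriv s x).hasDerivWithinAt) (hZ.continuous_time y).continuousOn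
      (fun s _ => (hZ.deriv s y).hasDerivWithinAt) (by simp [hZ.zero]) t ⟨ht, le_rfl⟩
    rw [abs_of_nonneg ht, mul_comm]
    simpa using this
  -- Negative times are positive times for `-b`, which has the same Lipschitz constant.
  · have hneg : ∀ x s, HasDerivAt (fun s => Z (-s) x) (-b (Z (-s) x)) s := by
      intro x s
      have := (hZ.deriv (-s) x).scomp s (hasDerivAt_neg s)
      simpa [Function.comp_def] using this
    have hb' : LipschitzWith K (fun x => -b x) := by
      intro x y
      simpa [edist_neg_neg] using hb x y
    have := dist_le_of_trajectories_ODE (v := fun _ x => -b x) (fun _ => hb')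
      (f := fun s => Z (-s) x) (g := fun s => Z (-s) y) (a := 0) (b := -t) (δ := dist x y)
      ((hZ.continuous_time x).comp continuous_neg).continuousOn
      (fun s _ => (hneg x s).hasDerivWithinAt)
      ((hZ.continuous_time y).comp continuous_neg).continuousOn
      (fun s _ => (hneg y s).hasDerivWithinAt) (by simp [hZ.zero]) (-t) ⟨by linarith, le_rfl⟩
    rw [abs_of_nonpos ht, mul_comm]
    simpa using this

lemma lipschitzWith (hZ : IsFlow b Z) (hb : LipschitzWith K b) {T t : ℝ} (ht : |t| ≤ T) :
    LipschitzWith (Real.toNNReal (Real.exp (K * T))) (Z t) := by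
  refine LipschitzWith.of_dist_le_mul fun x y => (hZ.dist_le hb t x y).trans ?_
  rw [Real.coe_toNNReal _ (Real.exp_pos _).le]
  gcongr

/-- Each orbit is continuous in time and the time maps are Lipschitz in space, uniformly for bounded
times. -/
lemma continuous_uncurry (hZ : IsFlow b Z) (hb : LipschitzWith K b) :
    Continuous fun p : ℝ × G => Z p.1 p.2 := by
  rw [continuous_iff_continuousAt]
  rintro ⟨t, x⟩
  have h : ContinuousOn (fun p : ℝ × G => Z p.1 p.2) (Ioo (t - 1) (t + 1) ×ˢ univ) := by
    refine continuousOn_prod_of_continuousOn_lipschitzOnWith' _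
      (Real.toNNReal (Real.exp (K * (|t| + 1)))) (fun s hs => ?_)
      (fun y _ => (hZ.continuous_time y).continuousOn)
    refine (hZ.lipschitzWith hb ?_).lipschitzOnWith
    have : |s - t| < 1 := abs_lt.2 ⟨by linarith [hs.1], by linarith [hs.2]⟩
    linarith [abs_sub_abs_le_abs_sub s t]
  exact h.continuousAt (prod_mem_nhds (Ioo_mem_nhds (by linarith) (by linarith)) univ_mem)

/-- The flow at a fixed time, as a homeomorphism. -/
def homeo (hZ : IsFlow b Z) (hb : LipschitzWith K b) (t : ℝ) : G ≃ₜ G where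
  toFun := Z t
  invFun := Z (-t)
  left_inv := hZ.neg_apply hb t
  right_inv := hZ.apply_neg hb t
  continuous_toFun := (hZ.continuous_uncurry hb).comp (Continuous.prodMk_right t)
  continuous_invFun := (hZ.continuous_uncurry hb).comp (Continuous.prodMk_right (-t))

end IsFlow

end Flow

/-! ### Maximum principle and chord bound from touching parabolas. -/

section SecondOrder

/-- A continuous function which can be touched from below at every point by parabolas of
arbitrarily small negative curvature satisfies the maximum principle. -/
lemma nonpos_of_lower_parabola {f : ℝ → ℝ} {a b : ℝ} (hf : ContinuousOn f (Icc a b))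
    (h : ∀ t ∈ Ioo a b, ∀ ε > 0, ∃ m : ℝ, ∀ᶠ s in 𝓝 t, f t + m * (s - t) - ε * (s - t) ^ 2 ≤ f s)
    (ha : f a ≤ 0) (hb : f b ≤ 0) {t : ℝ} (ht : t ∈ Icc a b) : f t ≤ 0 := by
  by_contra! hpos
  set c : ℝ := (t - a) * (b - t) with hc
  have hc0 : 0 ≤ c := mul_nonneg (by linarith [ht.1]) (by linarith [ht.2])
  set ε : ℝ := f t / (2 * (c + 1)) with hε
  have hε0 : 0 < ε := by positivity
  have hεc : ε * c < f t := by
    rw [hε, div_mul_eq_mul_div, div_lt_iff₀ (by positivity)]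
    nlinarith
  -- The added parabola vanishes at the end points, so `g` has a positive interior maximum. There
  -- the lower parabola of `f` with curvature term `-ε/2` becomes one for `g` with curvature term
  -- `+ε/2`, which is impossible at a maximum.
  set g : ℝ → ℝ := fun s => f s + ε * ((s - a) * (s - b)) with hg
  have hgc : ContinuousOn g (Icc a b) := hf.add (by fun_prop)
  obtain ⟨u, hu, hmax⟩ := isCompact_Icc.exists_isMaxOn ⟨t, ht⟩ hgc
  have hgt : 0 < g t := by
    have : ε * ((t - a) * (t - b)) = -(ε * c) := by rw [hc]; ring
    simp only [hg]
    linarith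
  have hgu : 0 < g u := hgt.trans_le (hmax ht)
  have hua : u ≠ a := by
    rintro rfl
    simp [hg] at hgu
    linarith
  have hub : u ≠ b := by
    rintro rfl
    simp [hg] at hgu
    linarith
  have hu' : u ∈ Ioo a b := ⟨lt_of_le_of_ne hu.1 hua.symm, lt_of_le_of_ne hu.2 hub⟩
  obtain ⟨m, hm⟩ := h u hu' (ε / 2) (by positivity)
  set m' : ℝ := m + ε * (2 * u - a - b) with hm'
  have hin : ∀ᶠ s in 𝓝 u, s ∈ Icc a b := Icc_mem_nhds hu'.1 hu'.2
  have key : ∀ᶠ s in 𝓝 u, m' * (s - u) + ε / 2 * (s - u) ^ 2 ≤ 0 := by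
    filter_upwards [hm, hin] with s hs hsi
    have h1 : g s ≤ g u := hmax hsi
    simp only [hg] at h1
    rw [hm']
    nlinarith
  obtain ⟨δ, hδ, hball⟩ := Metric.eventually_nhds_iff.1 key
  -- A step towards the side on which the linear term is nonnegative makes the quadratic term
  -- decisive.
  rcases le_total 0 m' with h0 | h0
  · have := hball (y := u + δ / 2) (by simp [abs_of_pos hδ, hδ])
    have e : u + δ / 2 - u = δ / 2 := by ring
    rw [e] at this
    have : 0 < m' * (δ / 2) + ε / 2 * (δ / 2) ^ 2 := by positivity
    linarith
  · have := hball (y := u - δ / 2) (by simp [abs_of_pos hδ, hδ])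
    have e : u - δ / 2 - u = -(δ / 2) := by ring
    rw [e] at this
    have h2 : 0 ≤ (-m') * (δ / 2) := mul_nonneg (by linarith) (by linarith)
    have h3 : 0 < ε / 2 * (δ / 2) ^ 2 := by positivity
    nlinarith

/-- Subtracting the chord changes only the slopes of the touching parabolas, so the maximum
principle applies to the difference. In this sense `f` is convex. -/
lemma le_chord_of_lower_parabola {f : ℝ → ℝ} {a b : ℝ} (hab : a < b)
    (hf : ContinuousOn f (Icc a b))
    (h : ∀ t ∈ Ioo a b, ∀ ε > 0, ∃ m : ℝ, ∀ᶠ s in 𝓝 t, f t + m * (s - t) - ε * (s - t) ^ 2 ≤ f s)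
    {t : ℝ} (ht : t ∈ Icc a b) : f t ≤ f a + (f b - f a) / (b - a) * (t - a) := by
  set k : ℝ := (f b - f a) / (b - a) with hk
  have := nonpos_of_lower_parabola (f := fun s => f s - (f a + k * (s - a))) (a := a) (b := b)
    (hf.sub (by fun_prop)) ?_ (by simp) ?_ ht
  · linarith
  · intro t ht ε hε
    obtain ⟨m, hm⟩ := h t ht ε hε
    refine ⟨m - k, hm.mono fun s hs => ?_⟩
    nlinarith
  · have : b - a ≠ 0 := by linarith
    simp only [hk, div_mul_cancel₀ _ this]
    linarith

/-- Taylor's formula with Peano remainder: the derivative of the remainder is `o(s - t)`, and the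
mean value inequality on the ball of radius `|s - t|` integrates this bound. -/
lemma second_order_expansion {l l' : ℝ → ℝ} {c t : ℝ} (h : ∀ s, HasDerivAt l (l' s) s)
    (h2 : HasDerivAt l' c t) {ε : ℝ} (hε : 0 < ε) :
    ∀ᶠ s in 𝓝 t, |l s - l t - l' t * (s - t) - c / 2 * (s - t) ^ 2| ≤ ε * (s - t) ^ 2 := by
  have h3 : ∀ᶠ s in 𝓝 t, ‖l' s - l' t - (s - t) * c‖ ≤ ε * ‖s - t‖ := by
    have := (hasDerivAt_iff_isLittleO.1 h2).def hε
    simpa [smul_eq_mul] using this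
  obtain ⟨δ, hδ, hball⟩ := Metric.eventually_nhds_iff.1 h3
  filter_upwards [Metric.ball_mem_nhds t hδ] with s hs
  set g : ℝ → ℝ := fun r => l r - l' t * (r - t) - c / 2 * (r - t) ^ 2 with hg
  have hgd : ∀ r, HasDerivAt g (l' r - l' t - (r - t) * c) r := by
    intro r
    have h1 : HasDerivAt (fun r => l' t * (r - t)) (l' t) r := by
      simpa using ((hasDerivAt_id r).sub_const t).const_mul (l' t)
    have h2 : HasDerivAt (fun r => c / 2 * (r - t) ^ 2) ((r - t) * c) r := by
      have h3 : HasDerivAt (fun r : ℝ => (r - t) ^ 2) (2 * (r - t)) r := by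
        simpa using ((hasDerivAt_id' r).sub_const t).fun_pow 2
      exact (h3.const_mul (c / 2)).congr_deriv (by ring)
    exact ((h r).sub h1).sub h2
  have hmv := Convex.norm_image_sub_le_of_norm_hasDerivWithin_le (f := g)
    (s := Metric.closedBall t |s - t|) (x := t) (y := s) (C := ε * |s - t|)
    (fun r _ => (hgd r).hasDerivWithinAt) (fun r hr => ?_) (convex_closedBall _ _)
    (Metric.mem_closedBall_self (abs_nonneg _)) (by simp [Real.dist_eq])
  · have e : g s - g t = l s - l t - l' t * (s - t) - c / 2 * (s - t) ^ 2 := by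
      simp only [hg]; ring
    rw [e, Real.norm_eq_abs, Real.norm_eq_abs, mul_assoc, abs_mul_abs_self, ← sq] at hmv
    exact hmv
  · have hr' : |r - t| ≤ |s - t| := by simpa [Real.dist_eq] using hr
    have hd : dist r t < δ := by
      rw [Real.dist_eq]
      exact hr'.trans_lt (by simpa [Real.dist_eq] using hs)
    refine (hball hd).trans ?_
    rw [Real.norm_eq_abs]
    gcongr

end SecondOrder

/-! ### Supporting planes and distances for the convex domain. -/

section Domain

variable {Ω : Set R3} {ρ : R3 → ℝ}

namespace IsSmoothConvexDomain

lemma isOpen (hΩ : IsSmoothConvexDomain Ω ρ) : IsOpen Ω := by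
  rw [hΩ.eq_sublevel]
  exact isOpen_lt hΩ.smooth.continuous continuous_const

lemma isCompact_closure (hΩ : IsSmoothConvexDomain Ω ρ) : IsCompact (closure Ω) :=
  hΩ.bounded.isCompact_closure

lemma notMem_of_mem_frontier (hΩ : IsSmoothConvexDomain Ω ρ) {x : R3} (hx : x ∈ frontier Ω) :
    x ∉ Ω := by
  rw [hΩ.isOpen.frontier_eq] at hx
  exact hx.2

lemma eq_zero_of_mem_frontier (hΩ : IsSmoothConvexDomain Ω ρ) {x : R3} (hx : x ∈ frontier Ω) :
    ρ x = 0 := by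
  have h1 := hΩ.notMem_of_mem_frontier hx
  rw [hΩ.eq_sublevel] at h1 hx
  have h2 : closure {x | ρ x < 0} ⊆ {x | ρ x ≤ 0} :=
    closure_minimal (fun x (h : ρ x < 0) => (h.le : ρ x ≤ 0)) (isClosed_le hΩ.smooth.continuous continuous_const)
  exact le_antisymm (h2 (frontier_subset_closure hx)) (not_lt.1 h1)

lemma gradient_ne_zero (hΩ : IsSmoothConvexDomain Ω ρ) {x : R3} (hx : x ∈ frontier Ω) :
    gradient ρ x ≠ 0 :=
  hΩ.regular x (hΩ.eq_zero_of_mem_frontier hx)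

lemma hasFDerivAt (hΩ : IsSmoothConvexDomain Ω ρ) (x : R3) :
    HasFDerivAt ρ (innerSL ℝ (gradient ρ x)) x :=
  (hΩ.smooth.differentiable (by simp) x).hasGradientAt.hasFDerivAt

lemma norm_outerNormal (hΩ : IsSmoothConvexDomain Ω ρ) {x : R3} (hx : x ∈ frontier Ω) :
    ‖outerNormal ρ x‖ = 1 := by
  rw [outerNormal, norm_smul, norm_inv, norm_norm,
    inv_mul_cancel₀ (norm_ne_zero_iff.2 (hΩ.gradient_ne_zero hx))]

lemma inner_outerNormal (x e : R3) :
    inner ℝ (outerNormal ρ x) e = ‖gradient ρ x‖⁻¹ * inner ℝ (gradient ρ x) e := by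
  rw [outerNormal, real_inner_smul_left]

lemma inner_gradient (hΩ : IsSmoothConvexDomain Ω ρ) {x : R3} (hx : x ∈ frontier Ω) (e : R3) :
    inner ℝ (gradient ρ x) e = ‖gradient ρ x‖ * inner ℝ (outerNormal ρ x) e := by
  rw [inner_outerNormal, ← mul_assoc,
    mul_inv_cancel₀ (norm_ne_zero_iff.2 (hΩ.gradient_ne_zero hx)), one_mul]

lemma norm_gradient_pos (hΩ : IsSmoothConvexDomain Ω ρ) {x : R3} (hx : x ∈ frontier Ω) :
    0 < ‖gradient ρ x‖ := norm_pos_iff.2 (hΩ.gradient_ne_zero hx)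

/-- A curve through a boundary point with outgoing velocity comes from the inside. -/
lemma eventually_mem_left (hΩ : IsSmoothConvexDomain Ω ρ) {c : ℝ → R3} {e : R3} {t : ℝ}
    (hx : c t ∈ frontier Ω) (hc : HasDerivAt c e t)
    (he : 0 < inner ℝ (outerNormal ρ (c t)) e) : ∀ᶠ s in 𝓝[<] t, c s ∈ Ω := by
  have h := (hΩ.hasFDerivAt (c t)).comp_hasDerivAt t hc
  have hpos : 0 < innerSL ℝ (gradient ρ (c t)) e := by
    rw [innerSL_apply_apply, hΩ.inner_gradient hx]
    exact mul_pos (hΩ.norm_gradient_pos hx) he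
  have h2 := (hasDerivAt_iff_tendsto_slope_left_right.1 h).1.eventually (lt_mem_nhds hpos)
  filter_upwards [h2, self_mem_nhdsWithin] with s hs hst
  rw [slope_def_field] at hs
  simp only [Function.comp_apply, hΩ.eq_zero_of_mem_frontier hx, sub_zero] at hs
  have hst' : s - t < 0 := by simpa using hst
  rw [hΩ.eq_sublevel]
  rcases div_pos_iff.1 hs with h | h
  · linarith [h.2]
  · exact h.1

/-- Rays from a boundary point in an inward direction enter the domain. -/
lemma eventually_add_smul_mem (hΩ : IsSmoothConvexDomain Ω ρ) {x e : R3}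
    (hx : x ∈ frontier Ω) (he : inner ℝ (outerNormal ρ x) e < 0) :
    ∀ᶠ s in 𝓝[>] (0 : ℝ), x + s • e ∈ Ω := by
  have hc : HasDerivAt (fun s : ℝ => x - s • e) (-e) 0 := by
    simpa using ((hasDerivAt_id (0 : ℝ)).smul_const e).const_sub x
  have h := hΩ.eventually_mem_left (c := fun s : ℝ => x - s • e) (t := 0) (by simpa using hx) hc
    (by simpa [inner_neg_right] using he)
  have h2 : Tendsto (fun s : ℝ => -s) (𝓝[>] 0) (𝓝[<] 0) := by
    have := tendsto_neg_nhdsGT (a := (0 : ℝ))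
    simpa using this
  filter_upwards [h2.eventually h] with s hs
  simpa using hs

/-- If `y` were beyond the tangent plane, the opposite direction `x - y` would enter `Ω`. Then `x`
would lie between an interior point and a point of the closure, hence inside `Ω` by convexity. -/
lemma inner_outerNormal_sub_nonpos (hΩ : IsSmoothConvexDomain Ω ρ) {x y : R3}
    (hx : x ∈ frontier Ω) (hy : y ∈ closure Ω) : inner ℝ (outerNormal ρ x) (y - x) ≤ 0 := by
  by_contra! hpos
  have hc : HasDerivAt (fun s : ℝ => x + s • (x - y)) (x - y) 0 := by
    simpa using ((hasDerivAt_id (0 : ℝ)).smul_const (x - y)).const_add x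
  have h := hΩ.eventually_add_smul_mem (x := x) (e := x - y) hx (by
    rw [← neg_sub y x, inner_neg_right]; linarith)
  obtain ⟨s, hs, hs0⟩ := (h.and self_mem_nhdsWithin).exists
  have hs0 : 0 < s := hs0
  have hxint : x ∈ interior Ω := by
    have := hΩ.convex.openSegment_interior_closure_subset_interior
      (x := x + s • (x - y)) (y := y) (by rwa [hΩ.isOpen.interior_eq]) hy
    apply this
    refine ⟨1 / (1 + s), s / (1 + s), by positivity, by positivity, by field_simp, ?_⟩
    have h1 : (1 / (1 + s)) + (1 / (1 + s)) * s = 1 := by field_simp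
    have h2 : s / (1 + s) = (1 / (1 + s)) * s := by ring
    rw [h2, smul_add, smul_smul, smul_sub]
    calc _ = ((1 / (1 + s)) + (1 / (1 + s)) * s) • x := by rw [add_smul]; abel
      _ = x := by rw [h1, one_smul]
  rw [hΩ.isOpen.interior_eq] at hxint
  exact hΩ.notMem_of_mem_frontier hx hxint

/-- As `Ω` is open, `y` can be pushed a little along the normal, and the weak inequality at the new
point is strict at `y`. -/
lemma inner_outerNormal_sub_neg (hΩ : IsSmoothConvexDomain Ω ρ) {x y : R3}
    (hx : x ∈ frontier Ω) (hy : y ∈ Ω) : inner ℝ (outerNormal ρ x) (y - x) < 0 := by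
  obtain ⟨δ, hδ, hball⟩ := Metric.isOpen_iff.1 hΩ.isOpen y hy
  have h := hΩ.inner_outerNormal_sub_nonpos hx (y := y + (δ / 2) • outerNormal ρ x)
    (subset_closure (hball (by
      simp [norm_smul, hΩ.norm_outerNormal hx, abs_of_pos hδ, hδ])))
  have e : y + (δ / 2) • outerNormal ρ x - x = (y - x) + (δ / 2) • outerNormal ρ x := by abel
  rw [e, inner_add_right, real_inner_smul_right, real_inner_self_eq_norm_sq,
    hΩ.norm_outerNormal hx] at h
  linarith

/-- A supporting functional at a boundary point annihilates the tangent directions. -/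
lemma inner_eq_zero_of_supporting (hΩ : IsSmoothConvexDomain Ω ρ) {p ν e : R3}
    (hp : p ∈ frontier Ω) (hν : ∀ y ∈ Ω, inner ℝ ν (y - p) ≤ 0)
    (he : inner ℝ (outerNormal ρ p) e = 0) : inner ℝ ν e = 0 := by
  have main : ∀ e, inner ℝ (outerNormal ρ p) e = 0 → inner ℝ ν e ≤ 0 := by
    intro e he
    by_contra! hpos
    set n := outerNormal ρ p
    have hn : inner ℝ n n = (1 : ℝ) := by
      rw [real_inner_self_eq_norm_sq, hΩ.norm_outerNormal hp]; norm_num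
    -- Tilting `e` inwards by `δ n` makes it enter `Ω`. This `δ` is small enough that `δ ⟨ν, n⟩ <
    -- ⟨ν, e⟩`, so the tilted ray violates the supporting inequality.
    set δ : ℝ := inner ℝ ν e / (2 * (|inner ℝ ν n| + 1)) with hδ
    have hδ0 : 0 < δ := by positivity
    have hev := hΩ.eventually_add_smul_mem (x := p) (e := e - δ • n) hp (by
      rw [inner_sub_right, he, real_inner_smul_right, hn]; linarith)
    obtain ⟨s, hs, hs0⟩ := (hev.and self_mem_nhdsWithin).exists
    have hs0 : 0 < s := hs0
    have h1 := hν _ hs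
    rw [add_sub_cancel_left, real_inner_smul_right, inner_sub_right, real_inner_smul_right] at h1
    have h2 : δ * inner ℝ ν n < inner ℝ ν e := by
      calc δ * inner ℝ ν n ≤ δ * |inner ℝ ν n| := by gcongr; exact le_abs_self _
        _ < inner ℝ ν e := by
          rw [hδ, div_mul_eq_mul_div, div_lt_iff₀ (by positivity)]
          nlinarith [abs_nonneg (inner ℝ ν n)]
    nlinarith
  refine le_antisymm (main e he) ?_
  have := main (-e) (by rw [inner_neg_right, he, neg_zero])
  rw [inner_neg_right] at this
  linarith

/-- The nearest boundary point of an interior point. -/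
lemma exists_nearest_boundary (hΩ : IsSmoothConvexDomain Ω ρ) {x : R3} (hx : x ∈ Ω) :
    ∃ q ∈ frontier Ω, dist x q = Metric.infDist x Ωᶜ ∧
      inner ℝ (outerNormal ρ q) (q - x) = Metric.infDist x Ωᶜ := by
  have hne : (Ωᶜ).Nonempty := by
    by_contra h
    rw [not_nonempty_iff_eq_empty, compl_empty_iff] at h
    exact NormedSpace.unbounded_univ ℝ R3 (h ▸ hΩ.bounded)
  obtain ⟨q, hq, hqd⟩ := hΩ.isOpen.isClosed_compl.exists_infDist_eq_dist hne x
  have hball : Metric.ball x (dist x q) ⊆ Ω := by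
    intro y hy
    by_contra hyΩ
    have := Metric.infDist_le_dist_of_mem (x := x) (s := Ωᶜ) hyΩ
    rw [hqd, dist_comm x y] at this
    exact absurd (Metric.mem_ball.1 hy) (not_lt.2 this)
  have hr : 0 < dist x q := dist_pos.2 (fun h => hq (h ▸ hx))
  have hqf : q ∈ frontier Ω := by
    rw [hΩ.isOpen.frontier_eq]
    refine ⟨closure_mono hball ?_, hq⟩
    rw [closure_ball _ hr.ne']
    simp [dist_comm]
  refine ⟨q, hqf, hqd.symm, ?_⟩
  rw [hqd]
  set n := outerNormal ρ q
  have hn1 : ‖n‖ = 1 := hΩ.norm_outerNormal hqf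
  apply le_antisymm
  · calc inner ℝ n (q - x) ≤ ‖n‖ * ‖q - x‖ := real_inner_le_norm _ _
      _ = dist x q := by rw [hn1, one_mul, dist_eq_norm, norm_sub_rev]
  -- For `s` below the distance, `x + s n` is still in `Ω`, hence strictly on the inner side of the
  -- tangent plane at `q`.
  · refine le_of_forall_lt_imp_le_of_dense fun s hs => ?_
    rcases le_or_gt s 0 with h0 | h0
    · have := hΩ.inner_outerNormal_sub_neg hqf hx
      rw [← neg_sub, inner_neg_right] at this
      linarith
    · have hy : x + s • n ∈ Ω := hball (by simp [norm_smul, hn1, abs_of_pos h0, hs])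
      have := hΩ.inner_outerNormal_sub_neg hqf hy
      have e : x + s • n - q = s • n - (q - x) := by abel
      rw [e, inner_sub_right, real_inner_smul_right, real_inner_self_eq_norm_sq] at this
      change s * ‖n‖ ^ 2 - _ < 0 at this
      rw [hn1] at this
      linarith

/-- Moving from `y` along the normal up to the tangent plane at `q` leaves `Ω`. The right side is
affine in `y`, which makes it a barrier along orbits. -/
lemma infDist_compl_le (hΩ : IsSmoothConvexDomain Ω ρ) {q y : R3} (hq : q ∈ frontier Ω)
    (hy : y ∈ Ω) : Metric.infDist y Ωᶜ ≤ inner ℝ (outerNormal ρ q) (q - y) := by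
  set n := outerNormal ρ q
  have hn1 : ‖n‖ = 1 := hΩ.norm_outerNormal hq
  set a : ℝ := inner ℝ n (q - y) with ha
  have ha0 : 0 < a := by
    have := hΩ.inner_outerNormal_sub_neg hq hy
    rw [← neg_sub, inner_neg_right] at this
    linarith
  have hmem : y + a • n ∈ Ωᶜ := by
    intro h
    have := hΩ.inner_outerNormal_sub_neg hq h
    have e : y + a • n - q = a • n - (q - y) := by abel
    rw [e, inner_sub_right, real_inner_smul_right, real_inner_self_eq_norm_sq] at this
    change a * ‖n‖ ^ 2 - a < 0 at this
    rw [hn1] at this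
    linarith
  refine (Metric.infDist_le_dist_of_mem hmem).trans ?_
  simp [norm_smul, hn1, abs_of_pos ha0]

end IsSmoothConvexDomain

end Domain

/-! ### Characteristics and their exit from the domain. -/

section Orbits

variable {Ω : Set R3} {ρ : R3 → ℝ}

/-- A global Lipschitz field, tangential on `∂Ω` and constant along the fibres of the
nearest-point projection onto `closure Ω`. -/
structure IsTangentField (Ω : Set R3) (ρ : R3 → ℝ) (K : ℝ≥0) (B : R3 → R3) : Prop where
  lipschitz : LipschitzWith K B
  tangential : ∀ x ∈ frontier Ω, inner ℝ (outerNormal ρ x) (B x) = 0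
  nearest : ∀ x, ∃ p ∈ closure Ω, B x = B p ∧ ∀ y ∈ closure Ω, inner ℝ (x - p) (y - p) ≤ 0

lemma exists_nearest_point {C : Set R3} (hne : C.Nonempty) (hC : IsClosed C) (hconv : Convex ℝ C)
    (x : R3) : ∃ p ∈ C, ∀ y ∈ C, inner ℝ (x - p) (y - p) ≤ 0 := by
  obtain ⟨p, hp, h⟩ := exists_norm_eq_iInf_of_complete_convex hne hC.isComplete hconv x
  exact ⟨p, hp, (norm_eq_iInf_iff_real_inner_le_zero hconv hp).1 h⟩

/-- Adding the two variational inequalities gives `‖p - p'‖² ≤ ⟨x - x', p - p'⟩`, and Cauchy–Schwarz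
concludes. -/
lemma dist_le_of_nearest {x x' p p' : R3} (h : inner ℝ (x - p) (p' - p) ≤ 0)
    (h' : inner ℝ (x' - p') (p - p') ≤ 0) : dist p p' ≤ dist x x' := by
  have key : ‖p - p'‖ ^ 2 ≤ inner ℝ (x - x') (p - p') := by
    rw [← real_inner_self_eq_norm_sq]
    have e1 : inner ℝ (x - p) (p' - p) = -inner ℝ (x - p) (p - p') := by
      rw [← inner_neg_right, neg_sub]
    rw [e1] at h
    have e2 : inner ℝ (x - x') (p - p')
        = inner ℝ (x - p) (p - p') - inner ℝ (x' - p') (p - p') + inner ℝ (p - p') (p - p') := by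
      rw [← inner_sub_left, ← inner_add_left]
      congr 1
      abel
    linarith
  have h2 : inner ℝ (x - x') (p - p') ≤ ‖x - x'‖ * ‖p - p'‖ := real_inner_le_norm _ _
  rw [dist_eq_norm, dist_eq_norm]
  by_contra! hlt
  nlinarith [norm_nonneg (p - p'), norm_nonneg (x - x'), hlt]

/-- The force field extends to a global field by composition with the nearest-point projection. -/
theorem IsForceField.exists_extension (hΩ : IsSmoothConvexDomain Ω ρ) {E : R3 → R3}
    (hE : IsForceField Ω ρ E) : ∃ (K : ℝ≥0) (B : R3 → R3), IsTangentField Ω ρ K B ∧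
      (∀ x ∈ Ω, B x = E x) ∧ ∀ j : Fin 3, (∀ x ∈ Ω, E x j = 0) → ∀ x, B x j = 0 := by
  obtain ⟨M, hM⟩ := hE.bounded
  have hdiff : ∀ x ∈ Ω, DifferentiableAt ℝ E x := fun x hx =>
    (hE.contDiffOn.differentiableOn (by simp)).differentiableAt (hΩ.isOpen.mem_nhds hx)
  -- Convexity turns the bound on the derivative into a Lipschitz bound on `Ω`; continuity carries
  -- it to the closure.
  have hlip : LipschitzOnWith (Real.toNNReal M) E Ω :=
    hΩ.convex.lipschitzOnWith_of_nnnorm_fderiv_le hdiff fun x hx => by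
      rw [← NNReal.coe_le_coe]
      exact (hM x hx).2.trans (Real.le_coe_toNNReal M)
  have hlip' : LipschitzOnWith (Real.toNNReal M) E (closure Ω) :=
    (lipschitzOnWith_closure_iff hE.continuousOn).2 hlip
  choose P hP hPn using exists_nearest_point hΩ.nonempty.closure isClosed_closure hΩ.convex.closure
  have hPid : ∀ x ∈ closure Ω, P x = x := by
    intro x hx
    have := hPn x x hx
    rw [real_inner_self_nonpos] at this
    exact (sub_eq_zero.1 this).symm
  refine ⟨Real.toNNReal M, fun x => E (P x), ⟨?_, ?_, ?_⟩, ?_, ?_⟩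
  · refine LipschitzWith.of_dist_le_mul fun x y => ?_
    refine (hlip'.dist_le_mul _ (hP x) _ (hP y)).trans ?_
    gcongr
    exact dist_le_of_nearest (hPn x _ (hP y)) (hPn y _ (hP x))
  · intro x hx
    simp only [hPid x (frontier_subset_closure hx)]
    exact hE.tangential x hx
  · intro x
    exact ⟨P x, hP x, by simp only [hPid _ (hP x)], hPn x⟩
  · intro x hx
    simp only [hPid x (subset_closure hx)]
  · intro j hj x
    have hc : closure Ω ⊆ {x | x ∈ closure Ω → E x j = 0} := by
      have hcont : ContinuousOn (fun x => E x j) (closure Ω) :=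
        (EuclideanSpace.proj (𝕜 := ℝ) j).continuous.comp_continuousOn hE.continuousOn
      intro x hx _
      have := EqOn.of_subset_closure (s := Ω) (t := closure Ω) (f := fun x => E x j)
        (g := fun _ => (0 : ℝ)) (fun x hx => hj x hx) hcont continuousOn_const subset_closure
        subset_rfl
      exact this hx
    exact hc (hP x) (hP x)

/-- The field `(v, B(x))` of the characteristic system. -/
def field (B : R3 → R3) (z : R3 × R3) : R3 × R3 := (z.2, B z.1)

lemma lipschitzWith_field {B : R3 → R3} {K : ℝ≥0} (hB : LipschitzWith K B) :
    LipschitzWith (max 1 K) (field B) := by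
  have h1 : LipschitzWith 1 (fun z : R3 × R3 => z.2) := LipschitzWith.prod_snd
  have h2 : LipschitzWith (K * 1) (fun z : R3 × R3 => B z.1) := hB.comp LipschitzWith.prod_fst
  rw [mul_one] at h2
  exact h1.prodMk h2

variable {K : ℝ≥0} {B : R3 → R3} {Z : ℝ → R3 × R3 → R3 × R3}

namespace IsFlow

lemma deriv_fst (hZ : IsFlow (field B) Z) (t : ℝ) (z : R3 × R3) :
    HasDerivAt (fun s => (Z s z).1) (Z t z).2 t :=
  (ContinuousLinearMap.fst ℝ R3 R3).hasFDerivAt.comp_hasDerivAt t (hZ.deriv t z)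

lemma deriv_snd (hZ : IsFlow (field B) Z) (t : ℝ) (z : R3 × R3) :
    HasDerivAt (fun s => (Z s z).2) (B (Z t z).1) t :=
  (ContinuousLinearMap.snd ℝ R3 R3).hasFDerivAt.comp_hasDerivAt t (hZ.deriv t z)

/-- Conservation of the `j`-th velocity component, which confines the orbits issuing from `Ω × 𝒰` to
velocities in `𝒱`. -/
lemma snd_apply_eq (hZ : IsFlow (field B) Z) {j : Fin 3} (hj : ∀ x, B x j = 0) (t : ℝ)
    (z : R3 × R3) : (Z t z).2 j = z.2 j := by
  have h : ∀ s, HasDerivAt (fun s => (Z s z).2 j) 0 s := by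
    intro s
    have := (EuclideanSpace.proj (𝕜 := ℝ) j).hasFDerivAt.comp_hasDerivAt s (hZ.deriv_snd s z)
    have e : (EuclideanSpace.proj (𝕜 := ℝ) j) (B (Z s z).1) = 0 := hj _
    rw [e] at this
    exact this
  have := is_const_of_deriv_eq_zero (fun s => (h s).differentiableAt) (fun s => (h s).deriv) t 0
  simpa [hZ.zero] using this

lemma hasDerivAt_inner_fst (hZ : IsFlow (field B) Z) (ν p : R3) (z : R3 × R3) (t : ℝ) :
    HasDerivAt (fun s => inner ℝ ν ((Z s z).1 - p)) (inner ℝ ν (Z t z).2) t :=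
  (innerSL ℝ ν).hasFDerivAt.comp_hasDerivAt t ((hZ.deriv_fst t z).sub_const p)

lemma hasDerivAt_inner_snd (hZ : IsFlow (field B) Z) (ν : R3) (z : R3 × R3) (t : ℝ) :
    HasDerivAt (fun s => inner ℝ ν (Z s z).2) (inner ℝ ν (B (Z t z).1)) t :=
  (innerSL ℝ ν).hasFDerivAt.comp_hasDerivAt t (hZ.deriv_snd t z)

end IsFlow

lemma continuous_fst_orbit (hZ : IsFlow (field B) Z) (z : R3 × R3) :
    Continuous fun t => (Z t z).1 := continuous_fst.comp (hZ.continuous_time z)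

/-- The distance to the domain is touched from below by almost flat parabolas along orbits. -/
lemma infDist_closure_lower_parabola (hΩ : IsSmoothConvexDomain Ω ρ) (hB : IsTangentField Ω ρ K B)
    (hZ : IsFlow (field B) Z) (z : R3 × R3) (t : ℝ) {ε : ℝ} (hε : 0 < ε) :
    ∃ m : ℝ, ∀ᶠ s in 𝓝 t, Metric.infDist (Z t z).1 (closure Ω) + m * (s - t) - ε * (s - t) ^ 2
      ≤ Metric.infDist (Z s z).1 (closure Ω) := by
  have hne : (closure Ω).Nonempty := hΩ.nonempty.closure
  by_cases hx : (Z t z).1 ∈ closure Ω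
  · refine ⟨0, Eventually.of_forall fun s => ?_⟩
    rw [Metric.infDist_zero_of_mem hx]
    nlinarith [Metric.infDist_nonneg (x := (Z s z).1) (s := closure Ω), sq_nonneg (s - t)]
  set x := (Z t z).1 with hxdef
  obtain ⟨p, hp, hBp, hin⟩ := hB.nearest x
  have hxp : x - p ≠ 0 := fun h => hx (by rw [sub_eq_zero.1 h]; exact hp)
  have hnorm : 0 < ‖x - p‖ := norm_pos_iff.2 hxp
  -- The affine function `⟨ν, y - p⟩` is at most the distance of `y` to the closure, with equality
  -- at `x`. Its expansion along the orbit supplies the parabola.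
  set ν : R3 := ‖x - p‖⁻¹ • (x - p) with hν
  have hν1 : ‖ν‖ = 1 := by rw [hν, norm_smul, norm_inv, norm_norm, inv_mul_cancel₀ hnorm.ne']
  have hνy : ∀ y ∈ closure Ω, inner ℝ ν (y - p) ≤ 0 := by
    intro y hy
    rw [hν, real_inner_smul_left]
    exact mul_nonpos_of_nonneg_of_nonpos (by positivity) (hin y hy)
  have hlow : ∀ y, inner ℝ ν (y - p) ≤ Metric.infDist y (closure Ω) := by
    intro y
    refine (Metric.le_infDist hne).2 fun k hk => ?_
    have e : y - p = (y - k) + (k - p) := by abel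
    rw [e, inner_add_right, dist_eq_norm]
    have h1 : inner ℝ ν (y - k) ≤ ‖ν‖ * ‖y - k‖ := real_inner_le_norm _ _
    rw [hν1, one_mul] at h1
    linarith [hνy k hk]
  have hpx : inner ℝ ν (x - p) = ‖x - p‖ := by
    rw [hν, real_inner_smul_left, real_inner_self_eq_norm_sq]
    field_simp
  have hpf : p ∈ frontier Ω := by
    rw [hΩ.isOpen.frontier_eq]
    refine ⟨hp, fun hpΩ => ?_⟩
    obtain ⟨δ, hδ, hball⟩ := Metric.isOpen_iff.1 hΩ.isOpen p hpΩ
    have := hνy (p + (δ / 2) • ν) (subset_closure (hball (by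
      simp [norm_smul, hν1, abs_of_pos hδ, hδ])))
    rw [add_sub_cancel_left, real_inner_smul_right, real_inner_self_eq_norm_sq, hν1] at this
    linarith
  -- The second derivative of the barrier vanishes: the field at `x` is the field at `p`, which is
  -- tangential, and `ν` supports `Ω` at `p`.
  have hcurv : inner ℝ ν (B x) = 0 := by
    rw [hBp]
    exact hΩ.inner_eq_zero_of_supporting hpf (fun y hy => hνy y (subset_closure hy))
      (hB.tangential p hpf)
  refine ⟨inner ℝ ν (Z t z).2, ?_⟩
  have hexp := second_order_expansion (hZ.hasDerivAt_inner_fst ν p z)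
    (hZ.hasDerivAt_inner_snd ν z t) hε
  filter_upwards [hexp] with s hs
  rw [← hxdef, hcurv] at hs
  have h1 : Metric.infDist x (closure Ω) ≤ inner ℝ ν (x - p) := by
    rw [hpx, ← dist_eq_norm]
    exact Metric.infDist_le_dist_of_mem hp
  have h2 := hlow (Z s z).1
  have h3 := (abs_le.1 hs).1
  linarith

/-- Just after an outgoing point the orbit lies strictly beyond the tangent plane, so its distance
to the closure is positive. This distance is convex in time and zero at the start, hence cannot
vanish again. -/
lemma fst_notMem_closure_of_gammaPlus (hΩ : IsSmoothConvexDomain Ω ρ) (hB : IsTangentField Ω ρ K B)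
    (hZ : IsFlow (field B) Z) {y : R3 × R3} (hy : y ∈ GammaPlus Ω ρ) {t : ℝ} (ht : 0 < t) :
    (Z t y).1 ∉ closure Ω := by
  intro hmem
  obtain ⟨hyf, hyv⟩ := hy
  set ν := outerNormal ρ y.1
  have hd := hZ.hasDerivAt_inner_fst ν y.1 y 0
  rw [hZ.zero] at hd
  have hev := (hasDerivAt_iff_tendsto_slope_left_right.1 hd).2.eventually (lt_mem_nhds hyv)
  obtain ⟨s, hs, hs0⟩ := (hev.and (Ioo_mem_nhdsGT ht)).exists
  rw [slope_def_field, hZ.zero, sub_self, inner_zero_right, sub_zero, sub_zero] at hs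
  have hspos : 0 < inner ℝ ν ((Z s y).1 - y.1) := by
    rcases div_pos_iff.1 hs with h | h
    · exact h.1
    · linarith [h.2, hs0.1]
  have hnot : (Z s y).1 ∉ closure Ω := fun h =>
    absurd (hΩ.inner_outerNormal_sub_nonpos hyf h) (not_le.2 hspos)
  have hpos : 0 < Metric.infDist (Z s y).1 (closure Ω) :=
    (isClosed_closure.notMem_iff_infDist_pos hΩ.nonempty.closure).1 hnot
  have h0 : Metric.infDist (Z 0 y).1 (closure Ω) = 0 := by
    rw [hZ.zero]
    exact Metric.infDist_zero_of_mem (frontier_subset_closure hyf)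
  have h1 : Metric.infDist (Z t y).1 (closure Ω) = 0 := Metric.infDist_zero_of_mem hmem
  have := le_chord_of_lower_parabola (f := fun s => Metric.infDist (Z s y).1 (closure Ω)) ht
    ((Metric.continuous_infDist_pt _).comp (continuous_fst_orbit hZ y)).continuousOn
    (fun t _ ε hε => infDist_closure_lower_parabola hΩ hB hZ y t hε) ⟨hs0.1.le, hs0.2.le⟩
  simp only [h0, h1] at this
  norm_num at this
  linarith

/-- The barrier is the distance to the tangent plane at the nearest boundary point `q`. Since `B q`
is tangential, the normal component of `B` at the orbit point is at most `K` times the distance to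
`q`; this is the curvature error. -/
lemma infDist_compl_upper_parabola (hΩ : IsSmoothConvexDomain Ω ρ) (hB : IsTangentField Ω ρ K B)
    (hZ : IsFlow (field B) Z) (z : R3 × R3) {t : ℝ} (ht : (Z t z).1 ∈ Ω) {ε : ℝ} (hε : 0 < ε) :
    ∃ m : ℝ, ∀ᶠ s in 𝓝 t, Metric.infDist (Z s z).1 Ωᶜ ≤ Metric.infDist (Z t z).1 Ωᶜ + m * (s - t)
      + (K * Metric.infDist (Z t z).1 Ωᶜ / 2 + ε) * (s - t) ^ 2 := by
  obtain ⟨q, hq, hqd, hqn⟩ := hΩ.exists_nearest_boundary ht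
  set n := outerNormal ρ q
  have hn1 : ‖n‖ = 1 := hΩ.norm_outerNormal hq
  set r := Metric.infDist (Z t z).1 Ωᶜ
  have hexp := second_order_expansion (hZ.hasDerivAt_inner_fst n q z)
    (hZ.hasDerivAt_inner_snd n z t) hε
  have hin : ∀ᶠ s in 𝓝 t, (Z s z).1 ∈ Ω :=
    (continuous_fst_orbit hZ z).continuousAt.eventually_mem (hΩ.isOpen.mem_nhds ht)
  have hcurv : -(K * r) ≤ inner ℝ n (B (Z t z).1) := by
    have e : inner ℝ n (B (Z t z).1) = inner ℝ n (B (Z t z).1 - B q) := by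
      rw [inner_sub_right, hB.tangential q hq, sub_zero]
    have h1 : |inner ℝ n (B (Z t z).1 - B q)| ≤ ‖n‖ * ‖B (Z t z).1 - B q‖ :=
      abs_real_inner_le_norm _ _
    have h2 := hB.lipschitz.dist_le_mul (Z t z).1 q
    rw [hqd, dist_eq_norm] at h2
    rw [hn1, one_mul] at h1
    rw [e]
    linarith [(abs_le.1 (h1.trans h2)).1]
  refine ⟨-inner ℝ n (Z t z).2, ?_⟩
  filter_upwards [hexp, hin] with s hs hsΩ
  have h1 := hΩ.infDist_compl_le hq hsΩ
  have h2 : inner ℝ n ((Z s z).1 - q) = -inner ℝ n (q - (Z s z).1) := by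
    rw [← inner_neg_right, neg_sub]
  have h3 : inner ℝ n ((Z t z).1 - q) = -r := by
    rw [← hqn, ← inner_neg_right, neg_sub]
  rw [h2, h3] at hs
  have h4 := (abs_le.1 hs).1
  nlinarith [sq_nonneg (s - t)]

/-- An orbit inside the domain cannot reach the boundary tangentially. -/
lemma inner_outerNormal_ne_zero_of_exit (hΩ : IsSmoothConvexDomain Ω ρ)
    (hB : IsTangentField Ω ρ K B) (hZ : IsFlow (field B) Z) (z : R3 × R3) {a τ : ℝ} (haτ : a < τ)
    (hin : ∀ t ∈ Ico a τ, (Z t z).1 ∈ Ω) (hτ : (Z τ z).1 ∈ frontier Ω) :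
    inner ℝ (outerNormal ρ (Z τ z).1) (Z τ z).2 ≠ 0 := by
  intro h0
  set q := (Z τ z).1 with hq
  set m : ℝ → ℝ := fun t => Metric.infDist (Z t z).1 Ωᶜ with hm
  have hmc : Continuous m := (Metric.continuous_infDist_pt _).comp (continuous_fst_orbit hZ z)
  have hmτ : m τ = 0 := Metric.infDist_zero_of_mem (hΩ.notMem_of_mem_frontier hτ)
  have hmpos : ∀ t ∈ Ico a τ, 0 < m t := fun t ht =>
    (hΩ.isOpen.isClosed_compl.notMem_iff_infDist_pos ⟨q, hΩ.notMem_of_mem_frontier hτ⟩).1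
      (by simpa using hin t ht)
  -- On an interval of length `l` with `K l² ≤ 1`, the curvature correction below is at most half of
  -- the maximum `M`.
  set l : ℝ := min (τ - a) (1 / (K + 1)) with hl
  have hl0 : 0 < l := lt_min (by linarith) (by positivity)
  have hKl : (K : ℝ) * l ^ 2 ≤ 1 := by
    have h1 : l ≤ 1 / (K + 1) := min_le_right _ _
    have h2 : l ^ 2 ≤ (1 / (K + 1 : ℝ)) ^ 2 := by gcongr
    have h3 : (K : ℝ) * (1 / (K + 1 : ℝ)) ^ 2 ≤ 1 := by
      rw [div_pow, one_pow, mul_one_div, div_le_one (by positivity)]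
      nlinarith [K.2]
    calc (K : ℝ) * l ^ 2 ≤ K * (1 / (K + 1 : ℝ)) ^ 2 := by gcongr
      _ ≤ 1 := h3
  have hla : a ≤ τ - l := by linarith [min_le_left (τ - a) (1 / ((K : ℝ) + 1))]
  obtain ⟨u, hu, humax⟩ := (isCompact_Icc (a := τ - l) (b := τ)).exists_isMaxOn
    ⟨τ, by constructor <;> linarith⟩ hmc.continuousOn
  set M := m u
  have hMpos : 0 < M := (hmpos (τ - l) ⟨hla, by linarith⟩).trans_le
    (humax (show τ - l ∈ Icc (τ - l) τ from ⟨le_rfl, by linarith⟩))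
  have huτ : u < τ := lt_of_le_of_ne hu.2 (fun h => by
    have : M = 0 := by rw [← hmτ, ← h]
    linarith)
  -- On `[u, τ]` one has `m ≤ M`, so the added parabola absorbs the curvature error of `-m`, and `f`
  -- satisfies the chord bound.
  set f : ℝ → ℝ := fun t => -m t + K * M / 2 * (t - τ) ^ 2 with hf
  have hpar : ∀ t ∈ Ioo u τ, ∀ ε > 0, ∃ c : ℝ, ∀ᶠ s in 𝓝 t,
      f t + c * (s - t) - ε * (s - t) ^ 2 ≤ f s := by
    intro t ht ε hε
    have htΩ := hin t ⟨by linarith [ht.1, hu.1], ht.2⟩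
    obtain ⟨c, hc⟩ := infDist_compl_upper_parabola hΩ hB hZ z htΩ hε
    refine ⟨-c + K * M * (t - τ), hc.mono fun s hs => ?_⟩
    have hmt : m t ≤ M := humax (show t ∈ Icc (τ - l) τ from ⟨by linarith [ht.1, hu.1], ht.2.le⟩)
    change m s ≤ m t + c * (s - t) + (K * m t / 2 + ε) * (s - t) ^ 2 at hs
    have h1 : (K : ℝ) * m t / 2 * (s - t) ^ 2 ≤ K * M / 2 * (s - t) ^ 2 := by gcongr
    simp only [hf]
    nlinarith
  -- The chord of `f` from a value at most `-M/2` at `u` to `0` at `τ` forces `m` to grow at least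
  -- linearly backwards from `τ`.
  have hchord : ∀ t ∈ Icc u τ, M / (2 * (τ - u)) * (τ - t) ≤ m t := by
    intro t ht
    have h1 := le_chord_of_lower_parabola huτ
      (by simp only [hf]; fun_prop : ContinuousOn f (Icc u τ)) hpar ht
    have hfτ : f τ = 0 := by simp [hf, hmτ]
    have hτu : 0 < τ - u := by linarith
    have hfu : f u ≤ -(M / 2) := by
      have h2 : (u - τ) ^ 2 ≤ l ^ 2 := by
        rw [← sq_abs (u - τ), abs_of_neg (by linarith)]
        have : -(u - τ) ≤ l := by linarith [hu.1]
        gcongr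
        linarith
      have h3 : (K : ℝ) * M / 2 * (u - τ) ^ 2 ≤ M / 2 := by
        calc (K : ℝ) * M / 2 * (u - τ) ^ 2 ≤ K * M / 2 * l ^ 2 := by gcongr
          _ = M / 2 * (K * l ^ 2) := by ring
          _ ≤ M / 2 * 1 := by gcongr
          _ = M / 2 := mul_one _
      simp only [hf]
      linarith
    rw [hfτ] at h1
    have h4 : f u + (0 - f u) / (τ - u) * (t - u) = f u * ((τ - t) / (τ - u)) := by
      field_simp
      ring
    rw [h4] at h1
    have h5 : f u * ((τ - t) / (τ - u)) ≤ -(M / 2) * ((τ - t) / (τ - u)) := by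
      have : 0 ≤ (τ - t) / (τ - u) := div_nonneg (by linarith [ht.2]) hτu.le
      gcongr
    have h6 : M / (2 * (τ - u)) * (τ - t) = M / 2 * ((τ - t) / (τ - u)) := by
      field_simp
    have h7 : -m t ≤ f t := by
      simp only [hf]
      have : 0 ≤ (K : ℝ) * M / 2 * (t - τ) ^ 2 := by positivity
      linarith
    rw [h6]
    linarith
  set κ : ℝ := M / (2 * (τ - u))
  have hκ : 0 < κ := div_pos hMpos (by linarith)
  have hd := hZ.hasDerivAt_inner_fst (outerNormal ρ q) q z τ
  rw [h0] at hd
  -- With tangential velocity the distance to the tangent plane at the exit point is `o(τ - s)`. It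
  -- dominates `m`, in contradiction to the linear growth.
  have hev := (hasDerivAt_iff_tendsto_slope_left_right.1 hd).1.eventually (gt_mem_nhds hκ)
  obtain ⟨s, hs, hsm⟩ := (hev.and (Ioo_mem_nhdsLT huτ)).exists
  have hsΩ := hin s ⟨by linarith [hsm.1, hu.1], hsm.2⟩
  have h1 := hΩ.infDist_compl_le hτ hsΩ
  have h2 := hchord s ⟨hsm.1.le, hsm.2.le⟩
  rw [slope_def_field, ← hq, sub_self, inner_zero_right, sub_zero] at hs
  have h3 : inner ℝ (outerNormal ρ q) ((Z s z).1 - q)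
      = -inner ℝ (outerNormal ρ q) (q - (Z s z).1) := by
    rw [← inner_neg_right, neg_sub]
  rw [h3, div_lt_iff_of_neg (by linarith [hsm.2])] at hs
  change m s ≤ _ at h1
  nlinarith

/-- An orbit leaving the domain does so through `Γ₊`. -/
theorem exists_exit (hΩ : IsSmoothConvexDomain Ω ρ) (hB : IsTangentField Ω ρ K B)
    (hZ : IsFlow (field B) Z) {z : R3 × R3} (hz : z.1 ∈ Ω) {t : ℝ} (ht : 0 < t)
    (hout : (Z t z).1 ∉ Ω) :
    ∃ τ ∈ Ioc 0 t, Z τ z ∈ GammaPlus Ω ρ ∧ ∀ s ∈ Ico 0 τ, (Z s z).1 ∈ Ω := by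
  set A : Set ℝ := Icc 0 t ∩ {s | (Z s z).1 ∈ Ωᶜ} with hA
  have hAc : IsCompact A := isCompact_Icc.inter_right
    (hΩ.isOpen.isClosed_compl.preimage (continuous_fst_orbit hZ z))
  -- The exit time is the first time outside `Ω`; it exists because the complement is closed.
  obtain ⟨τ, hτA, hτmin⟩ := hAc.exists_isLeast ⟨t, ⟨ht.le, le_rfl⟩, hout⟩
  have hτ0 : 0 < τ := lt_of_le_of_ne hτA.1.1 (fun h => hτA.2 (by rw [← h, hZ.zero]; exact hz))
  have hin : ∀ s ∈ Ico 0 τ, (Z s z).1 ∈ Ω := by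
    intro s hs
    by_contra hns
    exact absurd (hτmin ⟨⟨hs.1, hs.2.le.trans hτA.1.2⟩, hns⟩) (not_le.2 hs.2)
  have hcl : (Z τ z).1 ∈ closure Ω := by
    have hlim : Tendsto (fun s => (Z s z).1) (𝓝[<] τ) (𝓝 (Z τ z).1) :=
      ((continuous_fst_orbit hZ z).tendsto τ).mono_left nhdsWithin_le_nhds
    refine mem_closure_of_tendsto hlim ?_
    filter_upwards [Ioo_mem_nhdsLT hτ0] with s hs
    exact hin s ⟨hs.1.le, hs.2⟩
  have hfr : (Z τ z).1 ∈ frontier Ω := by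
    rw [hΩ.isOpen.frontier_eq]
    exact ⟨hcl, hτA.2⟩
  refine ⟨τ, ⟨hτ0, hτA.1.2⟩, ⟨hfr, ?_⟩, hin⟩
  -- The normal velocity is nonzero since tangential exit is excluded. It is not negative, since the
  -- orbit comes from the inner side of the tangent plane.
  refine lt_of_le_of_ne ?_
    (inner_outerNormal_ne_zero_of_exit hΩ hB hZ z hτ0 hin hfr).symm
  by_contra! hneg
  have hd := hZ.hasDerivAt_inner_fst (outerNormal ρ (Z τ z).1) (Z τ z).1 z τ
  have hev := (hasDerivAt_iff_tendsto_slope_left_right.1 hd).1.eventually (gt_mem_nhds hneg)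
  obtain ⟨s, hs, hsm⟩ := (hev.and (Ioo_mem_nhdsLT hτ0)).exists
  rw [slope_def_field, sub_self, inner_zero_right, sub_zero] at hs
  have h1 := hΩ.inner_outerNormal_sub_neg hfr (hin s ⟨hsm.1.le, hsm.2⟩)
  rcases div_neg_iff.1 hs with h | h
  · linarith
  · linarith [hsm.2]

lemma exists_fst_mem_of_gammaPlus (hΩ : IsSmoothConvexDomain Ω ρ) 
    (hZ : IsFlow (field B) Z) {y : R3 × R3} (hy : y ∈ GammaPlus Ω ρ) :
    ∀ᶠ s in 𝓝[>] (0 : ℝ), (Z (-s) y).1 ∈ Ω := by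
  have h := hΩ.eventually_mem_left (c := fun s => (Z s y).1) (t := 0) (e := y.2)
    (by rw [hZ.zero]; exact hy.1) (by simpa [hZ.zero] using hZ.deriv_fst 0 y)
    (by rw [hZ.zero]; exact hy.2)
  have h2 : Tendsto (fun s : ℝ => -s) (𝓝[>] 0) (𝓝[<] 0) := by
    have := tendsto_neg_nhdsGT (a := (0 : ℝ))
    simpa using this
  exact h2.eventually h

end Orbits

/-! ### Mollification and derivatives along a Lipschitz field. -/

section Mollify

open scoped Convolution
open ContinuousLinearMap (lsmul)

variable {G : Type*} [NormedAddCommGroup G] [NormedSpace ℝ G] [FiniteDimensional ℝ G]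
  [MeasurableSpace G] [BorelSpace G] (μ : Measure G) [μ.IsAddHaarMeasure]

/-- The standard mollifier at scale `1 / (n + 1)`. -/
def mollifier (n : ℕ) : ContDiffBump (0 : G) where
  rIn := 1 / (2 * (n + 1))
  rOut := 1 / (n + 1)
  rIn_pos := by positivity
  rIn_lt_rOut := by
    apply one_div_lt_one_div_of_lt (by positivity)
    have : (0 : ℝ) < n + 1 := by positivity
    linarith

/-- The mollification of `f` at scale `1 / (n + 1)`. -/
def mollify (n : ℕ) (f : G → ℝ) : G → ℝ :=
  ((mollifier n : ContDiffBump (0 : G)).normed μ ⋆[lsmul ℝ ℝ, μ] f)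

variable {μ}

set_option linter.unusedSectionVars false in
lemma mollify_apply (n : ℕ) (f : G → ℝ) (p : G) :
    mollify μ n f p = ∫ r, (mollifier n : ContDiffBump (0 : G)).normed μ r * f (p - r) ∂μ := rfl

lemma integrable_mollifier_mul (n : ℕ) {f : G → ℝ} (hf : Continuous f) :
    Integrable (fun r => (mollifier n : ContDiffBump (0 : G)).normed μ r * f r) μ := by
  refine Continuous.integrable_of_hasCompactSupport ?_ ?_
  · exact ((mollifier n : ContDiffBump (0 : G)).continuous_normed).mul hf
  · exact (ContDiffBump.hasCompactSupport_normed _).mul_right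

lemma dist_mollify_le (n : ℕ) {f : G → ℝ} (hf : Continuous f) {p : G} {ε : ℝ}
    (h : ∀ x ∈ Metric.ball p (1 / (n + 1)), |f x - f p| ≤ ε) : |mollify μ n f p - f p| ≤ ε := by
  have := ContDiffBump.dist_normed_convolution_le (φ := (mollifier n : ContDiffBump (0 : G)))
    (μ := μ) (g := f) (x₀ := p) (ε := ε) hf.aestronglyMeasurable h
  rwa [Real.dist_eq] at this

lemma tendsto_mollify {f : G → ℝ} (hf : Continuous f) (p : G) :
    Tendsto (fun n => mollify μ n f p) atTop (𝓝 (f p)) := by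
  rw [Metric.tendsto_atTop]
  intro ε hε
  obtain ⟨δ, hδ, hball⟩ := Metric.continuousAt_iff.1 hf.continuousAt (ε / 2) (by positivity)
  obtain ⟨N, hN⟩ := exists_nat_one_div_lt hδ
  refine ⟨N, fun n hn => ?_⟩
  rw [Real.dist_eq]
  refine lt_of_le_of_lt (dist_mollify_le n hf (ε := ε / 2) fun x hx => ?_) (by linarith)
  have h1 : (1 : ℝ) / (n + 1) ≤ 1 / (N + 1) := by gcongr
  exact (hball (lt_of_lt_of_le (Metric.mem_ball.1 hx) (h1.trans hN.le))).le

lemma contDiff_mollify (n : ℕ) {f : G → ℝ} (hf : LocallyIntegrable f μ) :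
    ContDiff ℝ ∞ (mollify μ n f) :=
  HasCompactSupport.contDiff_convolution_left (lsmul ℝ ℝ)
    (ContDiffBump.hasCompactSupport_normed _) (ContDiffBump.contDiff_normed _) hf

lemma tsupport_mollify_subset (n : ℕ) (f : G → ℝ) :
    tsupport (mollify μ n f) ⊆ Metric.cthickening (1 / (n + 1)) (tsupport f) := by
  refine closure_minimal (fun p hp => ?_) Metric.isClosed_cthickening
  have hp' := support_convolution_subset (lsmul ℝ ℝ) hp
  obtain ⟨r, hr, x, hx, rfl⟩ := hp'
  rw [ContDiffBump.support_normed_eq] at hr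
  refine Metric.mem_cthickening_of_dist_le _ x _ _ (subset_tsupport _ hx) ?_
  rw [dist_eq_norm, add_sub_cancel_right]
  exact (mem_ball_zero_iff.1 hr).le

lemma abs_integral_mollifier_mul_le (n : ℕ) {f : G → ℝ} {ε : ℝ} 
    (h : ∀ r ∈ Metric.ball (0 : G) (1 / (n + 1)), |f r| ≤ ε) :
    |∫ r, (mollifier n : ContDiffBump (0 : G)).normed μ r * f r ∂μ| ≤ ε := by
  have h1 : ∀ r, ‖(mollifier n : ContDiffBump (0 : G)).normed μ r * f r‖
      ≤ (mollifier n : ContDiffBump (0 : G)).normed μ r * ε := by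
    intro r
    rw [norm_mul, Real.norm_eq_abs, Real.norm_eq_abs,
      abs_of_nonneg (ContDiffBump.nonneg_normed _ r)]
    by_cases hr : r ∈ Metric.ball (0 : G) (1 / (n + 1))
    · gcongr
      · exact ContDiffBump.nonneg_normed _ r
      · exact h r hr
    · have : (mollifier n : ContDiffBump (0 : G)).normed μ r = 0 := by
        rw [← Function.notMem_support, ContDiffBump.support_normed_eq]
        exact hr
      simp [this]
  rw [← Real.norm_eq_abs]
  calc _ ≤ ∫ r, (mollifier n : ContDiffBump (0 : G)).normed μ r * ε ∂μ :=
        norm_integral_le_of_norm_le (integrable_mollifier_mul n continuous_const)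
          (Eventually.of_forall h1)
    _ = ε := by
      rw [integral_mul_const, ContDiffBump.integral_normed, one_mul]

lemma abs_mollify_sub_le {φ : G → ℝ} {C : ℝ≥0} (hφ : LipschitzWith C φ) (n : ℕ) (p p' : G) :
    |mollify μ n φ p - mollify μ n φ p'| ≤ C * dist p p' := by
  have hφc := hφ.continuous
  rw [mollify_apply, mollify_apply, ← integral_sub
    (integrable_mollifier_mul n (by fun_prop)) (integrable_mollifier_mul n (by fun_prop))]
  simp_rw [← mul_sub]
  refine abs_integral_mollifier_mul_le n fun r _ => ?_
  have := hφ.dist_le_mul (p - r) (p' - r)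
  rwa [Real.dist_eq, dist_sub_right] at this

/-- The commutator of mollification with differentiation along a Lipschitz field is small. -/
lemma abs_fderiv_mollify_sub_le {φ : G → ℝ} {C K : ℝ≥0} (hφ : LipschitzWith C φ) {b : G → G}
    (hb : LipschitzWith K b) {D : G → ℝ}
    (hφD : ∀ p, HasLineDerivAt ℝ φ (D p) p (b p)) (n : ℕ) (p : G) :
    |fderiv ℝ (mollify μ n φ) p (b p) - mollify μ n D p| ≤ C * K * (1 / (n + 1)) := by
  set k := (mollifier n : ContDiffBump (0 : G)).normed μ with hk
  have hdiff : DifferentiableAt ℝ (mollify μ n φ) p :=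
    (contDiff_mollify n hφ.continuous.locallyIntegrable).differentiable (by simp) p
  have hQ : Tendsto (fun h : ℝ => h⁻¹ • (mollify μ n φ (p + h • b p) - mollify μ n φ p)) (𝓝[≠] 0)
      (𝓝 (fderiv ℝ (mollify μ n φ) p (b p))) :=
    (hdiff.hasFDerivAt.hasLineDerivAt (b p)).tendsto_slope_zero
  -- The mollified derivative is a limit of averages of difference quotients, each taken in the
  -- direction of the field at its own point `p - r`; `hQ` uses the field at `p` instead.
  have hR : Tendsto (fun h : ℝ => ∫ r, k r * (h⁻¹ • (φ (p - r + h • b (p - r)) - φ (p - r))) ∂μ)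
      (𝓝[≠] 0) (𝓝 (mollify μ n D p)) := by
    rw [mollify_apply]
    refine tendsto_integral_filter_of_dominated_convergence
      (fun r => k r * (C * ‖b (p - r)‖)) ?_ ?_ ?_ ?_
    · refine Eventually.of_forall fun h => Continuous.aestronglyMeasurable ?_
      have := hφ.continuous
      have := hb.continuous
      have : Continuous k := ContDiffBump.continuous_normed _
      fun_prop
    · filter_upwards [self_mem_nhdsWithin] with h hh
      refine Eventually.of_forall fun r => ?_
      rw [norm_mul, Real.norm_eq_abs, abs_of_nonneg (ContDiffBump.nonneg_normed _ r)]
      refine mul_le_mul_of_nonneg_left ?_ (ContDiffBump.nonneg_normed _ r)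
      have h0 : h ≠ 0 := hh
      have h1 := hφ.dist_le_mul (p - r + h • b (p - r)) (p - r)
      rw [dist_self_add_left, norm_smul, dist_eq_norm] at h1
      rw [norm_smul, norm_inv, inv_mul_le_iff₀ (norm_pos_iff.2 h0)]
      linarith
    · exact integrable_mollifier_mul n (continuous_const.mul
        (hb.continuous.comp (continuous_const.sub continuous_id)).norm)
    · exact Eventually.of_forall fun r => ((hφD (p - r)).tendsto_slope_zero).const_mul (k r)
  refine le_of_tendsto (hQ.sub hR).abs ?_
  filter_upwards [self_mem_nhdsWithin] with h hh
  have h0 : h ≠ 0 := hh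
  have hφc := hφ.continuous
  have hbc := hb.continuous
  have e : h⁻¹ • (mollify μ n φ (p + h • b p) - mollify μ n φ p)
      = ∫ r, k r * (h⁻¹ • (φ (p + h • b p - r) - φ (p - r))) ∂μ := by
    rw [mollify_apply, mollify_apply, ← integral_sub
      (integrable_mollifier_mul n (by fun_prop)) (integrable_mollifier_mul n (by fun_prop)),
      ← integral_smul]
    refine integral_congr_ae (Eventually.of_forall fun r => ?_)
    simp only [smul_eq_mul]
    ring
  rw [e, ← integral_sub (integrable_mollifier_mul n (by fun_prop))
    (integrable_mollifier_mul n (by fun_prop))]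
  simp_rw [← mul_sub]
  -- The two quotients differ by at most `C ‖b p - b (p - r)‖ ≤ C K ‖r‖`, and the kernel lives on
  -- `‖r‖ < 1/(n+1)`.
  refine abs_integral_mollifier_mul_le n fun r hr => ?_
  rw [← smul_sub, sub_sub_sub_cancel_right, smul_eq_mul, abs_mul, abs_inv,
    inv_mul_le_iff₀ (abs_pos.2 h0)]
  have h1 := hφ.dist_le_mul (p + h • b p - r) (p - r + h • b (p - r))
  have e2 : p + h • b p - r - (p - r + h • b (p - r)) = h • (b p - b (p - r)) := by
    rw [smul_sub]; abel
  rw [Real.dist_eq, dist_eq_norm, e2, norm_smul, Real.norm_eq_abs] at h1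
  have h2 := hb.dist_le_mul p (p - r)
  rw [dist_eq_norm, dist_eq_norm, sub_sub_cancel] at h2
  have h3 : ‖r‖ ≤ 1 / (n + 1) := (mem_ball_zero_iff.1 hr).le
  calc _ ≤ (C : ℝ) * (|h| * ‖b p - b (p - r)‖) := h1
    _ ≤ C * (|h| * (K * (1 / (n + 1)))) := by gcongr; exact h2.trans (by gcongr)
    _ = |h| * (C * K * (1 / (n + 1))) := by ring

/-- Smooth approximation of a compactly supported Lipschitz function together with its derivative
along a Lipschitz field. -/
theorem exists_smooth_approx (μ : Measure G) [μ.IsAddHaarMeasure] {φ : G → ℝ} {C K : ℝ≥0}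
    (hφ : LipschitzWith C φ) (hs : HasCompactSupport φ) {b : G → G} (hb : LipschitzWith K b)
    {D : G → ℝ} (hD : Continuous D) (hφD : ∀ p, HasLineDerivAt ℝ φ (D p) p (b p)) :
    ∃ (f : ℕ → G → ℝ) (M : ℝ), (∀ n, ContDiff ℝ ∞ (f n)) ∧
      (∀ n, tsupport (f n) ⊆ Metric.cthickening (1 / (n + 1)) (tsupport φ)) ∧
      (∀ p, Tendsto (fun n => f n p) atTop (𝓝 (φ p))) ∧
      (∀ p, Tendsto (fun n => fderiv ℝ (f n) p (b p)) atTop (𝓝 (D p))) ∧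
      (∀ n p, |f n p| ≤ M) ∧ ∀ n p, |fderiv ℝ (f n) p (b p)| ≤ M := by
  set S := Metric.cthickening 1 (tsupport φ)
  have hS : IsCompact S := hs.isCompact.cthickening
  have hSn : ∀ n : ℕ, Metric.cthickening (1 / ((n : ℝ) + 1)) (tsupport φ) ⊆ S := fun n =>
    Metric.cthickening_mono (by
      rw [div_le_one (by positivity)]
      have : (0 : ℝ) ≤ n := by positivity
      linarith) _
  obtain ⟨M₁, hM₁⟩ := hS.exists_bound_of_continuousOn hb.continuous.continuousOn
  obtain ⟨M₂, hM₂⟩ := hs.exists_bound_of_continuous hφ.continuous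
  have hcd : ∀ n, ContDiff ℝ ∞ (mollify μ n φ) := fun n =>
    contDiff_mollify n hφ.continuous.locallyIntegrable
  have hsup : ∀ n, tsupport (mollify μ n φ) ⊆ S := fun n =>
    (tsupport_mollify_subset n φ).trans (hSn n)
  refine ⟨fun n => mollify μ n φ, max (|M₂|) (C * |M₁|), hcd,
    fun n => tsupport_mollify_subset n φ, tendsto_mollify hφ.continuous, ?_, ?_, ?_⟩
  · intro p
    have h1 : Tendsto (fun n : ℕ => (C : ℝ) * K * (1 / ((n : ℝ) + 1))) atTop (𝓝 0) := by
      have := tendsto_one_div_add_atTop_nhds_zero_nat (𝕜 := ℝ)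
      simpa using this.const_mul ((C : ℝ) * K)
    have h2 : Tendsto (fun n => fderiv ℝ (mollify μ n φ) p (b p) - mollify μ n D p) atTop (𝓝 0) :=
      squeeze_zero_norm (fun n => by
        rw [Real.norm_eq_abs]
        exact abs_fderiv_mollify_sub_le hφ hb hφD n p) h1
    simpa using h2.add (tendsto_mollify (μ := μ) hD p)
  · intro n p
    refine le_trans ?_ (le_max_left _ _)
    exact abs_integral_mollifier_mul_le n fun r _ => (hM₂ _).trans (le_abs_self _)
  · intro n p
    refine le_trans ?_ (le_max_right _ _)
    -- Mollification preserves the Lipschitz constant, and all supports lie in the compact set `S`,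
    -- on which the field is bounded.
    by_cases hp : p ∈ S
    · have hL : LipschitzWith C (mollify μ n φ) :=
        LipschitzWith.of_dist_le_mul fun p p' => by
          rw [Real.dist_eq]; exact abs_mollify_sub_le hφ n p p'
      calc |fderiv ℝ (mollify μ n φ) p (b p)| ≤ ‖fderiv ℝ (mollify μ n φ) p‖ * ‖b p‖ :=
            (fderiv ℝ (mollify μ n φ) p).le_opNorm (b p)
        _ ≤ C * |M₁| := by
          gcongr
          · exact norm_fderiv_le_of_lipschitz ℝ hL
          · exact (hM₁ p hp).trans (le_abs_self _)
    · have : fderiv ℝ (mollify μ n φ) p = 0 := by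
        by_contra hne
        exact hp (hsup n (support_fderiv_subset ℝ hne))
      rw [this]
      simp
      positivity

end Mollify

/-! ### Area of nearly flat sets. -/

section SurfaceArea

/-- The Euclidean plane. -/
abbrev R2 : Type := EuclideanSpace ℝ (Fin 2)

/-- The projection of `ℝ³` onto a coordinate plane, forgetting the `i`-th coordinate. -/
def coordProj (i : Fin 3) : R3 →L[ℝ] R2 :=
  LinearMap.toContinuousLinearMap
    { toFun := fun x => WithLp.toLp 2 fun k => x (i.succAbove k)
      map_add' := fun x y => by ext k; simp
      map_smul' := fun c x => by ext k; simp }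

@[simp] lemma coordProj_apply (i : Fin 3) (x : R3) (k : Fin 2) :
    coordProj i x k = x (i.succAbove k) := rfl

lemma exists_frame {n : R3} (hn : ‖n‖ = 1) : ∃ b : OrthonormalBasis (Fin 3) ℝ R3, b 2 = n := by
  have hv : Orthonormal ℝ (({2} : Set (Fin 3)).domRestrict fun _ => n) := by
    constructor
    · intro i; simpa using hn
    · intro i j hij
      exact absurd (Subtype.ext (i.2.trans j.2.symm)) hij
  obtain ⟨b, hb⟩ := hv.exists_orthonormalBasis_extension_of_card_eq (by simp)
  exact ⟨b, hb 2 rfl⟩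

/-- The transpose of an orthogonal matrix is orthogonal: this is Parseval's identity for two
coordinate vectors. -/
lemma frame_columns (b : OrthonormalBasis (Fin 3) ℝ R3) (k l : Fin 3) :
    b 0 k * b 0 l + b 1 k * b 1 l + b 2 k * b 2 l = if k = l then 1 else 0 := by
  have h := b.sum_inner_mul_inner (EuclideanSpace.single k (1 : ℝ)) (EuclideanSpace.single l 1)
  simp only [Fin.sum_univ_three, EuclideanSpace.inner_single_left, EuclideanSpace.inner_single_right,
    map_one, one_mul, PiLp.single_apply] at h
  simp only [conj_trivial] at h
  rw [h]
  simp only [eq_comm]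

/-- The parametrization of the plane spanned by the first two vectors of a frame, composed with a
coordinate projection. -/
def planeMap (b : OrthonormalBasis (Fin 3) ℝ R3) (i : Fin 3) : R2 →ₗ[ℝ] R2 where
  toFun w := coordProj i (w 0 • b 0 + w 1 • b 1)
  map_add' w w' := by
    rw [← map_add]
    congr 1
    simp only [PiLp.add_apply, add_smul]
    abel
  map_smul' c w := by
    rw [RingHom.id_apply, ← (coordProj i).map_smul, smul_add, smul_smul, smul_smul]
    rfl

/-- A 2×2 minor of an orthogonal matrix equals the complementary entry up to sign. The proof is
Lagrange's identity together with orthonormality of the columns. -/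
lemma abs_det_planeMap (b : OrthonormalBasis (Fin 3) ℝ R3) (i : Fin 3) :
    |LinearMap.det (planeMap b i)| = |b 2 i| := by
  rw [← sq_eq_sq_iff_abs_eq_abs,
    ← LinearMap.det_toMatrix (EuclideanSpace.basisFun (Fin 2) ℝ).toBasis, Matrix.det_fin_two]
  simp only [LinearMap.toMatrix_apply, OrthonormalBasis.coe_toBasis_repr_apply,
    OrthonormalBasis.coe_toBasis, EuclideanSpace.basisFun_repr, EuclideanSpace.basisFun_apply]
  have e : ∀ k l : Fin 2, planeMap b i (EuclideanSpace.single l 1) k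
      = if l = 0 then b 0 (i.succAbove k) else b 1 (i.succAbove k) := by
    intro k l
    fin_cases l <;> simp [planeMap]
  simp only [e]
  simp only [reduceIte, one_ne_zero]
  set k := i.succAbove 0
  set l := i.succAbove 1
  have hkl : k ≠ l := by
    simp only [k, l, ne_eq, Fin.succAbove_right_inj]
    decide
  have h1 := frame_columns b k k
  have h2 := frame_columns b l l
  have h3 := frame_columns b k l
  have h4 : (b 2 i) ^ 2 + (b 2 k) ^ 2 + (b 2 l) ^ 2 = 1 := by
    have h5 : ‖b 2‖ ^ 2 = 1 := by rw [b.norm_eq_one]; norm_num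
    rw [EuclideanSpace.norm_sq_eq, Fin.sum_univ_succAbove _ i, Fin.sum_univ_two] at h5
    simp only [Real.norm_eq_abs, sq_abs] at h5
    linarith
  simp only [reduceIte, hkl, if_false] at h1 h2 h3
  have e1 : b 0 k ^ 2 + b 1 k ^ 2 = 1 - b 2 k ^ 2 := by linarith
  have e2 : b 0 l ^ 2 + b 1 l ^ 2 = 1 - b 2 l ^ 2 := by linarith
  have e3 : b 0 k * b 0 l + b 1 k * b 1 l = -(b 2 k * b 2 l) := by linarith
  calc (b 0 k * b 1 l - b 1 k * b 0 l) ^ 2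
      = (b 0 k ^ 2 + b 1 k ^ 2) * (b 0 l ^ 2 + b 1 l ^ 2)
        - (b 0 k * b 0 l + b 1 k * b 1 l) ^ 2 := by ring
    _ = 1 - b 2 k ^ 2 - b 2 l ^ 2 := by rw [e1, e2, e3]; ring
    _ = b 2 i ^ 2 := by linarith

lemma volume_image_le_of_lipschitzOn {f : R3 → R2} {A : Set R3} {k : ℝ≥0}
    (h : LipschitzOnWith k f A) :
    volume (f '' A) ≤ (k : ℝ≥0∞) ^ 2 * (Measure.euclideanHausdorffMeasure 2 : Measure R3) A := by
  rw [← EuclideanSpace.euclideanHausdorffMeasure_eq_volume 2,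
    Measure.euclideanHausdorffMeasure_def, Measure.euclideanHausdorffMeasure_def]
  have := h.hausdorffMeasure_image_le (d := ((2 : ℕ) : ℝ)) (by positivity)
  rw [ENNReal.rpow_natCast] at this
  simp only [Measure.smul_apply, ENNReal.smul_def, smul_eq_mul]
  calc _ ≤ _ := mul_le_mul_right this _
    _ = _ := by ring

lemma euclideanHausdorffMeasure_le_of_antilipschitzOn {f : R3 → R2} {A : Set R3} {k : ℝ≥0}
    (h : ∀ x ∈ A, ∀ y ∈ A, dist x y ≤ k * dist (f x) (f y)) :
    (Measure.euclideanHausdorffMeasure 2 : Measure R3) A ≤ (k : ℝ≥0∞) ^ 2 * volume (f '' A) := by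
  rw [← EuclideanSpace.euclideanHausdorffMeasure_eq_volume 2,
    Measure.euclideanHausdorffMeasure_def, Measure.euclideanHausdorffMeasure_def]
  have hA : AntilipschitzWith k (fun x : A => f x) :=
    AntilipschitzWith.of_le_mul_dist fun x y => h x x.2 y y.2
  have h1 := hA.le_hausdorffMeasure_image (d := ((2 : ℕ) : ℝ)) (by positivity) univ
  have h2 := (isometry_subtype_coe (s := A)).hausdorffMeasure_image (d := ((2 : ℕ) : ℝ))
    (Or.inl (by positivity)) univ
  rw [← h2, ENNReal.rpow_natCast, image_univ, Subtype.range_coe] at h1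
  have e : (fun x : A => f x) '' univ = f '' A := by
    ext y; simp
  rw [e] at h1
  simp only [Measure.smul_apply, ENNReal.smul_def, smul_eq_mul]
  calc _ ≤ _ := mul_le_mul_right h1 _
    _ = _ := by ring

/-- A nearly flat set has nearly the area of its coordinate projection, divided by the
corresponding component of the normal. -/
lemma flat_comparison {n : R3} (hn : ‖n‖ = 1) {i : Fin 3} (hi : n i ≠ 0) {ε : ℝ} (hε : 0 < ε) :
    ∃ δ > 0, ∀ A : Set R3, (∀ x ∈ A, ∀ y ∈ A, |inner ℝ n (x - y)| ≤ δ * ‖x - y‖) →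
      volume (coordProj i '' A) ≤ ENNReal.ofReal (1 + ε) *
        (ENNReal.ofReal |n i| * (Measure.euclideanHausdorffMeasure 2 : Measure R3) A) ∧
      ENNReal.ofReal |n i| * (Measure.euclideanHausdorffMeasure 2 : Measure R3) A
        ≤ ENNReal.ofReal (1 + ε) * volume (coordProj i '' A) := by
  obtain ⟨b, hb⟩ := exists_frame hn
  have hdet : |LinearMap.det (planeMap b i)| = |n i| := by rw [abs_det_planeMap, hb]
  have hdet0 : LinearMap.det (planeMap b i) ≠ 0 := by
    rw [← abs_pos, hdet]
    exact abs_pos.2 hi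
  set L := LinearMap.equivOfDetNeZero (planeMap b i) hdet0 with hL
  have hLapply : ∀ w, L w = planeMap b i w := fun w => rfl
  -- `R` inverts the parametrization of the plane orthogonal to `n`: it reads off the first two
  -- frame coordinates, up to a multiple of the normal component. On nearly flat sets it is thus
  -- nearly an isometry.
  set R : R3 →ₗ[ℝ] R2 := L.symm.toLinearMap ∘ₗ (coordProj i : R3 →ₗ[ℝ] R2) with hR
  have hdecomp : ∀ x : R3, ∃ w : R2, R x = w + inner ℝ n x • R n ∧
      ‖x‖ ≤ ‖w‖ + |inner ℝ n x| ∧ ‖w‖ ≤ ‖x‖ := by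
    intro x
    set w : R2 := !₂[inner ℝ (b 0) x, inner ℝ (b 1) x] with hw
    have hx : x = (w 0 • b 0 + w 1 • b 1) + inner ℝ n x • n := by
      have := b.sum_repr' x
      rw [Fin.sum_univ_three, hb] at this
      simpa [hw] using this.symm
    have hnw : ‖w 0 • b 0 + w 1 • b 1‖ = ‖w‖ := by
      have h1 : ‖w 0 • b 0 + w 1 • b 1‖ ^ 2 = ‖w‖ ^ 2 := by
        rw [EuclideanSpace.norm_sq_eq w, Fin.sum_univ_two, ← real_inner_self_eq_norm_sq,
          inner_add_left, inner_add_right, inner_add_right]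
        simp only [real_inner_smul_left, real_inner_smul_right, real_inner_self_eq_norm_sq,
          norm_smul, mul_pow, b.norm_eq_one, b.inner_eq_zero (show (0 : Fin 3) ≠ 1 by decide),
          b.inner_eq_zero (show (1 : Fin 3) ≠ 0 by decide), Real.norm_eq_abs, sq_abs]
        ring
      exact (pow_left_inj₀ (norm_nonneg _) (norm_nonneg _) two_ne_zero).1 h1
    refine ⟨w, ?_, ?_, ?_⟩
    · conv_lhs => rw [hx]
      rw [map_add, map_smul]
      congr 1
      rw [hR, LinearMap.comp_apply]
      change L.symm (L w) = w
      exact L.symm_apply_apply w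
    · conv_lhs => rw [hx]
      refine (norm_add_le _ _).trans ?_
      rw [hnw, norm_smul, hn, mul_one, Real.norm_eq_abs]
    · have h2 : ‖w‖ ^ 2 ≤ ‖x‖ ^ 2 := by
        rw [EuclideanSpace.norm_sq_eq, Fin.sum_univ_two, ← b.sum_sq_norm_inner_right x,
          Fin.sum_univ_three]
        simp only [hw]
        simp
        positivity
      exact (pow_le_pow_iff_left₀ (norm_nonneg _) (norm_nonneg _) two_ne_zero).1 h2
  -- Two-dimensional measure scales with the square of the Lipschitz constant, so `(1 + η)² ≤ 1 + ε`
  -- is needed; `η ≤ 1` gives `(1 + η)² ≤ 1 + 3η`.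
  set η : ℝ := min 1 (ε / 3) with hη
  have hη0 : 0 < η := lt_min one_pos (by positivity)
  have hη1 : (1 + η) ^ 2 ≤ 1 + ε := by
    have h1 : η ≤ 1 := min_le_left _ _
    have h2 : η ≤ ε / 3 := min_le_right _ _
    nlinarith
  set C : ℝ := 1 + ‖R n‖ with hC
  have hC0 : 0 < C := by positivity
  -- With `δ C = η/(1+η)` both constants are within bounds: `1 + δ C ≤ 1 + η` and `1/(1 - δ C) = 1 +
  -- η`.
  refine ⟨η / ((1 + η) * C), by positivity, fun A hA => ?_⟩
  set δ : ℝ := η / ((1 + η) * C) with hδ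
  have hδC : δ * C = η / (1 + η) := by
    rw [hδ]; field_simp
  have hδC' : δ * C ≤ η := by
    rw [hδC, div_le_iff₀ (by positivity)]
    nlinarith
  have hδ0 : 0 < δ := by positivity
  have hRC : ‖R n‖ ≤ C := by rw [hC]; linarith
  set k : ℝ≥0 := ⟨1 + η, by positivity⟩
  have hk2 : ((k : ℝ≥0∞)) ^ 2 ≤ ENNReal.ofReal (1 + ε) := by
    have : (k : ℝ≥0∞) = ENNReal.ofReal (1 + η) := by
      rw [ENNReal.ofReal, Real.toNNReal_of_nonneg (by positivity)]
      rfl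
    rw [this, ← ENNReal.ofReal_pow (by positivity)]
    exact ENNReal.ofReal_le_ofReal hη1
  have hlip : LipschitzOnWith k R A := by
    refine LipschitzOnWith.of_dist_le_mul fun x hx y hy => ?_
    obtain ⟨w, h1, -, h3⟩ := hdecomp (x - y)
    have hs := hA x hx y hy
    rw [dist_eq_norm, dist_eq_norm, ← map_sub, h1]
    calc ‖w + inner ℝ n (x - y) • R n‖ ≤ ‖w‖ + |inner ℝ n (x - y)| * ‖R n‖ := by
          refine (norm_add_le _ _).trans ?_
          rw [norm_smul, Real.norm_eq_abs]
      _ ≤ ‖x - y‖ + δ * ‖x - y‖ * C := by gcongr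
      _ = (1 + δ * C) * ‖x - y‖ := by ring
      _ ≤ (1 + η) * ‖x - y‖ := by gcongr
  have hanti : ∀ x ∈ A, ∀ y ∈ A, dist x y ≤ k * dist (R x) (R y) := by
    intro x hx y hy
    obtain ⟨w, h1, h2, -⟩ := hdecomp (x - y)
    have hs := hA x hx y hy
    rw [dist_eq_norm, dist_eq_norm, ← map_sub]
    have h4 : ‖w‖ ≤ ‖R (x - y)‖ + |inner ℝ n (x - y)| * ‖R n‖ := by
      have : w = R (x - y) - inner ℝ n (x - y) • R n := by rw [h1]; abel
      conv_lhs => rw [this]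
      refine (norm_sub_le _ _).trans ?_
      rw [norm_smul, Real.norm_eq_abs]
    have h5 : ‖x - y‖ ≤ ‖R (x - y)‖ + δ * ‖x - y‖ * C := by
      have h6 : |inner ℝ n (x - y)| * C ≤ δ * ‖x - y‖ * C := by gcongr
      have h7 : |inner ℝ n (x - y)| * C
          = |inner ℝ n (x - y)| + |inner ℝ n (x - y)| * ‖R n‖ := by rw [hC]; ring
      linarith
    have h8 : ‖x - y‖ * (1 - η / (1 + η)) ≤ ‖R (x - y)‖ := by
      rw [← hδC]; linarith
    have h9 : 1 - η / (1 + η) = 1 / (1 + η) := by field_simp; ring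
    rw [h9, mul_one_div, div_le_iff₀ (by positivity)] at h8
    change ‖x - y‖ ≤ (1 + η) * ‖R (x - y)‖
    linarith
  -- The coordinate projection is the near isometry `R` followed by a linear map of determinant `± n
  -- i`, which accounts for that factor.
  have himg : coordProj i '' A = planeMap b i '' (R '' A) := by
    rw [image_image]
    refine image_congr fun x _ => ?_
    rw [← hLapply, hR, LinearMap.comp_apply]
    exact (L.apply_symm_apply _).symm
  have hvol : volume (coordProj i '' A) = ENNReal.ofReal |n i| * volume (R '' A) := by
    rw [himg, Measure.addHaar_image_linearMap, hdet]
  constructor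
  · rw [hvol]
    calc _ ≤ ENNReal.ofReal |n i| * (ENNReal.ofReal (1 + ε) * _) := by
          gcongr
          exact (volume_image_le_of_lipschitzOn hlip).trans (by gcongr)
      _ = _ := by ring
  · rw [hvol]
    calc _ ≤ ENNReal.ofReal |n i| * (ENNReal.ofReal (1 + ε) * volume (R '' A)) := by
          gcongr
          exact (euclideanHausdorffMeasure_le_of_antilipschitzOn hanti).trans (by gcongr)
      _ = _ := by ring

end SurfaceArea

/-! ### Coordinate projections of the boundary. -/

section Divergence

variable {Ω : Set R3} {ρ : R3 → ℝ}

/-- The part of the boundary where the `i`-th component of the normal has the sign of `s`. -/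
def boundaryPart (Ω : Set R3) (ρ : R3 → ℝ) (i : Fin 3) (s : ℝ) : Set R3 :=
  {x | x ∈ frontier Ω ∧ 0 < s * outerNormal ρ x i}

namespace IsSmoothConvexDomain

lemma continuous_gradient (hΩ : IsSmoothConvexDomain Ω ρ) : Continuous (gradient ρ) :=
  (InnerProductSpace.toDual ℝ R3).symm.continuous.comp (hΩ.smooth.continuous_fderiv (by simp))

lemma measurable_outerNormal (hΩ : IsSmoothConvexDomain Ω ρ) : Measurable (outerNormal ρ) :=
  hΩ.continuous_gradient.measurable.norm.inv.smul hΩ.continuous_gradient.measurable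

lemma measurable_outerNormal_apply (hΩ : IsSmoothConvexDomain Ω ρ) (i : Fin 3) :
    Measurable fun x => outerNormal ρ x i :=
  (EuclideanSpace.proj (𝕜 := ℝ) i).continuous.measurable.comp hΩ.measurable_outerNormal

lemma continuousAt_outerNormal (hΩ : IsSmoothConvexDomain Ω ρ) {x : R3} (hx : x ∈ frontier Ω) :
    ContinuousAt (outerNormal ρ) x :=
  (hΩ.continuous_gradient.norm.continuousAt.inv₀ (hΩ.norm_gradient_pos hx).ne').smul
    hΩ.continuous_gradient.continuousAt

lemma measurableSet_boundaryPart (hΩ : IsSmoothConvexDomain Ω ρ) (i : Fin 3) (s : ℝ) :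
    MeasurableSet (boundaryPart Ω ρ i s) :=
  isClosed_frontier.measurableSet.inter
    (measurableSet_lt measurable_const ((hΩ.measurable_outerNormal_apply i).const_mul s))

lemma eq_add_smul_of_coordProj_eq {i : Fin 3} {x y : R3} (h : coordProj i x = coordProj i y) :
    y - x = (y i - x i) • EuclideanSpace.single i (1 : ℝ) := by
  ext k
  by_cases hk : k = i
  · subst hk; simp
  · obtain ⟨l, rfl⟩ := Fin.exists_succAbove_eq hk
    have := congrArg (fun w : R2 => w l) h
    simp only [coordProj_apply] at this
    simp [this]

lemma inner_single_right (n : R3) (i : Fin 3) (c : ℝ) :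
    inner ℝ n (c • EuclideanSpace.single i (1 : ℝ)) = c * n i := by
  rw [real_inner_smul_right, EuclideanSpace.inner_single_right]
  simp

/-- Two such points on a line parallel to the `i`-th axis lie in each other's supporting
half-spaces. With normal components of equal sign, each can be neither above nor below the other. -/
lemma injOn_coordProj (hΩ : IsSmoothConvexDomain Ω ρ) (i : Fin 3) (s : ℝ) :
    InjOn (coordProj i) (boundaryPart Ω ρ i s) := by
  intro x hx y hy hxy
  have e1 := eq_add_smul_of_coordProj_eq hxy
  have e2 := eq_add_smul_of_coordProj_eq hxy.symm
  have h1 := hΩ.inner_outerNormal_sub_nonpos hx.1 (frontier_subset_closure hy.1)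
  have h2 := hΩ.inner_outerNormal_sub_nonpos hy.1 (frontier_subset_closure hx.1)
  rw [e1, inner_single_right] at h1
  rw [e2, inner_single_right] at h2
  have h3 := hx.2
  have h4 := hy.2
  have h5 : y i - x i = 0 := by
    rcases lt_trichotomy s 0 with hs | hs | hs
    · have a1 : outerNormal ρ x i < 0 := by nlinarith
      have a2 : outerNormal ρ y i < 0 := by nlinarith
      nlinarith
    · rw [hs] at h3; linarith
    · have a1 : 0 < outerNormal ρ x i := by nlinarith
      have a2 : 0 < outerNormal ρ y i := by nlinarith
      nlinarith
  rw [h5, zero_smul] at e1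
  exact (sub_eq_zero.1 e1).symm

/-- Locally, the boundary is nearly flat. -/
lemma eventually_flat (hΩ : IsSmoothConvexDomain Ω ρ) {x₀ : R3} (hx₀ : x₀ ∈ frontier Ω) {δ : ℝ}
    (hδ : 0 < δ) : ∃ W ∈ 𝓝 x₀, ∀ x ∈ W ∩ frontier Ω, ∀ y ∈ W ∩ frontier Ω,
      |inner ℝ (outerNormal ρ x₀) (x - y)| ≤ δ * ‖x - y‖ := by
  -- Strict differentiability compares two variable points near `x₀`; as `ρ` vanishes at both, only
  -- the linear term and a small error remain.
  have hstrict : HasStrictFDerivAt ρ (innerSL ℝ (gradient ρ x₀)) x₀ := by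
    have := (hΩ.smooth.contDiffAt (x := x₀)).hasStrictFDerivAt (by simp)
    rwa [(hΩ.hasFDerivAt x₀).fderiv] at this
  have hg := hΩ.norm_gradient_pos hx₀
  have h := (hasStrictFDerivAt_iff_isLittleO.1 hstrict).def (mul_pos hδ hg)
  rw [nhds_prod_eq] at h
  obtain ⟨W, hW, hWW⟩ := mem_prod_self_iff.1 h
  refine ⟨W, hW, fun x hx y hy => ?_⟩
  have h1 := hWW (mk_mem_prod hx.1 hy.1)
  simp only [mem_ofPred_eq, hΩ.eq_zero_of_mem_frontier hx.2, hΩ.eq_zero_of_mem_frontier hy.2, sub_zero, zero_sub,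
    innerSL_apply_apply, Real.norm_eq_abs] at h1
  rw [hΩ.inner_gradient hx₀, abs_neg, abs_mul, abs_norm] at h1
  have h2 : ‖gradient ρ x₀‖ * |inner ℝ (outerNormal ρ x₀) (x - y)|
      ≤ ‖gradient ρ x₀‖ * (δ * ‖x - y‖) := by linarith
  exact le_of_mul_le_mul_left h2 hg

/-- One factor `1 + ε` is lost by treating the boundary near `x₀` as flat, the other by freezing the
continuous density at `x₀`. -/
lemma local_area_comparison (hΩ : IsSmoothConvexDomain Ω ρ) {i : Fin 3} {s : ℝ} (hs : |s| = 1)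
    {x₀ : R3} (hx₀ : x₀ ∈ boundaryPart Ω ρ i s) {ε : ℝ} (hε : 0 < ε) :
    ∃ W ∈ 𝓝 x₀, MeasurableSet W ∧ ∀ A ⊆ W ∩ boundaryPart Ω ρ i s, MeasurableSet A →
      volume (coordProj i '' A) ≤ ENNReal.ofReal ((1 + ε) ^ 2) * ∫⁻ x in A,
        ENNReal.ofReal (s * outerNormal ρ x i) ∂(Measure.euclideanHausdorffMeasure 2 : Measure R3) ∧
      ∫⁻ x in A, ENNReal.ofReal (s * outerNormal ρ x i)
          ∂(Measure.euclideanHausdorffMeasure 2 : Measure R3)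
        ≤ ENNReal.ofReal ((1 + ε) ^ 2) * volume (coordProj i '' A) := by
  set m : Measure R3 := Measure.euclideanHausdorffMeasure 2
  set c : ℝ := s * outerNormal ρ x₀ i with hc
  have hc0 : 0 < c := hx₀.2
  have hcabs : |outerNormal ρ x₀ i| = c := by
    rw [← abs_of_pos hc0, hc, abs_mul, hs, one_mul]
  obtain ⟨δ, hδ, hflat⟩ := flat_comparison (hΩ.norm_outerNormal hx₀.1) (i := i)
    (fun h => by rw [h, abs_zero] at hcabs; linarith) hε
  obtain ⟨W₁, hW₁, hW₁'⟩ := hΩ.eventually_flat hx₀.1 hδ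
  have hcont : ContinuousAt (fun x => s * outerNormal ρ x i) x₀ :=
    continuousAt_const.mul ((EuclideanSpace.proj (𝕜 := ℝ) i).continuous.continuousAt.comp
      (hΩ.continuousAt_outerNormal hx₀.1))
  have h1 : ∀ᶠ x in 𝓝 x₀, s * outerNormal ρ x i < (1 + ε) * c :=
    hcont.eventually (gt_mem_nhds (by change c < _; nlinarith))
  have h2 : ∀ᶠ x in 𝓝 x₀, c / (1 + ε) < s * outerNormal ρ x i :=
    hcont.eventually (lt_mem_nhds (by
      change _ < c
      rw [div_lt_iff₀ (by positivity)]
      nlinarith))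
  obtain ⟨W, hWsub, hWo, hxW⟩ := mem_nhds_iff.1 (inter_mem hW₁ (inter_mem h1 h2))
  refine ⟨W, hWo.mem_nhds hxW, hWo.measurableSet, fun A hA hAm => ?_⟩
  obtain ⟨f1, f2⟩ := hflat A fun x hx y hy =>
    hW₁' x ⟨(hWsub (hA hx).1).1, (hA hx).2.1⟩ y ⟨(hWsub (hA hy).1).1, (hA hy).2.1⟩
  rw [hcabs] at f1 f2
  have hε1 : 0 < 1 + ε := by linarith
  have i1 : ∫⁻ x in A, ENNReal.ofReal (s * outerNormal ρ x i) ∂m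
      ≤ ENNReal.ofReal (1 + ε) * (ENNReal.ofReal c * m A) := by
    calc _ ≤ ∫⁻ x in A, ENNReal.ofReal ((1 + ε) * c) ∂m :=
          setLIntegral_mono' hAm fun x hx =>
            ENNReal.ofReal_le_ofReal (hWsub (hA hx).1).2.1.le
      _ = _ := by rw [setLIntegral_const, ENNReal.ofReal_mul hε1.le, mul_assoc]
  have i2 : ENNReal.ofReal c * m A
      ≤ ENNReal.ofReal (1 + ε) * ∫⁻ x in A, ENNReal.ofReal (s * outerNormal ρ x i) ∂m := by
    rw [← setLIntegral_const, ← lintegral_const_mul' _ _ ENNReal.ofReal_ne_top]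
    refine setLIntegral_mono' hAm fun x hx => ?_
    rw [← ENNReal.ofReal_mul hε1.le]
    refine ENNReal.ofReal_le_ofReal ?_
    have : c / (1 + ε) < s * outerNormal ρ x i := (hWsub (hA hx).1).2.2
    rw [div_lt_iff₀ hε1] at this
    linarith
  rw [ENNReal.ofReal_pow hε1.le, sq, mul_assoc, mul_assoc]
  exact ⟨f1.trans (by gcongr), i1.trans (by gcongr)⟩

/-- The area of the coordinate projection of a boundary piece on which the corresponding component
of the normal does not change sign. -/
theorem volume_coordProj_image (hΩ : IsSmoothConvexDomain Ω ρ) {i : Fin 3} {s : ℝ} (hs : |s| = 1)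
    {A : Set R3} (hA : A ⊆ boundaryPart Ω ρ i s) (hAm : MeasurableSet A) :
    volume (coordProj i '' A) = ∫⁻ x in A, ENNReal.ofReal (s * outerNormal ρ x i)
      ∂(Measure.euclideanHausdorffMeasure 2 : Measure R3) := by
  set m : Measure R3 := Measure.euclideanHausdorffMeasure 2
  set I : Set R3 → ℝ≥0∞ := fun A => ∫⁻ x in A, ENNReal.ofReal (s * outerNormal ρ x i) ∂m
  rcases A.eq_empty_or_nonempty with rfl | hne
  · simp
  have key : ∀ ε > 0, volume (coordProj i '' A) ≤ ENNReal.ofReal ((1 + ε) ^ 2) * I A ∧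
      I A ≤ ENNReal.ofReal ((1 + ε) ^ 2) * volume (coordProj i '' A) := by
    intro ε hε
    have hloc : ∀ x, ∃ W, x ∈ boundaryPart Ω ρ i s → W ∈ 𝓝 x ∧ MeasurableSet W ∧
        ∀ A ⊆ W ∩ boundaryPart Ω ρ i s, MeasurableSet A →
          volume (coordProj i '' A) ≤ ENNReal.ofReal ((1 + ε) ^ 2) * I A ∧
          I A ≤ ENNReal.ofReal ((1 + ε) ^ 2) * volume (coordProj i '' A) := by
      intro x
      by_cases hx : x ∈ boundaryPart Ω ρ i s
      · obtain ⟨W, h1, h2, h3⟩ := hΩ.local_area_comparison hs hx hε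
        exact ⟨W, fun _ => ⟨h1, h2, h3⟩⟩
      · exact ⟨univ, fun h => absurd h hx⟩
    choose W hW using hloc
    -- Countably many of the local neighbourhoods suffice. Since the projection is injective, both
    -- sides are countably additive over a disjoint refinement, so the local inequalities add up
    -- with the same constant, and `ε` may tend to zero.
    obtain ⟨t, htA, htc, hcov⟩ := TopologicalSpace.countable_cover_nhdsWithin (s := A) (f := W)
      fun x hx => mem_nhdsWithin_of_mem_nhds (hW x (hA hx)).1
    have htne : t.Nonempty := by
      by_contra h
      rw [not_nonempty_iff_eq_empty] at h
      obtain ⟨x, hx⟩ := hne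
      simpa [h] using hcov hx
    obtain ⟨u, rfl⟩ := htc.exists_eq_range htne
    have hu : ∀ k, u k ∈ boundaryPart Ω ρ i s := fun k => hA (htA (mem_range_self k))
    set V : ℕ → Set R3 := fun k => A ∩ disjointed (fun k => W (u k)) k with hV
    have hVm : ∀ k, MeasurableSet (V k) := fun k =>
      hAm.inter (MeasurableSet.disjointed (fun k => (hW _ (hu k)).2.1) k)
    have hVA : ∀ k, V k ⊆ A := fun k => inter_subset_left
    have hVW : ∀ k, V k ⊆ W (u k) ∩ boundaryPart Ω ρ i s := fun k x hx =>
      ⟨disjointed_subset (fun k => W (u k)) k hx.2, hA hx.1⟩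
    have hVd : Pairwise (Function.onFun Disjoint V) := fun k l hkl =>
      (disjoint_disjointed (fun k => W (u k)) hkl).mono inter_subset_right inter_subset_right
    have hVu : A = ⋃ k, V k := by
      rw [hV, ← inter_iUnion, iUnion_disjointed, inter_eq_left.2]
      intro x hx
      have := hcov hx
      rw [biUnion_range] at this
      exact this
    have hinj := hΩ.injOn_coordProj i s
    have hPm : ∀ k, MeasurableSet (coordProj i '' V k) := fun k =>
      (hVm k).image_of_continuousOn_injOn (coordProj i).continuous.continuousOn
        (hinj.mono ((hVA k).trans hA))
    have hPd : Pairwise (Function.onFun Disjoint fun k => coordProj i '' V k) := fun k l hkl =>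
      (hVd hkl).image hinj ((hVA k).trans hA) ((hVA l).trans hA)
    have e1 : volume (coordProj i '' A) = ∑' k, volume (coordProj i '' V k) := by
      conv_lhs => rw [hVu, image_iUnion]
      exact measure_iUnion hPd hPm
    have e2 : I A = ∑' k, I (V k) := by
      conv_lhs => rw [hVu]
      exact lintegral_iUnion hVm hVd _
    rw [e1, e2, ← ENNReal.tsum_mul_left, ← ENNReal.tsum_mul_left]
    exact ⟨ENNReal.tsum_le_tsum fun k => ((hW _ (hu k)).2.2 _ (hVW k) (hVm k)).1,
      ENNReal.tsum_le_tsum fun k => ((hW _ (hu k)).2.2 _ (hVW k) (hVm k)).2⟩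
  have hlim : ∀ c : ℝ≥0∞, Tendsto (fun n : ℕ => ENNReal.ofReal ((1 + 1 / ((n : ℝ) + 1)) ^ 2) * c)
      atTop (𝓝 c) := by
    intro c
    have h1 : Tendsto (fun n : ℕ => (1 + 1 / ((n : ℝ) + 1)) ^ 2) atTop (𝓝 ((1 + 0) ^ 2)) :=
      ((tendsto_one_div_add_atTop_nhds_zero_nat (𝕜 := ℝ)).const_add 1).pow 2
    have h2 := ENNReal.tendsto_ofReal h1
    have h3 := ENNReal.Tendsto.mul_const (b := c) h2 (Or.inl (by simp))
    simpa using h3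
  apply le_antisymm
  · exact ge_of_tendsto' (hlim (I A)) fun n => (key _ (by positivity)).1
  · exact ge_of_tendsto' (hlim _) fun n => (key _ (by positivity)).2

end IsSmoothConvexDomain

end Divergence

/-! ### The divergence theorem by slicing. -/

section Divergence

variable {Ω : Set R3} {ρ : R3 → ℝ}

/-- The point of `ℝ³` with `i`-th coordinate `t` and the other coordinates given by `w`. -/
def coordIns (i : Fin 3) (t : ℝ) (w : R2) : R3 := WithLp.toLp 2 (i.insertNth t w.ofLp)

@[simp] lemma coordIns_apply_self (i : Fin 3) (t : ℝ) (w : R2) : coordIns i t w i = t := by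
  simp [coordIns]

@[simp] lemma coordProj_coordIns (i : Fin 3) (t : ℝ) (w : R2) :
    coordProj i (coordIns i t w) = w := by
  ext k
  simp [coordIns]

lemma coordIns_sub (i : Fin 3) (t t' : ℝ) (w : R2) :
    coordIns i t w - coordIns i t' w = (t - t') • EuclideanSpace.single i (1 : ℝ) := by
  rw [IsSmoothConvexDomain.eq_add_smul_of_coordProj_eq (i := i) (by simp)]
  simp

lemma coordIns_coordProj (i : Fin 3) (x : R3) : coordIns i (x i) (coordProj i x) = x := by
  have := IsSmoothConvexDomain.eq_add_smul_of_coordProj_eq (i := i)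
    (x := x) (y := coordIns i (x i) (coordProj i x)) (by simp)
  rw [coordIns_apply_self, sub_self, zero_smul] at this
  exact sub_eq_zero.1 this

lemma coordIns_eq (i : Fin 3) (t : ℝ) (w : R2) :
    coordIns i t w = coordIns i 0 w + t • EuclideanSpace.single i (1 : ℝ) := by
  rw [← sub_eq_iff_eq_add', coordIns_sub, sub_zero]

lemma hasDerivAt_coordIns (i : Fin 3) (t : ℝ) (w : R2) :
    HasDerivAt (fun t => coordIns i t w) (EuclideanSpace.single i (1 : ℝ)) t := by
  have e : (fun t => coordIns i t w)
      = fun t => coordIns i 0 w + t • EuclideanSpace.single i (1 : ℝ) :=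
    funext fun t => coordIns_eq i t w
  rw [e]
  simpa using ((hasDerivAt_id' t).smul_const (EuclideanSpace.single i (1 : ℝ))).const_add
    (coordIns i 0 w)

lemma continuous_coordIns (i : Fin 3) (w : R2) : Continuous fun t => coordIns i t w :=
  continuous_iff_continuousAt.2 fun t => (hasDerivAt_coordIns i t w).continuousAt

lemma measurePreserving_coordIns (i : Fin 3) :
    MeasurePreserving (fun p : ℝ × R2 => coordIns i p.1 p.2) volume volume := by
  have h1 : MeasurePreserving (fun p : ℝ × R2 => (p.1, WithLp.ofLp p.2))
      (volume : Measure (ℝ × R2)) (volume : Measure (ℝ × (Fin 2 → ℝ))) :=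
    (MeasurePreserving.id volume).prod (PiLp.volume_preserving_ofLp (Fin 2))
  have h2 := (volume_preserving_piFinSuccAbove (fun _ : Fin 3 => ℝ) i).symm
  exact (PiLp.volume_preserving_toLp (Fin 3)).comp (h2.comp h1)

namespace IsSmoothConvexDomain

/-- Lines parallel to a coordinate axis meet the domain in an interval, whose end points lie in
the parts of the boundary with the corresponding sign of the normal. -/
lemma exists_chord (hΩ : IsSmoothConvexDomain Ω ρ) {i : Fin 3} {w : R2}
    (hw : w ∈ coordProj i '' Ω) : ∃ a b : ℝ, a < b ∧ (∀ t, coordIns i t w ∈ Ω ↔ t ∈ Ioo a b) ∧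
      coordIns i a w ∈ boundaryPart Ω ρ i (-1) ∧ coordIns i b w ∈ boundaryPart Ω ρ i 1 := by
  obtain ⟨x, hx, rfl⟩ := hw
  set w := coordProj i x
  set I : Set ℝ := {t | coordIns i t w ∈ Ω} with hI
  have hIo : IsOpen I := hΩ.isOpen.preimage (continuous_coordIns i w)
  have hIne : I.Nonempty := ⟨x i, by
    change coordIns i (x i) (coordProj i x) ∈ Ω
    rwa [coordIns_coordProj]⟩
  have hIc : OrdConnected I := by
    have : Convex ℝ I := by
      intro s hs t ht c d hc hd hcd
      have h := hΩ.convex hs ht hc hd hcd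
      have e : c • coordIns i s w + d • coordIns i t w = coordIns i (c • s + d • t) w := by
        rw [coordIns_eq i s, coordIns_eq i t, coordIns_eq i (c • s + d • t), smul_add, smul_add,
          smul_smul, smul_smul, smul_eq_mul, smul_eq_mul, add_smul]
        have : coordIns i 0 w = c • coordIns i 0 w + d • coordIns i 0 w := by
          rw [← add_smul, hcd, one_smul]
        conv_rhs => rw [this]
        abel
      rw [e] at h
      exact h
    exact this.ordConnected
  obtain ⟨M, hM⟩ := hΩ.bounded.exists_norm_le
  have hIb : ∀ t ∈ I, |t| ≤ M := fun t ht => by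
    have h1 := PiLp.norm_apply_le (coordIns i t w) i
    rw [coordIns_apply_self, Real.norm_eq_abs] at h1
    exact h1.trans (hM _ ht)
  have hba : BddAbove I := ⟨M, fun t ht => (abs_le.1 (hIb t ht)).2⟩
  have hbb : BddBelow I := ⟨-M, fun t ht => (abs_le.1 (hIb t ht)).1⟩
  have hIoo : I = Ioo (sInf I) (sSup I) := by
    apply Subset.antisymm
    · intro t ht
      obtain ⟨δ, hδ, hball⟩ := Metric.isOpen_iff.1 hIo t ht
      constructor
      · have : t - δ / 2 ∈ I := hball (by simp [abs_of_pos hδ, hδ])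
        linarith [csInf_le hbb this]
      · have : t + δ / 2 ∈ I := hball (by simp [abs_of_pos hδ, hδ])
        linarith [le_csSup hba this]
    · intro t ht
      obtain ⟨s, hs, hst⟩ := exists_lt_of_csInf_lt hIne ht.1
      obtain ⟨r, hr, htr⟩ := exists_lt_of_lt_csSup hIne ht.2
      exact hIc.out hs hr ⟨hst.le, htr.le⟩
  set a := sInf I
  set b := sSup I
  obtain ⟨t₀, ht₀⟩ := hIne
  have ht₀' : t₀ ∈ Ioo a b := by rwa [← hIoo]
  have hab : a < b := ht₀'.1.trans ht₀'.2
  have hiff : ∀ t, coordIns i t w ∈ Ω ↔ t ∈ Ioo a b := fun t => by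
    rw [← hIoo, hI]; rfl
  -- The end points are limits of points in `Ω` without being in `Ω`. The sign of the normal there
  -- is read off from an interior point of the chord.
  have hfr : ∀ t ∈ closure (Ioo a b), t ∉ Ioo a b → coordIns i t w ∈ frontier Ω := by
    intro t ht ht'
    rw [hΩ.isOpen.frontier_eq]
    refine ⟨?_, fun h => ht' ((hiff t).1 h)⟩
    have : MapsTo (fun t => coordIns i t w) (Ioo a b) Ω := fun t ht => (hiff t).2 ht
    exact this.closure (continuous_coordIns i w) ht
  have hcl : closure (Ioo a b) = Icc a b := closure_Ioo hab.ne
  have hafr := hfr a (by rw [hcl]; exact ⟨le_rfl, hab.le⟩) (by simp)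
  have hbfr := hfr b (by rw [hcl]; exact ⟨hab.le, le_rfl⟩) (by simp)
  refine ⟨a, b, hab, hiff, ⟨hafr, ?_⟩, ⟨hbfr, ?_⟩⟩
  · have h := hΩ.inner_outerNormal_sub_neg hafr ht₀
    rw [coordIns_sub, inner_single_right] at h
    nlinarith [ht₀'.1]
  · have h := hΩ.inner_outerNormal_sub_neg hbfr ht₀
    rw [coordIns_sub, inner_single_right] at h
    nlinarith [ht₀'.2]

/-- From a boundary point of this part the line parallel to the axis enters `Ω`. Conversely, the
chord over a point of the shadow of `Ω` ends in both parts. -/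
lemma coordProj_image_boundaryPart (hΩ : IsSmoothConvexDomain Ω ρ) (i : Fin 3) {s : ℝ}
    (hs : s = 1 ∨ s = -1) : coordProj i '' boundaryPart Ω ρ i s = coordProj i '' Ω := by
  apply Subset.antisymm
  · rintro _ ⟨x, hx, rfl⟩
    have hev := hΩ.eventually_add_smul_mem (e := (-s) • EuclideanSpace.single i (1 : ℝ)) hx.1 (by
      rw [inner_single_right]
      linarith [hx.2])
    obtain ⟨t, ht⟩ := hev.exists
    refine ⟨_, ht, ?_⟩
    ext k
    simp
  · intro w hw
    obtain ⟨a, b, -, -, ha, hb⟩ := hΩ.exists_chord hw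
    rcases hs with rfl | rfl
    · exact ⟨_, hb, by simp⟩
    · exact ⟨_, ha, by simp⟩

/-- The positive or negative part of the measure `nᵢ dμ` on the boundary. -/
def flux (Ω : Set R3) (ρ : R3 → ℝ) (i : Fin 3) (s : ℝ) : Measure R3 :=
  (surfaceMeasure Ω).withDensity fun x => ENNReal.ofReal (s * outerNormal ρ x i)

lemma measurable_flux_density (hΩ : IsSmoothConvexDomain Ω ρ) (i : Fin 3) (s : ℝ) :
    Measurable fun x => ENNReal.ofReal (s * outerNormal ρ x i) :=
  ((hΩ.measurable_outerNormal_apply i).const_mul s).ennreal_ofReal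

lemma flux_apply (hΩ : IsSmoothConvexDomain Ω ρ) (i : Fin 3) (s : ℝ) {A : Set R3}
    (hA : MeasurableSet A) : flux Ω ρ i s A = ∫⁻ x in A ∩ boundaryPart Ω ρ i s,
      ENNReal.ofReal (s * outerNormal ρ x i)
        ∂(Measure.euclideanHausdorffMeasure 2 : Measure R3) := by
  have hS := hΩ.measurableSet_boundaryPart i s
  rw [flux, withDensity_apply _ hA, surfaceMeasure, Measure.restrict_restrict hA]
  rw [← lintegral_indicator (hA.inter isClosed_frontier.measurableSet),
    ← lintegral_indicator (hA.inter hS)]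
  refine lintegral_congr fun x => ?_
  by_cases hx : x ∈ A ∩ boundaryPart Ω ρ i s
  · rw [indicator_of_mem hx, indicator_of_mem (show x ∈ A ∩ frontier Ω from ⟨hx.1, hx.2.1⟩)]
  · rw [indicator_of_notMem hx]
    by_cases hx' : x ∈ A ∩ frontier Ω
    · rw [indicator_of_mem hx', ENNReal.ofReal_eq_zero]
      by_contra! h
      exact hx ⟨hx'.1, hx'.2, h⟩
    · rw [indicator_of_notMem hx']

/-- The area formula as an identity of measures: the positive and negative parts of `nᵢ dμ` both
project to Lebesgue measure on the shadow of `Ω`. This replaces a parametrization of the boundary.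
-/
lemma map_coordProj_flux (hΩ : IsSmoothConvexDomain Ω ρ) (i : Fin 3) {s : ℝ}
    (hs : s = 1 ∨ s = -1) :
    (flux Ω ρ i s).map (coordProj i) = volume.restrict (coordProj i '' Ω) := by
  have hm : Measurable (coordProj i) := (coordProj i).continuous.measurable
  have hs1 : |s| = 1 := by rcases hs with rfl | rfl <;> simp
  ext S hS
  rw [Measure.map_apply hm hS, hΩ.flux_apply i s (hm hS), Measure.restrict_apply hS,
    ← hΩ.volume_coordProj_image hs1 inter_subset_right
      ((hm hS).inter (hΩ.measurableSet_boundaryPart i s)),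
    image_preimage_inter, hΩ.coordProj_image_boundaryPart i hs]

lemma isFiniteMeasure_flux (hΩ : IsSmoothConvexDomain Ω ρ) (i : Fin 3) {s : ℝ}
    (hs : s = 1 ∨ s = -1) : IsFiniteMeasure (flux Ω ρ i s) := by
  constructor
  have hm : Measurable (coordProj i) := (coordProj i).continuous.measurable
  have h := congrArg (fun μ => μ univ) (hΩ.map_coordProj_flux i hs)
  simp only [Measure.map_apply hm MeasurableSet.univ, preimage_univ, Measure.restrict_apply_univ]
    at h
  rw [h]
  exact ((coordProj i).lipschitz.isBounded_image hΩ.bounded).measure_lt_top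

lemma ae_flux_mem (hΩ : IsSmoothConvexDomain Ω ρ) (i : Fin 3) (s : ℝ) :
    ∀ᵐ x ∂(flux Ω ρ i s), x ∈ boundaryPart Ω ρ i s := by
  rw [ae_iff]
  change flux Ω ρ i s (boundaryPart Ω ρ i s)ᶜ = 0
  rw [hΩ.flux_apply i s (hΩ.measurableSet_boundaryPart i s).compl, compl_inter_self]
  simp

/-- The boundary has finite area. -/
theorem isFiniteMeasure_surfaceMeasure (hΩ : IsSmoothConvexDomain Ω ρ) :
    IsFiniteMeasure (surfaceMeasure Ω) := by
  constructor
  have h1 : surfaceMeasure Ω univ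
      ≤ ∫⁻ x, ∑ i : Fin 3, (ENNReal.ofReal (1 * outerNormal ρ x i)
        + ENNReal.ofReal (-1 * outerNormal ρ x i)) ∂(surfaceMeasure Ω) := by
    rw [← lintegral_one]
    refine lintegral_mono_ae ?_
    have : ∀ᵐ x ∂(surfaceMeasure Ω), x ∈ frontier Ω :=
      ae_restrict_mem isClosed_frontier.measurableSet
    filter_upwards [this] with x hx
    have hn := hΩ.norm_outerNormal hx
    -- Since `1 = ∑ nᵢ² ≤ ∑ |nᵢ|`, the area is at most the total mass of the six flux measures, each
    -- finite because the shadows are bounded.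
    have h2 : (1 : ℝ) ≤ ∑ i : Fin 3, |outerNormal ρ x i| := by
      have h3 : ‖outerNormal ρ x‖ ^ 2 = 1 := by rw [hn]; norm_num
      rw [EuclideanSpace.norm_sq_eq] at h3
      rw [← h3]
      refine Finset.sum_le_sum fun i _ => ?_
      have h4 : |outerNormal ρ x i| ≤ 1 := by
        have := PiLp.norm_apply_le (outerNormal ρ x) i
        rwa [hn, Real.norm_eq_abs] at this
      rw [Real.norm_eq_abs]
      nlinarith [abs_nonneg (outerNormal ρ x i)]
    have h5 : ∀ i, ENNReal.ofReal |outerNormal ρ x i| ≤ ENNReal.ofReal (1 * outerNormal ρ x i)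
        + ENNReal.ofReal (-1 * outerNormal ρ x i) := by
      intro i
      rcases le_total 0 (outerNormal ρ x i) with h | h
      · rw [abs_of_nonneg h, one_mul]; exact le_self_add
      · rw [abs_of_nonpos h, neg_one_mul]; exact le_add_self
    calc (1 : ℝ≥0∞) = ENNReal.ofReal 1 := by simp
      _ ≤ ENNReal.ofReal (∑ i : Fin 3, |outerNormal ρ x i|) := ENNReal.ofReal_le_ofReal h2
      _ = ∑ i : Fin 3, ENNReal.ofReal |outerNormal ρ x i| :=
        ENNReal.ofReal_sum_of_nonneg fun i _ => abs_nonneg _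
      _ ≤ _ := Finset.sum_le_sum fun i _ => h5 i
  refine h1.trans_lt ?_
  rw [lintegral_finsetSum _ fun i _ =>
    Measurable.fun_add (hΩ.measurable_flux_density i 1) (hΩ.measurable_flux_density i (-1))]
  refine ENNReal.sum_lt_top.2 fun i _ => ?_
  rw [lintegral_add_left (hΩ.measurable_flux_density i 1)]
  have f1 := (hΩ.isFiniteMeasure_flux i (Or.inl rfl)).measure_univ_lt_top
  have f2 := (hΩ.isFiniteMeasure_flux i (Or.inr rfl)).measure_univ_lt_top
  rw [flux, withDensity_apply _ MeasurableSet.univ, Measure.restrict_univ] at f1 f2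
  exact ENNReal.add_lt_top.2 ⟨f1, f2⟩

lemma exists_bound_on_frontier (hΩ : IsSmoothConvexDomain Ω ρ) {f : R3 → ℝ} (hf : Continuous f) :
    ∃ M, ∀ x ∈ closure Ω, ‖f x‖ ≤ M :=
  hΩ.isCompact_closure.exists_bound_of_continuousOn hf.continuousOn

lemma integrable_flux (hΩ : IsSmoothConvexDomain Ω ρ) (i : Fin 3) {s : ℝ} (hs : s = 1 ∨ s = -1)
    {f : R3 → ℝ} (hf : Continuous f) : Integrable f (flux Ω ρ i s) := by
  have := hΩ.isFiniteMeasure_flux i hs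
  obtain ⟨M, hM⟩ := hΩ.exists_bound_on_frontier hf
  refine Integrable.of_bound hf.aestronglyMeasurable M ?_
  filter_upwards [hΩ.ae_flux_mem i s] with x hx
  exact hM x (frontier_subset_closure hx.1)

/-- A function on part of the boundary, written in terms of the coordinate projection. -/
lemma exists_integral_flux_eq (hΩ : IsSmoothConvexDomain Ω ρ) (i : Fin 3) {s : ℝ}
    (hs : s = 1 ∨ s = -1) {f : R3 → ℝ} (hf : Continuous f) : ∃ F : R2 → ℝ,
      (∀ x ∈ boundaryPart Ω ρ i s, F (coordProj i x) = f x) ∧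
      IntegrableOn F (coordProj i '' Ω) ∧
      ∫ w in coordProj i '' Ω, F w = ∫ x, f x ∂(flux Ω ρ i s) := by
  have hm : Measurable (coordProj i) := (coordProj i).continuous.measurable
  -- A continuous injection on a Borel set is a measurable embedding, so the boundary values
  -- transfer to a measurable function of the projection.
  have hemb := ContinuousOn.measurableEmbedding (hΩ.measurableSet_boundaryPart i s)
    (coordProj i).continuous.continuousOn (hΩ.injOn_coordProj i s)
  obtain ⟨F, hFm, hF⟩ := hemb.exists_measurable_extend
    (g := fun x : boundaryPart Ω ρ i s => f x) (hf.measurable.comp measurable_subtype_coe)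
    (fun _ => ⟨0⟩)
  have hF' : ∀ x ∈ boundaryPart Ω ρ i s, F (coordProj i x) = f x := fun x hx =>
    congrFun hF ⟨x, hx⟩
  have hae : (fun x => F (coordProj i x)) =ᵐ[flux Ω ρ i s] f := by
    filter_upwards [hΩ.ae_flux_mem i s] with x hx
    exact hF' x hx
  refine ⟨F, hF', ?_, ?_⟩
  · rw [IntegrableOn, ← hΩ.map_coordProj_flux i hs,
      integrable_map_measure hFm.aestronglyMeasurable hm.aemeasurable]
    exact (hΩ.integrable_flux i hs hf).congr hae.symm
  · rw [← hΩ.map_coordProj_flux i hs, integral_map hm.aemeasurable hFm.aestronglyMeasurable]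
    exact integral_congr_ae hae

/-- Fubini along the `i`-th axis: on each chord the fundamental theorem of calculus gives the
difference of the end values, which are functions on the two boundary parts. -/
lemma integral_fderiv_single (hΩ : IsSmoothConvexDomain Ω ρ) (i : Fin 3) {f : R3 → ℝ}
    (hf : ContDiff ℝ 1 f) : ∫ x in Ω, fderiv ℝ f x (EuclideanSpace.single i 1)
      = ∫ x, f x ∂(flux Ω ρ i 1) - ∫ x, f x ∂(flux Ω ρ i (-1)) := by
  set g : R3 → ℝ := fun x => fderiv ℝ f x (EuclideanSpace.single i 1) with hg
  have hgc : Continuous g := (hf.continuous_fderiv (by simp)).clm_apply continuous_const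
  obtain ⟨F₁, hF₁, hF₁i, hF₁e⟩ := hΩ.exists_integral_flux_eq i (Or.inl rfl) hf.continuous
  obtain ⟨F₂, hF₂, hF₂i, hF₂e⟩ := hΩ.exists_integral_flux_eq i (Or.inr rfl) hf.continuous
  have hΩm := hΩ.isOpen.measurableSet
  have hgi : IntegrableOn g Ω :=
    (hgc.continuousOn.integrableOn_compact hΩ.isCompact_closure).mono_set subset_closure
  have hPm : MeasurableSet (coordProj i '' Ω) := by
    rw [← hΩ.coordProj_image_boundaryPart i (Or.inl rfl)]
    exact (hΩ.measurableSet_boundaryPart i 1).image_of_continuousOn_injOn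
      (coordProj i).continuous.continuousOn (hΩ.injOn_coordProj i 1)
  have hmp := measurePreserving_coordIns i
  have hind : Integrable (Ω.indicator g) := (integrable_indicator_iff hΩm).2 hgi
  have hline : ∀ w : R2, ∫ t, Ω.indicator g (coordIns i t w)
      = (coordProj i '' Ω).indicator (fun w => F₁ w - F₂ w) w := by
    intro w
    by_cases hw : w ∈ coordProj i '' Ω
    · obtain ⟨a, b, hab, hiff, ha, hb⟩ := hΩ.exists_chord hw
      rw [indicator_of_mem hw]
      have e : (fun t => Ω.indicator g (coordIns i t w))
          = (Ioo a b).indicator fun t => g (coordIns i t w) := by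
        ext t
        by_cases ht : t ∈ Ioo a b
        · rw [indicator_of_mem ht, indicator_of_mem ((hiff t).2 ht)]
        · rw [indicator_of_notMem ht, indicator_of_notMem (fun h => ht ((hiff t).1 h))]
      rw [e, integral_indicator measurableSet_Ioo, ← integral_Ioc_eq_integral_Ioo,
        ← intervalIntegral.integral_of_le hab.le]
      have hd : ∀ t ∈ uIcc a b, HasDerivAt (fun t => f (coordIns i t w)) (g (coordIns i t w)) t :=
        fun t _ => ((hf.differentiable (by simp) _).hasFDerivAt).comp_hasDerivAt t
          (hasDerivAt_coordIns i t w)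
      rw [intervalIntegral.integral_eq_sub_of_hasDerivAt hd
        ((hgc.comp (continuous_coordIns i w)).intervalIntegrable a b), ← hF₁ _ hb, ← hF₂ _ ha]
      simp
    · rw [indicator_of_notMem hw]
      have : ∀ t, Ω.indicator g (coordIns i t w) = 0 := fun t =>
        indicator_of_notMem (fun h => hw ⟨_, h, by simp⟩) _
      simp [this]
  calc ∫ x in Ω, g x = ∫ x, Ω.indicator g x := (integral_indicator hΩm).symm
    _ = ∫ p : ℝ × R2, Ω.indicator g (coordIns i p.1 p.2) := by
      rw [← hmp.map_eq, integral_map hmp.measurable.aemeasurable]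
      rw [hmp.map_eq]
      exact hind.aestronglyMeasurable
    _ = ∫ w : R2, ∫ t : ℝ, Ω.indicator g (coordIns i t w) := by
      have hi : Integrable (fun p : ℝ × R2 => Ω.indicator g (coordIns i p.1 p.2)) volume :=
        hmp.integrable_comp_of_integrable hind
      rw [Measure.volume_eq_prod] at hi ⊢
      exact integral_prod_symm _ hi
    _ = ∫ w in coordProj i '' Ω, (F₁ w - F₂ w) := by
      simp_rw [hline]
      exact integral_indicator hPm
    _ = _ := by rw [integral_sub hF₁i hF₂i, hF₁e, hF₂e]

/-- **Divergence theorem** on a smooth convex domain, for constant vector fields times functions. -/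
theorem integral_fderiv_eq (hΩ : IsSmoothConvexDomain Ω ρ) {f : R3 → ℝ} (hf : ContDiff ℝ 1 f)
    (v : R3) : ∫ x in Ω, fderiv ℝ f x v
      = ∫ x, f x * inner ℝ (outerNormal ρ x) v ∂(surfaceMeasure Ω) := by
  have := hΩ.isFiniteMeasure_surfaceMeasure
  obtain ⟨M, hM⟩ := hΩ.exists_bound_on_frontier hf.continuous
  have hfr : ∀ᵐ x ∂(surfaceMeasure Ω), x ∈ frontier Ω :=
    ae_restrict_mem isClosed_frontier.measurableSet
  have hint : ∀ i, Integrable (fun x => f x * outerNormal ρ x i) (surfaceMeasure Ω) := by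
    intro i
    refine Integrable.of_bound
      (hf.continuous.measurable.mul (hΩ.measurable_outerNormal_apply i)).aestronglyMeasurable
      (M * 1) ?_
    filter_upwards [hfr] with x hx
    rw [norm_mul]
    have h1 := hM x (frontier_subset_closure hx)
    have h2 : ‖outerNormal ρ x i‖ ≤ 1 := by
      have := PiLp.norm_apply_le (outerNormal ρ x) i
      rwa [hΩ.norm_outerNormal hx] at this
    exact mul_le_mul h1 h2 (norm_nonneg _) ((norm_nonneg _).trans h1)
  have hflux : ∀ i (s : ℝ), ∫ x, f x ∂(flux Ω ρ i s)
      = ∫ x, max (s * outerNormal ρ x i) 0 * f x ∂(surfaceMeasure Ω) := by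
    intro i s
    rw [flux, integral_withDensity_eq_integral_toReal_smul (hΩ.measurable_flux_density i s)
      (Eventually.of_forall fun x => ENNReal.ofReal_lt_top)]
    refine integral_congr_ae (Eventually.of_forall fun x => ?_)
    simp only [smul_eq_mul, ENNReal.toReal_ofReal']
  have hcoord : ∀ i, ∫ x in Ω, fderiv ℝ f x (EuclideanSpace.single i 1)
      = ∫ x, f x * outerNormal ρ x i ∂(surfaceMeasure Ω) := by
    intro i
    rw [hΩ.integral_fderiv_single i hf, hflux, hflux, ← integral_sub]
    · refine integral_congr_ae (Eventually.of_forall fun x => ?_)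
      simp only [one_mul, neg_one_mul]
      rcases le_total 0 (outerNormal ρ x i) with h | h
      · rw [max_eq_left h, max_eq_right (by linarith)]; ring
      · rw [max_eq_right h, max_eq_left (by linarith)]; ring
    all_goals
      refine Integrable.mono' (hint i).norm ?_ (Eventually.of_forall fun x => ?_)
      · exact ((((hΩ.measurable_outerNormal_apply i).const_mul _).max measurable_const).mul
          hf.continuous.measurable).aestronglyMeasurable
      · rw [norm_mul, norm_mul, mul_comm]
        gcongr
        rw [Real.norm_eq_abs, Real.norm_eq_abs, abs_of_nonneg (le_max_right _ _)]
        refine max_le ?_ (abs_nonneg _)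
        first
          | (rw [one_mul]; exact le_abs_self _)
          | (rw [neg_one_mul]; exact neg_le_abs _)
  have hv : ∀ x, fderiv ℝ f x v = ∑ i, v i * fderiv ℝ f x (EuclideanSpace.single i 1) := by
    intro x
    have e : v = ∑ i, v i • EuclideanSpace.single i (1 : ℝ) := by
      have := (EuclideanSpace.basisFun (Fin 3) ℝ).sum_repr v
      simpa using this.symm
    conv_lhs => rw [e]
    simp [map_sum]
  have hvn : ∀ x, f x * inner ℝ (outerNormal ρ x) v
      = ∑ i, v i * (f x * outerNormal ρ x i) := by
    intro x
    rw [PiLp.inner_apply, Finset.mul_sum]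
    refine Finset.sum_congr rfl fun i _ => ?_
    simp only [RCLike.inner_apply, conj_trivial]
    ring
  simp_rw [hv, hvn]
  rw [integral_finsetSum, integral_finsetSum]
  · refine Finset.sum_congr rfl fun i _ => ?_
    rw [integral_const_mul, integral_const_mul, hcoord]
  · exact fun i _ => (hint i).const_mul _
  · intro i _
    refine Integrable.const_mul ?_ _
    have hgc : Continuous fun x => fderiv ℝ f x (EuclideanSpace.single i 1) :=
      (hf.continuous_fderiv (by simp)).clm_apply continuous_const
    exact (hgc.continuousOn.integrableOn_compact hΩ.isCompact_closure).mono_set subset_closure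

end IsSmoothConvexDomain

end Divergence

/-! ### Backward transport by Duhamel's formula. -/

section Duhamel

variable {G : Type*} [NormedAddCommGroup G] [NormedSpace ℝ G]
  {b : G → G} {Z : ℝ → G → G} {K : ℝ≥0}

/-- The orbit and its tangent line differ by `o(s)`, and a Lipschitz function does not see this.
Hence the derivative along the orbit is a directional derivative, as needed for mollification. -/
lemma IsFlow.hasLineDerivAt (hZ : IsFlow b Z) {φ : G → ℝ} {C : ℝ≥0} (hφ : LipschitzWith C φ)
    {p : G} {d : ℝ} (h : HasDerivAt (fun s => φ (Z s p)) d 0) :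
    HasLineDerivAt ℝ φ d p (b p) := by
  rw [HasLineDerivAt]
  have h1 := hasDerivAt_iff_isLittleO_nhds_zero.1 h
  have h2 := hasDerivAt_iff_isLittleO_nhds_zero.1 (hZ.deriv 0 p)
  rw [hasDerivAt_iff_isLittleO_nhds_zero]
  simp only [zero_add, hZ.zero, zero_smul, add_zero] at h1 h2 ⊢
  have h3 : (fun s : ℝ => φ (p + s • b p) - φ (Z s p)) =o[𝓝 0] fun s => s := by
    refine Asymptotics.IsBigO.trans_isLittleO (g := fun s : ℝ => Z s p - p - s • b p) ?_ h2
    refine Asymptotics.IsBigO.of_bound C (Eventually.of_forall fun s => ?_)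
    have := hφ.dist_le_mul (p + s • b p) (Z s p)
    rw [dist_eq_norm, dist_comm, dist_eq_norm] at this
    rwa [sub_sub]
  refine (h1.add h3).congr_left fun s => ?_
  ring

/-- The attenuation factor along the orbit of `p` up to time `s`. -/
def attenuation (Z : ℝ → G → G) (q : G → ℝ) (s : ℝ) (p : G) : ℝ :=
  Real.exp (-∫ r in (0 : ℝ)..s, q (Z r p))

/-- The solution of the backward transport equation with absorption `q` and source `ψ`. -/
def duhamel (Z : ℝ → G → G) (q ψ : G → ℝ) (T : ℝ) (p : G) : ℝ :=
  ∫ s in (0 : ℝ)..T, ψ (Z s p) * attenuation Z q s p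

set_option linter.unusedSectionVars false in
lemma attenuation_nonneg (q : G → ℝ) (s : ℝ) (p : G) : 0 ≤ attenuation Z q s p :=
  (Real.exp_pos _).le

set_option linter.unusedSectionVars false in
lemma attenuation_le_one {q : G → ℝ} (hq : ∀ p, 0 ≤ q p) {s : ℝ} (hs : 0 ≤ s) (p : G) :
    attenuation Z q s p ≤ 1 := by
  rw [attenuation, Real.exp_le_one_iff, neg_nonpos]
  exact intervalIntegral.integral_nonneg hs fun r _ => hq _

lemma continuous_attenuation (hZ : IsFlow b Z) (hb : LipschitzWith K b) {q : G → ℝ}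
    (hq : Continuous q) : Continuous fun x : ℝ × G => attenuation Z q x.1 x.2 := by
  have hZc := hZ.continuous_uncurry hb
  refine Real.continuous_exp.comp (Continuous.neg ?_)
  have : Continuous (Function.uncurry fun (x : ℝ × G) (r : ℝ) => q (Z r x.2)) :=
    hq.comp (hZc.comp (continuous_snd.prodMk (continuous_snd.comp continuous_fst)))
  exact intervalIntegral.continuous_parametric_intervalIntegral_of_continuous this continuous_fst

lemma abs_exp_neg_sub_le {a c : ℝ} (ha : 0 ≤ a) (hc : 0 ≤ c) :
    |Real.exp (-a) - Real.exp (-c)| ≤ |a - c| := by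
  wlog h : a ≤ c generalizing a c
  · rw [abs_sub_comm, abs_sub_comm a c]
    exact this hc ha (le_of_not_ge h)
  rw [abs_of_nonneg (sub_nonneg.2 (Real.exp_le_exp.2 (neg_le_neg h))), abs_of_nonpos (by linarith)]
  have h1 : Real.exp (-a) * (1 - Real.exp (-(c - a))) = Real.exp (-a) - Real.exp (-c) := by
    rw [mul_sub, mul_one, ← Real.exp_add]
    congr 2
    ring
  rw [← h1]
  have h2 : Real.exp (-a) ≤ 1 := Real.exp_le_one_iff.2 (by linarith)
  have h3 : 1 - Real.exp (-(c - a)) ≤ c - a := by linarith [Real.add_one_le_exp (-(c - a))]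
  have h4 : 0 ≤ 1 - Real.exp (-(c - a)) := by
    linarith [Real.exp_le_one_iff.2 (show -(c - a) ≤ 0 by linarith)]
  nlinarith [Real.exp_pos (-a)]

lemma attenuation_sub_le (hZ : IsFlow b Z) (hb : LipschitzWith K b) {q : G → ℝ} {C : ℝ≥0}
    (hq : LipschitzWith C q) (hq0 : ∀ p, 0 ≤ q p) {T s : ℝ} (hs : s ∈ Icc 0 T) (p p' : G) :
    |attenuation Z q s p - attenuation Z q s p'| ≤ T * (C * (Real.exp (K * T) * dist p p')) := by
  have hint : ∀ p, IntervalIntegrable (fun r => q (Z r p)) volume 0 s := fun p =>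
    (hq.continuous.comp (hZ.continuous_time p)).intervalIntegrable 0 s
  refine (abs_exp_neg_sub_le (intervalIntegral.integral_nonneg hs.1 fun r _ => hq0 _)
    (intervalIntegral.integral_nonneg hs.1 fun r _ => hq0 _)).trans ?_
  rw [← intervalIntegral.integral_sub (hint p) (hint p')]
  have h1 := intervalIntegral.norm_integral_le_of_norm_le_const
    (f := fun r => q (Z r p) - q (Z r p')) (a := 0) (b := s)
    (C := C * (Real.exp (K * T) * dist p p')) fun r hr => by
      rw [uIoc_of_le hs.1] at hr
      have h2 := hq.dist_le_mul (Z r p) (Z r p')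
      rw [dist_eq_norm] at h2
      refine h2.trans ?_
      gcongr
      refine (hZ.dist_le hb r p p').trans ?_
      have : |r| ≤ T := by rw [abs_of_pos hr.1]; exact hr.2.trans hs.2
      gcongr
  rw [Real.norm_eq_abs, sub_zero, abs_of_nonneg hs.1] at h1
  refine h1.trans ?_
  rw [mul_comm]
  gcongr
  exact hs.2

lemma continuous_duhamel_integrand (hZ : IsFlow b Z) (hb : LipschitzWith K b) {q ψ : G → ℝ}
    (hq : Continuous q) (hψ : Continuous ψ) :
    Continuous fun x : ℝ × G => ψ (Z x.1 x.2) * attenuation Z q x.1 x.2 :=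
  (hψ.comp (hZ.continuous_uncurry hb)).mul (continuous_attenuation hZ hb hq)

lemma intervalIntegrable_duhamel (hZ : IsFlow b Z) (hb : LipschitzWith K b) {q ψ : G → ℝ}
    (hq : Continuous q) (hψ : Continuous ψ) (p : G) (a c : ℝ) :
    IntervalIntegrable (fun s => ψ (Z s p) * attenuation Z q s p) volume a c :=
  ((continuous_duhamel_integrand hZ hb hq hψ).comp
    (Continuous.prodMk_left p)).intervalIntegrable a c

/-- Lipschitz dependence is all that a Lipschitz flow provides; it is the regularity class of the
test functions used below. -/
lemma lipschitzWith_duhamel (hZ : IsFlow b Z) (hb : LipschitzWith K b) {q ψ : G → ℝ} {C C' : ℝ≥0}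
    (hq : LipschitzWith C q) (hq0 : ∀ p, 0 ≤ q p) (hψ : LipschitzWith C' ψ) {M : ℝ}
    (hM : ∀ p, |ψ p| ≤ M) {T : ℝ} (hT : 0 ≤ T) : ∃ L : ℝ≥0, LipschitzWith L (duhamel Z q ψ T) := by
  have hM0 : 0 ≤ M := (abs_nonneg _).trans (hM 0)
  set L : ℝ := (C' * Real.exp (K * T) + M * (T * (C * Real.exp (K * T)))) * T with hL
  have hL0 : 0 ≤ L := by positivity
  refine ⟨⟨L, hL0⟩, LipschitzWith.of_dist_le_mul fun p p' => ?_⟩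
  rw [Real.dist_eq, duhamel, duhamel, ← intervalIntegral.integral_sub
    (intervalIntegrable_duhamel hZ hb hq.continuous hψ.continuous p 0 T)
    (intervalIntegrable_duhamel hZ hb hq.continuous hψ.continuous p' 0 T)]
  have h1 := intervalIntegral.norm_integral_le_of_norm_le_const
    (f := fun s => ψ (Z s p) * attenuation Z q s p - ψ (Z s p') * attenuation Z q s p')
    (a := 0) (b := T)
    (C := (C' * Real.exp (K * T) + M * (T * (C * Real.exp (K * T)))) * dist p p') fun s hs => by
      rw [uIoc_of_le hT] at hs
      have e : ψ (Z s p) * attenuation Z q s p - ψ (Z s p') * attenuation Z q s p'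
          = (ψ (Z s p) - ψ (Z s p')) * attenuation Z q s p
            + ψ (Z s p') * (attenuation Z q s p - attenuation Z q s p') := by ring
      rw [e]
      refine (norm_add_le _ _).trans ?_
      rw [norm_mul, norm_mul, add_mul]
      refine add_le_add ?_ ?_
      · have h2 : ‖ψ (Z s p) - ψ (Z s p')‖ ≤ C' * (Real.exp (K * T) * dist p p') := by
          rw [← dist_eq_norm]
          refine (hψ.dist_le_mul _ _).trans ?_
          gcongr
          refine (hZ.dist_le hb s p p').trans ?_
          have : |s| ≤ T := by rw [abs_of_pos hs.1]; exact hs.2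
          gcongr
        have h3 : ‖attenuation Z q s p‖ ≤ 1 := by
          rw [Real.norm_eq_abs, abs_of_nonneg (attenuation_nonneg q s p)]
          exact attenuation_le_one hq0 hs.1.le p
        calc _ ≤ (C' * (Real.exp (K * T) * dist p p')) * 1 := by gcongr
          _ = _ := by ring
      · have h4 := attenuation_sub_le hZ hb hq hq0 ⟨hs.1.le, hs.2⟩ p p'
        rw [← Real.norm_eq_abs] at h4
        have h5 : ‖ψ (Z s p')‖ ≤ M := hM _
        calc _ ≤ M * (T * (C * (Real.exp (K * T) * dist p p'))) := by gcongr
          _ = _ := by ring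
  rw [sub_zero, abs_of_nonneg hT] at h1
  change _ ≤ L * dist p p'
  rw [hL]
  rw [← Real.norm_eq_abs]
  linarith

lemma hasCompactSupport_duhamel (hZ : IsFlow b Z) (hb : LipschitzWith K b) {q ψ : G → ℝ}
    (hψ : HasCompactSupport ψ) {T : ℝ} (hT : 0 ≤ T) : HasCompactSupport (duhamel Z q ψ T) := by
  have hS : IsCompact ((fun x : ℝ × G => Z (-x.1) x.2) '' (Icc 0 T ×ˢ tsupport ψ)) :=
    (isCompact_Icc.prod hψ).image
      ((hZ.continuous_uncurry hb).comp (continuous_fst.neg.prodMk continuous_snd))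
  refine HasCompactSupport.intro hS fun p hp => ?_
  rw [duhamel, intervalIntegral.integral_congr (g := fun _ => (0 : ℝ))]
  · simp
  · intro s hs
    rw [uIcc_of_le hT] at hs
    have : ψ (Z s p) = 0 := by
      by_contra hne
      exact hp ⟨(s, Z s p), ⟨hs, subset_tsupport _ hne⟩, hZ.neg_apply hb s p⟩
    simp [this]

/-- With `Q` and `A` the primitives along the orbit of `p`, the value at `Z h p` is `exp (Q h) (A (T
+ h) - A h)`. Differentiation at `h = 0` gives absorption, minus the source, and an end term from
the cut-off at time `T`. -/
lemma hasLineDerivAt_duhamel (hZ : IsFlow b Z) (hb : LipschitzWith K b) {q ψ : G → ℝ} {C C' : ℝ≥0}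
    (hq : LipschitzWith C q) (hq0 : ∀ p, 0 ≤ q p) (hψ : LipschitzWith C' ψ) {M : ℝ}
    (hM : ∀ p, |ψ p| ≤ M) {T : ℝ} (hT : 0 ≤ T) (p : G) :
    HasLineDerivAt ℝ (duhamel Z q ψ T)
      (q p * duhamel Z q ψ T p - ψ p + ψ (Z T p) * attenuation Z q T p) p (b p) := by
  obtain ⟨L, hL⟩ := lipschitzWith_duhamel hZ hb hq hq0 hψ hM hT
  refine hZ.hasLineDerivAt hL ?_
  set Q : ℝ → ℝ := fun u => ∫ r in (0 : ℝ)..u, q (Z r p) with hQ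
  have hqc : Continuous fun r => q (Z r p) := hq.continuous.comp (hZ.continuous_time p)
  have hQd : ∀ u, HasDerivAt Q (q (Z u p)) u := fun u =>
    intervalIntegral.integral_hasDerivAt_right (hqc.intervalIntegrable 0 u)
      hqc.aestronglyMeasurable.stronglyMeasurableAtFilter hqc.continuousAt
  set g : ℝ → ℝ := fun s => ψ (Z s p) * Real.exp (-Q s) with hg
  have hgc : Continuous g := by
    have h1 : Continuous Q := continuous_iff_continuousAt.2 fun u => (hQd u).continuousAt
    have h2 : Continuous fun s => ψ (Z s p) := hψ.continuous.comp (hZ.continuous_time p)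
    exact h2.mul (Real.continuous_exp.comp h1.neg)
  set A : ℝ → ℝ := fun u => ∫ s in (0 : ℝ)..u, g s with hA
  have hAd : ∀ u, HasDerivAt A (g u) u := fun u =>
    intervalIntegral.integral_hasDerivAt_right (hgc.intervalIntegrable 0 u)
      hgc.aestronglyMeasurable.stronglyMeasurableAtFilter hgc.continuousAt
  have hform : ∀ h, duhamel Z q ψ T (Z h p) = Real.exp (Q h) * (A (T + h) - A h) := by
    intro h
    have e1 : ∀ s, attenuation Z q s (Z h p) = Real.exp (Q h) * Real.exp (-Q (s + h)) := by
      intro s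
      have e : ∫ r in (0 : ℝ)..s, q (Z r (Z h p)) = Q (s + h) - Q h := by
        simp_rw [← hZ.add hb]
        rw [intervalIntegral.integral_comp_add_right (fun r => q (Z r p)) h, zero_add]
        exact (intervalIntegral.integral_interval_sub_left (hqc.intervalIntegrable _ _)
          (hqc.intervalIntegrable _ _)).symm
      rw [attenuation, e, ← Real.exp_add]
      congr 1
      ring
    have e2 : ∀ s, ψ (Z s (Z h p)) * attenuation Z q s (Z h p) = Real.exp (Q h) * g (s + h) := by
      intro s
      rw [e1, ← hZ.add hb, hg]
      ring
    rw [duhamel]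
    simp_rw [e2]
    rw [intervalIntegral.integral_const_mul,
      intervalIntegral.integral_comp_add_right g h, zero_add]
    congr 1
    exact (intervalIntegral.integral_interval_sub_left (hgc.intervalIntegrable _ _)
      (hgc.intervalIntegrable _ _)).symm
  have hA0 : A 0 = 0 := by simp [hA]
  have hQ0 : Q 0 = 0 := by simp [hQ]
  have hφp : duhamel Z q ψ T p = A T := by
    have := hform 0
    rw [hZ.zero, hQ0, hA0, add_zero, Real.exp_zero] at this
    linarith
  have hd : HasDerivAt (fun h => Real.exp (Q h) * (A (T + h) - A h))
      (Real.exp (Q 0) * q (Z 0 p) * (A (T + 0) - A 0) + Real.exp (Q 0) * (g (T + 0) - g 0)) 0 :=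
    ((hQd 0).exp).mul ((HasDerivAt.comp_const_add T 0 (hAd (T + 0))).sub (hAd 0))
  rw [show (fun s => duhamel Z q ψ T (Z s p))
    = fun h => Real.exp (Q h) * (A (T + h) - A h) from funext hform]
  refine hd.congr_deriv ?_
  rw [hQ0, hA0, hφp, add_zero, hZ.zero, Real.exp_zero]
  simp only [hg, hZ.zero, attenuation, hQ, intervalIntegral.integral_same, neg_zero,
    Real.exp_zero]
  ring

lemma continuous_duhamel_deriv (hZ : IsFlow b Z) (hb : LipschitzWith K b) {q ψ : G → ℝ}
    (hq : Continuous q) (hψ : Continuous ψ) (T : ℝ) :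
    Continuous fun p => q p * duhamel Z q ψ T p - ψ p + ψ (Z T p) * attenuation Z q T p := by
  have h1 : Continuous (duhamel Z q ψ T) :=
    intervalIntegral.continuous_parametric_intervalIntegral_of_continuous'
      (f := fun p s => ψ (Z s p) * attenuation Z q s p)
      ((continuous_duhamel_integrand hZ hb hq hψ).comp continuous_swap) 0 T
  have h2 := (continuous_duhamel_integrand hZ hb hq hψ).comp (Continuous.prodMk_right T)
  exact ((hq.mul h1).sub hψ).add h2

end Duhamel

/-! ### Bounded convergence on compact supports. -/

section Limits

variable {G : Type*} [MeasurableSpace G]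

/-- Bounded convergence for functions supported in a common compact set. -/
lemma tendsto_integral_of_bounded_support {ν : Measure G} {S : Set G} (hS : MeasurableSet S)
    (hνS : ν S ≠ ⊤) {f : ℕ → G → ℝ} {F : G → ℝ} {M : ℝ}
    (hf : ∀ n, AEStronglyMeasurable (f n) ν)
    (hM : ∀ n p, |f n p| ≤ M) (hs : ∀ n p, p ∉ S → f n p = 0)
    (hlim : ∀ᵐ p ∂ν, Tendsto (fun n => f n p) atTop (𝓝 (F p))) :
    Tendsto (fun n => ∫ p, f n p ∂ν) atTop (𝓝 (∫ p, F p ∂ν)) := by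
  refine tendsto_integral_of_dominated_convergence (S.indicator fun _ => M) hf ?_ ?_ hlim
  · exact (integrable_indicator_iff hS).2 (integrableOn_const hνS)
  · intro n
    refine Eventually.of_forall fun p => ?_
    by_cases hp : p ∈ S
    · rw [indicator_of_mem hp]; exact hM n p
    · rw [indicator_of_notMem hp, hs n p hp, norm_zero]

end Limits

/-! ### Green's formula in phase space. -/

section Green

variable {Ω : Set R3} {ρ : R3 → ℝ}

namespace IsSmoothConvexDomain

lemma measurable_inner_outerNormal (hΩ : IsSmoothConvexDomain Ω ρ) :
    Measurable fun z : R3 × R3 => inner ℝ (outerNormal ρ z.1) z.2 :=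
  (hΩ.measurable_outerNormal.comp measurable_fst).inner measurable_snd

lemma measurableSet_gammaPlus (hΩ : IsSmoothConvexDomain Ω ρ) : MeasurableSet (GammaPlus Ω ρ) :=
  (measurable_fst isClosed_frontier.measurableSet).inter
    (measurableSet_lt measurable_const hΩ.measurable_inner_outerNormal)

lemma measurableSet_gammaMinus (hΩ : IsSmoothConvexDomain Ω ρ) : MeasurableSet (GammaMinus Ω ρ) :=
  (measurable_fst isClosed_frontier.measurableSet).inter
    (measurableSet_lt hΩ.measurable_inner_outerNormal measurable_const)

lemma ae_fst_mem_frontier (hΩ : IsSmoothConvexDomain Ω ρ) :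
    ∀ᵐ z ∂((surfaceMeasure Ω).prod (volume : Measure R3)), z.1 ∈ frontier Ω := by
  have := hΩ.isFiniteMeasure_surfaceMeasure
  exact Measure.quasiMeasurePreserving_fst.ae
    (ae_restrict_mem isClosed_frontier.measurableSet)

lemma sigmaPlus_eq (hΩ : IsSmoothConvexDomain Ω ρ) : sigmaPlus Ω ρ =
    ((surfaceMeasure Ω).prod volume).withDensity
      fun z => ENNReal.ofReal (inner ℝ (outerNormal ρ z.1) z.2) := by
  rw [sigmaPlus, sigma, restrict_withDensity hΩ.measurableSet_gammaPlus,
    ← withDensity_indicator hΩ.measurableSet_gammaPlus]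
  refine withDensity_congr_ae ?_
  filter_upwards [hΩ.ae_fst_mem_frontier] with z hz
  by_cases h : 0 < inner ℝ (outerNormal ρ z.1) z.2
  · rw [indicator_of_mem (show z ∈ GammaPlus Ω ρ from ⟨hz, h⟩), abs_of_pos h]
  · rw [indicator_of_notMem (fun h' : z ∈ GammaPlus Ω ρ => h h'.2),
      ENNReal.ofReal_of_nonpos (not_lt.1 h)]

lemma sigmaMinus_eq (hΩ : IsSmoothConvexDomain Ω ρ) : sigmaMinus Ω ρ =
    ((surfaceMeasure Ω).prod volume).withDensity
      fun z => ENNReal.ofReal (-inner ℝ (outerNormal ρ z.1) z.2) := by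
  rw [sigmaMinus, sigma, restrict_withDensity hΩ.measurableSet_gammaMinus,
    ← withDensity_indicator hΩ.measurableSet_gammaMinus]
  refine withDensity_congr_ae ?_
  filter_upwards [hΩ.ae_fst_mem_frontier] with z hz
  by_cases h : inner ℝ (outerNormal ρ z.1) z.2 < 0
  · rw [indicator_of_mem (show z ∈ GammaMinus Ω ρ from ⟨hz, h⟩), abs_of_neg h]
  · rw [indicator_of_notMem (fun h' : z ∈ GammaMinus Ω ρ => h h'.2),
      ENNReal.ofReal_of_nonpos (by linarith [not_lt.1 h])]

instance instSFiniteSurface (Ω : Set R3) (ρ : R3 → ℝ) [SFinite (surfaceMeasure Ω)] :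
    SFinite (sigma Ω ρ) := by
  unfold sigma; infer_instance

lemma sFinite_sigmaPlus (hΩ : IsSmoothConvexDomain Ω ρ) : SFinite (sigmaPlus Ω ρ) := by
  have := hΩ.isFiniteMeasure_surfaceMeasure
  unfold sigmaPlus; infer_instance

lemma sFinite_sigmaMinus (hΩ : IsSmoothConvexDomain Ω ρ) : SFinite (sigmaMinus Ω ρ) := by
  have := hΩ.isFiniteMeasure_surfaceMeasure
  unfold sigmaMinus; infer_instance

lemma isFiniteMeasureOnCompacts_prod (hΩ : IsSmoothConvexDomain Ω ρ) :
    IsFiniteMeasureOnCompacts ((surfaceMeasure Ω).prod (volume : Measure R3)) := by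
  have := hΩ.isFiniteMeasure_surfaceMeasure
  infer_instance

lemma isFiniteMeasureOnCompacts_sigma (hΩ : IsSmoothConvexDomain Ω ρ) :
    IsFiniteMeasureOnCompacts (sigma Ω ρ) := by
  have := hΩ.isFiniteMeasureOnCompacts_prod
  constructor
  intro S hS
  obtain ⟨M, hM⟩ := hS.exists_bound_of_continuousOn (f := fun z : R3 × R3 => z.2)
    continuous_snd.continuousOn
  rw [sigma, withDensity_apply _ hS.measurableSet]
  calc _ ≤ ∫⁻ z in S, ENNReal.ofReal M ∂((surfaceMeasure Ω).prod volume) := by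
        refine lintegral_mono_ae ?_
        filter_upwards [ae_restrict_mem hS.measurableSet,
          ae_restrict_of_ae hΩ.ae_fst_mem_frontier] with z hz hzf
        refine ENNReal.ofReal_le_ofReal ((abs_real_inner_le_norm _ _).trans ?_)
        rw [hΩ.norm_outerNormal hzf, one_mul]
        exact hM z hz
    _ < ⊤ := by
        rw [setLIntegral_const]
        exact ENNReal.mul_lt_top ENNReal.ofReal_lt_top hS.measure_lt_top

lemma isFiniteMeasureOnCompacts_sigmaPlus (hΩ : IsSmoothConvexDomain Ω ρ) :
    IsFiniteMeasureOnCompacts (sigmaPlus Ω ρ) := by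
  have := hΩ.isFiniteMeasureOnCompacts_sigma
  unfold sigmaPlus; infer_instance

lemma isFiniteMeasureOnCompacts_sigmaMinus (hΩ : IsSmoothConvexDomain Ω ρ) :
    IsFiniteMeasureOnCompacts (sigmaMinus Ω ρ) := by
  have := hΩ.isFiniteMeasureOnCompacts_sigma
  unfold sigmaMinus; infer_instance

lemma integral_sigmaPlus_sub_sigmaMinus (hΩ : IsSmoothConvexDomain Ω ρ) {φ : R3 × R3 → ℝ}
    (hφ : Continuous φ) (hs : HasCompactSupport φ) :
    ∫ z, φ z ∂(sigmaPlus Ω ρ) - ∫ z, φ z ∂(sigmaMinus Ω ρ)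
      = ∫ z, φ z * inner ℝ (outerNormal ρ z.1) z.2 ∂((surfaceMeasure Ω).prod volume) := by
  have := hΩ.isFiniteMeasureOnCompacts_sigmaPlus
  have := hΩ.isFiniteMeasureOnCompacts_sigmaMinus
  have i1 : Integrable φ (sigmaPlus Ω ρ) := hφ.integrable_of_hasCompactSupport hs
  have i2 : Integrable φ (sigmaMinus Ω ρ) := hφ.integrable_of_hasCompactSupport hs
  have hm := hΩ.measurable_inner_outerNormal
  have hm' : Measurable fun z : R3 × R3 => -inner ℝ (outerNormal ρ z.1) z.2 := hm.neg
  rw [hΩ.sigmaPlus_eq] at i1 ⊢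
  rw [hΩ.sigmaMinus_eq] at i2 ⊢
  rw [integrable_withDensity_iff_integrable_smul' hm.ennreal_ofReal
    (Eventually.of_forall fun _ => ENNReal.ofReal_lt_top)] at i1
  rw [integrable_withDensity_iff_integrable_smul' hm'.ennreal_ofReal
    (Eventually.of_forall fun _ => ENNReal.ofReal_lt_top)] at i2
  rw [integral_withDensity_eq_integral_toReal_smul hm.ennreal_ofReal
      (Eventually.of_forall fun _ => ENNReal.ofReal_lt_top),
    integral_withDensity_eq_integral_toReal_smul hm'.ennreal_ofReal
      (Eventually.of_forall fun _ => ENNReal.ofReal_lt_top), ← integral_sub i1 i2]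
  refine integral_congr_ae (Eventually.of_forall fun z => ?_)
  simp only [smul_eq_mul, ENNReal.toReal_ofReal']
  rcases le_total 0 (inner ℝ (outerNormal ρ z.1) z.2) with h | h
  · rw [max_eq_left h, max_eq_right (by linarith)]; ring
  · rw [max_eq_right h, max_eq_left (by linarith)]; ring

lemma phase_univ_eq (Ω : Set R3) :
    phase Ω univ = (volume.restrict Ω).prod (volume : Measure R3) := by
  rw [phase, Measure.volume_eq_prod, ← Measure.prod_restrict, Measure.restrict_univ]

end IsSmoothConvexDomain

lemma integral_fderiv_eq_zero {f : R3 → ℝ} (hf : ContDiff ℝ 1 f) (hs : HasCompactSupport f)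
    (v : R3) : ∫ x, fderiv ℝ f x v = 0 := by
  have h1 : Continuous fun x => fderiv ℝ f x v :=
    (hf.continuous_fderiv (by simp)).clm_apply continuous_const
  have h2 : HasCompactSupport fun x => fderiv ℝ f x v := hs.fderiv_apply ℝ v
  have := integral_mul_fderiv_eq_neg_fderiv_mul_of_integrable (μ := (volume : Measure R3))
    (f := fun _ => (1 : ℝ)) (g := f) (v := v) (by simp)
    (by simpa using h1.integrable_of_hasCompactSupport h2)
    (by simpa using hf.continuous.integrable_of_hasCompactSupport hs)
    (fun _ _ => differentiableAt_const _) (fun x _ => hf.differentiable (by simp) x)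
  simpa using this

section C1

variable {B : R3 → R3} {φ : R3 × R3 → ℝ}

lemma hasCompactSupport_slice_left (hs : HasCompactSupport φ) (v : R3) :
    HasCompactSupport fun x => φ (x, v) :=
  HasCompactSupport.intro (hs.isCompact.image continuous_fst) fun x hx => by
    by_contra hne
    exact hx ⟨(x, v), subset_tsupport _ hne, rfl⟩

lemma hasCompactSupport_slice_right (hs : HasCompactSupport φ) (x : R3) :
    HasCompactSupport fun v => φ (x, v) :=
  HasCompactSupport.intro (hs.isCompact.image continuous_snd) fun v hv => by
    by_contra hne
    exact hv ⟨(x, v), subset_tsupport _ hne, rfl⟩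

lemma fderiv_slice_left (hφ : ContDiff ℝ 1 φ) (x v e : R3) :
    fderiv ℝ (fun x => φ (x, v)) x e = fderiv ℝ φ (x, v) (e, 0) := by
  have h := ((hφ.differentiable (by simp) (x, v)).hasFDerivAt).comp x
    (hasFDerivAt_prodMk_left (𝕜 := ℝ) x v)
  have h' : HasFDerivAt (fun x => φ (x, v)) _ x := h
  rw [h'.fderiv]
  simp

lemma fderiv_slice_right (hφ : ContDiff ℝ 1 φ) (x v e : R3) :
    fderiv ℝ (fun v => φ (x, v)) v e = fderiv ℝ φ (x, v) (0, e) := by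
  have h := ((hφ.differentiable (by simp) (x, v)).hasFDerivAt).comp v
    (hasFDerivAt_prodMk_right (𝕜 := ℝ) x v)
  have h' : HasFDerivAt (fun v => φ (x, v)) _ v := h
  rw [h'.fderiv]
  simp

lemma contDiff_slice_left (hφ : ContDiff ℝ 1 φ) (v : R3) : ContDiff ℝ 1 fun x => φ (x, v) :=
  hφ.comp (contDiff_id.prodMk contDiff_const)

lemma contDiff_slice_right (hφ : ContDiff ℝ 1 φ) (x : R3) : ContDiff ℝ 1 fun v => φ (x, v) :=
  hφ.comp (contDiff_const.prodMk contDiff_id)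

lemma continuous_fderiv_apply_field (hφ : ContDiff ℝ 1 φ) {c : R3 × R3 → R3 × R3}
    (hc : Continuous c) : Continuous fun z => fderiv ℝ φ z (c z) :=
  (hφ.continuous_fderiv (by simp)).clm_apply hc

lemma hasCompactSupport_fderiv_apply_field (hs : HasCompactSupport φ) (c : R3 × R3 → R3 × R3) :
    HasCompactSupport fun z => fderiv ℝ φ z (c z) :=
  (hs.fderiv ℝ).mono fun z hz => by
    intro h
    exact hz (by simp only [h]; rfl)

/-- Green's formula on `Ω × ℝ³` for continuously differentiable functions. -/
lemma integral_fderiv_field (hΩ : IsSmoothConvexDomain Ω ρ) (hB : Continuous B)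
    (hφ : ContDiff ℝ 1 φ) (hs : HasCompactSupport φ) :
    ∫ z, fderiv ℝ φ z (field B z) ∂(phase Ω univ)
      = ∫ z, φ z ∂(sigmaPlus Ω ρ) - ∫ z, φ z ∂(sigmaMinus Ω ρ) := by
  have := hΩ.isFiniteMeasure_surfaceMeasure
  have := hΩ.isFiniteMeasureOnCompacts_prod
  rw [hΩ.integral_sigmaPlus_sub_sigmaMinus hφ.continuous hs, IsSmoothConvexDomain.phase_univ_eq]
  have hc1 : Continuous fun z : R3 × R3 => ((z.2, 0) : R3 × R3) :=
    continuous_snd.prodMk continuous_const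
  have hc2 : Continuous fun z : R3 × R3 => ((0, B z.1) : R3 × R3) :=
    continuous_const.prodMk (hB.comp continuous_fst)
  have i1 : Integrable (fun z : R3 × R3 => fderiv ℝ φ z (z.2, 0))
      ((volume.restrict Ω).prod volume) :=
    (continuous_fderiv_apply_field hφ hc1).integrable_of_hasCompactSupport
      (hasCompactSupport_fderiv_apply_field hs _)
  have i2 : Integrable (fun z : R3 × R3 => fderiv ℝ φ z (0, B z.1))
      ((volume.restrict Ω).prod volume) :=
    (continuous_fderiv_apply_field hφ hc2).integrable_of_hasCompactSupport
      (hasCompactSupport_fderiv_apply_field hs _)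
  have hsplit : ∀ z : R3 × R3, fderiv ℝ φ z (field B z)
      = fderiv ℝ φ z (z.2, 0) + fderiv ℝ φ z (0, B z.1) := by
    intro z
    rw [← map_add]
    simp [field]
  simp_rw [hsplit]
  rw [integral_add i1 i2]
  -- The force does not depend on `v`, so this term is a derivative in `v` of a compactly supported
  -- function. The remaining term is the divergence theorem in `x` for each fixed `v`.
  have z2 : ∫ z : R3 × R3, fderiv ℝ φ z (0, B z.1) ∂((volume.restrict Ω).prod volume) = 0 := by
    rw [integral_prod _ i2]
    simp only
    have : ∀ x, ∫ v, fderiv ℝ φ (x, v) (0, B x) = 0 := by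
      intro x
      simp_rw [← fderiv_slice_right hφ]
      exact integral_fderiv_eq_zero (contDiff_slice_right hφ x)
        (hasCompactSupport_slice_right hs x) (B x)
    simp [this]
  rw [z2, add_zero, integral_prod_symm _ i1, integral_prod_symm]
  · refine integral_congr_ae (Eventually.of_forall fun v => ?_)
    simp only
    simp_rw [← fderiv_slice_left hφ]
    exact hΩ.integral_fderiv_eq (contDiff_slice_left hφ v) v
  · obtain ⟨M, hM⟩ := hs.isCompact.exists_bound_of_continuousOn (f := fun z : R3 × R3 => z.2)
      continuous_snd.continuousOn
    have hi : Integrable φ ((surfaceMeasure Ω).prod volume) :=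
      hφ.continuous.integrable_of_hasCompactSupport hs
    refine Integrable.mono' (hi.norm.mul_const |M|)
      (hφ.continuous.measurable.mul hΩ.measurable_inner_outerNormal).aestronglyMeasurable ?_
    filter_upwards [hΩ.ae_fst_mem_frontier] with z hz
    rw [norm_mul]
    by_cases h : z ∈ tsupport φ
    · gcongr
      refine (norm_inner_le_norm _ _).trans ?_
      rw [hΩ.norm_outerNormal hz, one_mul]
      exact (hM z h).trans (le_abs_self _)
    · rw [image_eq_zero_of_notMem_tsupport h]; simp

/-- The field `(v, B(x))` is divergence free: each component differentiates only in the variable on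
which its coefficient does not depend. No derivative of `B` enters. -/
lemma integral_fderiv_field_univ (hB : Continuous B) (hφ : ContDiff ℝ 1 φ)
    (hs : HasCompactSupport φ) : ∫ z, fderiv ℝ φ z (field B z) = 0 := by
  have hc1 : Continuous fun z : R3 × R3 => ((z.2, 0) : R3 × R3) :=
    continuous_snd.prodMk continuous_const
  have hc2 : Continuous fun z : R3 × R3 => ((0, B z.1) : R3 × R3) :=
    continuous_const.prodMk (hB.comp continuous_fst)
  have i1 : Integrable (fun z : R3 × R3 => fderiv ℝ φ z (z.2, 0)) (volume.prod volume) :=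
    (continuous_fderiv_apply_field hφ hc1).integrable_of_hasCompactSupport
      (hasCompactSupport_fderiv_apply_field hs _)
  have i2 : Integrable (fun z : R3 × R3 => fderiv ℝ φ z (0, B z.1)) (volume.prod volume) :=
    (continuous_fderiv_apply_field hφ hc2).integrable_of_hasCompactSupport
      (hasCompactSupport_fderiv_apply_field hs _)
  have hsplit : ∀ z : R3 × R3, fderiv ℝ φ z (field B z)
      = fderiv ℝ φ z (z.2, 0) + fderiv ℝ φ z (0, B z.1) := by
    intro z
    rw [← map_add]
    simp [field]
  simp_rw [hsplit]
  rw [Measure.volume_eq_prod, integral_add i1 i2, integral_prod _ i2, integral_prod_symm _ i1]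
  simp only
  have h1 : ∀ v, ∫ x, fderiv ℝ φ (x, v) (v, 0) = 0 := by
    intro v
    simp_rw [← fderiv_slice_left hφ]
    exact integral_fderiv_eq_zero (contDiff_slice_left hφ v) (hasCompactSupport_slice_left hs v) v
  have h2 : ∀ x, ∫ v, fderiv ℝ φ (x, v) (0, B x) = 0 := by
    intro x
    simp_rw [← fderiv_slice_right hφ]
    exact integral_fderiv_eq_zero (contDiff_slice_right hφ x)
      (hasCompactSupport_slice_right hs x) (B x)
  simp [h1, h2]

end C1

section Lipschitz

instance isAddHaarMeasure_volume_phaseSpace : (volume : Measure (R3 × R3)).IsAddHaarMeasure :=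
  inferInstanceAs (((volume : Measure R3).prod (volume : Measure R3)).IsAddHaarMeasure)

variable {K : ℝ≥0} {B : R3 → R3} {φ D : R3 × R3 → ℝ} {C : ℝ≥0}

/-- Green's formula on `Ω × ℝ³` and on `ℝ³ × ℝ³` for Lipschitz functions which have a continuous
derivative along the field. -/
lemma green_of_lipschitz (hΩ : IsSmoothConvexDomain Ω ρ) (hB : LipschitzWith K B)
    (hφ : LipschitzWith C φ) (hs : HasCompactSupport φ) (hD : Continuous D)
    (hφD : ∀ z, HasLineDerivAt ℝ φ (D z) z (field B z)) :
    ∫ z, D z ∂(phase Ω univ) = ∫ z, φ z ∂(sigmaPlus Ω ρ) - ∫ z, φ z ∂(sigmaMinus Ω ρ) ∧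
      ∫ z, D z = 0 := by
  have := hΩ.isFiniteMeasureOnCompacts_sigmaPlus
  have := hΩ.isFiniteMeasureOnCompacts_sigmaMinus
  obtain ⟨f, M, hf, hfs, hlim, hDlim, hM, hDM⟩ := exists_smooth_approx
    (volume : Measure (R3 × R3)) hφ hs (lipschitzWith_field hB) hD hφD
  set S := Metric.cthickening 1 (tsupport φ)
  have hS : IsCompact S := hs.isCompact.cthickening
  have hSn : ∀ n : ℕ, tsupport (f n) ⊆ S := fun n => (hfs n).trans
    (Metric.cthickening_mono (by
      rw [div_le_one (by positivity)]
      have : (0 : ℝ) ≤ n := by positivity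
      linarith) _)
  have hf1 : ∀ n, ContDiff ℝ 1 (f n) := fun n => (hf n).of_le (by norm_cast)
  have hfc : ∀ n, HasCompactSupport (f n) := fun n =>
    hS.of_isClosed_subset (isClosed_tsupport _) (hSn n)
  have hBf : Continuous (field B) := (lipschitzWith_field hB).continuous
  have hf0 : ∀ n z, z ∉ S → f n z = 0 := fun n z hz =>
    image_eq_zero_of_notMem_tsupport fun h => hz (hSn n h)
  have hD0 : ∀ n z, z ∉ S → fderiv ℝ (f n) z (field B z) = 0 := fun n z hz => by
    have : fderiv ℝ (f n) z = 0 := by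
      by_contra hne
      exact hz (hSn n (support_fderiv_subset ℝ hne))
    rw [this]; rfl
  have key1 : ∀ (ν : Measure (R3 × R3)) [IsFiniteMeasureOnCompacts ν],
      Tendsto (fun n => ∫ z, f n z ∂ν) atTop (𝓝 (∫ z, φ z ∂ν)) := fun ν _ =>
    tendsto_integral_of_bounded_support hS.measurableSet hS.measure_lt_top.ne
      (fun n => (hf1 n).continuous.aestronglyMeasurable) hM hf0 (Eventually.of_forall hlim)
  have key2 : ∀ (ν : Measure (R3 × R3)) [IsFiniteMeasureOnCompacts ν],
      Tendsto (fun n => ∫ z, fderiv ℝ (f n) z (field B z) ∂ν) atTop (𝓝 (∫ z, D z ∂ν)) := fun ν _ =>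
    tendsto_integral_of_bounded_support hS.measurableSet hS.measure_lt_top.ne
      (fun n => (continuous_fderiv_apply_field (hf1 n) hBf).aestronglyMeasurable) hDM hD0
      (Eventually.of_forall hDlim)
  have hph : IsFiniteMeasureOnCompacts (phase Ω univ) := by unfold phase; infer_instance
  constructor
  · refine tendsto_nhds_unique (key2 (phase Ω univ)) ?_
    simp_rw [fun n => integral_fderiv_field hΩ hB.continuous (hf1 n) (hfc n)]
    exact (key1 _).sub (key1 _)
  · refine tendsto_nhds_unique (key2 volume) ?_
    simp_rw [fun n => integral_fderiv_field_univ hB.continuous (hf1 n) (hfc n)]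
    exact tendsto_const_nhds

end Lipschitz

end Green

/-! ### Measures determined by smooth test functions. -/

section Ext

variable {G : Type*} [NormedAddCommGroup G] [NormedSpace ℝ G] [FiniteDimensional ℝ G]
  [MeasurableSpace G] [BorelSpace G]

/-- Two locally finite measures with the same integrals of smooth compactly supported functions
are equal. -/
lemma measure_ext_of_contDiff {μ ν : Measure G} [IsFiniteMeasureOnCompacts μ]
    [IsFiniteMeasureOnCompacts ν]
    (h : ∀ f : G → ℝ, ContDiff ℝ ∞ f → HasCompactSupport f → ∫ x, f x ∂μ = ∫ x, f x ∂ν) :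
    μ = ν := by
  have : ProperSpace G := FiniteDimensional.proper_real G
  refine Measure.ext_of_integral_eq_on_compactlySupported fun f => ?_
  set S := Metric.cthickening 1 (tsupport f) with hS
  have hSc : IsCompact S := f.hasCompactSupport.isCompact.cthickening
  have hfc : Continuous f := f.continuous
  obtain ⟨M, hM⟩ := hfc.bounded_above_of_compact_support f.hasCompactSupport
  have hsub : ∀ n : ℕ, tsupport (mollify Measure.addHaar n f) ⊆ S := fun n =>
    (tsupport_mollify_subset n f).trans (Metric.cthickening_mono (by
      rw [div_le_one (by positivity)]
      have : (0 : ℝ) ≤ n := by positivity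
      linarith) _)
  have hsm : ∀ n : ℕ, ContDiff ℝ ∞ (mollify Measure.addHaar n f) := fun n =>
    contDiff_mollify n hfc.locallyIntegrable
  have hlim : ∀ (ν : Measure G) [IsFiniteMeasureOnCompacts ν],
      Tendsto (fun n => ∫ x, mollify Measure.addHaar n f x ∂ν) atTop (𝓝 (∫ x, f x ∂ν)) :=
    fun ν _ => tendsto_integral_of_bounded_support hSc.measurableSet hSc.measure_lt_top.ne
      (fun n => (hsm n).continuous.aestronglyMeasurable) (M := M)
      (fun n p => by
        rw [mollify_apply]
        exact abs_integral_mollifier_mul_le n (f := fun r => f (p - r)) fun r _ => hM _)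
      (fun n p hp => image_eq_zero_of_notMem_tsupport fun h => hp (hsub n h))
      (Eventually.of_forall fun p => tendsto_mollify hfc p)
  refine tendsto_nhds_unique (hlim μ) ?_
  simp_rw [fun n => h _ (hsm n) (hSc.of_isClosed_subset (isClosed_tsupport _) (hsub n))]
  exact hlim ν

end Ext

/-! ### Liouville's theorem. -/

section VolumePreserving

variable {Ω : Set R3} {ρ : R3 → ℝ} {K : ℝ≥0} {B : R3 → R3} {Z : ℝ → R3 × R3 → R3 × R3}

/-- Green's formula for `∫₀^δ f(Zₛz) ds`, whose derivative along the field is `f ∘ Z_δ - f`. It is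
the Duhamel solution with zero absorption and source `f`. -/
lemma green_flow (hΩ : IsSmoothConvexDomain Ω ρ) (hB : LipschitzWith K B)
    (hZ : IsFlow (field B) Z) {f : R3 × R3 → ℝ} (hf : ContDiff ℝ ∞ f) (hs : HasCompactSupport f)
    {δ : ℝ} (hδ : 0 ≤ δ) :
    ∫ z, (f (Z δ z) - f z) ∂(phase Ω univ)
        = ∫ z, (∫ s in (0 : ℝ)..δ, f (Z s z)) ∂(sigmaPlus Ω ρ)
          - ∫ z, (∫ s in (0 : ℝ)..δ, f (Z s z)) ∂(sigmaMinus Ω ρ) ∧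
      ∫ z, (f (Z δ z) - f z) = 0 := by
  have hb := lipschitzWith_field hB
  obtain ⟨C, hC⟩ := ContDiff.lipschitzWith_of_hasCompactSupport hs hf (by simp)
  obtain ⟨M, hM⟩ := hf.continuous.bounded_above_of_compact_support hs
  have hq : LipschitzWith 0 (fun _ : R3 × R3 => (0 : ℝ)) := LipschitzWith.const 0
  have hq0 : ∀ p : R3 × R3, 0 ≤ (fun _ : R3 × R3 => (0 : ℝ)) p := fun _ => le_rfl
  have hatt : ∀ s p, attenuation Z (fun _ => (0 : ℝ)) s p = 1 := by simp [attenuation]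
  have hdu : ∀ p, duhamel Z (fun _ => (0 : ℝ)) f δ p = ∫ s in (0 : ℝ)..δ, f (Z s p) := by
    intro p
    simp [duhamel, hatt]
  obtain ⟨L, hL⟩ := lipschitzWith_duhamel hZ hb hq hq0 hC hM hδ
  have key := green_of_lipschitz hΩ hB hL (hasCompactSupport_duhamel hZ hb hs hδ)
    (continuous_duhamel_deriv hZ hb continuous_const hf.continuous δ)
    (fun p => hasLineDerivAt_duhamel hZ hb hq hq0 hC hM hδ p)
  simp only [hdu, hatt, zero_mul, mul_one, zero_sub] at key
  simp only [neg_add_eq_sub] at key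
  exact key

/-- The flow of the field `(v, B(x))` preserves Lebesgue measure. -/
theorem measurePreserving_flow (hΩ : IsSmoothConvexDomain Ω ρ) (hB : LipschitzWith K B)
    (hZ : IsFlow (field B) Z) (t : ℝ) : MeasurePreserving (Z t) volume volume := by
  have hb := lipschitzWith_field hB
  have main : ∀ t : ℝ, 0 ≤ t → MeasurePreserving (Z t) volume volume := by
    intro t ht
    have hcont : Continuous (Z t) := (hZ.homeo hb t).continuous
    have hfin : IsFiniteMeasureOnCompacts (Measure.map (Z t) (volume : Measure (R3 × R3))) :=
      ⟨fun S hS => by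
        rw [Measure.map_apply hcont.measurable hS.measurableSet]
        exact ((hZ.homeo hb t).isCompact_preimage.2 hS).measure_lt_top⟩
    refine ⟨hcont.measurable, measure_ext_of_contDiff fun f hf hs => ?_⟩
    rw [integral_map hcont.aemeasurable hf.continuous.aestronglyMeasurable]
    have h := (green_flow hΩ hB hZ hf hs ht).2
    rw [integral_sub] at h
    · linarith
    · have hi : Integrable f (Measure.map (Z t) (volume : Measure (R3 × R3))) :=
        hf.continuous.integrable_of_hasCompactSupport hs
      exact hi.comp_measurable hcont.measurable
    · exact hf.continuous.integrable_of_hasCompactSupport hs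
  rcases le_total 0 t with ht | ht
  · exact main t ht
  · have h := main (-t) (by linarith)
    have hm : Measurable (Z t) := (hZ.homeo hb t).continuous.measurable
    refine ⟨hm, ?_⟩
    nth_rewrite 1 [← h.map_eq]
    rw [Measure.map_map hm h.measurable]
    have : Z t ∘ Z (-t) = id := funext fun z => hZ.apply_neg hb t z
    rw [this, Measure.map_id]

end VolumePreserving

/-! ### Change of variables between the outgoing boundary and phase space. -/

section Swept

variable {Ω : Set R3} {ρ : R3 → ℝ} {K : ℝ≥0} {B : R3 → R3} {Z : ℝ → R3 × R3 → R3 × R3}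

/-- The union of the orbits through the outgoing boundary. -/
def swept (Ω : Set R3) (ρ : R3 → ℝ) (Z : ℝ → R3 × R3 → R3 × R3) : Set (R3 × R3) :=
  {z | ∃ a, Z a z ∈ GammaPlus Ω ρ}

lemma measurable_flow (hB : LipschitzWith K B) (hZ : IsFlow (field B) Z) :
    Measurable fun p : ℝ × R3 × R3 => Z p.1 p.2 :=
  (hZ.continuous_uncurry (lipschitzWith_field hB)).measurable

/-- Since no orbit returns to the closure of `Ω` after an outgoing point, an orbit has at most one
such point. -/
lemma flow_of_gammaPlus_eq (hΩ : IsSmoothConvexDomain Ω ρ) (hB : IsTangentField Ω ρ K B)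
    (hZ : IsFlow (field B) Z) {y y' : R3 × R3} (hy : y ∈ GammaPlus Ω ρ) (hy' : y' ∈ GammaPlus Ω ρ)
    {a : ℝ} (h : Z a y = y') : a = 0 := by
  have hb := lipschitzWith_field hB.lipschitz
  rcases lt_trichotomy a 0 with ha | ha | ha
  · refine absurd (frontier_subset_closure hy.1)
      ?_
    have e : Z (-a) y' = y := by rw [← h, hZ.neg_apply hb]
    rw [← e]
    exact fst_notMem_closure_of_gammaPlus hΩ hB hZ hy' (by linarith)
  · exact ha
  · refine absurd (frontier_subset_closure hy'.1) ?_
    rw [← h]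
    exact fst_notMem_closure_of_gammaPlus hΩ hB hZ hy ha

/-- The flux measure transported along the flow during the time interval `(0, δ)`. -/
def emitted (Z : ℝ → R3 × R3 → R3 × R3) (δ : ℝ) (σ : Measure (R3 × R3)) : Measure (R3 × R3) :=
  ((volume.restrict (Ioo 0 δ)).prod σ).map fun p => Z p.1 p.2

lemma isFiniteMeasureOnCompacts_emitted (hB : LipschitzWith K B) (hZ : IsFlow (field B) Z)
    (δ : ℝ) (σ : Measure (R3 × R3)) [SFinite σ] [IsFiniteMeasureOnCompacts σ] :
    IsFiniteMeasureOnCompacts (emitted Z δ σ) := by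
  have hb := lipschitzWith_field hB
  refine ⟨fun S hS => ?_⟩
  have hS' : IsCompact ((fun p : ℝ × R3 × R3 => Z (-p.1) p.2) '' (Icc 0 δ ×ˢ S)) :=
    (isCompact_Icc.prod hS).image
      ((hZ.continuous_uncurry hb).comp (continuous_fst.neg.prodMk continuous_snd))
  rw [emitted, Measure.map_apply (measurable_flow hB hZ) hS.measurableSet]
  set S' := (fun p : ℝ × R3 × R3 => Z (-p.1) p.2) '' (Icc 0 δ ×ˢ S)
  have h1 : ((volume.restrict (Ioo 0 δ)).prod σ) ((fun p : ℝ × R3 × R3 => Z p.1 p.2) ⁻¹' S)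
      ≤ ((volume.restrict (Ioo 0 δ)).prod σ) (univ ×ˢ S') := by
    refine measure_mono_ae ?_
    have hmem : ∀ᵐ p ∂((volume.restrict (Ioo 0 δ)).prod σ), p.1 ∈ Ioo 0 δ :=
      Measure.quasiMeasurePreserving_fst.ae (ae_restrict_mem measurableSet_Ioo)
    filter_upwards [hmem] with p hp hpS
    exact ⟨trivial, ⟨(p.1, Z p.1 p.2), ⟨⟨hp.1.le, hp.2.le⟩, hpS⟩, hZ.neg_apply hb _ _⟩⟩
  refine h1.trans_lt ?_
  rw [Measure.prod_prod]
  exact ENNReal.mul_lt_top (by simp) hS'.measure_lt_top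

lemma integral_emitted (hB : LipschitzWith K B) (hZ : IsFlow (field B) Z)
    {δ : ℝ} (hδ : 0 ≤ δ) (σ : Measure (R3 × R3)) [SFinite σ] [IsFiniteMeasureOnCompacts σ]
    {f : R3 × R3 → ℝ} (hf : Continuous f) (hs : HasCompactSupport f) :
    ∫ z, f z ∂(emitted Z δ σ) = ∫ z, (∫ s in (0 : ℝ)..δ, f (Z s z)) ∂σ := by
  have := isFiniteMeasureOnCompacts_emitted hB hZ δ σ
  have hi : Integrable f (emitted Z δ σ) := hf.integrable_of_hasCompactSupport hs
  have hm := measurable_flow hB hZ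
  rw [emitted, integral_map hm.aemeasurable hf.aestronglyMeasurable]
  rw [emitted] at hi
  have hi' : Integrable (fun p : ℝ × R3 × R3 => f (Z p.1 p.2))
      ((volume.restrict (Ioo 0 δ)).prod σ) := hi.comp_measurable hm
  rw [integral_prod_symm _ hi']
  simp_rw [intervalIntegral.integral_of_le hδ, integral_Ioc_eq_integral_Ioo]

lemma measurableSet_fst_mem (hΩ : IsSmoothConvexDomain Ω ρ) (hB : LipschitzWith K B)
    (hZ : IsFlow (field B) Z) (δ : ℝ) : MeasurableSet {z | (Z δ z).1 ∈ Ω} :=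
  (hΩ.isOpen.preimage (continuous_fst.comp
    (hZ.homeo (lipschitzWith_field hB) δ).continuous)).measurableSet

/-- The balance of phase volume in `Ω` during a time `δ`. -/
lemma volume_add_emitted (hΩ : IsSmoothConvexDomain Ω ρ) (hB : LipschitzWith K B)
    (hZ : IsFlow (field B) Z) {δ : ℝ} (hδ : 0 ≤ δ) :
    volume.restrict {z | (Z (-δ) z).1 ∈ Ω} + emitted Z δ (sigmaMinus Ω ρ)
      = phase Ω univ + emitted Z δ (sigmaPlus Ω ρ) := by
  have hb := lipschitzWith_field hB
  have := hΩ.isFiniteMeasureOnCompacts_sigmaPlus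
  have := hΩ.isFiniteMeasureOnCompacts_sigmaMinus
  have := hΩ.sFinite_sigmaPlus
  have := hΩ.sFinite_sigmaMinus
  have := isFiniteMeasureOnCompacts_emitted hB hZ δ (sigmaPlus Ω ρ)
  have := isFiniteMeasureOnCompacts_emitted hB hZ δ (sigmaMinus Ω ρ)
  have hph : IsFiniteMeasureOnCompacts (phase Ω univ) := by unfold phase; infer_instance
  have hadd : ∀ (μ ν : Measure (R3 × R3)) [IsFiniteMeasureOnCompacts μ]
      [IsFiniteMeasureOnCompacts ν], IsFiniteMeasureOnCompacts (μ + ν) := fun μ ν _ _ =>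
    ⟨fun S hS => by
      rw [Measure.add_apply]
      exact ENNReal.add_lt_top.2 ⟨hS.measure_lt_top, hS.measure_lt_top⟩⟩
  have := hadd (volume.restrict {z | (Z (-δ) z).1 ∈ Ω}) (emitted Z δ (sigmaMinus Ω ρ))
  have := hadd (phase Ω univ) (emitted Z δ (sigmaPlus Ω ρ))
  refine measure_ext_of_contDiff fun f hf hs => ?_
  have hi : ∀ (μ : Measure (R3 × R3)) [IsFiniteMeasureOnCompacts μ], Integrable f μ := fun μ _ =>
    hf.continuous.integrable_of_hasCompactSupport hs
  rw [integral_add_measure (hi _) (hi _), integral_add_measure (hi _) (hi _),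
    integral_emitted hB hZ hδ _ hf.continuous hs, integral_emitted hB hZ hδ _ hf.continuous hs]
  have hmp := (measurePreserving_flow hΩ hB hZ δ).restrict_preimage
    (measurableSet_fst_mem hΩ hB hZ (-δ))
  have hpre : Z δ ⁻¹' {z | (Z (-δ) z).1 ∈ Ω} = Ω ×ˢ univ := by
    ext z
    simp [hZ.neg_apply hb]
  rw [hpre] at hmp
  have h1 : ∫ z, f (Z δ z) ∂(phase Ω univ)
      = ∫ z, f z ∂(volume.restrict {z | (Z (-δ) z).1 ∈ Ω}) :=
    hmp.integral_comp (hZ.homeo hb δ).measurableEmbedding f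
  have hi' : Integrable (fun z => f (Z δ z)) (phase Ω univ) :=
    hmp.integrable_comp_of_integrable (hi _)
  -- Tested with `f`, the gain of volume of the transported domain over `Ω` is the outgoing minus
  -- the incoming flux during `(0, δ)`.
  have h := (green_flow hΩ hB hZ hf hs hδ).1
  rw [integral_sub hi' (hi _), h1] at h
  linarith

/-- Points outside `Ω` which were in `Ω` a time `δ` ago. -/
def justLeft (Ω : Set R3) (Z : ℝ → R3 × R3 → R3 × R3) (δ : ℝ) : Set (R3 × R3) :=
  {z | (Z (-δ) z).1 ∈ Ω ∧ z.1 ∉ closure Ω}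

lemma measurableSet_justLeft (hΩ : IsSmoothConvexDomain Ω ρ) (hB : LipschitzWith K B)
    (hZ : IsFlow (field B) Z) (δ : ℝ) : MeasurableSet (justLeft Ω Z δ) :=
  (measurableSet_fst_mem hΩ hB hZ (-δ)).inter
    (measurable_fst isClosed_closure.measurableSet).compl

/-- A point of `justLeft` lies on the orbit of a unique outgoing boundary point. -/
lemma exists_of_mem_justLeft (hΩ : IsSmoothConvexDomain Ω ρ) (hB : IsTangentField Ω ρ K B)
    (hZ : IsFlow (field B) Z) {δ : ℝ} (hδ : 0 < δ) {z : R3 × R3} (hz : z ∈ justLeft Ω Z δ) :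
    ∃ a ∈ Ioo 0 δ, Z (-a) z ∈ GammaPlus Ω ρ ∧ ∀ s ∈ Ioc a δ, (Z (-s) z).1 ∈ Ω := by
  have hb := lipschitzWith_field hB.lipschitz
  -- The orbit is followed from its position in `Ω` a time `δ` ago to its first exit at `τ`; the
  -- exit thus lies `δ - τ` in the past.
  obtain ⟨τ, hτ, hΓ, hin⟩ := exists_exit hΩ hB hZ hz.1 hδ
    (by rw [hZ.apply_neg hb]; exact fun h => hz.2 (subset_closure h))
  rw [← hZ.add hb] at hΓ
  refine ⟨δ - τ, ⟨?_, by linarith [hτ.1]⟩, by rwa [neg_sub, sub_eq_add_neg], fun s hs => ?_⟩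
  · refine lt_of_le_of_ne (by linarith [hτ.2]) fun h => ?_
    rw [show τ + -δ = 0 by linarith, hZ.zero] at hΓ
    exact hz.2 (frontier_subset_closure hΓ.1)
  · have := hin (δ - s) ⟨by linarith [hs.2], by linarith [hs.1]⟩
    rw [← hZ.add hb] at this
    convert this using 3
    ring

lemma mem_Ioo_of_flow_mem_justLeft (hΩ : IsSmoothConvexDomain Ω ρ) (hB : IsTangentField Ω ρ K B)
    (hZ : IsFlow (field B) Z) {δ : ℝ} (hδ : 0 < δ) {y : R3 × R3} (hy : y ∈ GammaPlus Ω ρ) {a : ℝ}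
    (h : Z a y ∈ justLeft Ω Z δ) : a ∈ Ioo 0 δ := by
  have hb := lipschitzWith_field hB.lipschitz
  obtain ⟨a', ha', hΓ, -⟩ := exists_of_mem_justLeft hΩ hB hZ hδ h
  rw [← hZ.add hb] at hΓ
  have := flow_of_gammaPlus_eq hΩ hB hZ hy hΓ rfl
  rwa [show a = a' by linarith]

/-- Such an orbit would have an outgoing point. If that came before `y`, the orbit has returned to
the closure; if it is `y`, the signs of the normal velocity clash; if it comes after `y`, then `y`
is still in `Ω`. -/
lemma flow_gammaMinus_notMem_justLeft (hΩ : IsSmoothConvexDomain Ω ρ)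
    (hB : IsTangentField Ω ρ K B) (hZ : IsFlow (field B) Z) {δ : ℝ}
    {y : R3 × R3} (hy : y ∈ GammaMinus Ω ρ) {a : ℝ} (ha : a ∈ Ioo 0 δ) :
    Z a y ∉ justLeft Ω Z δ := by
  have hb := lipschitzWith_field hB.lipschitz
  intro h
  obtain ⟨a', ha', hΓ, hin⟩ := exists_of_mem_justLeft hΩ hB hZ (ha.1.trans ha.2) h
  have e : ∀ s, Z (-s) (Z a y) = Z (a - s) y := fun s => by
    rw [← hZ.add hb]; congr 1; ring
  simp_rw [e] at hΓ hin
  rcases lt_trichotomy a a' with hlt | heq | hgt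
  · have := fst_notMem_closure_of_gammaPlus hΩ hB hZ hΓ (t := a' - a) (by linarith)
    rw [← hZ.add hb, show a' - a + (a - a') = 0 by ring, hZ.zero] at this
    exact this (frontier_subset_closure hy.1)
  · rw [heq, sub_self, hZ.zero] at hΓ
    exact lt_asymm hΓ.2 hy.2
  · have := hin a ⟨hgt, ha.2.le⟩
    rw [sub_self, hZ.zero] at this
    exact hΩ.notMem_of_mem_frontier hy.1 this

lemma ae_sigmaPlus (hΩ : IsSmoothConvexDomain Ω ρ) : ∀ᵐ z ∂(sigmaPlus Ω ρ), z ∈ GammaPlus Ω ρ :=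
  ae_restrict_mem hΩ.measurableSet_gammaPlus

lemma ae_sigmaMinus (hΩ : IsSmoothConvexDomain Ω ρ) :
    ∀ᵐ z ∂(sigmaMinus Ω ρ), z ∈ GammaMinus Ω ρ :=
  ae_restrict_mem hΩ.measurableSet_gammaMinus

/-- `dσ` on `Γ₊` transported along the flow for all times. -/
def emittedAll (Ω : Set R3) (ρ : R3 → ℝ) (Z : ℝ → R3 × R3 → R3 × R3) : Measure (R3 × R3) :=
  ((volume : Measure ℝ).prod (sigmaPlus Ω ρ)).map fun p => Z p.1 p.2

/-- On this set the volume balance reduces to two terms: neither `Ω` nor the incoming emission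
charges it, and the outgoing emission reaches it only for times in `(0, δ)`. -/
lemma emittedAll_restrict_justLeft (hΩ : IsSmoothConvexDomain Ω ρ) (hB : IsTangentField Ω ρ K B)
    (hZ : IsFlow (field B) Z) {δ : ℝ} (hδ : 0 < δ) :
    (emittedAll Ω ρ Z).restrict (justLeft Ω Z δ) = volume.restrict (justLeft Ω Z δ) := by
  have := hΩ.sFinite_sigmaPlus
  have := hΩ.sFinite_sigmaMinus
  have hm := measurable_flow hB.lipschitz hZ
  ext A hA
  have hJ := measurableSet_justLeft hΩ hB.lipschitz hZ δ
  rw [Measure.restrict_apply hA, Measure.restrict_apply hA]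
  set A' := A ∩ justLeft Ω Z δ with hA'
  have hA'm : MeasurableSet A' := hA.inter hJ
  have h := congrArg (fun μ => μ A') (volume_add_emitted hΩ hB.lipschitz hZ hδ.le)
  simp only [Measure.add_apply] at h
  have e1 : (volume.restrict {z | (Z (-δ) z).1 ∈ Ω}) A' = volume A' := by
    rw [Measure.restrict_apply hA'm, inter_eq_left.2]
    exact fun z hz => hz.2.1
  have e2 : phase Ω univ A' = 0 := by
    rw [phase, Measure.restrict_apply hA'm]
    convert measure_empty (μ := volume)
    rw [← disjoint_iff_inter_eq_empty, disjoint_left]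
    exact fun z hz hz' => hz.2.2 (subset_closure hz'.1)
  have e3 : emitted Z δ (sigmaMinus Ω ρ) A' = 0 := by
    rw [emitted, Measure.map_apply hm hA'm]
    rw [measure_eq_zero_iff_ae_notMem]
    have hmem : ∀ᵐ p ∂((volume.restrict (Ioo 0 δ)).prod (sigmaMinus Ω ρ)), p.1 ∈ Ioo 0 δ :=
      Measure.quasiMeasurePreserving_fst.ae (ae_restrict_mem measurableSet_Ioo)
    have hmem2 : ∀ᵐ p ∂((volume.restrict (Ioo 0 δ)).prod (sigmaMinus Ω ρ)),
        p.2 ∈ GammaMinus Ω ρ := Measure.quasiMeasurePreserving_snd.ae (ae_sigmaMinus hΩ)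
    filter_upwards [hmem, hmem2] with p h1 h2 h3
    exact flow_gammaMinus_notMem_justLeft hΩ hB hZ h2 h1 h3.2
  have e4 : emitted Z δ (sigmaPlus Ω ρ) A' = emittedAll Ω ρ Z A' := by
    rw [emitted, emittedAll, Measure.map_apply hm hA'm, Measure.map_apply hm hA'm]
    have : (volume.restrict (Ioo 0 δ)).prod (sigmaPlus Ω ρ)
        = (volume.prod (sigmaPlus Ω ρ)).restrict (Ioo 0 δ ×ˢ univ) := by
      rw [← Measure.prod_restrict, Measure.restrict_univ]
    rw [this, Measure.restrict_apply (hm hA'm)]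
    refine measure_congr ?_
    have hmem2 : ∀ᵐ p ∂((volume : Measure ℝ).prod (sigmaPlus Ω ρ)), p.2 ∈ GammaPlus Ω ρ :=
      Measure.quasiMeasurePreserving_snd.ae (ae_sigmaPlus hΩ)
    filter_upwards [hmem2] with p hp
    refine propext ⟨fun h => h.1, fun h => ⟨h, ?_, trivial⟩⟩
    exact mem_Ioo_of_flow_mem_justLeft hΩ hB hZ hδ hp h.2
  rw [e1, e2, e3, e4, add_zero, zero_add] at h
  exact h.symm

/-- Translation invariance of `da`. Together with Liouville's theorem it carries the identity of
measures on `justLeft` along the orbits. -/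
lemma measurePreserving_emittedAll (hΩ : IsSmoothConvexDomain Ω ρ) (hB : LipschitzWith K B)
    (hZ : IsFlow (field B) Z) (c : ℝ) :
    MeasurePreserving (Z c) (emittedAll Ω ρ Z) (emittedAll Ω ρ Z) := by
  have hb := lipschitzWith_field hB
  have := hΩ.sFinite_sigmaPlus
  have hm := measurable_flow hB hZ
  have hc : Measurable (Z c) := (hZ.homeo hb c).continuous.measurable
  refine ⟨hc, ?_⟩
  have h1 : MeasurePreserving (Prod.map (fun a : ℝ => c + a) (id : R3 × R3 → R3 × R3))
      (volume.prod (sigmaPlus Ω ρ)) (volume.prod (sigmaPlus Ω ρ)) :=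
    (measurePreserving_add_left volume c).prod (MeasurePreserving.id _)
  rw [emittedAll, Measure.map_map hc hm]
  nth_rewrite 2 [← h1.map_eq]
  rw [Measure.map_map hm h1.measurable]
  congr 1
  funext p
  exact (hZ.add hb c p.1 p.2).symm

lemma swept_eq_iUnion (hΩ : IsSmoothConvexDomain Ω ρ) (hB : IsTangentField Ω ρ K B)
    (hZ : IsFlow (field B) Z) :
    swept Ω ρ Z = ⋃ i : ℚ × ℕ, Z i.1 ⁻¹' justLeft Ω Z (1 / ((i.2 : ℝ) + 1)) := by
  have hb := lipschitzWith_field hB.lipschitz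
  ext z
  simp only [mem_iUnion, mem_preimage]
  constructor
  · rintro ⟨a, ha⟩
    obtain ⟨ε, hε, hin⟩ := mem_nhdsGT_iff_exists_Ioo_subset.1
      (exists_fst_mem_of_gammaPlus hΩ hZ ha)
    obtain ⟨n, hn⟩ := exists_nat_one_div_lt (show (0 : ℝ) < ε from hε)
    set δ : ℝ := 1 / ((n : ℝ) + 1) with hδdef
    have hδ : 0 < δ := by positivity
    -- At a rational time shortly after the outgoing time `a` the orbit has left the closure, while
    -- a time `δ` earlier it was still in `Ω`.
    obtain ⟨c, hc1, hc2⟩ := exists_rat_btwn (show a < a + δ by linarith)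
    have e : ∀ s, Z s z = Z (s - a) (Z a z) := fun s => by
      rw [← hZ.add hb]; congr 1; ring
    refine ⟨(c, n), ?_, ?_⟩
    · rw [← hZ.add hb, e]
      have h : (Z (-(a + δ - c)) (Z a z)).1 ∈ Ω :=
        hin (show a + δ - c ∈ Ioo 0 ε from ⟨by linarith, by linarith⟩)
      convert h using 3
      simp only [hδdef]
      ring
    · rw [e]
      exact fst_notMem_closure_of_gammaPlus hΩ hB hZ ha (by simpa using by linarith)
  · rintro ⟨i, hi⟩
    obtain ⟨a, -, hΓ, -⟩ := exists_of_mem_justLeft hΩ hB hZ (by positivity) hi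
    exact ⟨-a + i.1, by rwa [hZ.add hb]⟩

lemma measurableSet_swept (hΩ : IsSmoothConvexDomain Ω ρ) (hB : IsTangentField Ω ρ K B)
    (hZ : IsFlow (field B) Z) : MeasurableSet (swept Ω ρ Z) := by
  rw [swept_eq_iUnion hΩ hB hZ]
  exact MeasurableSet.iUnion fun i =>
    (hZ.homeo (lipschitzWith_field hB.lipschitz) i.1).continuous.measurable
      (measurableSet_justLeft hΩ hB.lipschitz hZ _)

/-- The map `(a, y) ↦ Z a y` sends `da ⊗ dσ` on `ℝ × Γ₊` to Lebesgue measure. -/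
theorem measurePreserving_swept (hΩ : IsSmoothConvexDomain Ω ρ) (hB : IsTangentField Ω ρ K B)
    (hZ : IsFlow (field B) Z) :
    MeasurePreserving (fun p : ℝ × R3 × R3 => Z p.1 p.2)
      ((volume : Measure ℝ).prod (sigmaPlus Ω ρ)) (volume.restrict (swept Ω ρ Z)) := by
  have hb := lipschitzWith_field hB.lipschitz
  have := hΩ.sFinite_sigmaPlus
  refine ⟨measurable_flow hB.lipschitz hZ, ?_⟩
  change emittedAll Ω ρ Z = _
  have h1 : (emittedAll Ω ρ Z).restrict (swept Ω ρ Z) = emittedAll Ω ρ Z := by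
    refine Measure.restrict_eq_self_of_ae_mem ?_
    rw [emittedAll]
    refine (ae_map_iff (p := fun z => z ∈ swept Ω ρ Z)
      (measurable_flow hB.lipschitz hZ).aemeasurable (measurableSet_swept hΩ hB hZ)).2 ?_
    have hmem : ∀ᵐ p ∂((volume : Measure ℝ).prod (sigmaPlus Ω ρ)), p.2 ∈ GammaPlus Ω ρ :=
      Measure.quasiMeasurePreserving_snd.ae (ae_sigmaPlus hΩ)
    filter_upwards [hmem] with p hp
    exact ⟨-p.1, by rwa [hZ.neg_apply hb]⟩
  -- It suffices to compare the measures on countably many pieces, each a flow image of a set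
  -- `justLeft` where they are known to agree.
  rw [← h1, swept_eq_iUnion hΩ hB hZ, Measure.restrict_iUnion_congr]
  intro i
  set δ : ℝ := 1 / ((i.2 : ℝ) + 1)
  have hδ : 0 < δ := by positivity
  have hJ := measurableSet_justLeft hΩ hB.lipschitz hZ δ
  have e := emittedAll_restrict_justLeft hΩ hB hZ hδ
  have hpre : Z (-i.1) ⁻¹' (Z i.1 ⁻¹' justLeft Ω Z δ) = justLeft Ω Z δ := by
    ext z
    simp [hZ.apply_neg hb]
  have hm : MeasurableSet (Z i.1 ⁻¹' justLeft Ω Z δ) :=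
    (hZ.homeo hb i.1).continuous.measurable hJ
  have p1 := (measurePreserving_emittedAll hΩ hB.lipschitz hZ (-i.1)).restrict_preimage hm
  have p2 := (measurePreserving_flow hΩ hB.lipschitz hZ (-i.1)).restrict_preimage hm
  rw [hpre] at p1 p2
  rw [← p1.map_eq, ← p2.map_eq, e]

end Swept

/-! ### Weak equation for the difference of two solutions. -/

section WeakDifference

variable {Ω : Set R3} {ρ : R3 → ℝ} {T : ℝ}

lemma tendsto_integral_mul_of_bounded_support {G : Type*} [MeasurableSpace G] {ν : Measure G}
    {S : Set G} (hS : MeasurableSet S) {A : G → ℝ} (hA : IntegrableOn A S ν)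
    {f : ℕ → G → ℝ} {F : G → ℝ} {M : ℝ} (hAm : AEStronglyMeasurable A ν)
    (hf : ∀ n, AEStronglyMeasurable (f n) ν)
    (hM : ∀ n p, |f n p| ≤ M) (hs : ∀ n p, p ∉ S → f n p = 0)
    (hlim : ∀ᵐ p ∂ν, Tendsto (fun n => f n p) atTop (𝓝 (F p))) :
    Tendsto (fun n => ∫ p, A p * f n p ∂ν) atTop (𝓝 (∫ p, A p * F p ∂ν)) := by
  refine tendsto_integral_of_dominated_convergence (S.indicator fun p => |A p| * M)
    (fun n => hAm.mul (hf n)) ?_ ?_ ?_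
  · exact (integrable_indicator_iff hS).2 (hA.abs.mul_const M)
  · intro n
    refine Eventually.of_forall fun p => ?_
    by_cases hp : p ∈ S
    · rw [indicator_of_mem hp, norm_mul]
      exact mul_le_mul_of_nonneg_left (hM n p) (abs_nonneg _)
    · rw [indicator_of_notMem hp, hs n p hp, mul_zero, norm_zero]
  · filter_upwards [hlim] with p hp
    exact hp.const_mul _

lemma _root_.MeasureTheory.MemLp.integrableOn_isCompact {G : Type*} [TopologicalSpace G]
    [MeasurableSpace G] {ν : Measure G} [IsFiniteMeasureOnCompacts ν] {A : G → ℝ}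
    (hA : MemLp A 2 ν) {S : Set G} (hS : IsCompact S) : IntegrableOn A S ν := by
  have : IsFiniteMeasure (ν.restrict S) := ⟨by simpa using hS.measure_lt_top⟩
  exact (hA.restrict S).integrable (by norm_num)

instance isAddHaarMeasure_volume_spaceTime : (volume : Measure (ℝ × R3 × R3)).IsAddHaarMeasure :=
  Measure.prod.instIsAddHaarMeasure (volume : Measure ℝ) (volume : Measure (R3 × R3))

lemma isFiniteMeasureOnCompacts_timed (T : ℝ) (μ : Measure (R3 × R3))
    [IsFiniteMeasureOnCompacts μ] [SFinite μ] : IsFiniteMeasureOnCompacts (timed T μ) := by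
  unfold timed; infer_instance

lemma ae_timed_mem (T : ℝ) (μ : Measure (R3 × R3)) [SFinite μ] :
    ∀ᵐ p ∂(timed T μ), p.1 ∈ Ioo 0 T :=
  Measure.quasiMeasurePreserving_fst.ae (ae_restrict_mem measurableSet_Ioo)

lemma ae_timed_of_ae (T : ℝ) {μ : Measure (R3 × R3)} [SFinite μ] {P : R3 × R3 → Prop}
    (h : ∀ᵐ z ∂μ, P z) : ∀ᵐ p ∂(timed T μ), P p.2 :=
  Measure.quasiMeasurePreserving_snd.ae h

instance sFinite_phase (Ω U : Set R3) : SFinite (phase Ω U) := by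
  unfold phase; infer_instance

instance isFiniteMeasureOnCompacts_phase (Ω U : Set R3) :
    IsFiniteMeasureOnCompacts (phase Ω U) := by
  unfold phase; infer_instance

lemma ae_phase_mem (hΩ : IsSmoothConvexDomain Ω ρ) : ∀ᵐ z ∂(phase Ω univ), z.1 ∈ Ω := by
  have h := ae_restrict_mem (μ := (volume : Measure (R3 × R3)))
    (hΩ.isOpen.measurableSet.prod MeasurableSet.univ)
  filter_upwards [h] with z hz using hz.1

lemma memLp_absorption_mul {μ : Measure (R3 × R3)} [SFinite μ] {q : R3 × R3 → ℝ}
    (hq : MemLp q ⊤ μ) {u : ℝ × R3 × R3 → ℝ} (hu : MemLp u 2 (timed T μ)) :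
    MemLp (fun p => q p.2 * u p) 2 (timed T μ) :=
  MemLp.mul' hu (hq.comp_snd (volume.restrict (Ioo 0 T)))

/-- The space-time field `(1, v, B(x))`. -/
def timeField (B : R3 → R3) (p : ℝ × R3 × R3) : ℝ × R3 × R3 := (1, field B p.2)

lemma lipschitzWith_timeField {K : ℝ≥0} {B : R3 → R3} (hB : LipschitzWith K B) :
    LipschitzWith (max 1 K) (timeField B) := by
  have h1 : LipschitzWith 0 (fun _ : ℝ × R3 × R3 => (1 : ℝ)) := LipschitzWith.const 1
  have h2 : LipschitzWith (max 1 K * 1) (fun p : ℝ × R3 × R3 => field B p.2) :=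
    (lipschitzWith_field hB).comp LipschitzWith.prod_snd
  rw [mul_one] at h2
  have := h1.prodMk h2
  rwa [max_eq_right (zero_le)] at this

/-- The space-time flow. -/
def timeFlow (Z : ℝ → R3 × R3 → R3 × R3) (s : ℝ) (p : ℝ × R3 × R3) : ℝ × R3 × R3 :=
  (p.1 + s, Z s p.2)

lemma isFlow_timeFlow {B : R3 → R3} {Z : ℝ → R3 × R3 → R3 × R3} (hZ : IsFlow (field B) Z) :
    IsFlow (timeField B) (timeFlow Z) where
  zero p := by simp [timeFlow, hZ.zero]
  deriv t p := ((hasDerivAt_id t).const_add p.1).prodMk (hZ.deriv t p.2)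

variable {E B : R3 → R3} {K : ℝ≥0} {q₁ q₂ g : R3 × R3 → ℝ} {S h u₁ u₂ γ₁ γ₂ : ℝ × R3 × R3 → ℝ}

/-- The common source, initial value and incoming data cancel on subtraction. The extended field may
replace `E` because the integrals run over `Ω`. -/
lemma weak_difference (hΩ : IsSmoothConvexDomain Ω ρ) (hB : Continuous B)
    (hEB : ∀ x ∈ Ω, B x = E x) (hS : MemLp S 2 (timed T (phase Ω univ)))
    (hq₁ : IsAbsorption Ω q₁) (hq₂ : IsAbsorption Ω q₂)
    (h₁ : IsWeakSolution T Ω ρ E q₁ S g h u₁ γ₁) (h₂ : IsWeakSolution T Ω ρ E q₂ S g h u₂ γ₂)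
    {φ : ℝ × R3 × R3 → ℝ} (hφ : ContDiff ℝ 1 φ) (hs : HasCompactSupport φ)
    (ht : tsupport φ ⊆ {p | p.1 < T}) :
    ∫ p, (u₁ p - u₂ p) * fderiv ℝ φ p (timeField B p) ∂(timed T (phase Ω univ))
      + ∫ p, (q₂ p.2 * u₂ p - q₁ p.2 * u₁ p) * φ p ∂(timed T (phase Ω univ))
      = ∫ p, (γ₁ p - γ₂ p) * φ p ∂(timed T (sigmaPlus Ω ρ)) := by
  have := hΩ.isFiniteMeasureOnCompacts_sigmaPlus
  have := hΩ.sFinite_sigmaPlus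
  have := isFiniteMeasureOnCompacts_timed T (phase Ω univ)
  have := isFiniteMeasureOnCompacts_timed T (sigmaPlus Ω ρ)
  have hDc : Continuous fun p => fderiv ℝ φ p (timeField B p) := by
    refine (hφ.continuous_fderiv (by simp)).clm_apply ?_
    exact continuous_const.prodMk ((continuous_snd.comp continuous_snd).prodMk
      (hB.comp (continuous_fst.comp continuous_snd)))
  have hDs : HasCompactSupport fun p => fderiv ℝ φ p (timeField B p) :=
    (hs.fderiv ℝ).mono fun z hz => by
      intro h
      exact hz (by simp only [h]; rfl)
  have hD2 : MemLp (fun p => fderiv ℝ φ p (timeField B p)) 2 (timed T (phase Ω univ)) :=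
    hDc.memLp_of_hasCompactSupport hDs
  have hφ2 : MemLp φ 2 (timed T (phase Ω univ)) := hφ.continuous.memLp_of_hasCompactSupport hs
  have hφ2' : MemLp φ 2 (timed T (sigmaPlus Ω ρ)) := hφ.continuous.memLp_of_hasCompactSupport hs
  have hE : ∀ᵐ p ∂(timed T (phase Ω univ)),
      fderiv ℝ φ p (1, p.2.2, E p.2.1) = fderiv ℝ φ p (timeField B p) := by
    filter_upwards [ae_timed_of_ae T (ae_phase_mem hΩ)] with p hp
    simp [timeField, field, hEB _ hp]
  have rew : ∀ {q : R3 × R3 → ℝ} {u : ℝ × R3 × R3 → ℝ}, IsAbsorption Ω q →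
      MemLp u 2 (timed T (phase Ω univ)) →
      ∫ p, (u p * fderiv ℝ φ p (1, p.2.2, E p.2.1) + (S p - q p.2 * u p) * φ p)
          ∂(timed T (phase Ω univ))
        = ∫ p, u p * fderiv ℝ φ p (timeField B p) ∂(timed T (phase Ω univ))
          + (∫ p, S p * φ p ∂(timed T (phase Ω univ))
            - ∫ p, q p.2 * u p * φ p ∂(timed T (phase Ω univ))) := by
    intro q u hq hu
    have i1 : Integrable (fun p => S p * φ p) (timed T (phase Ω univ)) := hS.integrable_mul hφ2
    have i2 : Integrable (fun p => q p.2 * u p * φ p) (timed T (phase Ω univ)) :=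
      (memLp_absorption_mul hq.memLp hu).integrable_mul hφ2
    have i3 : Integrable (fun p => u p * fderiv ℝ φ p (timeField B p))
      (timed T (phase Ω univ)) := hu.integrable_mul hD2
    have i4 : Integrable (fun p => S p * φ p - q p.2 * u p * φ p) (timed T (phase Ω univ)) :=
      i1.sub i2
    rw [← integral_sub i1 i2, ← integral_add i3 i4]
    refine integral_congr_ae ?_
    filter_upwards [hE] with p hp
    rw [hp]
    ring
  have w1 := h₁.weak φ hφ hs ht
  have w2 := h₂.weak φ hφ hs ht
  rw [rew hq₁ h₁.memLp] at w1
  rw [rew hq₂ h₂.memLp] at w2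
  have j1 : Integrable (fun p => u₁ p * fderiv ℝ φ p (timeField B p))
      (timed T (phase Ω univ)) := h₁.memLp.integrable_mul hD2
  have j2 : Integrable (fun p => u₂ p * fderiv ℝ φ p (timeField B p))
      (timed T (phase Ω univ)) := h₂.memLp.integrable_mul hD2
  have j3 : Integrable (fun p => q₁ p.2 * u₁ p * φ p) (timed T (phase Ω univ)) :=
      (memLp_absorption_mul hq₁.memLp h₁.memLp).integrable_mul hφ2
  have j4 : Integrable (fun p => q₂ p.2 * u₂ p * φ p) (timed T (phase Ω univ)) :=
      (memLp_absorption_mul hq₂.memLp h₂.memLp).integrable_mul hφ2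
  have j5 : Integrable (fun p => γ₁ p * φ p) (timed T (sigmaPlus Ω ρ)) :=
    h₁.memLp_trace.integrable_mul hφ2'
  have j6 : Integrable (fun p => γ₂ p * φ p) (timed T (sigmaPlus Ω ρ)) :=
    h₂.memLp_trace.integrable_mul hφ2'
  simp_rw [sub_mul]
  rw [integral_sub j1 j2, integral_sub j4 j3, integral_sub j5 j6]
  linarith

/-- The difference of two weak formulations, for Lipschitz test functions with a continuous
derivative along the field. -/
lemma weak_difference_of_lipschitz (hΩ : IsSmoothConvexDomain Ω ρ) (hB : LipschitzWith K B)
    (hEB : ∀ x ∈ Ω, B x = E x) (hS : MemLp S 2 (timed T (phase Ω univ)))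
    (hq₁ : IsAbsorption Ω q₁) (hq₂ : IsAbsorption Ω q₂)
    (h₁ : IsWeakSolution T Ω ρ E q₁ S g h u₁ γ₁) (h₂ : IsWeakSolution T Ω ρ E q₂ S g h u₂ γ₂)
    {φ D : ℝ × R3 × R3 → ℝ} {C : ℝ≥0} (hφ : LipschitzWith C φ) (hs : HasCompactSupport φ)
    (ht : tsupport φ ⊆ {p | p.1 < T}) (hD : Continuous D)
    (hφD : ∀ p, HasLineDerivAt ℝ φ (D p) p (timeField B p)) :
    ∫ p, (u₁ p - u₂ p) * D p ∂(timed T (phase Ω univ))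
      + ∫ p, (q₂ p.2 * u₂ p - q₁ p.2 * u₁ p) * φ p ∂(timed T (phase Ω univ))
      = ∫ p, (γ₁ p - γ₂ p) * φ p ∂(timed T (sigmaPlus Ω ρ)) := by
  have := hΩ.isFiniteMeasureOnCompacts_sigmaPlus
  have := hΩ.sFinite_sigmaPlus
  have := isFiniteMeasureOnCompacts_timed T (phase Ω univ)
  have := isFiniteMeasureOnCompacts_timed T (sigmaPlus Ω ρ)
  obtain ⟨f, M, hf, hfs, hlim, hDlim, hM, hDM⟩ := exists_smooth_approx
    (volume : Measure (ℝ × R3 × R3)) hφ hs (lipschitzWith_timeField hB) hD hφD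
  -- Mollification enlarges supports by `1/(n+1)`. A thickening of the compact support stays in `{t
  -- < T}`, so the approximations are admissible for large `n`.
  obtain ⟨ε, hε, hεs⟩ := hs.isCompact.exists_cthickening_subset_open
    (isOpen_lt continuous_fst continuous_const) ht
  obtain ⟨N, hN⟩ := exists_nat_one_div_lt hε
  set S' := Metric.cthickening 1 (tsupport φ)
  have hS' : IsCompact S' := hs.isCompact.cthickening
  have hSn : ∀ n : ℕ, tsupport (f n) ⊆ S' := fun n => (hfs n).trans
    (Metric.cthickening_mono (by
      rw [div_le_one (by positivity)]
      have : (0 : ℝ) ≤ n := by positivity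
      linarith) _)
  have hf1 : ∀ n, ContDiff ℝ 1 (f n) := fun n => (hf n).of_le (by norm_cast)
  have hfc : ∀ n, HasCompactSupport (f n) := fun n =>
    hS'.of_isClosed_subset (isClosed_tsupport _) (hSn n)
  have hBf : Continuous (timeField B) := (lipschitzWith_timeField hB).continuous
  have hf0 : ∀ n z, z ∉ S' → f n z = 0 := fun n z hz =>
    image_eq_zero_of_notMem_tsupport fun h => hz (hSn n h)
  have hD0 : ∀ n z, z ∉ S' → fderiv ℝ (f n) z (timeField B z) = 0 := fun n z hz => by
    have : fderiv ℝ (f n) z = 0 := by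
      by_contra hne
      exact hz (hSn n (support_fderiv_subset ℝ hne))
    rw [this]; rfl
  have hfsm : ∀ n (ν : Measure (ℝ × R3 × R3)), AEStronglyMeasurable (f n) ν := fun n ν =>
    (hf1 n).continuous.aestronglyMeasurable
  have m1 : MemLp (fun p => u₁ p - u₂ p) 2 (timed T (phase Ω univ)) := h₁.memLp.sub h₂.memLp
  have m2 : MemLp (fun p => q₂ p.2 * u₂ p - q₁ p.2 * u₁ p) 2 (timed T (phase Ω univ)) :=
    (memLp_absorption_mul hq₂.memLp h₂.memLp).sub (memLp_absorption_mul hq₁.memLp h₁.memLp)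
  have m3 : MemLp (fun p => γ₁ p - γ₂ p) 2 (timed T (sigmaPlus Ω ρ)) :=
    h₁.memLp_trace.sub h₂.memLp_trace
  have l1 := tendsto_integral_mul_of_bounded_support hS'.measurableSet
    (m1.integrableOn_isCompact hS') m1.1
    (fun n => (((hf1 n).continuous_fderiv (by simp)).clm_apply hBf).aestronglyMeasurable)
    hDM hD0 (Eventually.of_forall hDlim)
  have l2 := tendsto_integral_mul_of_bounded_support hS'.measurableSet
    (m2.integrableOn_isCompact hS') m2.1 (fun n => hfsm n _) hM hf0 (Eventually.of_forall hlim)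
  have l3 := tendsto_integral_mul_of_bounded_support hS'.measurableSet
    (m3.integrableOn_isCompact hS') m3.1 (fun n => hfsm n _) hM hf0 (Eventually.of_forall hlim)
  refine tendsto_nhds_unique (l1.add l2) (l3.congr' ?_)
  filter_upwards [eventually_ge_atTop N] with n hn
  refine (weak_difference hΩ hB.continuous hEB hS hq₁ hq₂ h₁ h₂ (hf1 n) (hfc n) ?_).symm
  refine (hfs n).trans ((Metric.cthickening_mono ?_ _).trans hεs)
  refine le_trans ?_ hN.le
  gcongr

end WeakDifference

/-! ### Measurability of integrals along orbits. -/

section Measurability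

lemma measurable_intervalIntegral {Y : Type*} [MeasurableSpace Y] {f : ℝ → Y → ℝ}
    (hf : Measurable (Function.uncurry f)) :
    Measurable fun x : ℝ × Y => ∫ r in (0 : ℝ)..x.1, f r x.2 := by
  have key : ∀ s : Set ((ℝ × Y) × ℝ), MeasurableSet s →
      Measurable fun x : ℝ × Y => ∫ r, s.indicator (fun w => f w.2 w.1.2) (x, r) := by
    intro s hs
    have h1 : Measurable fun w : (ℝ × Y) × ℝ => f w.2 w.1.2 :=
      hf.comp (measurable_snd.prodMk (measurable_snd.comp measurable_fst))
    exact ((h1.indicator hs).stronglyMeasurable.integral_prod_right' (ν := volume)).measurable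
  have h1 := key {w | 0 < w.2 ∧ w.2 ≤ w.1.1}
    ((measurableSet_lt measurable_const measurable_snd).inter
      (measurableSet_le measurable_snd (measurable_fst.comp measurable_fst)))
  have h2 := key {w | w.1.1 < w.2 ∧ w.2 ≤ 0}
    ((measurableSet_lt (measurable_fst.comp measurable_fst) measurable_snd).inter
      (measurableSet_le measurable_snd measurable_const))
  convert h1.sub h2 using 1
  funext x
  rw [Pi.sub_apply, intervalIntegral, ← integral_indicator measurableSet_Ioc,
    ← integral_indicator measurableSet_Ioc]
  rfl

variable {G : Type*} [MeasurableSpace G] {Z : ℝ → G → G}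

lemma measurable_attenuation (hZ : Measurable fun x : ℝ × G => Z x.1 x.2) {q : G → ℝ}
    (hq : Measurable q) : Measurable fun x : ℝ × G => attenuation Z q x.1 x.2 :=
  Real.measurable_exp.comp
    (measurable_intervalIntegral (f := fun r p => q (Z r p)) (hq.comp hZ)).neg

end Measurability

/-! ### Duhamel solutions under convergence of the absorption. -/

section DuhamelLimit

variable {G : Type*} [NormedAddCommGroup G] [NormedSpace ℝ G] {b : G → G} {Z : ℝ → G → G} {K : ℝ≥0}

/-- The set of points whose orbit meets `S` during the time `[0, T]`. -/
def pastOf (Z : ℝ → G → G) (T : ℝ) (S : Set G) : Set G :=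
  (fun x : ℝ × G => Z (-x.1) x.2) '' (Icc 0 T ×ˢ S)

lemma isCompact_pastOf (hZ : IsFlow b Z) (hb : LipschitzWith K b) (T : ℝ) {S : Set G}
    (hS : IsCompact S) : IsCompact (pastOf Z T S) :=
  (isCompact_Icc.prod hS).image
    ((hZ.continuous_uncurry hb).comp (continuous_fst.neg.prodMk continuous_snd))

lemma mem_pastOf (hZ : IsFlow b Z) (hb : LipschitzWith K b) {T s : ℝ} (hs : s ∈ Icc 0 T)
    {S : Set G} {p : G} (h : Z s p ∈ S) : p ∈ pastOf Z T S :=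
  ⟨(s, Z s p), ⟨hs, h⟩, hZ.neg_apply hb s p⟩

lemma duhamel_eq_zero (hZ : IsFlow b Z) (hb : LipschitzWith K b) {q ψ : G → ℝ} {T : ℝ}
    (hT : 0 ≤ T) {p : G} (hp : p ∉ pastOf Z T (tsupport ψ)) : duhamel Z q ψ T p = 0 := by
  rw [duhamel, intervalIntegral.integral_congr (g := fun _ => (0 : ℝ))]
  · simp
  · intro s hs
    rw [uIcc_of_le hT] at hs
    have : ψ (Z s p) = 0 := by
      by_contra hne
      exact hp (mem_pastOf hZ hb hs (subset_tsupport _ hne))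
    simp [this]

lemma abs_duhamel_le {q ψ : G → ℝ} (hq : ∀ p, 0 ≤ q p) {M : ℝ} (hM : ∀ p, |ψ p| ≤ M) {T : ℝ}
    (hT : 0 ≤ T) (p : G) : |duhamel Z q ψ T p| ≤ M * T := by
  have h := intervalIntegral.norm_integral_le_of_norm_le_const
    (f := fun s => ψ (Z s p) * attenuation Z q s p) (a := 0) (b := T) (C := M) fun s hs => by
      rw [uIoc_of_le hT] at hs
      rw [norm_mul, Real.norm_eq_abs, Real.norm_eq_abs, abs_of_nonneg (attenuation_nonneg q s p)]
      exact (mul_le_of_le_one_right (abs_nonneg _) (attenuation_le_one hq hs.1.le p)).trans (hM _)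
  rwa [sub_zero, abs_of_nonneg hT] at h

/-- Two dominated convergences, in the exponent and in the outer integral. Convergence of the
absorption is needed only at almost every time of the one orbit. -/
lemma tendsto_duhamel (hZ : IsFlow b Z) (hb : LipschitzWith K b) {q : G → ℝ} {f : ℕ → G → ℝ}
    {ψ : G → ℝ} (hψ : Continuous ψ) {M : ℝ} (hM : ∀ p, |ψ p| ≤ M)
    (hf : ∀ n, Continuous (f n)) {M' : ℝ} (hf0 : ∀ n p, 0 ≤ f n p)
    (hfM : ∀ n p, f n p ≤ M') {T : ℝ} (hT : 0 ≤ T) {p : G}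
    (h : ∀ᵐ r : ℝ, Tendsto (fun n => f n (Z r p)) atTop (𝓝 (q (Z r p)))) :
    Tendsto (fun n => duhamel Z (f n) ψ T p) atTop (𝓝 (duhamel Z q ψ T p)) := by
  have hZc := hZ.continuous_time p
  have hatt : ∀ s, 0 ≤ s → Tendsto (fun n => attenuation Z (f n) s p) atTop
      (𝓝 (attenuation Z q s p)) := by
    intro s hs
    refine (Real.continuous_exp.tendsto _).comp (Tendsto.neg ?_)
    refine intervalIntegral.tendsto_integral_filter_of_dominated_convergence (fun _ => M')
      (Eventually.of_forall fun n => ((hf n).comp hZc).aestronglyMeasurable) ?_ (by simp) ?_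
    · refine Eventually.of_forall fun n => Eventually.of_forall fun r _ => ?_
      rw [Real.norm_eq_abs, abs_of_nonneg (hf0 n _)]
      exact hfM n _
    · filter_upwards [h] with r hr _ using hr
  refine intervalIntegral.tendsto_integral_filter_of_dominated_convergence (fun _ => M)
    (Eventually.of_forall fun n => ((continuous_duhamel_integrand hZ hb (hf n) hψ).comp
      (Continuous.prodMk_left p)).aestronglyMeasurable) ?_ (by simp) ?_
  · refine Eventually.of_forall fun n => Eventually.of_forall fun s hs => ?_
    rw [uIoc_of_le hT] at hs
    rw [norm_mul, Real.norm_eq_abs, Real.norm_eq_abs,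
      abs_of_nonneg (attenuation_nonneg (f n) s p)]
    exact (mul_le_of_le_one_right (abs_nonneg _)
      (attenuation_le_one (hf0 n) hs.1.le p)).trans (hM _)
  · refine Eventually.of_forall fun s hs => ?_
    rw [uIoc_of_le hT] at hs
    exact (hatt s hs.1.le).const_mul _

end DuhamelLimit

/-! ### Lipschitz approximation of the absorption. -/

section Approximation

/-- A bounded absorption coefficient of compact support is an almost everywhere limit of Lipschitz
ones with the same bounds. -/
lemma exists_absorption_approx {q : R3 × R3 → ℝ} (hq : Measurable q) (h0 : ∀ z, 0 ≤ q z) {M : ℝ}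
    (hM : ∀ z, q z ≤ M) (hs : HasCompactSupport q) :
    ∃ f : ℕ → R3 × R3 → ℝ, (∀ n, ∃ C : ℝ≥0, LipschitzWith C (f n)) ∧ (∀ n z, 0 ≤ f n z) ∧
      (∀ n z, f n z ≤ M) ∧ ∀ᵐ z, Tendsto (fun n => f n z) atTop (𝓝 (q z)) := by
  have hqi : Integrable q := by
    have : IntegrableOn q (tsupport q) := by
      refine Measure.integrableOn_of_bounded (M := M) hs.isCompact.measure_lt_top.ne
        hq.aestronglyMeasurable (Eventually.of_forall fun z => ?_)
      rw [Real.norm_eq_abs, abs_of_nonneg (h0 z)]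
      exact hM z
    exact (integrableOn_iff_integrable_of_support_subset (subset_tsupport q)).1 this
  have hli := hqi.locallyIntegrable
  refine ⟨fun n => mollify volume n q, fun n => ?_, fun n z => ?_, fun n z => ?_, ?_⟩
  · have hcs : HasCompactSupport (mollify volume n q) :=
      (hs.isCompact.cthickening (r := 1 / ((n : ℝ) + 1))).of_isClosed_subset
        (isClosed_tsupport _) (tsupport_mollify_subset n q)
    exact ContDiff.lipschitzWith_of_hasCompactSupport hcs (contDiff_mollify n hli) (by simp)
  · simp only [mollify_apply]
    exact integral_nonneg fun r => mul_nonneg (ContDiffBump.nonneg_normed _ r) (h0 _)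
  · simp only [mollify_apply]
    exact (le_abs_self _).trans (abs_integral_mollifier_mul_le n (f := fun r => q (z - r))
      fun r _ => by rw [abs_of_nonneg (h0 _)]; exact hM _)
  -- Lebesgue differentiation for mollifiers; it requires the outer radius to be at most a fixed
  -- multiple, here 2, of the inner radius.
  · refine ContDiffBump.ae_convolution_tendsto_right_of_locallyIntegrable (K := 2) ?_
      (Eventually.of_forall fun n => ?_) hli
    · exact tendsto_one_div_add_atTop_nhds_zero_nat
    · change 1 / ((n : ℝ) + 1) ≤ 2 * (1 / (2 * ((n : ℝ) + 1)))
      refine le_of_eq ?_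
      field_simp

end Approximation

/-! ### Null sets along orbits. -/

section FlowAE

variable {Ω : Set R3} {ρ : R3 → ℝ} {K : ℝ≥0} {B : R3 → R3} {Z : ℝ → R3 × R3 → R3 × R3}

lemma quasiMeasurePreserving_flow (hΩ : IsSmoothConvexDomain Ω ρ) (hB : LipschitzWith K B)
    (hZ : IsFlow (field B) Z) :
    Measure.QuasiMeasurePreserving (fun x : ℝ × R3 × R3 => Z x.1 x.2)
      ((volume : Measure ℝ).prod volume) volume := by
  have h := (MeasurePreserving.id (volume : Measure ℝ)).skew_product
    (g := fun r z => Z r z) (measurable_flow hB hZ)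
    (Eventually.of_forall fun r => (measurePreserving_flow hΩ hB hZ r).map_eq)
  exact Measure.quasiMeasurePreserving_snd.comp h.quasiMeasurePreserving

lemma ae_ae_flow_of_ae {μ : Measure (R3 × R3)} [SFinite μ]
    (h : Measure.QuasiMeasurePreserving (fun x : ℝ × R3 × R3 => Z x.1 x.2)
      ((volume : Measure ℝ).prod μ) volume) {P : R3 × R3 → Prop} (hP : ∀ᵐ z, P z) :
    ∀ᵐ z ∂μ, ∀ᵐ r : ℝ, P (Z r z) := by
  have h2 : ∀ᵐ x ∂(μ.prod (volume : Measure ℝ)), P (Z x.2 x.1) :=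
    Measure.measurePreserving_swap.quasiMeasurePreserving.ae (h.ae hP)
  exact Measure.ae_ae_of_ae_prod h2

lemma ae_phase_flow (hΩ : IsSmoothConvexDomain Ω ρ) (hB : LipschitzWith K B)
    (hZ : IsFlow (field B) Z) {P : R3 × R3 → Prop} (hP : ∀ᵐ z, P z) :
    ∀ᵐ z ∂(phase Ω univ), ∀ᵐ r : ℝ, P (Z r z) :=
  ae_restrict_of_ae (ae_ae_flow_of_ae (quasiMeasurePreserving_flow hΩ hB hZ) hP)

/-- The outgoing boundary is itself null in phase space, but the change of variables shows that the
orbits of almost all of its points meet a null set only for a null set of times. -/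
lemma ae_sigmaPlus_flow (hΩ : IsSmoothConvexDomain Ω ρ) (hB : IsTangentField Ω ρ K B)
    (hZ : IsFlow (field B) Z) {P : R3 × R3 → Prop} (hP : ∀ᵐ z, P z) :
    ∀ᵐ y ∂(sigmaPlus Ω ρ), ∀ᵐ r : ℝ, P (Z r y) := by
  have := hΩ.sFinite_sigmaPlus
  refine ae_ae_flow_of_ae ?_ hP
  exact (measurePreserving_swept hΩ hB hZ).quasiMeasurePreserving.mono_right
    (Measure.absolutelyContinuous_of_le Measure.restrict_le_self)

end FlowAE

/-! ### Testing with backward solutions. -/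

section WeakTransport

variable {Ω : Set R3} {ρ : R3 → ℝ} {T : ℝ} {E B : R3 → R3} {K : ℝ≥0}
  {Z : ℝ → R3 × R3 → R3 × R3}
  {q₁ q₂ g q : R3 × R3 → ℝ} {S h u₁ u₂ γ₁ γ₂ : ℝ × R3 × R3 → ℝ}

lemma integrable_mul_of_bounded_support {G : Type*} [MeasurableSpace G] {ν : Measure G}
    {S : Set G} (hS : MeasurableSet S) {A f : G → ℝ} (hA : IntegrableOn A S ν) {M : ℝ}
    (hAm : AEStronglyMeasurable A ν) (hf : AEStronglyMeasurable f ν)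
    (hM : ∀ p, |f p| ≤ M) (hs : ∀ p, p ∉ S → f p = 0) : Integrable (fun p => A p * f p) ν := by
  refine Integrable.mono' ((integrable_indicator_iff hS).2 (hA.abs.mul_const M))
    (hAm.mul hf) (Eventually.of_forall fun p => ?_)
  by_cases hp : p ∈ S
  · rw [indicator_of_mem hp, norm_mul]
    exact mul_le_mul_of_nonneg_left (hM p) (abs_nonneg _)
  · rw [indicator_of_notMem hp, hs p hp, mul_zero, norm_zero]

/-- The difference of two weak formulations, tested with the solution of the backward transport
equation with a source outside of the closure of `Ω`. -/
lemma weak_transport (hΩ : IsSmoothConvexDomain Ω ρ) (hB : IsTangentField Ω ρ K B)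
    (hZ : IsFlow (field B) Z) (hT : 0 < T)
    (hEB : ∀ x ∈ Ω, B x = E x) (hS : MemLp S 2 (timed T (phase Ω univ)))
    (hq₁ : IsAbsorption Ω q₁) (hq₂ : IsAbsorption Ω q₂)
    (h₁ : IsWeakSolution T Ω ρ E q₁ S g h u₁ γ₁) (h₂ : IsWeakSolution T Ω ρ E q₂ S g h u₂ γ₂)
    (hq : Measurable q) (hq0 : ∀ z, 0 ≤ q z) {M : ℝ} (hqM : ∀ z, q z ≤ M)
    (hqs : HasCompactSupport q) (hqq : ∀ᵐ z ∂(phase Ω univ), q z = q₁ z)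
    {ψ : ℝ × R3 × R3 → ℝ} (hψ : ContDiff ℝ ∞ ψ) (hψs : HasCompactSupport ψ)
    (hψT : tsupport ψ ⊆ {p | p.1 < T ∧ p.2.1 ∉ closure Ω}) :
    ∫ p, (q₂ p.2 - q₁ p.2) * u₂ p * duhamel (timeFlow Z) (fun p => q p.2) ψ T p
        ∂(timed T (phase Ω univ))
      = ∫ p, (γ₁ p - γ₂ p) * duhamel (timeFlow Z) (fun p => q p.2) ψ T p
        ∂(timed T (sigmaPlus Ω ρ)) := by
  have := hΩ.isFiniteMeasureOnCompacts_sigmaPlus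
  have := hΩ.sFinite_sigmaPlus
  have := isFiniteMeasureOnCompacts_timed T (phase Ω univ)
  have := isFiniteMeasureOnCompacts_timed T (sigmaPlus Ω ρ)
  have hZZ := isFlow_timeFlow hZ
  have hbb := lipschitzWith_timeField hB.lipschitz
  obtain ⟨f, hfL, hf0, hfM, hflim⟩ := exists_absorption_approx hq hq0 hqM hqs
  choose Cf hCf using hfL
  obtain ⟨C, hC⟩ := ContDiff.lipschitzWith_of_hasCompactSupport hψs hψ (by simp)
  obtain ⟨M', hM'⟩ := hψ.continuous.bounded_above_of_compact_support hψs
  have hM0 : 0 ≤ M := (hq0 0).trans (hqM 0)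
  have hM'0 : 0 ≤ M' := (norm_nonneg _).trans (hM' 0)
  set Q : ℕ → ℝ × R3 × R3 → ℝ := fun n p => f n p.2 with hQ
  have hQL : ∀ n, LipschitzWith (Cf n * 1) (Q n) := fun n => (hCf n).comp LipschitzWith.prod_snd
  have hQ0 : ∀ n p, 0 ≤ Q n p := fun n p => hf0 n _
  set φ : ℕ → ℝ × R3 × R3 → ℝ := fun n => duhamel (timeFlow Z) (Q n) ψ T with hφ
  set Φ : ℝ × R3 × R3 → ℝ := duhamel (timeFlow Z) (fun p => q p.2) ψ T with hΦ
  set S' := pastOf (timeFlow Z) T (tsupport ψ) with hS'def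
  have hS' : IsCompact S' := isCompact_pastOf hZZ hbb T hψs.isCompact
  have hφ0 : ∀ n p, p ∉ S' → φ n p = 0 := fun n p hp => duhamel_eq_zero hZZ hbb hT.le hp
  have hΦ0 : ∀ p, p ∉ S' → Φ p = 0 := fun p hp => duhamel_eq_zero hZZ hbb hT.le hp
  have hφM : ∀ n p, |φ n p| ≤ M' * T := fun n p => abs_duhamel_le (hQ0 n) hM' hT.le p
  have hΦM : ∀ p, |Φ p| ≤ M' * T := fun p => abs_duhamel_le (fun _ => hq0 _) hM' hT.le p
  -- The support is propagated only backwards in time, so it remains below `T`.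
  have hS'T : S' ⊆ {p | p.1 < T} := by
    rintro _ ⟨⟨s, p⟩, ⟨hs, hp⟩, rfl⟩
    have := (hψT hp).1
    simp only [timeFlow, mem_ofPred_eq] at this ⊢
    linarith [hs.1]
  have hφL : ∀ n, ∃ L : ℝ≥0, LipschitzWith L (φ n) := fun n =>
    lipschitzWith_duhamel hZZ hbb (hQL n) (hQ0 n) hC hM' hT.le
  have hφc : ∀ n (ν : Measure (ℝ × R3 × R3)), AEStronglyMeasurable (φ n) ν := fun n ν => by
    obtain ⟨L, hL⟩ := hφL n
    exact hL.continuous.aestronglyMeasurable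
  have hlim1 : ∀ᵐ p ∂(timed T (phase Ω univ)), Tendsto (fun n => φ n p) atTop (𝓝 (Φ p)) := by
    filter_upwards [ae_timed_of_ae T (ae_phase_flow hΩ hB.lipschitz hZ hflim)] with p hp
    exact tendsto_duhamel hZZ hbb hψ.continuous hM' (fun n => (hQL n).continuous) hQ0
      (fun n p => hfM n _) hT.le hp
  have hlim2 : ∀ᵐ p ∂(timed T (sigmaPlus Ω ρ)), Tendsto (fun n => φ n p) atTop (𝓝 (Φ p)) := by
    filter_upwards [ae_timed_of_ae T (ae_sigmaPlus_flow hΩ hB hZ hflim)] with p hp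
    exact tendsto_duhamel hZZ hbb hψ.continuous hM' (fun n => (hQL n).continuous) hQ0
      (fun n p => hfM n _) hT.le hp
  have hlimQ : ∀ᵐ p ∂(timed T (phase Ω univ)), Tendsto (fun n => Q n p) atTop (𝓝 (q p.2)) :=
    ae_timed_of_ae T (ae_restrict_of_ae hflim)
  have hΦm : AEStronglyMeasurable Φ (timed T (phase Ω univ)) :=
    aestronglyMeasurable_of_tendsto_ae atTop (fun n => hφc n _) hlim1
  have m1 : MemLp (fun p => u₁ p - u₂ p) 2 (timed T (phase Ω univ)) := h₁.memLp.sub h₂.memLp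
  have m2 : MemLp (fun p => q₂ p.2 * u₂ p - q₁ p.2 * u₁ p) 2 (timed T (phase Ω univ)) :=
    (memLp_absorption_mul hq₂.memLp h₂.memLp).sub (memLp_absorption_mul hq₁.memLp h₁.memLp)
  have m3 : MemLp (fun p => γ₁ p - γ₂ p) 2 (timed T (sigmaPlus Ω ρ)) :=
    h₁.memLp_trace.sub h₂.memLp_trace
  have hQφM : ∀ n p, |Q n p * φ n p| ≤ M * (M' * T) := fun n p => by
    rw [abs_mul, abs_of_nonneg (hQ0 n p)]
    exact mul_le_mul (hfM n _) (hφM n p) (abs_nonneg _) hM0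
  have l1 := tendsto_integral_mul_of_bounded_support hS'.measurableSet
    (m1.integrableOn_isCompact hS') m1.1 (f := fun n p => Q n p * φ n p)
    (F := fun p => q p.2 * Φ p)
    (fun n => (hQL n).continuous.aestronglyMeasurable.mul (hφc n _))
    hQφM (fun n p hp => by rw [hφ0 n p hp, mul_zero])
    (by filter_upwards [hlim1, hlimQ] with p h1 h2 using h2.mul h1)
  have l2 := tendsto_integral_mul_of_bounded_support hS'.measurableSet
    (m2.integrableOn_isCompact hS') m2.1 (fun n => hφc n _) hφM hφ0 hlim1
  have l3 := tendsto_integral_mul_of_bounded_support hS'.measurableSet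
    (m3.integrableOn_isCompact hS') m3.1 (fun n => hφc n _) hφM hφ0 hlim2
  have hn : ∀ n, ∫ p, (u₁ p - u₂ p) * (Q n p * φ n p) ∂(timed T (phase Ω univ))
      + ∫ p, (q₂ p.2 * u₂ p - q₁ p.2 * u₁ p) * φ n p ∂(timed T (phase Ω univ))
      = ∫ p, (γ₁ p - γ₂ p) * φ n p ∂(timed T (sigmaPlus Ω ρ)) := by
    intro n
    obtain ⟨L, hL⟩ := hφL n
    have hts : tsupport (φ n) ⊆ S' := closure_minimal (fun p hp => by
      by_contra hne
      exact hp (hφ0 n p hne)) hS'.isClosed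
    rw [← weak_difference_of_lipschitz hΩ hB.lipschitz hEB hS hq₁ hq₂ h₁ h₂ hL
      (hS'.of_isClosed_subset (isClosed_tsupport _) hts) (hts.trans hS'T)
      (continuous_duhamel_deriv hZZ hbb (hQL n).continuous hψ.continuous T)
      (fun p => hasLineDerivAt_duhamel hZZ hbb (hQL n) (hQ0 n) hC hM' hT.le p)]
    congr 1
    refine integral_congr_ae ?_
    filter_upwards [ae_timed_mem T (phase Ω univ), ae_timed_of_ae T (ae_phase_mem hΩ)]
      with p hp hpΩ
    -- Inside `Ω` the source of the backward equation vanishes, and the end term vanishes because it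
    -- is evaluated after time `T`. Only absorption is left of the derivative.
    have e1 : ψ p = 0 := by
      by_contra hne
      exact (hψT (subset_tsupport _ hne)).2 (subset_closure hpΩ)
    have e2 : ψ (timeFlow Z T p) = 0 := by
      by_contra hne
      have := (hψT (subset_tsupport _ hne)).1
      simp only [timeFlow] at this
      linarith [hp.1]
    rw [e1, e2, zero_mul, sub_zero, add_zero]
  have key := tendsto_nhds_unique (l1.add l2) (l3.congr fun n => (hn n).symm)
  rw [← key]
  have i1 : Integrable (fun p => (u₁ p - u₂ p) * (q p.2 * Φ p)) (timed T (phase Ω univ)) :=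
    integrable_mul_of_bounded_support hS'.measurableSet (m1.integrableOn_isCompact hS') m1.1
      ((hq.comp measurable_snd).aestronglyMeasurable.mul hΦm) (M := M * (M' * T))
      (fun p => by
        rw [abs_mul, abs_of_nonneg (hq0 _)]
        exact mul_le_mul (hqM _) (hΦM p) (abs_nonneg _) hM0)
      (fun p hp => by rw [hΦ0 p hp, mul_zero])
  have i2 : Integrable (fun p => (q₂ p.2 * u₂ p - q₁ p.2 * u₁ p) * Φ p)
      (timed T (phase Ω univ)) :=
    integrable_mul_of_bounded_support hS'.measurableSet (m2.integrableOn_isCompact hS') m2.1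
      hΦm hΦM hΦ0
  -- In the limit the absorption cancels the unknown `u₁`: `(u₁ - u₂) q₁ + q₂ u₂ - q₁ u₁ = (q₂ - q₁)
  -- u₂`.
  rw [← integral_add i1 i2]
  refine integral_congr_ae ?_
  filter_upwards [ae_timed_of_ae T hqq] with p hp
  rw [hp]
  ring

end WeakTransport

/-! ### Duality between backward and forward solutions. -/

section Pairing

variable {Ω : Set R3} {ρ : R3 → ℝ} {T : ℝ} {B : R3 → R3} {K : ℝ≥0}
  {Z : ℝ → R3 × R3 → R3 × R3} {q : R3 × R3 → ℝ} {F ψ γ : ℝ × R3 × R3 → ℝ}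

lemma measurePreserving_timeFlow (hΩ : IsSmoothConvexDomain Ω ρ) (hB : LipschitzWith K B)
    (hZ : IsFlow (field B) Z) (s : ℝ) : MeasurePreserving (timeFlow Z s) volume volume :=
  (measurePreserving_add_right volume s).prod (measurePreserving_flow hΩ hB hZ s)

lemma measurable_timeFlow (hB : LipschitzWith K B) (hZ : IsFlow (field B) Z) :
    Measurable fun x : ℝ × ℝ × R3 × R3 => timeFlow Z x.1 x.2 :=
  ((isFlow_timeFlow hZ).continuous_uncurry (lipschitzWith_timeField hB)).measurable

/-- The solution of the forward transport equation with absorption `q` and source `F`. -/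
def forward (Z : ℝ → R3 × R3 → R3 × R3) (q : R3 × R3 → ℝ) (F : ℝ × R3 × R3 → ℝ) (T : ℝ)
    (p : ℝ × R3 × R3) : ℝ :=
  ∫ s in Ioo 0 T, F (timeFlow Z (-s) p) * attenuation Z q s (Z (-s) p.2)

lemma integrable_forward_integrand (hΩ : IsSmoothConvexDomain Ω ρ) (hB : LipschitzWith K B)
    (hZ : IsFlow (field B) Z) (hq : Measurable q) (hq0 : ∀ z, 0 ≤ q z)
    (hF : Integrable F) :
    Integrable (fun x : ℝ × ℝ × R3 × R3 =>
        F (timeFlow Z (-x.1) x.2) * attenuation Z q x.1 (Z (-x.1) x.2.2))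
      ((volume.restrict (Ioo 0 T)).prod volume) := by
  have hm : Measurable fun x : ℝ × ℝ × R3 × R3 => timeFlow Z (-x.1) x.2 :=
    (measurable_timeFlow hB hZ).comp (measurable_fst.neg.prodMk measurable_snd)
  have h := (MeasurePreserving.id (volume.restrict (Ioo 0 T))).skew_product
    (μc := (volume : Measure (ℝ × R3 × R3))) (μd := volume)
    (g := fun r p => timeFlow Z (-r) p) hm
    (Eventually.of_forall fun r => (measurePreserving_timeFlow hΩ hB hZ (-r)).map_eq)
  have h1 : Integrable (fun x : ℝ × ℝ × R3 × R3 => F (timeFlow Z (-x.1) x.2))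
      ((volume.restrict (Ioo 0 T)).prod volume) :=
    h.integrable_comp_of_integrable (hF.comp_snd (volume.restrict (Ioo 0 T)))
  have hatt : Measurable fun x : ℝ × ℝ × R3 × R3 => attenuation Z q x.1 (Z (-x.1) x.2.2) :=
    (measurable_attenuation (measurable_flow hB hZ) hq).comp
      (measurable_fst.prodMk ((measurable_flow hB hZ).comp
        (measurable_fst.neg.prodMk (measurable_snd.comp measurable_snd))))
  refine Integrable.mono' h1.norm (h1.aestronglyMeasurable.mul hatt.aestronglyMeasurable) ?_
  have hmem : ∀ᵐ x ∂((volume.restrict (Ioo 0 T)).prod (volume : Measure (ℝ × R3 × R3))),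
      x.1 ∈ Ioo 0 T := Measure.quasiMeasurePreserving_fst.ae (ae_restrict_mem measurableSet_Ioo)
  filter_upwards [hmem] with x hx
  rw [norm_mul, Real.norm_eq_abs (attenuation _ _ _ _), abs_of_nonneg (attenuation_nonneg _ _ _)]
  exact mul_le_of_le_one_right (norm_nonneg _) (attenuation_le_one hq0 hx.1.le _)

lemma integrable_forward (hΩ : IsSmoothConvexDomain Ω ρ) (hB : LipschitzWith K B)
    (hZ : IsFlow (field B) Z) (hq : Measurable q) (hq0 : ∀ z, 0 ≤ q z)
    (hF : Integrable F) : Integrable (forward Z q F T) :=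
  (integrable_forward_integrand hΩ hB hZ hq hq0 hF).integral_prod_right

/-- The backward and the forward solution operators are dual to each other. -/
lemma integral_mul_duhamel (hΩ : IsSmoothConvexDomain Ω ρ) (hB : LipschitzWith K B)
    (hZ : IsFlow (field B) Z) (hT : 0 ≤ T) (hq : Measurable q) (hq0 : ∀ z, 0 ≤ q z)
    (hF : Integrable F) (hψ : Continuous ψ) {M : ℝ} (hM : ∀ p, |ψ p| ≤ M) :
    ∫ p, F p * duhamel (timeFlow Z) (fun p => q p.2) ψ T p
      = ∫ p, ψ p * forward Z q F T p := by
  have hatt : Measurable fun x : ℝ × ℝ × R3 × R3 => attenuation Z q x.1 x.2.2 :=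
    (measurable_attenuation (measurable_flow hB hZ) hq).comp
      (measurable_fst.prodMk (measurable_snd.comp measurable_snd))
  have hmem : ∀ᵐ x ∂((volume.restrict (Ioo 0 T)).prod (volume : Measure (ℝ × R3 × R3))),
      x.1 ∈ Ioo 0 T := Measure.quasiMeasurePreserving_fst.ae (ae_restrict_mem measurableSet_Ioo)
  have hH : Integrable (fun x : ℝ × ℝ × R3 × R3 =>
      F x.2 * (ψ (timeFlow Z x.1 x.2) * attenuation Z q x.1 x.2.2))
      ((volume.restrict (Ioo 0 T)).prod volume) := by
    refine Integrable.mono' ((hF.norm.mul_const M).comp_snd (volume.restrict (Ioo 0 T))) ?_ ?_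
    · exact hF.aestronglyMeasurable.comp_snd.mul
        ((hψ.measurable.comp (measurable_timeFlow hB hZ)).mul hatt).aestronglyMeasurable
    · filter_upwards [hmem] with x hx
      rw [norm_mul, norm_mul, Real.norm_eq_abs (attenuation _ _ _ _),
        abs_of_nonneg (attenuation_nonneg _ _ _)]
      refine mul_le_mul_of_nonneg_left ?_ (norm_nonneg _)
      exact (mul_le_of_le_one_right (norm_nonneg _) (attenuation_le_one hq0 hx.1.le _)).trans
        (hM _)
  have hG := integrable_forward_integrand (T := T) hΩ hB hZ hq hq0 hF
  have hG' : Integrable (fun x : ℝ × ℝ × R3 × R3 =>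
      ψ x.2 * (F (timeFlow Z (-x.1) x.2) * attenuation Z q x.1 (Z (-x.1) x.2.2)))
      ((volume.restrict (Ioo 0 T)).prod volume) :=
    hG.bdd_mul (hψ.comp continuous_snd).aestronglyMeasurable
      (Eventually.of_forall fun x => hM x.2)
  calc ∫ p, F p * duhamel (timeFlow Z) (fun p => q p.2) ψ T p
      = ∫ p, ∫ s in Ioo 0 T, F p * (ψ (timeFlow Z s p) * attenuation Z q s p.2) := by
        refine integral_congr_ae (Eventually.of_forall fun p => ?_)
        simp only
        rw [duhamel, intervalIntegral.integral_of_le hT, integral_Ioc_eq_integral_Ioo,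
          ← integral_const_mul]
        rfl
    _ = ∫ s in Ioo 0 T, ∫ p, F p * (ψ (timeFlow Z s p) * attenuation Z q s p.2) :=
        (integral_integral_swap hH).symm
    _ = ∫ s in Ioo 0 T, ∫ p, ψ p * (F (timeFlow Z (-s) p) * attenuation Z q s (Z (-s) p.2)) := by
        refine integral_congr_ae (Eventually.of_forall fun s => ?_)
        simp only
        have hbb := lipschitzWith_timeField hB
        have hZZ := isFlow_timeFlow hZ
        -- For fixed `s` the substitution along the volume preserving space-time flow moves the
        -- transport from `ψ` to `F`.
        rw [← (measurePreserving_timeFlow hΩ hB hZ (-s)).integral_comp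
          (hZZ.homeo hbb (-s)).measurableEmbedding]
        refine integral_congr_ae (Eventually.of_forall fun p => ?_)
        simp only
        rw [hZZ.apply_neg hbb]
        change F (timeFlow Z (-s) p) * (ψ p * attenuation Z q s (Z (-s) p.2)) = _
        ring
    _ = ∫ p, ∫ s in Ioo 0 T, ψ p * (F (timeFlow Z (-s) p) * attenuation Z q s (Z (-s) p.2)) :=
        integral_integral_swap hG'
    _ = ∫ p, ψ p * forward Z q F T p := by
        simp_rw [integral_const_mul]
        rfl

/-- At the points which are reached from an outgoing boundary point, the forward solution is
given by the orbit inside of `Ω`. -/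
lemma forward_timeFlow (hΩ : IsSmoothConvexDomain Ω ρ) (hB : IsTangentField Ω ρ K B)
    (hZ : IsFlow (field B) Z) (hq : Measurable q) (hq0 : ∀ z, 0 ≤ q z) {M : ℝ}
    (hqM : ∀ z, q z ≤ M) (hqΩ : ∀ z : R3 × R3, z.1 ∉ Ω → q z = 0)
    (hF : ∀ p : ℝ × R3 × R3, ¬(0 < p.1 ∧ p.2.1 ∈ Ω) → F p = 0)
    {y : R3 × R3} (hy : y ∈ GammaPlus Ω ρ) {t a : ℝ} (ht : 0 < t) (ha : 0 < a) (hta : t + a < T) :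
    forward Z q F T (timeFlow Z a (t, y))
      = ∫ s in (0 : ℝ)..t, F (t - s, Z (-s) y) * attenuation (fun r => Z (-r)) q s y := by
  have hb := lipschitzWith_field hB.lipschitz
  have hout : ∀ s, 0 ≤ s → (Z s y).1 ∉ Ω := by
    intro s hs
    rcases hs.eq_or_lt with rfl | hs
    · rw [hZ.zero]; exact hΩ.notMem_of_mem_frontier hy.1
    · exact fun h => fst_notMem_closure_of_gammaPlus hΩ hB hZ hy hs (subset_closure h)
  set f : ℝ → ℝ := fun s => F (timeFlow Z (-s) (timeFlow Z a (t, y)))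
    * attenuation Z q s (Z (-s) (timeFlow Z a (t, y)).2) with hf
  have hfst : ∀ s, timeFlow Z (-s) (timeFlow Z a (t, y)) = (t + a - s, Z (a - s) y) := by
    intro s
    simp only [timeFlow]
    rw [← hZ.add hb, neg_add_eq_sub, ← sub_eq_add_neg]
  -- For `s ≤ a` the orbit point lies at or after the outgoing point, hence outside `Ω`; for `s ≥ t
  -- + a` the time is not positive. In both cases the source vanishes.
  have hf0 : ∀ s, s ∉ Ioo a (t + a) → f s = 0 := by
    intro s hs
    simp only [hf]
    rw [hfst, hF, zero_mul]
    rintro ⟨h1, h2⟩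
    simp only at h1 h2
    refine hs ⟨?_, by linarith⟩
    by_contra hle
    exact hout _ (by linarith) h2
  have e1 : forward Z q F T (timeFlow Z a (t, y)) = ∫ s in Ioo a (t + a), f s := by
    rw [forward]
    exact setIntegral_eq_of_subset_of_forall_sdiff_eq_zero measurableSet_Ioo
      (Ioo_subset_Ioo ha.le hta.le) fun s hs => hf0 s hs.2
  have e2 : ∫ s in Ioo a (t + a), f s = ∫ s in (0 : ℝ)..t, f (s + a) := by
    rw [intervalIntegral.integral_comp_add_right f a, zero_add,
      intervalIntegral.integral_of_le (by linarith), integral_Ioc_eq_integral_Ioo]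
  rw [e1, e2]
  refine intervalIntegral.integral_congr fun s hs => ?_
  rw [uIcc_of_le ht.le] at hs
  simp only [hf]
  rw [hfst]
  have e3 : (t + a - (s + a), Z (a - (s + a)) y) = (t - s, Z (-s) y) := by
    rw [show t + a - (s + a) = t - s by ring, show a - (s + a) = -s by ring]
  rw [e3]
  congr 1
  have e4 : Z (-(s + a)) (timeFlow Z a (t, y)).2 = Z (-s) y := by
    change Z (-(s + a)) (Z a y) = _
    rw [← hZ.add hb]; congr 1; ring
  rw [e4, attenuation, attenuation]
  congr 2
  have hint : ∀ c d : ℝ, IntervalIntegrable (fun r => q (Z r (Z (-s) y))) volume c d := by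
    intro c d
    refine (intervalIntegrable_const (c := M)).mono_fun' ?_ (Eventually.of_forall fun r => ?_)
    · exact (hq.comp (hZ.continuous_time _).measurable).aestronglyMeasurable
    · simp only [Real.norm_eq_abs]
      rw [abs_of_nonneg (hq0 _)]
      exact hqM _
  rw [← intervalIntegral.integral_add_adjacent_intervals (hint 0 s) (hint s (s + a))]
  -- Absorption vanishes outside `Ω`, so the stretch of the orbit after the outgoing point does not
  -- attenuate.
  have z1 : ∫ r in s..(s + a), q (Z r (Z (-s) y)) = 0 := by
    rw [intervalIntegral.integral_congr (g := fun _ => (0 : ℝ))]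
    · simp
    · intro r hr
      rw [uIcc_of_le (by linarith)] at hr
      simp only
      rw [← hZ.add hb]
      exact hqΩ _ (hout _ (by linarith [hr.1]))
  rw [z1, add_zero]
  have := intervalIntegral.integral_comp_sub_left (a := 0) (b := s)
    (fun r => q (Z (-r) y)) s
  rw [sub_self, sub_zero] at this
  rw [← this]
  refine intervalIntegral.integral_congr fun r _ => ?_
  rw [← hZ.add hb]
  congr 2
  ring

end Pairing

/-! ### The trace as an integral along characteristics. -/

section Identification

variable {Ω : Set R3} {ρ : R3 → ℝ} {T : ℝ} {E B : R3 → R3} {K : ℝ≥0}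
  {Z : ℝ → R3 × R3 → R3 × R3}
  {q₁ q₂ g q : R3 × R3 → ℝ} {S h u₁ u₂ γ₁ γ₂ F γ : ℝ × R3 × R3 → ℝ}

/-- The shear `t ↦ t + a` preserves `dt` for each fixed `a`, and the change of variables in `(a, y)`
does the rest. -/
lemma measurePreserving_timeFlow_swept (hΩ : IsSmoothConvexDomain Ω ρ)
    (hB : IsTangentField Ω ρ K B) (hZ : IsFlow (field B) Z) :
    MeasurePreserving (fun x : (ℝ × R3 × R3) × ℝ => timeFlow Z x.2 x.1)
      (((volume : Measure ℝ).prod (sigmaPlus Ω ρ)).prod volume)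
      ((volume : Measure ℝ).prod (volume.restrict (swept Ω ρ Z))) := by
  have := hΩ.sFinite_sigmaPlus
  have h1 : MeasurePreserving (fun x : (ℝ × R3 × R3) × ℝ => (x.1.1, x.1.2, x.2))
      (((volume : Measure ℝ).prod (sigmaPlus Ω ρ)).prod volume)
      ((volume : Measure ℝ).prod ((sigmaPlus Ω ρ).prod volume)) :=
    measurePreserving_prodAssoc _ _ _
  have h2 : MeasurePreserving (fun x : ℝ × (R3 × R3) × ℝ => (x.2, x.1))
      ((volume : Measure ℝ).prod ((sigmaPlus Ω ρ).prod volume))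
      (((sigmaPlus Ω ρ).prod volume).prod volume) := Measure.measurePreserving_swap
  have h3 : MeasurePreserving (fun x : ((R3 × R3) × ℝ) × ℝ => (x.1, x.2 + x.1.2))
      (((sigmaPlus Ω ρ).prod (volume : Measure ℝ)).prod volume)
      (((sigmaPlus Ω ρ).prod (volume : Measure ℝ)).prod volume) :=
    (MeasurePreserving.id _).skew_product
      (g := fun (w : (R3 × R3) × ℝ) (t : ℝ) => t + w.2)
      (measurable_snd.add (measurable_snd.comp measurable_fst))
      (Eventually.of_forall fun w => (measurePreserving_add_right volume w.2).map_eq)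
  have h4 : MeasurePreserving (fun x : ((R3 × R3) × ℝ) × ℝ => (x.2, x.1))
      (((sigmaPlus Ω ρ).prod (volume : Measure ℝ)).prod volume)
      ((volume : Measure ℝ).prod ((sigmaPlus Ω ρ).prod volume)) := Measure.measurePreserving_swap
  have h5 : MeasurePreserving (fun w : (R3 × R3) × ℝ => Z w.2 w.1)
      ((sigmaPlus Ω ρ).prod volume) (volume.restrict (swept Ω ρ Z)) :=
    (measurePreserving_swept hΩ hB hZ).comp Measure.measurePreserving_swap
  have h6 := (MeasurePreserving.id (volume : Measure ℝ)).prod h5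
  exact h6.comp (h4.comp (h3.comp (h2.comp h1)))

lemma injOn_timeFlow (hΩ : IsSmoothConvexDomain Ω ρ)
    (hB : IsTangentField Ω ρ K B) (hZ : IsFlow (field B) Z) :
    InjOn (fun x : (ℝ × R3 × R3) × ℝ => timeFlow Z x.2 x.1) {x | x.1.2 ∈ GammaPlus Ω ρ} := by
  have hb := lipschitzWith_field hB.lipschitz
  rintro ⟨⟨t, y⟩, a⟩ hy ⟨⟨t', y'⟩, a'⟩ hy' h
  simp only [timeFlow, Prod.mk.injEq] at h
  have e : Z (a - a') y = y' := by
    rw [← hZ.neg_apply hb a' y', ← h.2, ← hZ.add hb]; congr 1; ring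
  have e2 := flow_of_gammaPlus_eq hΩ hB hZ hy hy' e
  have e3 : a = a' := by linarith
  subst e3
  rw [sub_self, hZ.zero] at e
  simp only [Prod.mk.injEq, and_true]
  exact ⟨by linarith [h.1], e⟩

/-- A function on `(0,T) × Γ₊` extends along the orbits to a function in space-time. -/
lemma exists_extension_along_flow (hΩ : IsSmoothConvexDomain Ω ρ)
    (hB : IsTangentField Ω ρ K B) (hZ : IsFlow (field B) Z) (T : ℝ) (hγ : Measurable γ) :
    ∃ Γ : ℝ × R3 × R3 → ℝ, Measurable Γ ∧ ∀ p a, p.2 ∈ GammaPlus Ω ρ →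
      Γ (timeFlow Z a p) = (Ioo 0 T ×ˢ (univ : Set (R3 × R3))).indicator γ p
        * (Ioo 0 T).indicator 1 a := by
  have hs : MeasurableSet {x : (ℝ × R3 × R3) × ℝ | x.1.2 ∈ GammaPlus Ω ρ} :=
    (measurable_snd.comp measurable_fst) hΩ.measurableSet_gammaPlus
  have hc : Continuous fun x : (ℝ × R3 × R3) × ℝ => timeFlow Z x.2 x.1 :=
    ((isFlow_timeFlow hZ).continuous_uncurry (lipschitzWith_timeField hB.lipschitz)).comp
      continuous_swap
  -- Each point lies on the space-time orbit of at most one boundary datum, so the prescription is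
  -- consistent, and injectivity on a Borel set makes it measurable.
  have hemb := hc.continuousOn.measurableEmbedding hs (injOn_timeFlow hΩ hB hZ)
  have hgm : Measurable fun x : (ℝ × R3 × R3) × ℝ =>
      (Ioo 0 T ×ˢ (univ : Set (R3 × R3))).indicator γ x.1 * (Ioo 0 T).indicator 1 x.2 :=
    ((hγ.indicator (measurableSet_Ioo.prod MeasurableSet.univ)).comp measurable_fst).mul
      (((measurable_one (α := ℝ) (β := ℝ)).indicator measurableSet_Ioo).comp measurable_snd)
  obtain ⟨Γ, hΓ, hΓe⟩ := hemb.exists_measurable_extend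
    (hgm.comp measurable_subtype_coe) (fun _ => inferInstance)
  refine ⟨Γ, hΓ, fun p a hp => ?_⟩
  exact congrFun hΓe ⟨(p, a), hp⟩

instance sFinite_timed (T : ℝ) (μ : Measure (R3 × R3)) [SFinite μ] : SFinite (timed T μ) := by
  unfold timed; infer_instance

lemma timed_eq_restrict (T : ℝ) (μ : Measure (R3 × R3)) [SFinite μ] :
    timed T μ = ((volume : Measure ℝ).prod μ).restrict (Ioo 0 T ×ˢ univ) := by
  rw [timed, ← Measure.prod_restrict, Measure.restrict_univ]

/-- Only boundary points in the compact past of `S` contribute, and on a compact set the square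
integrable trace is integrable. -/
lemma integrable_trace_mul (hΩ : IsSmoothConvexDomain Ω ρ)
    (hB : IsTangentField Ω ρ K B) (hZ : IsFlow (field B) Z)
    (hγ : MemLp γ 2 (timed T (sigmaPlus Ω ρ))) {S : Set (ℝ × R3 × R3)}
    (hS : IsCompact S) {f : ℝ × R3 × R3 → ℝ} (hf : Measurable f) {M : ℝ} (hM : ∀ p, |f p| ≤ M)
    (hfS : ∀ p, p ∉ S → f p = 0) :
    Integrable (fun x : (ℝ × R3 × R3) × ℝ => γ x.1 * f (timeFlow Z x.2 x.1))
      ((timed T (sigmaPlus Ω ρ)).prod (volume.restrict (Ioo 0 T))) := by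
  have := hΩ.isFiniteMeasureOnCompacts_sigmaPlus
  have := hΩ.sFinite_sigmaPlus
  have := isFiniteMeasureOnCompacts_timed T (sigmaPlus Ω ρ)
  have hZZ := isFlow_timeFlow hZ
  have hbb := lipschitzWith_timeField hB.lipschitz
  have hS' := isCompact_pastOf hZZ hbb T hS
  have h1 : Integrable ((pastOf (timeFlow Z) T S).indicator fun p => |γ p| * M)
      (timed T (sigmaPlus Ω ρ)) :=
    (integrable_indicator_iff hS'.measurableSet).2
      ((hγ.integrableOn_isCompact hS').abs.mul_const M)
  refine Integrable.mono' (h1.comp_fst (volume.restrict (Ioo 0 T))) ?_ ?_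
  · exact hγ.1.comp_fst.mul (hf.comp ((measurable_timeFlow hB.lipschitz hZ).comp
      measurable_swap)).aestronglyMeasurable
  · have hmem : ∀ᵐ x ∂((timed T (sigmaPlus Ω ρ)).prod (volume.restrict (Ioo 0 T))),
      x.2 ∈ Ioo 0 T := Measure.quasiMeasurePreserving_snd.ae (ae_restrict_mem measurableSet_Ioo)
    filter_upwards [hmem] with x hx
    by_cases hp : x.1 ∈ pastOf (timeFlow Z) T S
    · rw [indicator_of_mem hp, norm_mul]
      exact mul_le_mul_of_nonneg_left (hM _) (abs_nonneg _)
    · rw [indicator_of_notMem hp, hfS, mul_zero, norm_zero]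
      exact fun h => hp (mem_pastOf hZZ hbb ⟨hx.1.le, hx.2.le⟩ h)

/-- Integrals of the extension of a trace along the orbits. -/
lemma integral_extension_mul (hΩ : IsSmoothConvexDomain Ω ρ)
    (hB : IsTangentField Ω ρ K B) (hZ : IsFlow (field B) Z)
    (hγ : MemLp γ 2 (timed T (sigmaPlus Ω ρ))) {Γ : ℝ × R3 × R3 → ℝ} (hΓm : Measurable Γ)
    (hΓ : ∀ p a, p.2 ∈ GammaPlus Ω ρ →
      Γ (timeFlow Z a p) = (Ioo 0 T ×ˢ (univ : Set (R3 × R3))).indicator γ p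
        * (Ioo 0 T).indicator 1 a) {S : Set (ℝ × R3 × R3)}
    (hS : IsCompact S) {f : ℝ × R3 × R3 → ℝ} (hf : Measurable f) {M : ℝ} (hM : ∀ p, |f p| ≤ M)
    (hfS : ∀ p, p ∉ S → f p = 0) :
    Integrable (fun p => f p * ((univ ×ˢ swept Ω ρ Z).indicator Γ p)) ∧
      ∫ p, f p * ((univ ×ˢ swept Ω ρ Z).indicator Γ p)
        = ∫ p, γ p * (∫ a in Ioo 0 T, f (timeFlow Z a p)) ∂(timed T (sigmaPlus Ω ρ)) := by
  have := hΩ.sFinite_sigmaPlus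
  have hint := integrable_trace_mul hΩ hB hZ hγ hS hf hM hfS
  have hmp := measurePreserving_timeFlow_swept hΩ hB hZ
  have hsw : MeasurableSet ((univ : Set ℝ) ×ˢ swept Ω ρ Z) :=
    MeasurableSet.univ.prod (measurableSet_swept hΩ hB hZ)
  have hres : (volume : Measure ℝ).prod (volume.restrict (swept Ω ρ Z))
      = (volume : Measure (ℝ × R3 × R3)).restrict (univ ×ˢ swept Ω ρ Z) := by
    rw [Measure.volume_eq_prod ℝ (R3 × R3), ← Measure.prod_restrict, Measure.restrict_univ]
  have hres2 : (timed T (sigmaPlus Ω ρ)).prod (volume.restrict (Ioo 0 T))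
      = (((volume : Measure ℝ).prod (sigmaPlus Ω ρ)).prod volume).restrict
        ((Ioo 0 T ×ˢ univ) ×ˢ Ioo 0 T) := by
    rw [timed_eq_restrict, Measure.prod_restrict]
  have hms : MeasurableSet ((Ioo 0 T ×ˢ (univ : Set (R3 × R3))) ×ˢ Ioo 0 T) :=
    (measurableSet_Ioo.prod MeasurableSet.univ).prod measurableSet_Ioo
  have hmem : ∀ᵐ x ∂(((volume : Measure ℝ).prod (sigmaPlus Ω ρ)).prod (volume : Measure ℝ)),
      x.1.2 ∈ GammaPlus Ω ρ := Measure.quasiMeasurePreserving_fst.ae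
        (Measure.quasiMeasurePreserving_snd.ae (ae_sigmaPlus hΩ))
  have hae : (fun x : (ℝ × R3 × R3) × ℝ => f (timeFlow Z x.2 x.1) * Γ (timeFlow Z x.2 x.1))
      =ᵐ[((volume : Measure ℝ).prod (sigmaPlus Ω ρ)).prod volume]
      ((Ioo 0 T ×ˢ univ) ×ˢ Ioo 0 T).indicator
        fun x => γ x.1 * f (timeFlow Z x.2 x.1) := by
    filter_upwards [hmem] with x hx
    rw [hΓ _ _ hx]
    by_cases h1 : x.1 ∈ Ioo 0 T ×ˢ (univ : Set (R3 × R3)) <;> by_cases h2 : x.2 ∈ Ioo 0 T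
    · rw [indicator_of_mem h1, indicator_of_mem h2, indicator_of_mem (mk_mem_prod h1 h2)]
      simp [mul_comm]
    · rw [indicator_of_notMem h2, indicator_of_notMem (s := (Ioo 0 T ×ˢ univ) ×ˢ Ioo 0 T) (fun h => h2 h.2)]
      simp
    · rw [indicator_of_notMem h1, indicator_of_notMem (s := (Ioo 0 T ×ˢ univ) ×ˢ Ioo 0 T) (fun h => h1 h.1)]
      simp
    · rw [indicator_of_notMem h2, indicator_of_notMem (s := (Ioo 0 T ×ˢ univ) ×ˢ Ioo 0 T) (fun h => h2 h.2)]
      simp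
  have hind : (fun p => f p * ((univ ×ˢ swept Ω ρ Z).indicator Γ p))
      = (univ ×ˢ swept Ω ρ Z).indicator fun p => f p * Γ p := by
    funext p
    by_cases hp : p ∈ (univ : Set ℝ) ×ˢ swept Ω ρ Z
    · rw [indicator_of_mem hp, indicator_of_mem hp]
    · rw [indicator_of_notMem hp, indicator_of_notMem hp, mul_zero]
  have hfΓ : Measurable fun p => f p * Γ p := hf.mul hΓm
  have hint2 : Integrable (fun x : (ℝ × R3 × R3) × ℝ =>
      f (timeFlow Z x.2 x.1) * Γ (timeFlow Z x.2 x.1))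
      (((volume : Measure ℝ).prod (sigmaPlus Ω ρ)).prod volume) := by
    rw [integrable_congr hae, integrable_indicator_iff hms, IntegrableOn, ← hres2]
    exact hint
  constructor
  · rw [hind, integrable_indicator_iff hsw, IntegrableOn, ← hres]
    exact (hmp.integrable_comp hfΓ.aestronglyMeasurable).1 hint2
  · rw [hind, integral_indicator hsw, ← hres, ← hmp.map_eq,
      integral_map hmp.measurable.aemeasurable hfΓ.aestronglyMeasurable, integral_congr_ae hae,
      integral_indicator hms, ← hres2, integral_prod _ hint]
    simp_rw [integral_const_mul]

/-- The trace of the difference of two solutions, as an integral along the orbits. -/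
theorem trace_representation (hΩ : IsSmoothConvexDomain Ω ρ) (hB : IsTangentField Ω ρ K B)
    (hZ : IsFlow (field B) Z) (hT : 0 < T)
    (hEB : ∀ x ∈ Ω, B x = E x) (hS : MemLp S 2 (timed T (phase Ω univ)))
    (hq₁ : IsAbsorption Ω q₁) (hq₂ : IsAbsorption Ω q₂)
    (h₁ : IsWeakSolution T Ω ρ E q₁ S g h u₁ γ₁) (h₂ : IsWeakSolution T Ω ρ E q₂ S g h u₂ γ₂)
    (hq : Measurable q) (hq0 : ∀ z, 0 ≤ q z) {M : ℝ} (hqM : ∀ z, q z ≤ M)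
    (hqs : HasCompactSupport q) (hqΩ : ∀ z : R3 × R3, z.1 ∉ Ω → q z = 0)
    (hqq : ∀ᵐ z ∂(phase Ω univ), q z = q₁ z) (hF : Integrable F)
    (hF0 : ∀ p : ℝ × R3 × R3, ¬(p.1 ∈ Ioo 0 T ∧ p.2.1 ∈ Ω) → F p = 0)
    (hFF : ∀ᵐ p ∂(timed T (phase Ω univ)), F p = (q₂ p.2 - q₁ p.2) * u₂ p) :
    ∀ᵐ p ∂(timed T (sigmaPlus Ω ρ)), γ₁ p - γ₂ p
      = ∫ s in (0 : ℝ)..p.1, F (p.1 - s, Z (-s) p.2) * attenuation (fun r => Z (-r)) q s p.2 := by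
  have := hΩ.sFinite_sigmaPlus
  have hb := lipschitzWith_field hB.lipschitz
  have m3 : MemLp (fun p => γ₁ p - γ₂ p) 2 (timed T (sigmaPlus Ω ρ)) :=
    h₁.memLp_trace.sub h₂.memLp_trace
  set γ : ℝ × R3 × R3 → ℝ := m3.1.mk _ with hγdef
  have hγm : Measurable γ := m3.1.stronglyMeasurable_mk.measurable
  have hγe : (fun p => γ₁ p - γ₂ p) =ᵐ[timed T (sigmaPlus Ω ρ)] γ := m3.1.ae_eq_mk
  have hγ : MemLp γ 2 (timed T (sigmaPlus Ω ρ)) := (memLp_congr_ae hγe).1 m3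
  obtain ⟨Γ, hΓm, hΓ⟩ := exists_extension_along_flow hΩ hB hZ T hγm
  set W := forward Z q F T with hW
  have hWi : Integrable W := integrable_forward hΩ hB.lipschitz hZ hq hq0 hF
  -- Outside the closure of `Ω` the forward solution should carry the trace unchanged along the
  -- orbits; `G` measures the failure of this.
  set G : ℝ × R3 × R3 → ℝ := fun p => W p - (univ ×ˢ swept Ω ρ Z).indicator Γ p with hG
  have hsw : MeasurableSet ((univ : Set ℝ) ×ˢ swept Ω ρ Z) :=
    MeasurableSet.univ.prod (measurableSet_swept hΩ hB hZ)
  have hΓli : LocallyIntegrable ((univ ×ˢ swept Ω ρ Z).indicator Γ)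
      (volume : Measure (ℝ × R3 × R3)) := by
    rw [locallyIntegrable_iff]
    intro S hS
    have := (integral_extension_mul hΩ hB hZ hγ hΓm hΓ hS
      (f := S.indicator 1) ((measurable_one).indicator hS.measurableSet) (M := 1)
      (fun p => by by_cases hp : p ∈ S <;> simp [hp]) (fun p hp => by simp [hp])).1
    rw [← integrable_indicator_iff hS.measurableSet]
    refine this.congr (Eventually.of_forall fun p => ?_)
    by_cases hp : p ∈ S <;> simp [hp]
  have hGli : LocallyIntegrable G := hWi.locallyIntegrable.sub hΓli
  set U : Set (ℝ × R3 × R3) := {p | p.1 < T ∧ p.2.1 ∉ closure Ω} with hU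
  have hUo : IsOpen U := (isOpen_lt continuous_fst continuous_const).inter
    (isClosed_closure.isOpen_compl.preimage (continuous_fst.comp continuous_snd))
  -- The integral of `G` against every smooth `ψ` supported in `U` vanishes, by duality of the
  -- forward and backward solutions and the tested weak equation.
  have hG0 : ∀ᵐ p, p ∈ U → G p = 0 := by
    refine hUo.ae_eq_zero_of_integral_contDiff_smul_eq_zero (hGli.locallyIntegrableOn U) ?_
    intro ψ hψ hψs hψU
    obtain ⟨M', hM'⟩ := hψ.continuous.bounded_above_of_compact_support hψs
    have wt := weak_transport hΩ hB hZ hT hEB hS hq₁ hq₂ h₁ h₂ hq hq0 hqM hqs hqq hψ hψs hψU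
    obtain ⟨i2, e2⟩ := integral_extension_mul hΩ hB hZ hγ hΓm hΓ hψs.isCompact
      hψ.continuous.measurable hM' (fun p hp => image_eq_zero_of_notMem_tsupport hp)
    have i1 : Integrable fun p => ψ p * W p :=
      hWi.bdd_mul hψ.continuous.aestronglyMeasurable (Eventually.of_forall hM')
    simp only [smul_eq_mul, hG, mul_sub]
    rw [integral_sub i1 i2, e2, sub_eq_zero,
      ← integral_mul_duhamel hΩ hB.lipschitz hZ hT.le hq hq0 hF hψ.continuous hM']
    have e3 : ∫ p, F p * duhamel (timeFlow Z) (fun p => q p.2) ψ T p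
        = ∫ p, (q₂ p.2 - q₁ p.2) * u₂ p * duhamel (timeFlow Z) (fun p => q p.2) ψ T p
          ∂(timed T (phase Ω univ)) := by
      have hres : timed T (phase Ω univ)
          = (volume : Measure (ℝ × R3 × R3)).restrict (Ioo 0 T ×ˢ (Ω ×ˢ univ)) := by
        rw [timed, phase, Measure.prod_restrict, ← Measure.volume_eq_prod]
      rw [← setIntegral_eq_integral_of_forall_compl_eq_zero
        (s := Ioo 0 T ×ˢ (Ω ×ˢ (univ : Set R3))), ← hres]
      · refine integral_congr_ae ?_
        filter_upwards [hFF] with p hp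
        rw [hp]
      · intro p hp
        rw [hF0 p (fun h => hp ⟨h.1, h.2, trivial⟩), zero_mul]
    rw [e3, wt]
    refine integral_congr_ae ?_
    filter_upwards [hγe, ae_timed_of_ae T (ae_sigmaPlus hΩ)] with p hp hpΓ
    rw [hp]
    congr 1
    rw [duhamel, intervalIntegral.integral_of_le hT.le, integral_Ioc_eq_integral_Ioo]
    refine setIntegral_congr_fun measurableSet_Ioo fun s hs => ?_
    -- From an outgoing point the orbit never meets `Ω` again, so no absorption takes place.
    have hatt : attenuation (timeFlow Z) (fun p => q p.2) s p = 1 := by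
      rw [attenuation, intervalIntegral.integral_congr (g := fun _ => (0 : ℝ))]
      · simp
      · intro r hr
        rw [uIcc_of_le hs.1.le] at hr
        refine hqΩ _ ?_
        rcases hr.1.eq_or_lt with h0 | h0
        · change (Z r p.2).1 ∉ Ω
          rw [← h0, hZ.zero]
          exact hΩ.notMem_of_mem_frontier hpΓ.1
        · exact fun h => fst_notMem_closure_of_gammaPlus hΩ hB hZ hpΓ h0 (subset_closure h)
    rw [hatt, mul_one]
  have hmp := measurePreserving_timeFlow_swept hΩ hB hZ
  have hac : (volume : Measure ℝ).prod (volume.restrict (swept Ω ρ Z))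
      ≪ (volume : Measure (ℝ × R3 × R3)) :=
    (Measure.AbsolutelyContinuous.refl _).prod
      (Measure.absolutelyContinuous_of_le Measure.restrict_le_self)
  -- The identity holds almost everywhere in space-time. The change of variables makes it hold for
  -- almost every boundary datum at almost every later time.
  have hpull : ∀ᵐ p ∂((volume : Measure ℝ).prod (sigmaPlus Ω ρ)), ∀ᵐ a : ℝ,
      timeFlow Z a p ∈ U → G (timeFlow Z a p) = 0 :=
    Measure.ae_ae_of_ae_prod (hmp.quasiMeasurePreserving.ae (hac.ae_le hG0))
  have hpull' : ∀ᵐ p ∂(timed T (sigmaPlus Ω ρ)), ∀ᵐ a : ℝ,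
      timeFlow Z a p ∈ U → G (timeFlow Z a p) = 0 := by
    rw [timed_eq_restrict]
    exact ae_restrict_of_ae hpull
  filter_upwards [hpull', hγe, ae_timed_of_ae T (ae_sigmaPlus hΩ), ae_timed_mem T (sigmaPlus Ω ρ)]
    with p hp hpγ hpΓ hpT
  rw [hpγ]
  have hne : (ae (volume.restrict (Ioo 0 (T - p.1)))).NeBot := by
    rw [ae_neBot]
    intro h0
    have := congrArg (fun μ => μ univ) h0
    simp only [Measure.restrict_apply_univ, Real.volume_Ioo, Measure.coe_zero, Pi.zero_apply,
      ENNReal.ofReal_eq_zero] at this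
    linarith [hpT.2]
  -- One good time after the outgoing point and before `T` suffices: there the extension has the
  -- value of the trace, and the forward solution is the integral over the past orbit.
  obtain ⟨a, ha, haI⟩ := ((ae_restrict_of_ae (s := Ioo 0 (T - p.1)) hp).and
    (ae_restrict_mem measurableSet_Ioo)).exists
  have hmU : timeFlow Z a p ∈ U :=
    ⟨by simp only [timeFlow]; linarith [haI.2],
      fst_notMem_closure_of_gammaPlus hΩ hB hZ hpΓ haI.1⟩
  have hval := ha hmU
  have hsm : timeFlow Z a p ∈ (univ : Set ℝ) ×ˢ swept Ω ρ Z :=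
    ⟨trivial, -a, by simp only [timeFlow]; rwa [hZ.neg_apply hb]⟩
  simp only [hG] at hval
  rw [indicator_of_mem hsm, hΓ p a hpΓ,
    indicator_of_mem (show p ∈ Ioo 0 T ×ˢ (univ : Set (R3 × R3)) from ⟨hpT, trivial⟩),
    indicator_of_mem (show a ∈ Ioo 0 T from ⟨haI.1, by linarith [haI.2, hpT.1]⟩),
    Pi.one_apply, mul_one, sub_eq_zero] at hval
  rw [← hval, hW]
  exact forward_timeFlow hΩ hB hZ hq hq0 hqM hqΩ
    (fun p' hp' => hF0 p' fun h => hp' ⟨h.1.1, h.2⟩) hpΓ hpT.1 haI.1 (by linarith [haI.2])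

end Identification

/-! ### Volterra inequalities and convolutions in time. -/

section Volterra

lemma intervalIntegrable_of_bound {f : ℝ → ℝ} (hf : Measurable f) {M a b : ℝ} (hab : a ≤ b)
    (hM : ∀ t ∈ Icc a b, |f t| ≤ M) : IntervalIntegrable f volume a b := by
  rw [intervalIntegrable_iff_integrableOn_Ioc_of_le hab]
  refine Measure.integrableOn_of_bounded (M := M) (by simp) hf.aestronglyMeasurable ?_
  filter_upwards [ae_restrict_mem measurableSet_Ioc] with t ht
  exact hM t ⟨ht.1.le, ht.2⟩

/-- Nonnegativity of the variance about the mean `I / T`. -/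
lemma sq_integral_le {f : ℝ → ℝ} {T : ℝ} (hT : 0 ≤ T) (hf : IntervalIntegrable f volume 0 T)
    (hf2 : IntervalIntegrable (fun t => f t ^ 2) volume 0 T) :
    (∫ t in (0 : ℝ)..T, f t) ^ 2 ≤ T * ∫ t in (0 : ℝ)..T, f t ^ 2 := by
  rcases hT.eq_or_lt with rfl | hT
  · simp
  set I := ∫ t in (0 : ℝ)..T, f t with hI
  have h0 : 0 ≤ ∫ t in (0 : ℝ)..T, (f t - I / T) ^ 2 :=
    intervalIntegral.integral_nonneg hT.le fun t _ => sq_nonneg _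
  have e : ∫ t in (0 : ℝ)..T, (f t - I / T) ^ 2
      = (∫ t in (0 : ℝ)..T, f t ^ 2) - I ^ 2 / T := by
    have e1 : ∀ t, (f t - I / T) ^ 2 = f t ^ 2 - 2 * (I / T) * f t + (I / T) ^ 2 := fun t => by ring
    simp_rw [e1]
    rw [intervalIntegral.integral_add (hf2.sub (hf.const_mul _)) intervalIntegrable_const,
      intervalIntegral.integral_sub hf2 (hf.const_mul _), intervalIntegral.integral_const_mul,
      intervalIntegral.integral_const, ← hI, smul_eq_mul]
    field_simp
    ring
  rw [e] at h0
  have : I ^ 2 / T ≤ ∫ t in (0 : ℝ)..T, f t ^ 2 := by linarith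
  rwa [div_le_iff₀' hT] at this

/-- A square integral estimate for Volterra inequalities. -/
lemma integral_sq_le_of_volterra {k D : ℝ → ℝ} (hk : Measurable k) (hD : Measurable D)
    {M M' T a b : ℝ} (hT : 0 < T) (ha : 0 ≤ a) (hb : 0 < b) (hk0 : ∀ t, 0 ≤ k t)
    (hkM : ∀ t, k t ≤ M) (hDM : ∀ t ∈ Icc 0 T, |D t| ≤ M')
    (h : ∀ t ∈ Ioo 0 T, k t ≤ a * |D t| + b * ∫ s in (0 : ℝ)..t, k s) :
    ∫ t in (0 : ℝ)..T, k t ^ 2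
      ≤ (2 * a ^ 2 + 2 * a ^ 2 * b ^ 2 * T ^ 2 * Real.exp (b * T) ^ 2)
        * ∫ t in (0 : ℝ)..T, D t ^ 2 := by
  have hki : ∀ c d, IntervalIntegrable k volume c d := fun c d =>
    (intervalIntegrable_const (c := M)).mono_fun' hk.aestronglyMeasurable
      (Eventually.of_forall fun t => by
        simp only [Real.norm_eq_abs]; rw [abs_of_nonneg (hk0 t)]; exact hkM t)
  have hDi : ∀ x ∈ Icc 0 T, IntervalIntegrable (fun t => |D t|) volume 0 x := fun x hx =>
    intervalIntegrable_of_bound (hD.abs) hx.1 (M := M') fun t ht => by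
      rw [abs_abs]; exact hDM t ⟨ht.1, ht.2.trans hx.2⟩
  have hTT : T ∈ Icc 0 T := ⟨hT.le, le_rfl⟩
  set κ : ℝ → ℝ := fun t => ∫ s in (0 : ℝ)..t, k s with hκ
  have hκc : Continuous κ := intervalIntegral.continuous_primitive hki 0
  have hκ0 : ∀ t, 0 ≤ t → 0 ≤ κ t := fun t ht =>
    intervalIntegral.integral_nonneg ht fun s _ => hk0 s
  -- Grönwall is applied to the primitive of `κ`, which is differentiable everywhere, whereas `k` is
  -- only measurable.
  set H : ℝ → ℝ := fun t => ∫ s in (0 : ℝ)..t, κ s with hH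
  have hH0 : ∀ t, 0 ≤ t → 0 ≤ H t := fun t ht =>
    intervalIntegral.integral_nonneg ht fun s hs => hκ0 s hs.1
  have hHd : ∀ t, HasDerivAt H (κ t) t := fun t =>
    intervalIntegral.integral_hasDerivAt_right (hκc.intervalIntegrable 0 t)
      hκc.aestronglyMeasurable.stronglyMeasurableAtFilter hκc.continuousAt
  set α : ℝ := a * ∫ t in (0 : ℝ)..T, |D t| with hα
  have hI0 : 0 ≤ ∫ t in (0 : ℝ)..T, |D t| :=
    intervalIntegral.integral_nonneg hT.le fun s _ => abs_nonneg _
  have hα0 : 0 ≤ α := mul_nonneg ha hI0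
  have hκle : ∀ x ∈ Icc 0 T, κ x ≤ b * H x + α := by
    intro x hx
    have h1 : κ x ≤ ∫ s in (0 : ℝ)..x, (a * |D s| + b * κ s) := by
      refine intervalIntegral.integral_mono_on_of_le_Ioo hx.1 (hki 0 x)
        (((hDi x hx).const_mul a).add ((hκc.intervalIntegrable 0 x).const_mul b)) fun s hs => ?_
      exact h s ⟨hs.1, hs.2.trans_le hx.2⟩
    rw [intervalIntegral.integral_add ((hDi x hx).const_mul a)
      ((hκc.intervalIntegrable 0 x).const_mul b), intervalIntegral.integral_const_mul,
      intervalIntegral.integral_const_mul] at h1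
    have h2 : ∫ t in (0 : ℝ)..x, |D t| ≤ ∫ t in (0 : ℝ)..T, |D t| :=
      intervalIntegral.integral_mono_interval le_rfl hx.1 hx.2
        (Eventually.of_forall fun t => abs_nonneg _) (hDi T hTT)
    have h3 := mul_le_mul_of_nonneg_left h2 ha
    linarith
  have hgr : ∀ x ∈ Icc 0 T, κ x ≤ α * Real.exp (b * T) := by
    intro x hx
    have hG := norm_le_gronwallBound_of_norm_deriv_right_le (f := H) (f' := κ) (δ := 0) (K := b)
      (ε := α) (a := 0) (b := T) (fun t _ => (hHd t).continuousAt.continuousWithinAt)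
      (fun t _ => (hHd t).hasDerivWithinAt) (by simp [hH]) (fun t ht => by
        rw [Real.norm_eq_abs, Real.norm_eq_abs, abs_of_nonneg (hκ0 t ht.1),
          abs_of_nonneg (hH0 t ht.1)]
        exact hκle t ⟨ht.1, ht.2.le⟩) x hx
    rw [gronwallBound_of_K_ne_0 hb.ne', Real.norm_eq_abs, abs_of_nonneg (hH0 x hx.1)] at hG
    simp only [zero_mul, zero_add, sub_zero] at hG
    have h1 := mul_le_mul_of_nonneg_left hG hb.le
    have h2 : b * (α / b * (Real.exp (b * x) - 1)) = α * Real.exp (b * x) - α := by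
      field_simp
    have h3 : Real.exp (b * x) ≤ Real.exp (b * T) :=
      Real.exp_le_exp.2 (mul_le_mul_of_nonneg_left hx.2 hb.le)
    have h4 := mul_le_mul_of_nonneg_left h3 hα0
    linarith [hκle x hx]
  have hD2 : IntervalIntegrable (fun t => D t ^ 2) volume 0 T :=
    intervalIntegrable_of_bound (hD.pow_const 2) hT.le (M := M' ^ 2) fun t ht => by
      rw [abs_pow]; exact pow_le_pow_left₀ (abs_nonneg _) (hDM t ht) 2
  have hk2 : IntervalIntegrable (fun t => k t ^ 2) volume 0 T :=
    intervalIntegrable_of_bound (hk.pow_const 2) hT.le (M := M ^ 2) fun t _ => by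
      rw [abs_pow, abs_of_nonneg (hk0 t)]; exact pow_le_pow_left₀ (hk0 t) (hkM t) 2
  -- Grönwall's bound for `κ` gives `k ≤ a|D| + c`. After squaring, Cauchy–Schwarz bounds `c²` by
  -- the integral of `D²`; this is the second term of the constant.
  set c : ℝ := b * (α * Real.exp (b * T)) with hc
  have hc0 : 0 ≤ c := by positivity
  have hle : ∫ t in (0 : ℝ)..T, k t ^ 2 ≤ ∫ t in (0 : ℝ)..T, (2 * a ^ 2 * D t ^ 2 + 2 * c ^ 2) := by
    refine intervalIntegral.integral_mono_on_of_le_Ioo hT.le hk2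
      ((hD2.const_mul _).add intervalIntegrable_const) fun t ht => ?_
    have h1 : k t ≤ a * |D t| + c :=
      (h t ht).trans (by
        have := mul_le_mul_of_nonneg_left (hgr t ⟨ht.1.le, ht.2.le⟩) hb.le
        linarith)
    have h2 := pow_le_pow_left₀ (hk0 t) h1 2
    have h3 : (a * |D t| + c) ^ 2 ≤ 2 * (a * |D t|) ^ 2 + 2 * c ^ 2 := by
      nlinarith [sq_nonneg (a * |D t| - c)]
    rw [mul_pow, sq_abs] at h3
    linarith
  rw [intervalIntegral.integral_add (hD2.const_mul _) intervalIntegrable_const,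
    intervalIntegral.integral_const_mul, intervalIntegral.integral_const, sub_zero,
    smul_eq_mul] at hle
  have hcs : (∫ t in (0 : ℝ)..T, |D t|) ^ 2 ≤ T * ∫ t in (0 : ℝ)..T, D t ^ 2 := by
    have := sq_integral_le hT.le (hDi T hTT) (by simpa using hD2)
    simpa using this
  have hc2 : c ^ 2 = (a ^ 2 * b ^ 2 * Real.exp (b * T) ^ 2) * (∫ t in (0 : ℝ)..T, |D t|) ^ 2 := by
    rw [hc, hα]; ring
  have hfin := mul_le_mul_of_nonneg_left hcs
    (show 0 ≤ 2 * T * (a ^ 2 * b ^ 2 * Real.exp (b * T) ^ 2) by positivity)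
  rw [hc2] at hle
  linarith

/-- Differentiation of a convolution in time. -/
lemma integral_convolution_eq {A G : ℝ → ℝ} {d : ℝ → ℝ → ℝ} (hA : Measurable A)
    (hG : Measurable G) (hd : Measurable (Function.uncurry d)) {MA MG Md : ℝ}
    (hMA : ∀ s, 0 ≤ s → |A s| ≤ MA) (hMG : ∀ s, |G s| ≤ MG) (hMd : ∀ r s, |d r s| ≤ Md)
    {t : ℝ} (ht : 0 ≤ t) :
    ∫ s in (0 : ℝ)..t, A s * (G s + ∫ r in (0 : ℝ)..(t - s), d r s)
      = ∫ τ in (0 : ℝ)..t, (A τ * G τ + ∫ s in (0 : ℝ)..τ, A s * d (τ - s) s) := by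
  have hMA0 : 0 ≤ MA := (abs_nonneg _).trans (hMA 0 le_rfl)
  have hMd0 : 0 ≤ Md := (abs_nonneg _).trans (hMd 0 0)
  have i1 : IntervalIntegrable (fun s => A s * G s) volume 0 t :=
    intervalIntegrable_of_bound (hA.mul hG) ht (M := MA * MG) fun s hs => by
      rw [Pi.mul_apply, abs_mul]; exact mul_le_mul (hMA s hs.1) (hMG s) (abs_nonneg _) hMA0
  -- After the substitution `τ = r + s` the double integral runs over the triangle `s < τ ≤ t`, and
  -- Fubini exchanges the order.
  set Φ : ℝ → ℝ → ℝ := fun s τ => (Ioi s).indicator (fun τ => A s * d (τ - s) s) τ with hΦ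
  have hΦm : Measurable (Function.uncurry Φ) := by
    have h1 : Measurable fun x : ℝ × ℝ => A x.1 * d (x.2 - x.1) x.1 :=
      (hA.comp measurable_fst).mul
        (hd.comp ((measurable_snd.sub measurable_fst).prodMk measurable_fst))
    exact h1.indicator (measurableSet_lt measurable_fst measurable_snd)
  have hΦM : ∀ s τ, 0 ≤ s → |Φ s τ| ≤ MA * Md := by
    intro s τ hs
    by_cases h : τ ∈ Ioi s
    · simp only [hΦ]
      rw [indicator_of_mem h, abs_mul]
      exact mul_le_mul (hMA s hs) (hMd _ s) (abs_nonneg _) hMA0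
    · simp only [hΦ]
      rw [indicator_of_notMem h, abs_zero]
      positivity
  have hΦi : Integrable (Function.uncurry Φ)
      ((volume.restrict (Ioc 0 t)).prod (volume.restrict (Ioc 0 t))) :=
    Integrable.of_bound hΦm.aestronglyMeasurable (MA * Md) (by
      have hmem : ∀ᵐ x ∂((volume.restrict (Ioc 0 t)).prod (volume.restrict (Ioc 0 t))),
          x.1 ∈ Ioc 0 t :=
        Measure.quasiMeasurePreserving_fst.ae (ae_restrict_mem measurableSet_Ioc)
      filter_upwards [hmem] with x hx using hΦM x.1 x.2 hx.1.le)
  have eL : ∀ s ∈ Ioc 0 t, A s * (∫ r in (0 : ℝ)..(t - s), d r s) = ∫ τ in Ioc 0 t, Φ s τ := by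
    intro s hs
    have h1 := intervalIntegral.integral_comp_sub_right (a := s) (b := t) (fun r => d r s) s
    rw [sub_self] at h1
    rw [← h1, ← intervalIntegral.integral_const_mul, intervalIntegral.integral_of_le hs.2]
    simp only [hΦ]
    rw [setIntegral_indicator measurableSet_Ioi]
    congr 2
    ext x
    simp only [mem_Ioc, mem_inter_iff, mem_Ioi]
    constructor
    · rintro ⟨h1, h2⟩; exact ⟨⟨hs.1.trans h1, h2⟩, h1⟩
    · rintro ⟨⟨_, h2⟩, h3⟩; exact ⟨h3, h2⟩
  have eR : ∀ τ ∈ Ioc 0 t, ∫ s in (0 : ℝ)..τ, A s * d (τ - s) s = ∫ s in Ioc 0 t, Φ s τ := by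
    intro τ hτ
    have : ∀ s, Φ s τ = (Iio τ).indicator (fun s => A s * d (τ - s) s) s := by
      intro s
      simp only [hΦ, indicator, mem_Ioi, mem_Iio]
    simp_rw [this]
    rw [setIntegral_indicator measurableSet_Iio, intervalIntegral.integral_of_le hτ.1.le,
      integral_Ioc_eq_integral_Ioo]
    congr 2
    ext x
    simp only [mem_Ioo, mem_inter_iff, mem_Ioc, mem_Iio]
    constructor
    · rintro ⟨h1, h2⟩; exact ⟨⟨h1, h2.le.trans hτ.2⟩, h2⟩
    · rintro ⟨⟨h1, _⟩, h3⟩; exact ⟨h1, h3⟩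
  have iL : IntervalIntegrable (fun s => A s * ∫ r in (0 : ℝ)..(t - s), d r s) volume 0 t := by
    rw [intervalIntegrable_iff_integrableOn_Ioc_of_le ht]
    refine (hΦi.integral_prod_left).congr ?_
    filter_upwards [ae_restrict_mem measurableSet_Ioc] with s hs using (eL s hs).symm
  have iR : IntervalIntegrable (fun τ => ∫ s in (0 : ℝ)..τ, A s * d (τ - s) s) volume 0 t := by
    rw [intervalIntegrable_iff_integrableOn_Ioc_of_le ht]
    refine (hΦi.integral_prod_right).congr ?_
    filter_upwards [ae_restrict_mem measurableSet_Ioc] with s hs using (eR s hs).symm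
  simp_rw [mul_add]
  rw [intervalIntegral.integral_add i1 iL, intervalIntegral.integral_add i1 iR]
  congr 1
  rw [intervalIntegral.integral_of_le ht, intervalIntegral.integral_of_le ht,
    setIntegral_congr_fun measurableSet_Ioc eL, setIntegral_congr_fun measurableSet_Ioc eR]
  exact integral_integral_swap hΦi

end Volterra

/-! ### Exit before the observation time. -/

section Exit

variable {Ω : Set R3} {ρ : R3 → ℝ} {T : ℝ} {E B : R3 → R3} {K : ℝ≥0}
  {Z : ℝ → R3 × R3 → R3 × R3} {U V : Set R3} {j : Fin 3}

/-- In the presence of a weight, the orbits through `Ω × U` leave `Ω` before the time `T`. -/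
lemma exists_exit_lt (hΩ : IsSmoothConvexDomain Ω ρ) (hB : IsTangentField Ω ρ K B)
    (hZ : IsFlow (field B) Z) (hT : 0 < T) (hEB : ∀ x ∈ Ω, B x = E x)
    (hBj : ∀ x, B x j = 0) (hUV : ∀ w ∈ U, ∀ v : R3, v j = w j → v ∈ V)
    (hV : HasWeight T Ω E V) {z : R3 × R3} (hz : z.1 ∈ Ω) (hzU : z.2 ∈ U) :
    ∃ τ ∈ Ioo 0 T, Z τ z ∈ GammaPlus Ω ρ := by
  obtain ⟨φ₀, β, r, R, γ₀, hβ, hr, hγ₀, hφ, hφb, hTR, hφd⟩ := hV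
  -- A time below `T` that still exceeds `(R - r)/β`; the strict inequality leaves room for an exit
  -- strictly before `T`.
  obtain ⟨t₀, ht₀, ht₀T⟩ := exists_between (max_lt hT hTR)
  have ht0 : 0 < t₀ := (le_max_left _ _).trans_lt ht₀
  have hRt : R - r < β * t₀ := by
    have := (le_max_right _ _).trans_lt ht₀
    rwa [div_lt_iff₀' hβ] at this
  by_cases hstay : ∀ s ∈ Icc 0 t₀, (Z s z).1 ∈ Ω
  · exfalso
    have hVs : ∀ s, (Z s z).2 ∈ V := fun s => hUV z.2 hzU _ (hZ.snd_apply_eq hBj s z)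
    have hd : ∀ s ∈ Icc 0 t₀, HasDerivAt (fun s => φ₀ (Z s z))
        (fderiv ℝ φ₀ (Z s z) (field B (Z s z))) s := by
      intro s hs
      have hdiff : DifferentiableAt ℝ φ₀ (Z s z) :=
        (hφ.differentiableOn (by simp)).differentiableAt
          ((hΩ.isOpen.prod isOpen_univ).mem_nhds ⟨hstay s hs, trivial⟩)
      exact hdiff.hasFDerivAt.comp_hasDerivAt s (hZ.deriv s z)
    have hlow : ∀ s ∈ Icc 0 t₀, β + γ₀ ≤ fderiv ℝ φ₀ (Z s z) (field B (Z s z)) := by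
      intro s hs
      have := hφd _ (hstay s hs) _ (hVs s)
      rw [field, hEB _ (hstay s hs)]
      have e : ((Z s z).1, (Z s z).2) = Z s z := rfl
      rw [e] at this
      linarith
    -- Staying in `Ω` up to `t₀` would raise `φ₀` by at least `(β + γ₀) t₀ > R - r`, more than its
    -- whole range.
    have hmv := (convex_Icc 0 t₀).mul_sub_le_image_sub_of_le_deriv
      (f := fun s => φ₀ (Z s z)) (C := β + γ₀)
      (fun s hs => (hd s hs).continuousAt.continuousWithinAt)
      (fun s hs => (hd s (interior_subset hs)).differentiableAt.differentiableWithinAt)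
      (fun s hs => by rw [(hd s (interior_subset hs)).deriv]; exact hlow s (interior_subset hs))
      0 ⟨le_rfl, ht0.le⟩ t₀ ⟨ht0.le, le_rfl⟩ ht0.le
    have b1 := (hφb _ (hstay 0 ⟨le_rfl, ht0.le⟩) _ (hVs 0)).1
    have b2 := (hφb _ (hstay t₀ ⟨ht0.le, le_rfl⟩) _ (hVs t₀)).2
    have e : ∀ s, ((Z s z).1, (Z s z).2) = Z s z := fun s => rfl
    rw [e] at b1 b2
    nlinarith
  · push Not at hstay
    obtain ⟨s, hs, hout⟩ := hstay
    have hs0 : 0 < s := by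
      refine lt_of_le_of_ne hs.1 fun h => hout ?_
      rw [← h, hZ.zero]; exact hz
    obtain ⟨τ, hτ, hΓ, -⟩ := exists_exit hΩ hB hZ hz hs0 hout
    exact ⟨τ, ⟨hτ.1, hτ.2.trans_lt (hs.2.trans_lt ht₀T)⟩, hΓ⟩

end Exit

/-! ### Integrals over the outgoing boundary. -/

section TraceMeasure

variable {Ω : Set R3} {ρ : R3 → ℝ} {T : ℝ} {B : R3 → R3} {K : ℝ≥0}
  {Z : ℝ → R3 × R3 → R3 × R3}

lemma lintegral_swept (hΩ : IsSmoothConvexDomain Ω ρ) (hB : IsTangentField Ω ρ K B)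
    (hZ : IsFlow (field B) Z) {f : R3 × R3 → ℝ≥0∞} (hf : Measurable f) :
    ∫⁻ p, f (Z (-p.1) p.2) ∂((volume : Measure ℝ).prod (sigmaPlus Ω ρ))
      = ∫⁻ z in swept Ω ρ Z, f z := by
  have := hΩ.sFinite_sigmaPlus
  have h1 : MeasurePreserving (Prod.map (fun a : ℝ => -a) (id : R3 × R3 → R3 × R3))
      (volume.prod (sigmaPlus Ω ρ)) (volume.prod (sigmaPlus Ω ρ)) :=
    (Measure.measurePreserving_neg volume).prod (MeasurePreserving.id _)
  have h2 := (measurePreserving_swept hΩ hB hZ).comp h1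
  rw [← h2.lintegral_comp hf]
  rfl

lemma lintegral_trace_le (hΩ : IsSmoothConvexDomain Ω ρ) (hB : IsTangentField Ω ρ K B)
    (hZ : IsFlow (field B) Z) {f : R3 × R3 → ℝ≥0∞} (hf : Measurable f) :
    ∫⁻ p, f (Z (-p.1) p.2) ∂(timed T (sigmaPlus Ω ρ)) ≤ ∫⁻ z, f z := by
  have := hΩ.sFinite_sigmaPlus
  rw [timed_eq_restrict]
  refine (setLIntegral_le_lintegral _ _).trans ?_
  rw [lintegral_swept hΩ hB hZ hf]
  exact setLIntegral_le_lintegral _ _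

/-- The exit hypothesis puts all the mass on orbits through `Γ₊`. As the crossing is unique, the
times that contribute lie in `(0, T)`, so restricting to them loses nothing. -/
lemma lintegral_le_trace (hΩ : IsSmoothConvexDomain Ω ρ) (hB : IsTangentField Ω ρ K B)
    (hZ : IsFlow (field B) Z) {f : R3 × R3 → ℝ≥0∞} (hf : Measurable f)
    (hexit : ∀ z, f z ≠ 0 → ∃ τ ∈ Ioo 0 T, Z τ z ∈ GammaPlus Ω ρ) :
    ∫⁻ z, f z ≤ ∫⁻ p, f (Z (-p.1) p.2) ∂(timed T (sigmaPlus Ω ρ)) := by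
  have hb := lipschitzWith_field hB.lipschitz
  have := hΩ.sFinite_sigmaPlus
  have e1 : ∫⁻ z in swept Ω ρ Z, f z = ∫⁻ z, f z := by
    rw [← lintegral_indicator (measurableSet_swept hΩ hB hZ)]
    congr 1
    funext z
    by_cases hz : z ∈ swept Ω ρ Z
    · rw [indicator_of_mem hz]
    · rw [indicator_of_notMem hz]
      by_contra hne
      obtain ⟨τ, -, hτ⟩ := hexit z (Ne.symm hne)
      exact hz ⟨τ, hτ⟩
  rw [← e1, ← lintegral_swept hΩ hB hZ hf, timed_eq_restrict,
    ← lintegral_indicator (measurableSet_Ioo.prod MeasurableSet.univ)]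
  refine lintegral_mono_ae ?_
  have hmem : ∀ᵐ p ∂((volume : Measure ℝ).prod (sigmaPlus Ω ρ)), p.2 ∈ GammaPlus Ω ρ :=
    Measure.quasiMeasurePreserving_snd.ae (ae_sigmaPlus hΩ)
  filter_upwards [hmem] with p hp
  by_cases h0 : f (Z (-p.1) p.2) = 0
  · rw [h0]; exact zero_le
  · obtain ⟨τ, hτ, hΓ⟩ := hexit _ h0
    rw [← hZ.add hb] at hΓ
    have := flow_of_gammaPlus_eq hΩ hB hZ hp hΓ rfl
    have hpτ : p.1 = τ := by linarith
    rw [indicator_of_mem (show p ∈ Ioo 0 T ×ˢ (univ : Set (R3 × R3)) from ⟨hpτ ▸ hτ, trivial⟩)]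

end TraceMeasure

/-! ### Square integrals over boundary and phase space. -/

section SquareIntegrals

lemma enorm_sq_eq_ofReal (x : ℝ) : ‖x‖ₑ ^ 2 = ENNReal.ofReal (x ^ 2) := by
  rw [← ofReal_norm, ← ENNReal.ofReal_pow (norm_nonneg _), Real.norm_eq_abs, sq_abs]

lemma eLpNorm_two_eq {α : Type*} [MeasurableSpace α] (f : α → ℝ) (μ : Measure α) :
    eLpNorm f 2 μ = (∫⁻ x, ‖f x‖ₑ ^ 2 ∂μ) ^ (1 / 2 : ℝ) := by
  rw [eLpNorm_eq_lintegral_rpow_enorm_toReal (by norm_num) (by norm_num)]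
  simp

lemma eLpNorm_le_of_lintegral_sq_le {α β : Type*} [MeasurableSpace α] [MeasurableSpace β]
    {f : α → ℝ} {g : β → ℝ} {μ : Measure α} {ν : Measure β} {c : ℝ} (hc : 0 ≤ c)
    (h : ∫⁻ x, ‖f x‖ₑ ^ 2 ∂μ ≤ ENNReal.ofReal (c ^ 2) * ∫⁻ x, ‖g x‖ₑ ^ 2 ∂ν) :
    eLpNorm f 2 μ ≤ ENNReal.ofReal c * eLpNorm g 2 ν := by
  rw [eLpNorm_two_eq, eLpNorm_two_eq]
  refine (ENNReal.rpow_le_rpow h (by norm_num)).trans ?_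
  rw [ENNReal.mul_rpow_of_nonneg _ _ (by norm_num), ENNReal.ofReal_pow hc]
  refine le_of_eq ?_
  congr 1
  rw [← ENNReal.rpow_natCast, ← ENNReal.rpow_mul]
  norm_num

lemma lintegral_timed_sq {T : ℝ} (hT : 0 ≤ T) {μ : Measure (R3 × R3)} [SFinite μ]
    {f : ℝ × R3 × R3 → ℝ} (hf : Measurable f) {M : ℝ}
    (hM : ∀ t ∈ Icc 0 T, ∀ y, |f (t, y)| ≤ M) :
    ∫⁻ p, ‖f p‖ₑ ^ 2 ∂(timed T μ) = ∫⁻ y, ENNReal.ofReal (∫ t in (0 : ℝ)..T, f (t, y) ^ 2) ∂μ := by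
  rw [timed, lintegral_prod_symm _ (hf.enorm.pow_const 2).aemeasurable]
  refine lintegral_congr fun y => ?_
  simp_rw [enorm_sq_eq_ofReal]
  rw [intervalIntegral.integral_of_le hT, integral_Ioc_eq_integral_Ioo,
    ofReal_integral_eq_lintegral_ofReal]
  · have hm : Measurable fun t => f (t, y) := hf.comp (measurable_id.prodMk measurable_const)
    refine Measure.integrableOn_of_bounded (M := M ^ 2) (by simp)
      (hm.pow_const 2).aestronglyMeasurable ?_
    filter_upwards [ae_restrict_mem measurableSet_Ioo] with t ht
    rw [Real.norm_eq_abs, abs_pow]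
    exact pow_le_pow_left₀ (abs_nonneg _) (hM t ⟨ht.1.le, ht.2.le⟩ y) 2
  · exact Eventually.of_forall fun t => sq_nonneg _

lemma lintegral_timed_sq_le {T : ℝ} (hT : 0 ≤ T) {μ : Measure (R3 × R3)} [SFinite μ]
    {f g : ℝ × R3 × R3 → ℝ} (hf : Measurable f) (hg : Measurable g) {M M' c : ℝ} (hc : 0 ≤ c)
    (hM : ∀ t ∈ Icc 0 T, ∀ y, |f (t, y)| ≤ M) (hM' : ∀ t ∈ Icc 0 T, ∀ y, |g (t, y)| ≤ M')
    (h : ∀ y, ∫ t in (0 : ℝ)..T, f (t, y) ^ 2 ≤ c * ∫ t in (0 : ℝ)..T, g (t, y) ^ 2) :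
    ∫⁻ p, ‖f p‖ₑ ^ 2 ∂(timed T μ) ≤ ENNReal.ofReal c * ∫⁻ p, ‖g p‖ₑ ^ 2 ∂(timed T μ) := by
  rw [lintegral_timed_sq hT hf hM, lintegral_timed_sq hT hg hM',
    ← lintegral_const_mul' _ _ ENNReal.ofReal_ne_top]
  refine lintegral_mono fun y => ?_
  rw [← ENNReal.ofReal_mul hc]
  exact ENNReal.ofReal_le_ofReal (h y)

end SquareIntegrals

/-! ### Estimates of the time derivative of the trace. -/

section TraceDerivative

variable {Ω : Set R3} {ρ : R3 → ℝ} {T : ℝ} {B : R3 → R3} {K : ℝ≥0}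
  {Z : ℝ → R3 × R3 → R3 × R3} {q Q G : R3 × R3 → ℝ} {d : ℝ × R3 × R3 → ℝ}

/-- The value of `Q` at time `s` in the past of `y`, attenuated by `q` on the way. -/
def backValue (Z : ℝ → R3 × R3 → R3 × R3) (q Q : R3 × R3 → ℝ) (s : ℝ) (y : R3 × R3) : ℝ :=
  Q (Z (-s) y) * attenuation (fun r => Z (-r)) q s y

/-- The time derivative of the trace of the solution with absorption `q`, whose source is `Q`
times the function with initial value `G` and time derivative `d`. -/
def traceDeriv (Z : ℝ → R3 × R3 → R3 × R3) (q Q G : R3 × R3 → ℝ) (d : ℝ × R3 × R3 → ℝ)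
    (p : ℝ × R3 × R3) : ℝ :=
  backValue Z q Q p.1 p.2 * G (Z (-p.1) p.2)
    + ∫ s in (0 : ℝ)..p.1, backValue Z q Q s p.2 * d (p.1 - s, Z (-s) p.2)

lemma measurable_back (hB : LipschitzWith K B) (hZ : IsFlow (field B) Z) :
    Measurable fun p : ℝ × R3 × R3 => Z (-p.1) p.2 :=
  (measurable_flow hB hZ).comp (measurable_fst.neg.prodMk measurable_snd)

lemma measurable_backValue (hB : LipschitzWith K B) (hZ : IsFlow (field B) Z) (hq : Measurable q)
    (hQ : Measurable Q) : Measurable fun p : ℝ × R3 × R3 => backValue Z q Q p.1 p.2 :=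
  (hQ.comp (measurable_back hB hZ)).mul
    (measurable_attenuation (Z := fun r => Z (-r)) (measurable_back hB hZ) hq)

lemma measurable_traceDeriv (hB : LipschitzWith K B) (hZ : IsFlow (field B) Z) (hq : Measurable q)
    (hQ : Measurable Q) (hG : Measurable G) (hd : Measurable d) :
    Measurable (traceDeriv Z q Q G d) := by
  have h1 := measurable_backValue hB hZ hq hQ
  have h2 : Measurable (Function.uncurry fun (r : ℝ) (p : ℝ × R3 × R3) =>
      backValue Z q Q r p.2 * d (p.1 - r, Z (-r) p.2)) := by
    have e1 : Measurable fun x : ℝ × ℝ × R3 × R3 => (x.1, x.2.2) :=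
      measurable_fst.prodMk (measurable_snd.comp measurable_snd)
    exact (h1.comp e1).mul (hd.comp
      (((measurable_fst.comp measurable_snd).sub measurable_fst).prodMk
        ((measurable_back hB hZ).comp e1)))
  exact (h1.mul (hG.comp (measurable_back hB hZ))).add
    ((measurable_intervalIntegral h2).comp (measurable_fst.prodMk measurable_id))

lemma abs_backValue_le (hq0 : ∀ z, 0 ≤ q z) {s : ℝ} (hs : 0 ≤ s) (y : R3 × R3) :
    |backValue Z q Q s y| ≤ |Q (Z (-s) y)| := by
  rw [backValue, abs_mul, abs_of_nonneg (attenuation_nonneg q s y)]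
  exact mul_le_of_le_one_right (abs_nonneg _) (attenuation_le_one hq0 hs y)

lemma measurable_back_time (hZ : IsFlow (field B) Z) (y : R3 × R3) :
    Measurable fun s => Z (-s) y :=
  ((hZ.continuous_time y).comp continuous_neg).measurable

lemma measurable_backValue_time (hB : LipschitzWith K B) (hZ : IsFlow (field B) Z)
    (hq : Measurable q) (hQ : Measurable Q) (y : R3 × R3) :
    Measurable fun s => backValue Z q Q s y :=
  (measurable_backValue hB hZ hq hQ).comp (measurable_id.prodMk measurable_const)

/-- The trace is a convolution in time in which the coefficient and the attenuation depend on `s`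
alone; the derivative therefore falls on the other factor, and the coefficient needs no regularity.
-/
lemma integral_traceDeriv (hB : LipschitzWith K B) (hZ : IsFlow (field B) Z) (hq : Measurable q)
    (hQ : Measurable Q) (hG : Measurable G) (hd : Measurable d) (hq0 : ∀ z, 0 ≤ q z)
    {M M' : ℝ} (hQM : ∀ z, |Q z| ≤ M) (hGM : ∀ z, |G z| ≤ M') (hdM : ∀ p, |d p| ≤ M')
    {t : ℝ} (ht : 0 ≤ t) (y : R3 × R3) :
    ∫ s in (0 : ℝ)..t, backValue Z q Q s y
        * (G (Z (-s) y) + ∫ r in (0 : ℝ)..(t - s), d (r, Z (-s) y))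
      = ∫ s in (0 : ℝ)..t, traceDeriv Z q Q G d (s, y) :=
  integral_convolution_eq (d := fun r s => d (r, Z (-s) y))
    (measurable_backValue_time hB hZ hq hQ y)
    (hG.comp (measurable_back_time hZ y))
    (hd.comp (measurable_fst.prodMk ((measurable_back_time hZ y).comp measurable_snd)))
    (fun _ hs => (abs_backValue_le hq0 hs y).trans (hQM _)) (fun _ => hGM _) (fun _ _ => hdM _) ht

lemma abs_integral_backValue_mul_le (hB : LipschitzWith K B) (hZ : IsFlow (field B) Z)
    (hQ : Measurable Q) (hq0 : ∀ z, 0 ≤ q z)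
    {M M' : ℝ} (hQM : ∀ z, |Q z| ≤ M) (hdM : ∀ p, |d p| ≤ M') (hM' : 0 ≤ M')
    {t : ℝ} (ht : 0 ≤ t) (y : R3 × R3) :
    |∫ s in (0 : ℝ)..t, backValue Z q Q s y * d (t - s, Z (-s) y)|
      ≤ M' * ∫ s in (0 : ℝ)..t, |Q (Z (-s) y)| := by
  have hb := lipschitzWith_field hB
  rw [← intervalIntegral.integral_const_mul, ← Real.norm_eq_abs]
  refine intervalIntegral.norm_integral_le_of_norm_le ht (Eventually.of_forall fun s hs => ?_) ?_
  · rw [norm_mul, mul_comm]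
    exact mul_le_mul (hdM _) (abs_backValue_le hq0 hs.1.le y) (norm_nonneg _) hM'
  · refine IntervalIntegrable.const_mul (intervalIntegrable_of_bound
      ((hQ.comp (measurable_back_time hZ y)).abs) ht (M := M) fun s _ => ?_) _
    rw [abs_abs]
    exact hQM _

lemma abs_traceDeriv_le (hB : LipschitzWith K B) (hZ : IsFlow (field B) Z)
    (hQ : Measurable Q) (hq0 : ∀ z, 0 ≤ q z)
    {M M' : ℝ} (hQM : ∀ z, |Q z| ≤ M) (hGM : ∀ z, |G z| ≤ M') (hdM : ∀ p, |d p| ≤ M')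
    {t : ℝ} (ht : 0 ≤ t) (y : R3 × R3) :
    |traceDeriv Z q Q G d (t, y)|
      ≤ M' * |Q (Z (-t) y)| + M' * ∫ s in (0 : ℝ)..t, |Q (Z (-s) y)| := by
  have hM' : 0 ≤ M' := (abs_nonneg _).trans (hGM 0)
  rw [traceDeriv]
  refine (abs_add_le _ _).trans (add_le_add ?_
    (abs_integral_backValue_mul_le hB hZ hQ hq0 hQM hdM hM' ht y))
  rw [abs_mul, mul_comm]
  exact mul_le_mul (hGM _) (abs_backValue_le hq0 ht y) (abs_nonneg _) hM'

lemma integral_abs_back_le (hZ : IsFlow (field B) Z) (hQ : Measurable Q) {M : ℝ}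
    (hQM : ∀ z, |Q z| ≤ M) {t : ℝ} (ht : t ∈ Icc 0 T) (y : R3 × R3) :
    ∫ s in (0 : ℝ)..t, |Q (Z (-s) y)| ≤ ∫ s in (0 : ℝ)..T, |Q (Z (-s) y)| :=
  intervalIntegral.integral_mono_interval le_rfl ht.1 ht.2
    (Eventually.of_forall fun _ => abs_nonneg _)
    (intervalIntegrable_of_bound ((hQ.comp (measurable_back_time hZ y)).abs) (ht.1.trans ht.2)
      (M := M) fun s _ => by rw [abs_abs]; exact hQM _)

lemma integral_abs_back_le_const {M : ℝ} (hQM : ∀ z, |Q z| ≤ M) (hT : 0 ≤ T)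
    (y : R3 × R3) : ∫ s in (0 : ℝ)..T, |Q (Z (-s) y)| ≤ M * T := by
  have := intervalIntegral.norm_integral_le_of_norm_le_const
    (f := fun s => |Q (Z (-s) y)|) (a := 0) (b := T) (C := M) fun s _ => by
      rw [Real.norm_eq_abs, abs_abs]; exact hQM _
  rw [sub_zero, abs_of_nonneg hT] at this
  exact (le_abs_self _).trans this

lemma abs_traceDeriv_le_const (hB : LipschitzWith K B) (hZ : IsFlow (field B) Z)
    (hQ : Measurable Q) (hq0 : ∀ z, 0 ≤ q z)
    {M M' : ℝ} (hQM : ∀ z, |Q z| ≤ M) (hGM : ∀ z, |G z| ≤ M') (hdM : ∀ p, |d p| ≤ M')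
    {t : ℝ} (ht : t ∈ Icc 0 T) (y : R3 × R3) :
    |traceDeriv Z q Q G d (t, y)| ≤ M' * M + M' * (M * T) := by
  have hM' : 0 ≤ M' := (abs_nonneg _).trans (hGM 0)
  refine (abs_traceDeriv_le hB hZ hQ hq0 hQM hGM hdM ht.1 y).trans ?_
  have h1 := mul_le_mul_of_nonneg_left (hQM (Z (-t) y)) hM'
  have h2 := mul_le_mul_of_nonneg_left ((integral_abs_back_le hZ hQ hQM ht y).trans
    (integral_abs_back_le_const hQM (ht.1.trans ht.2) y)) hM'
  linarith

lemma integral_traceDeriv_sq_le (hB : LipschitzWith K B) (hZ : IsFlow (field B) Z)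
    (hq : Measurable q) (hQ : Measurable Q) (hG : Measurable G) (hd : Measurable d)
    (hq0 : ∀ z, 0 ≤ q z) (hT : 0 ≤ T)
    {M M' : ℝ} (hQM : ∀ z, |Q z| ≤ M) (hGM : ∀ z, |G z| ≤ M') (hdM : ∀ p, |d p| ≤ M')
    (y : R3 × R3) :
    ∫ t in (0 : ℝ)..T, traceDeriv Z q Q G d (t, y) ^ 2
      ≤ (2 * M' * (1 + T)) ^ 2 * ∫ t in (0 : ℝ)..T, Q (Z (-t) y) ^ 2 := by
  have hM' : 0 ≤ M' := (abs_nonneg _).trans (hGM 0)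
  set I := ∫ s in (0 : ℝ)..T, |Q (Z (-s) y)| with hI
  have hI0 : 0 ≤ I := intervalIntegral.integral_nonneg hT fun _ _ => abs_nonneg _
  have hQy : Measurable fun s => Q (Z (-s) y) := hQ.comp (measurable_back_time hZ y)
  have hQ2 : IntervalIntegrable (fun t => Q (Z (-t) y) ^ 2) volume 0 T :=
    intervalIntegrable_of_bound (hQy.pow_const 2) hT (M := M ^ 2) fun t _ => by
      rw [abs_pow]; exact pow_le_pow_left₀ (abs_nonneg _) (hQM _) 2
  have hQ1 : IntervalIntegrable (fun t => |Q (Z (-t) y)|) volume 0 T :=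
    intervalIntegrable_of_bound hQy.abs hT (M := M) fun t _ => by rw [abs_abs]; exact hQM _
  have hDm : Measurable fun t => traceDeriv Z q Q G d (t, y) :=
    (measurable_traceDeriv hB hZ hq hQ hG hd).comp (measurable_id.prodMk measurable_const)
  have hD2 : IntervalIntegrable (fun t => traceDeriv Z q Q G d (t, y) ^ 2) volume 0 T :=
    intervalIntegrable_of_bound (hDm.pow_const 2) hT (M := (M' * M + M' * (M * T)) ^ 2)
      fun t ht => by
        rw [abs_pow]
        exact pow_le_pow_left₀ (abs_nonneg _)
          (abs_traceDeriv_le_const hB hZ hQ hq0 hQM hGM hdM ht y) 2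
  have h1 : ∫ t in (0 : ℝ)..T, traceDeriv Z q Q G d (t, y) ^ 2
      ≤ ∫ t in (0 : ℝ)..T, (2 * M' ^ 2 * Q (Z (-t) y) ^ 2 + 2 * M' ^ 2 * I ^ 2) := by
    refine intervalIntegral.integral_mono_on hT hD2
      ((hQ2.const_mul _).add intervalIntegrable_const) fun t ht => ?_
    have h2 := abs_traceDeriv_le hB hZ hQ hq0 hQM hGM hdM ht.1 y
    have h3 := mul_le_mul_of_nonneg_left (integral_abs_back_le hZ hQ hQM ht y) hM'
    have h4 : |traceDeriv Z q Q G d (t, y)| ≤ M' * |Q (Z (-t) y)| + M' * I := by linarith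
    have h5 := pow_le_pow_left₀ (abs_nonneg _) h4 2
    rw [sq_abs] at h5
    rw [← sq_abs (Q (Z (-t) y))]
    nlinarith [sq_nonneg (M' * |Q (Z (-t) y)| - M' * I)]
  rw [intervalIntegral.integral_add (hQ2.const_mul _) intervalIntegrable_const,
    intervalIntegral.integral_const_mul, intervalIntegral.integral_const, sub_zero,
    smul_eq_mul] at h1
  have hcs : I ^ 2 ≤ T * ∫ t in (0 : ℝ)..T, Q (Z (-t) y) ^ 2 := by
    have := sq_integral_le hT hQ1 (by simpa using hQ2)
    simpa using this
  have hJ0 : 0 ≤ ∫ t in (0 : ℝ)..T, Q (Z (-t) y) ^ 2 :=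
    intervalIntegral.integral_nonneg hT fun _ _ => sq_nonneg _
  set J := ∫ t in (0 : ℝ)..T, Q (Z (-t) y) ^ 2
  have h6 := mul_le_mul_of_nonneg_left hcs (show 0 ≤ T * (2 * M' ^ 2) by positivity)
  -- The estimates give the factor `2M'²(1 + T²)`; this is the amount by which `(2M'(1 + T))²`
  -- exceeds it.
  have h7 : 0 ≤ M' ^ 2 * (2 + 8 * T + 2 * T ^ 2) * J := by positivity
  nlinarith

lemma attenuation_ge {M₀ : ℝ} (hq0 : ∀ z, 0 ≤ q z) (hqM : ∀ z, q z ≤ M₀)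
    {t : ℝ} (ht : t ∈ Icc 0 T) (y : R3 × R3) :
    Real.exp (-(M₀ * T)) ≤ attenuation (fun r => Z (-r)) q t y := by
  have hM₀ : 0 ≤ M₀ := (hq0 0).trans (hqM 0)
  rw [attenuation, Real.exp_le_exp, neg_le_neg_iff]
  have := intervalIntegral.norm_integral_le_of_norm_le_const
    (f := fun r => q (Z (-r) y)) (a := 0) (b := t) (C := M₀) fun s _ => by
      rw [Real.norm_eq_abs, abs_of_nonneg (hq0 _)]; exact hqM _
  rw [sub_zero, abs_of_nonneg ht.1] at this
  exact (le_abs_self _).trans (this.trans (mul_le_mul_of_nonneg_left ht.2 hM₀))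

/-- The leading term of the trace derivative is solved for the coefficient. Dividing by the
attenuation and by `G` costs at most `a`, and the memory term has kernel bounded by `C₁`; this is a
Volterra inequality with constants `a` and `a C₁`. -/
lemma integral_back_sq_le (hB : LipschitzWith K B) (hZ : IsFlow (field B) Z)
    (hq : Measurable q) (hQ : Measurable Q) (hG : Measurable G) (hd : Measurable d)
    (hq0 : ∀ z, 0 ≤ q z) (hT : 0 < T) {M₀ C₁ C₂ M a : ℝ} (hqM : ∀ z, q z ≤ M₀)
    (hQM : ∀ z, |Q z| ≤ M) (hGM : ∀ z, |G z| ≤ C₁) (hdM : ∀ p, |d p| ≤ C₁)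
    (hC₁ : 0 < C₁) (hC₂ : 0 < C₂) (hGQ : ∀ z, Q z ≠ 0 → C₂ ≤ |G z|)
    (ha : a = Real.exp (M₀ * T) / C₂) (y : R3 × R3) :
    ∫ t in (0 : ℝ)..T, |Q (Z (-t) y)| ^ 2
      ≤ (2 * a ^ 2 + 2 * a ^ 2 * (a * C₁) ^ 2 * T ^ 2 * Real.exp (a * C₁ * T) ^ 2)
        * ∫ t in (0 : ℝ)..T, traceDeriv Z q Q G d (t, y) ^ 2 := by
  have ha0 : 0 < a := by rw [ha]; positivity
  have hQy : Measurable fun s => Q (Z (-s) y) := hQ.comp (measurable_back_time hZ y)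
  have hDm : Measurable fun t => traceDeriv Z q Q G d (t, y) :=
    (measurable_traceDeriv hB hZ hq hQ hG hd).comp (measurable_id.prodMk measurable_const)
  refine integral_sq_le_of_volterra hQy.abs hDm hT ha0.le (mul_pos ha0 hC₁)
    (fun _ => abs_nonneg _) (fun _ => hQM _)
    (fun t ht => abs_traceDeriv_le_const hB hZ hQ hq0 hQM hGM hdM ht y) fun t ht => ?_
  have htI : t ∈ Icc 0 T := ⟨ht.1.le, ht.2.le⟩
  set I := ∫ s in (0 : ℝ)..t, |Q (Z (-s) y)| with hI
  have h1 := abs_integral_backValue_mul_le hB hZ hQ hq0 hQM hdM hC₁.le ht.1.le y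
  have h2 : backValue Z q Q t y * G (Z (-t) y) = traceDeriv Z q Q G d (t, y)
      - ∫ s in (0 : ℝ)..t, backValue Z q Q s y * d (t - s, Z (-s) y) := by
    rw [traceDeriv]; ring
  have h3 : |backValue Z q Q t y * G (Z (-t) y)| ≤ |traceDeriv Z q Q G d (t, y)| + C₁ * I := by
    rw [h2]
    exact (abs_sub _ _).trans (by linarith)
  have h4 : |Q (Z (-t) y)| ≤ a * |backValue Z q Q t y * G (Z (-t) y)| := by
    by_cases h0 : Q (Z (-t) y) = 0
    · rw [h0, abs_zero]; positivity
    · rw [backValue, abs_mul, abs_mul, abs_of_nonneg (attenuation_nonneg q t y)]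
      have e1 := attenuation_ge (Z := Z) hq0 hqM htI y
      have e2 := hGQ _ h0
      have e3 : Real.exp (-(M₀ * T)) * C₂
          ≤ attenuation (fun r => Z (-r)) q t y * |G (Z (-t) y)| :=
        mul_le_mul e1 e2 hC₂.le (attenuation_nonneg q t y)
      have e4 : a * (Real.exp (-(M₀ * T)) * C₂) = 1 := by
        rw [ha, Real.exp_neg]
        field_simp
      have e5 := mul_le_mul_of_nonneg_left e3 ha0.le
      rw [e4] at e5
      calc |Q (Z (-t) y)| = |Q (Z (-t) y)| * 1 := (mul_one _).symm
        _ ≤ |Q (Z (-t) y)| * (a * (attenuation (fun r => Z (-r)) q t y * |G (Z (-t) y)|)) :=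
            mul_le_mul_of_nonneg_left e5 (abs_nonneg _)
        _ = _ := by ring
  have h5 := mul_le_mul_of_nonneg_left h3 ha0.le
  calc |Q (Z (-t) y)| ≤ a * (|traceDeriv Z q Q G d (t, y)| + C₁ * I) := h4.trans h5
    _ = _ := by ring

/-- The two-sided estimate between a coefficient and the time derivative of the trace. -/
lemma eLpNorm_traceDeriv_equiv (hΩ : IsSmoothConvexDomain Ω ρ) (hB : IsTangentField Ω ρ K B)
    (hZ : IsFlow (field B) Z)
    (hq : Measurable q) (hQ : Measurable Q) (hG : Measurable G) (hd : Measurable d)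
    (hq0 : ∀ z, 0 ≤ q z) (hT : 0 < T) {M₀ C₁ C₂ M a c : ℝ} (hqM : ∀ z, q z ≤ M₀)
    (hQM : ∀ z, |Q z| ≤ M) (hGM : ∀ z, |G z| ≤ C₁) (hdM : ∀ p, |d p| ≤ C₁)
    (hC₁ : 0 < C₁) (hC₂ : 0 < C₂) (hGQ : ∀ z, Q z ≠ 0 → C₂ ≤ |G z|)
    (ha : a = Real.exp (M₀ * T) / C₂) (hc : 0 ≤ c)
    (hc2 : c ^ 2 = 2 * a ^ 2 + 2 * a ^ 2 * (a * C₁) ^ 2 * T ^ 2 * Real.exp (a * C₁ * T) ^ 2)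
    (hexit : ∀ z, Q z ≠ 0 → ∃ τ ∈ Ioo 0 T, Z τ z ∈ GammaPlus Ω ρ) :
    eLpNorm (traceDeriv Z q Q G d) 2 (timed T (sigmaPlus Ω ρ))
        ≤ ENNReal.ofReal (2 * C₁ * (1 + T)) * eLpNorm Q 2 volume ∧
      eLpNorm Q 2 volume
        ≤ ENNReal.ofReal c * eLpNorm (traceDeriv Z q Q G d) 2 (timed T (sigmaPlus Ω ρ)) := by
  have := hΩ.sFinite_sigmaPlus
  have hDm := measurable_traceDeriv hB.lipschitz hZ hq hQ hG hd
  have hDM : ∀ t ∈ Icc 0 T, ∀ y, |traceDeriv Z q Q G d (t, y)| ≤ C₁ * M + C₁ * (M * T) :=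
    fun t ht y => abs_traceDeriv_le_const hB.lipschitz hZ hQ hq0 hQM hGM hdM ht y
  have hkm : Measurable fun p : ℝ × R3 × R3 => Q (Z (-p.1) p.2) :=
    hQ.comp (measurable_back hB.lipschitz hZ)
  have hkM : ∀ t ∈ Icc 0 T, ∀ y, |Q (Z (-t) y)| ≤ M := fun t _ y => hQM _
  have hQe : Measurable fun z => ‖Q z‖ₑ ^ 2 := hQ.enorm.pow_const 2
  constructor
  · refine eLpNorm_le_of_lintegral_sq_le (by positivity) ?_
    refine (lintegral_timed_sq_le hT.le hDm hkm (by positivity) hDM hkM fun y =>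
      integral_traceDeriv_sq_le hB.lipschitz hZ hq hQ hG hd hq0 hT.le hQM hGM hdM y).trans ?_
    gcongr
    exact lintegral_trace_le hΩ hB hZ hQe
  · refine eLpNorm_le_of_lintegral_sq_le hc ?_
    refine (lintegral_le_trace hΩ hB hZ hQe fun z hz => hexit z fun h => hz (by simp [h])).trans ?_
    refine lintegral_timed_sq_le hT.le hkm hDm (sq_nonneg c) hkM hDM fun y => ?_
    have := integral_back_sq_le hB.lipschitz hZ hq hQ hG hd hq0 hT hqM hQM hGM hdM hC₁ hC₂ hGQ ha y
    rw [hc2]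
    simpa using this

end TraceDerivative

/-! ### Borel representatives of the data. -/

section Representatives

variable {Ω U : Set R3} {ρ : R3 → ℝ} {T : ℝ} {q₁ q₂ g : R3 × R3 → ℝ}

lemma phase_eq_restrict (Ω : Set R3) (hU : MeasurableSet U) :
    phase Ω U = (phase Ω univ).restrict (univ ×ˢ U) := by
  rw [phase, phase, Measure.restrict_restrict (MeasurableSet.univ.prod hU), prod_inter_prod,
    univ_inter, inter_univ]

lemma ae_phase_iff (hU : MeasurableSet U) {P : R3 × R3 → Prop} :
    (∀ᵐ z ∂(phase Ω U), P z) ↔ ∀ᵐ z ∂(phase Ω univ), z.2 ∈ U → P z := by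
  rw [phase_eq_restrict Ω hU, ae_restrict_iff' (MeasurableSet.univ.prod hU)]
  simp

lemma ae_timed_phase_iff (hU : MeasurableSet U) {P : ℝ × R3 × R3 → Prop} :
    (∀ᵐ p ∂(timed T (phase Ω U)), P p) ↔
      ∀ᵐ p ∂(timed T (phase Ω univ)), p.2.2 ∈ U → P p := by
  have e : timed T (phase Ω U) = (timed T (phase Ω univ)).restrict (univ ×ˢ (univ ×ˢ U)) := by
    rw [timed, timed, ← Measure.prod_restrict, Measure.restrict_univ, phase_eq_restrict Ω hU]
  rw [e, ae_restrict_iff' (MeasurableSet.univ.prod (MeasurableSet.univ.prod hU))]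
  simp

lemma hasCompactSupport_of_subset_prod (hΩ : IsSmoothConvexDomain Ω ρ) {K : Set R3}
    (hK : IsCompact K) {f : R3 × R3 → ℝ} (hf : ∀ z, f z ≠ 0 → z.1 ∈ Ω ∧ z.2 ∈ K) :
    HasCompactSupport f :=
  HasCompactSupport.intro (hΩ.bounded.isCompact_closure.prod hK) fun z hz => by
    by_contra h
    exact hz ⟨subset_closure (hf z h).1, (hf z h).2⟩

/-- An absorption coefficient has a bounded Borel representative with compact support. -/
lemma exists_absorption_representative (hΩ : IsSmoothConvexDomain Ω ρ) (hq : IsAbsorption Ω q₁)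
    {M : ℝ} (hM : 0 ≤ M) (hle : ∀ᵐ z ∂(phase Ω univ), q₁ z ≤ M) :
    ∃ q : R3 × R3 → ℝ, Measurable q ∧ (∀ z, 0 ≤ q z) ∧ (∀ z, q z ≤ M) ∧ HasCompactSupport q ∧
      (∀ z, z.1 ∉ Ω → q z = 0) ∧ ∀ᵐ z ∂(phase Ω univ), q z = q₁ z := by
  obtain ⟨K, hK, hqK⟩ := hq.compact
  have hs : MeasurableSet (Ω ×ˢ K) := hΩ.isOpen.measurableSet.prod hK.measurableSet
  have hm := hq.memLp.aestronglyMeasurable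
  refine ⟨(Ω ×ˢ K).indicator fun z => min (max (hm.mk _ z) 0) M, ?_, ?_, ?_, ?_, ?_, ?_⟩
  · exact ((hm.stronglyMeasurable_mk.measurable.max measurable_const).min
      measurable_const).indicator hs
  · exact fun z => indicator_nonneg (fun z _ => le_min (le_max_right _ _) hM) z
  · exact fun z => indicator_apply_le' (fun _ => min_le_right _ _) fun _ => hM
  · refine hasCompactSupport_of_subset_prod hΩ hK fun z hz => ?_
    have := mem_of_indicator_ne_zero hz
    exact this
  · exact fun z hz => indicator_of_notMem (fun h => hz h.1) _
  · filter_upwards [hle, hq.nonneg, hm.ae_eq_mk, ae_phase_mem hΩ] with z h1 h2 h3 h4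
    by_cases hz : z.2 ∈ K
    · rw [indicator_of_mem (show z ∈ Ω ×ˢ K from ⟨h4, hz⟩), ← h3, max_eq_left h2, min_eq_left h1]
    · rw [indicator_of_notMem (fun h => hz h.2)]
      exact (hqK z.1 h4 z.2 hz).symm

lemma exists_bounded_representative {α : Type*} [MeasurableSpace α] {μ : Measure α} {f : α → ℝ}
    (hf : AEStronglyMeasurable f μ) {C : ℝ} (hC : 0 ≤ C) :
    ∃ f' : α → ℝ, Measurable f' ∧ (∀ x, |f' x| ≤ C) ∧ ∀ᵐ x ∂μ, |f x| ≤ C → f' x = f x := by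
  refine ⟨fun x => max (-C) (min C (hf.mk _ x)), ?_, fun x => abs_le.2 ⟨le_max_left _ _, ?_⟩, ?_⟩
  · exact measurable_const.max (measurable_const.min hf.stronglyMeasurable_mk.measurable)
  · exact max_le (by linarith) (min_le_left _ _)
  · filter_upwards [hf.ae_eq_mk] with x hx h
    rw [← hx, min_eq_right (abs_le.1 h).2, max_eq_right (abs_le.1 h).1]

/-- The difference of two absorption coefficients has a bounded Borel representative with compact
support, which vanishes off the set where the initial value is bounded below. -/
lemma exists_difference_representative (hΩ : IsSmoothConvexDomain Ω ρ) (hU : MeasurableSet U)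
    (hq₁ : IsAbsorption Ω q₁) (hq₂ : IsAbsorption Ω q₂)
    (hsupp : ∀ x ∈ Ω, tsupport (fun v => q₁ (x, v) - q₂ (x, v)) ⊆ U)
    {G : R3 × R3 → ℝ} (hG : Measurable G) {C₂ : ℝ}
    (hGC : ∀ᵐ z ∂(phase Ω univ), z.2 ∈ U → C₂ ≤ |G z|) :
    ∃ (Q : R3 × R3 → ℝ) (M : ℝ), Measurable Q ∧ (∀ z, |Q z| ≤ M) ∧ HasCompactSupport Q ∧
      (∀ z, Q z ≠ 0 → z.1 ∈ Ω ∧ z.2 ∈ U ∧ C₂ ≤ |G z|) ∧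
      ∀ᵐ z ∂(phase Ω univ), Q z = q₂ z - q₁ z := by
  obtain ⟨K₁, hK₁, hqK₁⟩ := hq₁.compact
  obtain ⟨K₂, hK₂, hqK₂⟩ := hq₂.compact
  have hf : MemLp (q₂ - q₁) ⊤ (phase Ω univ) := hq₂.memLp.sub hq₁.memLp
  set M : ℝ := (eLpNorm (q₂ - q₁) ⊤ (phase Ω univ)).toReal with hM
  have hfM : ∀ᵐ z ∂(phase Ω univ), |(q₂ - q₁) z| ≤ M := by
    have := ae_le_eLpNormEssSup (f := q₂ - q₁) (μ := phase Ω univ)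
    filter_upwards [this] with z hz
    rw [← eLpNorm_exponent_top] at hz
    have := ENNReal.toReal_mono hf.2.ne hz
    rwa [toReal_enorm] at this
  obtain ⟨f, hfm, hfb, hff⟩ := exists_bounded_representative hf.1 (ENNReal.toReal_nonneg : 0 ≤ M)
  -- Cutting off to this set makes the lower bound on `|G|` and the support conditions hold at every
  -- point where `Q ≠ 0`; almost everywhere in `Ω × ℝ³` nothing is lost.
  set A : Set (R3 × R3) := Ω ×ˢ (U ∩ (K₁ ∪ K₂)) ∩ {z | C₂ ≤ |G z|} with hA
  have hAm : MeasurableSet A :=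
    (hΩ.isOpen.measurableSet.prod (hU.inter (hK₁.measurableSet.union hK₂.measurableSet))).inter
      (measurableSet_le measurable_const hG.abs)
  refine ⟨A.indicator f, M, hfm.indicator hAm, fun z => ?_, ?_, fun z hz => ?_, ?_⟩
  · by_cases hz : z ∈ A
    · rw [indicator_of_mem hz]; exact hfb z
    · rw [indicator_of_notMem hz, abs_zero]; exact ENNReal.toReal_nonneg
  · refine hasCompactSupport_of_subset_prod hΩ (hK₁.union hK₂) fun z hz => ?_
    have := mem_of_indicator_ne_zero hz
    exact ⟨this.1.1, this.1.2.2⟩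
  · have := mem_of_indicator_ne_zero hz
    exact ⟨this.1.1, this.1.2.1, this.2⟩
  · filter_upwards [hff, hfM, hGC, ae_phase_mem hΩ] with z h1 h2 h3 h4
    by_cases hz : z ∈ A
    · rw [indicator_of_mem hz]; exact h1 h2
    · rw [indicator_of_notMem hz]
      by_cases hzU : z.2 ∈ U
      · have hK : z.2 ∉ K₁ ∪ K₂ := fun hK => hz ⟨⟨h4, hzU, hK⟩, h3 hzU⟩
        rw [mem_union, not_or] at hK
        have e1 := hqK₁ z.1 h4 z.2 hK.1
        have e2 := hqK₂ z.1 h4 z.2 hK.2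
        simp only [Prod.mk.eta] at e1 e2
        rw [e1, e2, sub_zero]
      · have := image_eq_zero_of_notMem_tsupport fun h => hzU (hsupp z.1 h4 h)
        simp only [Prod.mk.eta] at this
        linarith

/-- By Fubini, for almost every phase point the two functions agree at almost every time, which is
enough for the time integrals. -/
lemma ae_timed_integral_congr {μ : Measure (R3 × R3)} [SFinite μ] {d d' : ℝ × R3 × R3 → ℝ}
    (h : ∀ᵐ p ∂(timed T μ), d p = d' p) :
    ∀ᵐ p ∂(timed T μ), ∫ s in (0 : ℝ)..p.1, d (s, p.2) = ∫ s in (0 : ℝ)..p.1, d' (s, p.2) := by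
  have h1 : ∀ᵐ x ∂(μ.prod (volume.restrict (Ioo 0 T))), d x.swap = d' x.swap :=
    Measure.measurePreserving_swap.quasiMeasurePreserving.ae h
  filter_upwards [ae_timed_of_ae T (Measure.ae_ae_of_ae_prod h1), ae_timed_mem T μ] with p hp ht
  rw [intervalIntegral.integral_of_le ht.1.le, intervalIntegral.integral_of_le ht.1.le]
  refine integral_congr_ae (ae_restrict_of_ae_restrict_of_subset ?_ hp)
  exact fun s hs => ⟨hs.1, hs.2.trans_lt ht.2⟩

/-- The source term of the equation for the difference of two solutions. -/
def source (T : ℝ) (Q G : R3 × R3 → ℝ) (d : ℝ × R3 × R3 → ℝ) (p : ℝ × R3 × R3) : ℝ :=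
  (Ioo 0 T ×ˢ (univ : Set (R3 × R3))).indicator
    (fun p => Q p.2 * (G p.2 + ∫ s in (0 : ℝ)..p.1, d (s, p.2))) p

lemma integrable_source {Q G : R3 × R3 → ℝ} {d : ℝ × R3 × R3 → ℝ} (hQ : Measurable Q)
    (hG : Measurable G) (hd : Measurable d) {M C : ℝ} (hQM : ∀ z, |Q z| ≤ M)
    (hGC : ∀ z, |G z| ≤ C) (hdC : ∀ p, |d p| ≤ C) (hQs : HasCompactSupport Q) :
    Integrable (source T Q G d) := by
  have hC : 0 ≤ C := (abs_nonneg _).trans (hGC 0)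
  have hM : 0 ≤ M := (abs_nonneg _).trans (hQM 0)
  have hmeas : Measurable (source T Q G d) := by
    refine Measurable.indicator ?_ (measurableSet_Ioo.prod MeasurableSet.univ)
    refine (hQ.comp measurable_snd).mul ((hG.comp measurable_snd).add ?_)
    exact measurable_intervalIntegral (f := fun s z => d (s, z)) hd
  have hKc : IsCompact (Icc 0 T ×ˢ tsupport Q) := isCompact_Icc.prod hQs
  have hsub : Function.support (source T Q G d) ⊆ Icc 0 T ×ˢ tsupport Q := by
    intro p hp
    have h1 := mem_of_indicator_ne_zero hp
    refine ⟨⟨h1.1.1.le, h1.1.2.le⟩, subset_tsupport _ fun h => hp ?_⟩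
    rw [source, indicator_of_mem h1, h, zero_mul]
  rw [← integrableOn_iff_integrable_of_support_subset hsub]
  refine Measure.integrableOn_of_bounded (M := M * (C + C * T)) hKc.measure_lt_top.ne
    hmeas.aestronglyMeasurable ?_
  filter_upwards [ae_restrict_mem hKc.measurableSet] with p hp
  have hT : 0 ≤ T := hp.1.1.trans hp.1.2
  by_cases h : p ∈ Ioo 0 T ×ˢ (univ : Set (R3 × R3))
  · rw [source, indicator_of_mem h, norm_mul]
    refine mul_le_mul (hQM _) ?_ (norm_nonneg _) hM
    refine (norm_add_le _ _).trans (add_le_add (hGC _) ?_)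
    refine (intervalIntegral.norm_integral_le_of_norm_le_const (C := C)
      fun s _ => hdC _).trans ?_
    rw [sub_zero, abs_of_nonneg hp.1.1]
    exact mul_le_mul_of_nonneg_left hp.1.2 hC
  · rw [source, indicator_of_notMem h, norm_zero]
    positivity

end Representatives

/-! ### The stability estimate. -/

section Stability

variable {Ω U V : Set R3} {ρ : R3 → ℝ} {T : ℝ} {E : R3 → R3} {j : Fin 3}
  {q₁ q₂ g : R3 × R3 → ℝ} {S h u₁ u₂ γ₁ γ₂ : ℝ × R3 × R3 → ℝ}

/-- The two-sided stability estimate, with explicit constants. -/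
lemma exists_timeDeriv_trace (hΩ : IsSmoothConvexDomain Ω ρ) (hE : IsForceField Ω ρ E)
    (hEj : ∀ x ∈ Ω, E x j = 0) (hT : 0 < T) (hU : MeasurableSet U)
    (hUV : ∀ w ∈ U, ∀ v : R3, v j = w j → v ∈ V) (hV : HasWeight T Ω E V)
    (hS : MemLp S 2 (timed T (phase Ω univ))) {C₁ C₂ M₀ a c : ℝ} (hC₁ : 0 < C₁) (hC₂ : 0 < C₂)
    (hM₀ : 0 ≤ M₀) (ha : a = Real.exp (M₀ * T) / C₂) (hc : 0 ≤ c)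
    (hc2 : c ^ 2 = 2 * a ^ 2 + 2 * a ^ 2 * (a * C₁) ^ 2 * T ^ 2 * Real.exp (a * C₁ * T) ^ 2)
    (hq₁ : IsAbsorption Ω q₁) (hq₂ : IsAbsorption Ω q₂)
    (hle : ∀ᵐ z ∂(phase Ω univ), q₁ z ≤ M₀)
    (hsupp : ∀ x ∈ Ω, tsupport (fun v => q₁ (x, v) - q₂ (x, v)) ⊆ U)
    (hg : MemLp g 2 (phase Ω univ))
    (h₁ : IsWeakSolution T Ω ρ E q₁ S g h u₁ γ₁) (h₂ : IsWeakSolution T Ω ρ E q₂ S g h u₂ γ₂)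
    (hP : MemP T Ω U C₁ C₂ g u₂) :
    ∃ D : ℝ × R3 × R3 → ℝ, MemLp D 2 (timed T (sigmaPlus Ω ρ)) ∧
      HasTimeDeriv T (sigmaPlus Ω ρ) (γ₁ - γ₂) 0 D ∧
      eLpNorm D 2 (timed T (sigmaPlus Ω ρ))
        ≤ ENNReal.ofReal (2 * C₁ * (1 + T)) * eLpNorm (q₁ - q₂) 2 (phase Ω univ) ∧
      eLpNorm (q₁ - q₂) 2 (phase Ω univ)
        ≤ ENNReal.ofReal c * eLpNorm D 2 (timed T (sigmaPlus Ω ρ)) := by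
  have := hΩ.sFinite_sigmaPlus
  obtain ⟨K, B, hB, hEB, hBj⟩ := hE.exists_extension hΩ
  obtain ⟨Z, hZ⟩ := exists_isFlow (lipschitzWith_field hB.lipschitz)
  obtain ⟨hgC, hgC', d₀, hd₀m, hd₀C, hd₀⟩ := hP
  obtain ⟨q, hq, hq0, hqM, hqs, hqΩ, hqq⟩ := exists_absorption_representative hΩ hq₁ hM₀ hle
  -- The truncation at `C₁` agrees with `g` only over `𝒰`. That is enough, because the data enter
  -- only multiplied by `Q`.
  obtain ⟨G, hG, hGM, hGg⟩ := exists_bounded_representative hg.aestronglyMeasurable hC₁.le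
  have hGU : ∀ᵐ z ∂(phase Ω univ), z.2 ∈ U → G z = g z := by
    filter_upwards [hGg, (ae_phase_iff hU).1 hgC] with z h1 h2 hz using h1 (h2 hz)
  have hGC : ∀ᵐ z ∂(phase Ω univ), z.2 ∈ U → C₂ ≤ |G z| := by
    filter_upwards [hGU, (ae_phase_iff hU).1 hgC'] with z h1 h2 hz
    rw [h1 hz]; exact h2 hz
  obtain ⟨Q, M, hQ, hQM, hQs, hQU, hQq⟩ :=
    exists_difference_representative hΩ hU hq₁ hq₂ hsupp hG hGC
  obtain ⟨d, hd, hdM, hdd⟩ := exists_bounded_representative hd₀m hC₁.le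
  have hu₂ : ∀ᵐ p ∂(timed T (phase Ω univ)), p.2.2 ∈ U →
      u₂ p = g p.2 + ∫ s in (0 : ℝ)..p.1, d (s, p.2) := by
    rw [← ae_timed_phase_iff hU]
    have hd' : ∀ᵐ p ∂(timed T (phase Ω U)), d₀ p = d p := by
      filter_upwards [hdd, hd₀C] with p h1 h2 using (h1 h2).symm
    filter_upwards [hd₀, ae_timed_integral_congr hd'] with p h1 h2
    rw [h1, h2]
  have hFF : ∀ᵐ p ∂(timed T (phase Ω univ)),
      source T Q G d p = (q₂ p.2 - q₁ p.2) * u₂ p := by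
    filter_upwards [hu₂, ae_timed_of_ae T hGU, ae_timed_of_ae T hQq, ae_timed_mem T _]
      with p h1 h2 h3 h4
    rw [source, indicator_of_mem (show p ∈ Ioo 0 T ×ˢ (univ : Set (R3 × R3)) from ⟨h4, trivial⟩),
      ← h3]
    by_cases h0 : Q p.2 = 0
    · rw [h0, zero_mul, zero_mul]
    · have hp := (hQU _ h0).2.1
      rw [h1 hp, h2 hp]
  have hF0 : ∀ p : ℝ × R3 × R3, ¬(p.1 ∈ Ioo 0 T ∧ p.2.1 ∈ Ω) → source T Q G d p = 0 := by
    intro p hp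
    by_cases h : p ∈ Ioo 0 T ×ˢ (univ : Set (R3 × R3))
    · rw [source, indicator_of_mem h]
      by_cases h0 : Q p.2 = 0
      · rw [h0, zero_mul]
      · exact absurd ⟨h.1, (hQU _ h0).1⟩ hp
    · rw [source, indicator_of_notMem h]
  have hrep := trace_representation hΩ hB hZ hT hEB hS hq₁ hq₂ h₁ h₂ hq hq0 hqM hqs hqΩ hqq
    (integrable_source (T := T) hQ hG hd hQM hGM hdM hQs) hF0 hFF
  have hequiv := eLpNorm_traceDeriv_equiv hΩ hB hZ hq hQ hG hd hq0 hT hqM hQM hGM hdM hC₁ hC₂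
    (fun z hz => (hQU z hz).2.2) ha hc hc2 fun z hz =>
      exists_exit_lt hΩ hB hZ hT hEB (hBj j hEj) hUV hV (hQU z hz).1 (hQU z hz).2.1
  have hnorm : eLpNorm (q₁ - q₂) 2 (phase Ω univ) = eLpNorm Q 2 volume := by
    have e1 : eLpNorm (q₁ - q₂) 2 (phase Ω univ) = eLpNorm Q 2 (phase Ω univ) := by
      rw [eLpNorm_sub_comm]
      exact eLpNorm_congr_ae (hQq.mono fun z hz => hz.symm)
    rw [e1, phase]
    exact eLpNorm_restrict_eq_of_support_subset fun z hz => ⟨(hQU z hz).1, trivial⟩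
  have hQ2 : MemLp Q 2 volume :=
    hQs.memLp_of_bound hQ.aestronglyMeasurable M (Eventually.of_forall hQM)
  rw [hnorm]
  refine ⟨traceDeriv Z q Q G d, ⟨?_, ?_⟩, ?_, hequiv⟩
  · exact (measurable_traceDeriv hB.lipschitz hZ hq hQ hG hd).aestronglyMeasurable
  · exact hequiv.1.trans_lt (ENNReal.mul_lt_top ENNReal.ofReal_lt_top hQ2.2)
  -- The orbit formula for the trace starts from zero at `t = 0`, and it is the time integral of the
  -- derivative already estimated.
  · filter_upwards [hrep, ae_timed_mem T (sigmaPlus Ω ρ)] with p hp ht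
    rw [Pi.sub_apply, hp, Pi.zero_apply, zero_add,
      ← integral_traceDeriv hB.lipschitz hZ hq hQ hG hd hq0 hQM hGM hdM ht.1.le,
      intervalIntegral.integral_of_le ht.1.le, intervalIntegral.integral_of_le ht.1.le,
      integral_Ioc_eq_integral_Ioo, integral_Ioc_eq_integral_Ioo]
    refine setIntegral_congr_fun measurableSet_Ioo fun s hs => ?_
    have hmem : (p.1 - s, Z (-s) p.2) ∈ Ioo 0 T ×ˢ (univ : Set (R3 × R3)) :=
      ⟨⟨by linarith [hs.2], by linarith [hs.1, ht.2]⟩, trivial⟩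
    rw [source, indicator_of_mem hmem, backValue]
    ring

end Stability

end Transport

end

theorem theorem1 (Ω : Set Transport.R3) (ρ : Transport.R3 → ℝ)
    (hΩ : Transport.IsSmoothConvexDomain Ω ρ)
    (E : Transport.R3 → Transport.R3) (hE : Transport.IsForceField Ω ρ E)
    (j : Fin 3) (hEj : ∀ x ∈ Ω, E x j = 0)
    (T : ℝ) (hT : 0 < T)
    (U V : Set Transport.R3) (hU : MeasurableSet U)
    (hUV : ∀ w ∈ U, ∀ v : Transport.R3, v j = w j → v ∈ V)
    (hV : Transport.HasWeight T Ω E V)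
    (S : ℝ × Transport.R3 × Transport.R3 → ℝ)
    (hS : MeasureTheory.MemLp S 2 (Transport.timed T (Transport.phase Ω Set.univ)))
    (C₁ C₂ : ℝ) (hC₁ : 0 < C₁) (hC₂ : 0 < C₂) :
    ∃ c : ℝ, 0 < c ∧ ∀ C₀ : ℝ, ∃ C : ℝ, 0 < C ∧
      ∀ (q₁ q₂ g : Transport.R3 × Transport.R3 → ℝ)
        (h u₁ u₂ γ₁ γ₂ : ℝ × Transport.R3 × Transport.R3 → ℝ),
        Transport.IsAbsorption Ω q₁ → Transport.IsAbsorption Ω q₂ →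
        (∀ᵐ z ∂(Transport.phase Ω Set.univ), q₁ z ≤ C₀) →
        (∀ x ∈ Ω, tsupport (fun v => q₁ (x, v) - q₂ (x, v)) ⊆ U) →
        MeasureTheory.MemLp g 2 (Transport.phase Ω Set.univ) →
        MeasureTheory.MemLp h 2 (Transport.timed T (Transport.sigmaMinus Ω ρ)) →
        Transport.IsWeakSolution T Ω ρ E q₁ S g h u₁ γ₁ →
        Transport.IsWeakSolution T Ω ρ E q₂ S g h u₂ γ₂ →
        Transport.MemP T Ω U C₁ C₂ g u₂ →
        ∃ (f₀ : Transport.R3 × Transport.R3 → ℝ)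
          (d : ℝ × Transport.R3 × Transport.R3 → ℝ),
          MeasureTheory.MemLp d 2 (Transport.timed T (Transport.sigmaPlus Ω ρ)) ∧
          Transport.HasTimeDeriv T (Transport.sigmaPlus Ω ρ) (γ₁ - γ₂) f₀ d ∧
          ENNReal.ofReal c *
              MeasureTheory.eLpNorm d 2 (Transport.timed T (Transport.sigmaPlus Ω ρ))
            ≤ MeasureTheory.eLpNorm (q₁ - q₂) 2 (Transport.phase Ω Set.univ) ∧
          MeasureTheory.eLpNorm (q₁ - q₂) 2 (Transport.phase Ω Set.univ)
            ≤ ENNReal.ofReal C *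
              MeasureTheory.eLpNorm d 2 (Transport.timed T (Transport.sigmaPlus Ω ρ)) := by
  -- The lower constant is chosen before `C₀`: bounding the trace derivative uses only that the
  -- attenuation is at most one.
  refine ⟨(2 * C₁ * (1 + T))⁻¹, by positivity, fun C₀ => ?_⟩
  -- `C₀` enters through the smallest possible attenuation. The maximum with zero provides a
  -- nonnegative upper bound for `q₁` whatever the sign of `C₀`.
  obtain ⟨a, ha⟩ : ∃ a, a = Real.exp (max C₀ 0 * T) / C₂ := ⟨_, rfl⟩
  have ha0 : 0 < a := by rw [ha]; positivity
  have hpos : 0 < 2 * a ^ 2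
      + 2 * a ^ 2 * (a * C₁) ^ 2 * T ^ 2 * Real.exp (a * C₁ * T) ^ 2 := by positivity
  refine ⟨_, Real.sqrt_pos.2 hpos, ?_⟩
  intro q₁ q₂ g h u₁ u₂ γ₁ γ₂ hq₁ hq₂ hle hsupp hg _ h₁ h₂ hP
  obtain ⟨D, hD, hDt, hlow, hup⟩ := Transport.exists_timeDeriv_trace hΩ hE hEj hT hU hUV hV hS
    hC₁ hC₂ (le_max_right C₀ 0) ha (Real.sqrt_nonneg _) (Real.sq_sqrt hpos.le) hq₁ hq₂
    (hle.mono fun z hz => hz.trans (le_max_left _ _)) hsupp hg h₁ h₂ hP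
  refine ⟨0, D, hD, hDt, ?_, hup⟩
  have hk : 0 < 2 * C₁ * (1 + T) := by positivity
  calc ENNReal.ofReal (2 * C₁ * (1 + T))⁻¹ * MeasureTheory.eLpNorm D 2 _
      ≤ ENNReal.ofReal (2 * C₁ * (1 + T))⁻¹ * (ENNReal.ofReal (2 * C₁ * (1 + T)) *
          MeasureTheory.eLpNorm (q₁ - q₂) 2 (Transport.phase Ω Set.univ)) := by gcongr
    _ = MeasureTheory.eLpNorm (q₁ - q₂) 2 (Transport.phase Ω Set.univ) := by
        rw [← mul_assoc, ← ENNReal.ofReal_mul (inv_nonneg.2 hk.le), inv_mul_cancel₀ hk.ne',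
          ENNReal.ofReal_one, one_mul]
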